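/- Let $(\mathbf C,|\cdot|)$ be either the field of complex numbers with its usual absolute value or an algebraically closed field with an ultrametric absolute value. Let $q\in\mathbf C$ satisfy $|q|=1$, let $q$ not be a root of unity, and assume that the series $\sum_{n\ge 0}\frac{x^n}{(1-q)(1-q^2)\cdots(1-q^n)}$ has a positive radius of convergence. Let $\mathbf C\{x\}$ be the ring of power series with positive radius of convergence, $\mathbf K=\mathrm{Frac}\,\mathbf C\{x\}$, $\widehat{\mathbf K}=\mathbf C((x))$, and $\sigma_q f(x)=f(qx)$. A $q$-difference module over $F\in\{\mathbf K,\widehat{\mathbf K}\}$ is a finite-dimensional $F$-vector space $M$ with an additive bijection $\Sigma_q:M\to M$ such that $\Sigma_q(fm)=\sigma_q(f)\Sigma_q(m)$; morphisms are the $F$-linear maps commuting with $\Sigma_q$. Let $\mathcal B_q$, $\widehat{\mathcal B}_q$ be the categories of $q$-difference modules over $\mathbf K$, $\widehat{\mathbf K}$, and for $\mathcal M=(M,\Sigma_q)$ in $\mathcal B_q$ put $\mathcal M_{\widehat{\mathbf K}}=(M\otimes_{\mathbf K}\widehat{\mathbf K},\Sigma_q\otimes\sigma_q)$. Let $\mathcal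 B_q^{iso}$ be the full subcategory of $\mathcal B_q$ of those $\mathcal M$ such that every $\mathcal N$ in $\mathcal B_q$ with $\mathcal N_{\widehat{\mathbf K}}\cong\mathcal M_{\widehat{\mathbf K}}$ is isomorphic to $\mathcal M$ in $\mathcal B_q$. The Newton polygon of an operator $\mathcal L=\sum_{i=0}^{\nu}a_i(x)\sigma_q^i$, $a_i\in\mathbf C\{x\}$, $a_\nu\ne 0$, is the convex hull of $\{(i,k): a_i\neq 0,\ k\ge \mathrm{ord}_x a_i\}$ in $\mathbb R^2$; its slopes are those of its non-vertical edges. A module $\mathcal M$ in $\mathcal B_q$ is pure of slope $\mu\in\mathbb Q$ if $M\cong\mathbf K[\sigma_q]/\mathbf K[\sigma_q]\mathcal L$ for such an $\mathcal L$, of order $\nu=\dim_{\mathbf K}M$, whose only slope is $\mu$; the zero module is regarded as pure of every slope. Let $\mathcal B_q^{iso,f}$ be the full subcategory of $\mathcal B_q^{iso}$ of modules that are pure of slope $0$. A $\mathbb Q$-graded object of $\mathcal B_q^{iso,f}$ is a family $(X_\mu)_{\mu\in\mathbb Q}$ of objects of $\mathcal B_q^{iso,f}$, only finitely many of which are nonzero;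 a morphism is a family of morphisms $X_\mu\to Y_\mu$. Then: 1. There is an equivalence of categories $E$ from $\mathcal B_q^{iso}$ to the category of $\mathbb Q$-graded objects of $\mathcal B_q^{iso,f}$ such that, for every $\mathcal M$ in $\mathcal B_q^{iso}$ and every $\mu\in\mathbb Q$, $\mathcal M$ is pure of slope $\mu$ if and only if $E(\mathcal M)$ is concentrated in degree $\mu$. 2. Each $\mathcal M$ in $\mathcal B_q^{iso}$ is a direct sum $M=\bigoplus_{\mu\in\mathbb Q}M_\mu$ of $q$-difference submodules, where $M_\mu$ is an object of $\mathcal B_q^{iso}$ that is pure of slope $\mu$. 3. Morphisms respect the grading: if $\mathcal M,\mathcal N$ are in $\mathcal B_q^{iso}$, with decompositions $M=\bigoplus_\mu M_\mu$, $N=\bigoplus_\mu N_\mu$ as in 2, then $\varphi(M_\mu)\subseteq N_\mu$ for every morphism $\varphi:\mathcal M\to\mathcal N$ and every $\mu\in\mathbb Q$. 4. If $\mathcal M,\mathcal N$ in $\mathcal B_q$ are pure of different slopes, then every morphism $\mathcal M\to\mathcal N$ is zero. -/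

import Mathlib

open CategoryTheory TensorProduct

universe u v w

noncomputable section

namespace QDiff

section Fields

variable {C : Type u} [NormedField C]

/-- A power series has positive radius of convergence: its coefficients grow at most
geometrically. -/
def IsConvergent (f : PowerSeries C) : Prop :=
  ∃ A B : ℝ, ∀ n : ℕ, ‖PowerSeries.coeff n f‖ ≤ A * B ^ n

theorem IsConvergent.exists_pos {f : PowerSeries C} (hf : IsConvergent f) :
    ∃ A B : ℝ, 0 ≤ A ∧ 0 < B ∧ ∀ n : ℕ, ‖PowerSeries.coeff n f‖ ≤ A * B ^ n := by
  obtain ⟨A, B, h⟩ := hf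
  refine ⟨|A|, |B| + 1, abs_nonneg _, by positivity, fun n => (h n).trans ?_⟩
  calc A * B ^ n ≤ |A * B ^ n| := le_abs_self _
    _ = |A| * |B| ^ n := by rw [abs_mul, abs_pow]
    _ ≤ |A| * (|B| + 1) ^ n := by gcongr; linarith

variable (C) in
/-- The ring `C{x}` of germs at `0` of analytic functions. -/
def germRing : Subring (PowerSeries C) where
  carrier := {f | IsConvergent f}
  zero_mem' := ⟨0, 0, by simp⟩
  one_mem' := by
    refine ⟨1, 1, fun n => ?_⟩
    rw [PowerSeries.coeff_one]
    split_ifs <;> simp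
  neg_mem' := by
    rintro f ⟨A, B, h⟩
    exact ⟨A, B, fun n => by simpa using h n⟩
  add_mem' := by
    intro f g hf hg
    obtain ⟨A, B, hA, hB, h⟩ := hf.exists_pos
    obtain ⟨A', B', hA', hB', h'⟩ := hg.exists_pos
    refine ⟨A + A', max B B', fun n => ?_⟩
    rw [map_add, add_mul]
    refine (norm_add_le _ _).trans (add_le_add ((h n).trans ?_) ((h' n).trans ?_))
    · gcongr; exact le_max_left _ _
    · gcongr; exact le_max_right _ _
  mul_mem' := by
    intro f g hf hg
    obtain ⟨A, B, hA, hB, h⟩ := hf.exists_pos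
    obtain ⟨A', B', hA', hB', h'⟩ := hg.exists_pos
    refine ⟨A * A', 2 * max B B', fun n => ?_⟩
    rw [PowerSeries.coeff_mul]
    have key : ∀ p ∈ Finset.HasAntidiagonal.antidiagonal n,
        ‖PowerSeries.coeff p.1 f * PowerSeries.coeff p.2 g‖ ≤ A * A' * (max B B') ^ n := by
      intro p hp
      rw [Finset.HasAntidiagonal.mem_antidiagonal] at hp
      rw [norm_mul, ← hp, pow_add]
      calc ‖PowerSeries.coeff p.1 f‖ * ‖PowerSeries.coeff p.2 g‖
          ≤ (A * (max B B') ^ p.1) * (A' * (max B B') ^ p.2) := by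
            refine mul_le_mul ((h _).trans ?_) ((h' _).trans ?_) (norm_nonneg _) (by positivity)
            · gcongr; exact le_max_left _ _
            · gcongr; exact le_max_right _ _
        _ = _ := by ring
    have hn : ((n : ℝ) + 1) ≤ 2 ^ n := by exact_mod_cast Nat.lt_two_pow_self (n := n)
    calc ‖∑ p ∈ Finset.HasAntidiagonal.antidiagonal n, PowerSeries.coeff p.1 f * PowerSeries.coeff p.2 g‖
        ≤ ∑ p ∈ Finset.HasAntidiagonal.antidiagonal n, A * A' * (max B B') ^ n :=
          (norm_sum_le _ _).trans (Finset.sum_le_sum key)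
      _ = ((n : ℝ) + 1) * (A * A' * (max B B') ^ n) := by simp
      _ ≤ 2 ^ n * (A * A' * (max B B') ^ n) := by gcongr
      _ = A * A' * (2 * max B B') ^ n := by rw [mul_pow]; ring

variable (C) in
/-- The field `K = C({x})` of germs at `0` of meromorphic functions: the field of fractions of
`C{x}`, inside the field `C((x))` of formal Laurent series. -/
def germField : Subfield (LaurentSeries C) where
  carrier := {f | ∃ g ∈ germRing C, ∃ h ∈ germRing C, h ≠ 0 ∧
    f = HahnSeries.ofPowerSeries ℤ C g / HahnSeries.ofPowerSeries ℤ C h}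
  zero_mem' := ⟨0, zero_mem _, 1, one_mem _, one_ne_zero, by simp⟩
  one_mem' := ⟨1, one_mem _, 1, one_mem _, one_ne_zero, by simp⟩
  neg_mem' := by
    rintro _ ⟨g, hg, h, hh, h0, rfl⟩
    exact ⟨-g, neg_mem hg, h, hh, h0, by rw [map_neg, neg_div]⟩
  add_mem' := by
    rintro _ _ ⟨g, hg, h, hh, h0, rfl⟩ ⟨g', hg', h', hh', h0', rfl⟩
    refine ⟨g * h' + h * g', add_mem (mul_mem hg hh') (mul_mem hh hg'), h * h', mul_mem hh hh',
      mul_ne_zero h0 h0', ?_⟩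
    rw [div_add_div _ _ ((map_ne_zero_iff _ HahnSeries.ofPowerSeries_injective).2 h0)
      ((map_ne_zero_iff _ HahnSeries.ofPowerSeries_injective).2 h0')]
    simp
  mul_mem' := by
    rintro _ _ ⟨g, hg, h, hh, h0, rfl⟩ ⟨g', hg', h', hh', h0', rfl⟩
    exact ⟨g * g', mul_mem hg hg', h * h', mul_mem hh hh', mul_ne_zero h0 h0',
      by rw [div_mul_div_comm, map_mul, map_mul]⟩
  inv_mem' := by
    rintro _ ⟨g, hg, h, hh, h0, rfl⟩
    by_cases hg0 : g = 0
    · exact ⟨0, zero_mem _, 1, one_mem _, one_ne_zero, by simp [hg0]⟩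
    · exact ⟨h, hh, g, hg, hg0, by rw [inv_div]⟩

/-- A convergent power series, seen as an element of `C({x})`. -/
def toGermField (f : germRing C) : germField C :=
  ⟨HahnSeries.ofPowerSeries ℤ C f.1, f.1, f.2, 1, one_mem _, one_ne_zero, by simp⟩

/-- The underlying function of `f(x) ↦ f(qx)` on `C((x))`. -/
def shiftFun (q : Cˣ) (f : LaurentSeries C) : LaurentSeries C where
  coeff n := ((q ^ n : Cˣ) : C) * f.coeff n
  isPWO_support' := f.isPWO_support.mono fun n hn => by
    simp only [Function.mem_support, HahnSeries.mem_support] at hn ⊢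
    exact right_ne_zero_of_mul hn

theorem shiftFun_mul (q : Cˣ) (f g : LaurentSeries C) :
    shiftFun q (f * g) = shiftFun q f * shiftFun q g := by
  ext n
  rw [HahnSeries.coeff_mul]
  change ((q ^ n : Cˣ) : C) * (f * g).coeff n = _
  rw [HahnSeries.coeff_mul, Finset.mul_sum]
  refine Finset.sum_congr ?_ ?_
  · ext p
    have h1 : ((q ^ p.1 : Cˣ) : C) ≠ 0 := Units.ne_zero _
    have h2 : ((q ^ p.2 : Cˣ) : C) ≠ 0 := Units.ne_zero _
    simp only [Finset.mem_antidiagonal, HahnSeries.mem_support, shiftFun, ne_eq, mul_eq_zero, h1, h2,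
      false_or]
  · intro p hp
    simp only [Finset.mem_antidiagonal] at hp
    change _ = (((q ^ p.1 : Cˣ) : C) * f.coeff p.1) * (((q ^ p.2 : Cˣ) : C) * g.coeff p.2)
    rw [← hp.2.2, zpow_add, Units.val_mul]
    ring

/-- The automorphism `σ_q : f(x) ↦ f(qx)` of `C((x))`. -/
def shift (q : Cˣ) : LaurentSeries C ≃+* LaurentSeries C where
  toFun := shiftFun q
  invFun := shiftFun q⁻¹
  left_inv f := by
    ext n
    change ((q⁻¹ ^ n : Cˣ) : C) * (((q ^ n : Cˣ) : C) * f.coeff n) = f.coeff n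
    rw [← mul_assoc, ← Units.val_mul, ← mul_zpow]
    simp
  right_inv f := by
    ext n
    change ((q ^ n : Cˣ) : C) * (((q⁻¹ ^ n : Cˣ) : C) * f.coeff n) = f.coeff n
    rw [← mul_assoc, ← Units.val_mul, ← mul_zpow]
    simp
  map_mul' := shiftFun_mul q
  map_add' f g := by
    ext n
    simp [shiftFun, mul_add]

theorem shift_ofPowerSeries (q : Cˣ) (f : PowerSeries C) :
    shift q (HahnSeries.ofPowerSeries ℤ C f) =
      HahnSeries.ofPowerSeries ℤ C (PowerSeries.rescale (q : C) f) := by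
  ext n
  change ((q ^ n : Cˣ) : C) * (HahnSeries.ofPowerSeries ℤ C f).coeff n = _
  rcases lt_or_ge n 0 with hn | hn
  · rw [PowerSeries.coeff_coe, PowerSeries.coeff_coe, if_pos hn, if_pos hn, mul_zero]
  · lift n to ℕ using hn
    simp [PowerSeries.coeff_coe, PowerSeries.coeff_rescale]

theorem rescale_mem (q : Cˣ) {f : PowerSeries C} (hf : f ∈ germRing C) :
    PowerSeries.rescale (q : C) f ∈ germRing C := by
  obtain ⟨A, B, h⟩ := hf
  refine ⟨A, ‖(q : C)‖ * B, fun n => ?_⟩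
  rw [PowerSeries.coeff_rescale, norm_mul, norm_pow, mul_pow]
  calc ‖(q : C)‖ ^ n * ‖PowerSeries.coeff n f‖ ≤ ‖(q : C)‖ ^ n * (A * B ^ n) := by
        gcongr; exact h n
    _ = _ := by ring

theorem shift_mem (q : Cˣ) {f : LaurentSeries C} (hf : f ∈ germField C) :
    shift q f ∈ germField C := by
  obtain ⟨g, hg, h, hh, h0, rfl⟩ := hf
  refine ⟨_, rescale_mem q hg, _, rescale_mem q hh, ?_, ?_⟩
  · intro h1
    apply h0
    have h2 : shift q (HahnSeries.ofPowerSeries ℤ C h) = 0 := by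
      rw [shift_ofPowerSeries, h1, map_zero]
    have h3 : HahnSeries.ofPowerSeries ℤ C h = HahnSeries.ofPowerSeries ℤ C 0 := by
      rw [map_zero]
      exact (map_eq_zero_iff _ (shift q).injective).1 h2
    exact HahnSeries.ofPowerSeries_injective h3
  · rw [map_div₀, shift_ofPowerSeries, shift_ofPowerSeries]

/-- The automorphism `σ_q : f(x) ↦ f(qx)` of `C({x})`. -/
def germShift (q : Cˣ) : germField C ≃+* germField C where
  toFun f := ⟨shift q f.1, shift_mem q f.2⟩
  invFun f := ⟨shift q⁻¹ f.1, shift_mem q⁻¹ f.2⟩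
  left_inv f := Subtype.ext ((shift q).left_inv f.1)
  right_inv f := Subtype.ext ((shift q).right_inv f.1)
  map_mul' f g := Subtype.ext (map_mul (shift q) f.1 g.1)
  map_add' f g := Subtype.ext (map_add (shift q) f.1 g.1)

end Fields

section Modules

/-- A `q`-difference module over a field `F` with automorphism `σ`: a finite-dimensional
`F`-vector space with a `σ`-semilinear bijection `Φ`. -/
structure QDiffModule (F : Type u) [Field F] (σ : F ≃+* F) : Type (max u (v + 1)) where
  carrier : Type v
  [addCommGroup : AddCommGroup carrier]
  [module : Module F carrier]
  [finiteDimensional : FiniteDimensional F carrier]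
  Φ : carrier →ₛₗ[(σ : F →+* F)] carrier
  bijective : Function.Bijective Φ

attribute [instance] QDiffModule.addCommGroup QDiffModule.module QDiffModule.finiteDimensional

variable {F : Type u} [Field F] {σ : F ≃+* F}

namespace QDiffModule

/-- Morphisms of `q`-difference modules: linear maps commuting with the operators. -/
@[ext]
structure Hom (M N : QDiffModule.{u, v} F σ) where
  toLinearMap : M.carrier →ₗ[F] N.carrier
  comm : ∀ m, toLinearMap (M.Φ m) = N.Φ (toLinearMap m)

instance : Category (QDiffModule.{u, v} F σ) where
  Hom M N := Hom M N
  id M := ⟨LinearMap.id, fun _ => rfl⟩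
  comp f g := ⟨g.toLinearMap ∘ₗ f.toLinearMap, fun m => by
    simp [f.comm, g.comm]⟩

/-- The linear map underlying a morphism. -/
def lin {M N : QDiffModule.{u, v} F σ} (f : M ⟶ N) : M.carrier →ₗ[F] N.carrier :=
  Hom.toLinearMap f

/-- A subspace is stable if it is mapped bijectively to itself by `Φ`. -/
def IsStable (M : QDiffModule.{u, v} F σ) (W : Submodule F M.carrier) : Prop :=
  ∀ m, M.Φ m ∈ W ↔ m ∈ W

/-- The `q`-difference submodule carried by a stable subspace. -/
def sub (M : QDiffModule.{u, v} F σ) (W : Submodule F M.carrier) (hW : M.IsStable W) :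
    QDiffModule.{u, v} F σ where
  carrier := W
  Φ :=
    { toFun := fun m => ⟨M.Φ m.1, (hW m.1).2 m.2⟩
      map_add' := fun a b => Subtype.ext (map_add M.Φ a.1 b.1)
      map_smul' := fun c a => Subtype.ext (M.Φ.map_smulₛₗ c a.1) }
  bijective := by
    constructor
    · intro a b h
      exact Subtype.ext (M.bijective.1 (congrArg Subtype.val h))
    · rintro ⟨b, hb⟩
      obtain ⟨a, rfl⟩ := M.bijective.2 b
      exact ⟨⟨a, (hW a).1 hb⟩, rfl⟩

variable {G : Type w} [Field G] [Algebra F G]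

/-- The operator `g ⊗ m ↦ τ(g) ⊗ Φ(m)` on `G ⊗_F M`, where `τ` extends `σ`. -/
def baseChangeΦ (τ : G ≃+* G) (h : ∀ a : F, τ (algebraMap F G a) = algebraMap F G (σ a))
    (M : QDiffModule.{u, v} F σ) :
    G ⊗[F] M.carrier →ₛₗ[(τ : G →+* G)] G ⊗[F] M.carrier :=
  let τ' : G →ₛₗ[(σ : F →+* F)] G :=
    { toFun := τ
      map_add' := map_add τ
      map_smul' := fun c g => by
        simp [Algebra.smul_def, h] }
  { toFun := TensorProduct.map τ' M.Φ
    map_add' := map_add _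
    map_smul' := fun c z => by
      induction z using TensorProduct.induction_on with
      | zero => simp
      | tmul g m => simp [TensorProduct.smul_tmul', τ']
      | add a b ha hb => rw [smul_add, map_add, ha, hb, map_add, smul_add] }

theorem baseChangeΦ_tmul (τ : G ≃+* G) (h : ∀ a : F, τ (algebraMap F G a) = algebraMap F G (σ a))
    (M : QDiffModule.{u, v} F σ) (g : G) (m : M.carrier) :
    baseChangeΦ τ h M (g ⊗ₜ m) = τ g ⊗ₜ M.Φ m := rfl

theorem baseChangeΦ_bijective (τ : G ≃+* G)
    (h : ∀ a : F, τ (algebraMap F G a) = algebraMap F G (σ a)) (M : QDiffModule.{u, v} F σ) :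
    Function.Bijective (baseChangeΦ τ h M) := by
  have hsurj : Function.Surjective (baseChangeΦ τ h M) := by
    intro z
    induction z using TensorProduct.induction_on with
    | zero => exact ⟨0, map_zero _⟩
    | tmul g m =>
      obtain ⟨m, rfl⟩ := M.bijective.2 m
      exact ⟨τ.symm g ⊗ₜ m, by rw [baseChangeΦ_tmul, RingEquiv.apply_symm_apply]⟩
    | add a b ha hb =>
      obtain ⟨a, rfl⟩ := ha
      obtain ⟨b, rfl⟩ := hb
      exact ⟨a + b, map_add _ _ _⟩
  refine ⟨?_, hsurj⟩
  let e : M.carrier ≃+ M.carrier := AddEquiv.ofBijective M.Φ.toAddMonoidHom M.bijective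
  let ψ : M.carrier →ₛₗ[(σ.symm : F →+* F)] M.carrier :=
    { toFun := e.symm
      map_add' := map_add _
      map_smul' := fun c m => by
        apply e.injective
        rw [AddEquiv.apply_symm_apply]
        change _ = M.Φ (σ.symm c • e.symm m)
        rw [M.Φ.map_smulₛₗ]
        change _ = σ (σ.symm c) • e (e.symm m)
        simp }
  let τ'' : G →ₛₗ[(σ.symm : F →+* F)] G :=
    { toFun := τ.symm
      map_add' := map_add _
      map_smul' := fun c g => by
        apply τ.injective
        simp [Algebra.smul_def, h] }
  refine Function.LeftInverse.injective (g := TensorProduct.map τ'' ψ) fun z => ?_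
  induction z using TensorProduct.induction_on with
  | zero => simp
  | tmul g m =>
    rw [baseChangeΦ_tmul, TensorProduct.map_tmul]
    have h1 : τ'' (τ g) = g := τ.symm_apply_apply g
    have h2 : ψ (M.Φ m) = m := e.symm_apply_apply m
    rw [h1, h2]
  | add a b ha hb => rw [map_add, map_add, ha, hb]

/-- Extension of scalars `M ↦ (G ⊗_F M, τ ⊗ Φ)`. -/
def baseChange (τ : G ≃+* G) (h : ∀ a : F, τ (algebraMap F G a) = algebraMap F G (σ a))
    (M : QDiffModule.{u, v} F σ) : QDiffModule.{w, max w v} G τ where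
  carrier := G ⊗[F] M.carrier
  Φ := baseChangeΦ τ h M
  bijective := baseChangeΦ_bijective τ h M

end QDiffModule

end Modules

section NewtonPolygon

variable {C : Type u} [NormedField C]

/-- The points `(i, k)` with `a_i ≠ 0` and `k ≥ ord_x a_i`, for the operator `∑ a_i(x) σ_q^i`. -/
def newtonPoints {n : ℕ} (a : Fin (n + 1) → germRing C) : Set (ℝ × ℝ) :=
  {p | ∃ i : Fin (n + 1), a i ≠ 0 ∧ p.1 = (i : ℕ) ∧ ((a i).1.order.toNat : ℝ) ≤ p.2}

/-- The Newton polygon of the operator `∑ a_i(x) σ_q^i`. -/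
def newtonPolygon {n : ℕ} (a : Fin (n + 1) → germRing C) : Set (ℝ × ℝ) :=
  convexHull ℝ (newtonPoints a)

/-- `s` is a finite slope of the Newton polygon: some line of slope `s` lies below the polygon
and meets it along a segment of positive length. -/
def IsSlope {n : ℕ} (a : Fin (n + 1) → germRing C) (s : ℝ) : Prop :=
  ∃ c : ℝ, (∀ p ∈ newtonPolygon a, s * p.1 + c ≤ p.2) ∧
    ∃ p ∈ newtonPolygon a, ∃ p' ∈ newtonPolygon a, p.1 < p'.1 ∧
      p.2 = s * p.1 + c ∧ p'.2 = s * p'.1 + c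

/-- Slopes in terms of the orders of the coefficients only. -/
theorem isSlope_iff {n : ℕ} (a : Fin (n + 1) → germRing C) (s : ℝ) :
    IsSlope a s ↔ ∃ c : ℝ,
      (∀ i, a i ≠ 0 → s * (i : ℕ) + c ≤ ((a i).1.order.toNat : ℝ)) ∧
      ∃ i j : Fin (n + 1), i < j ∧ a i ≠ 0 ∧ a j ≠ 0 ∧
        ((a i).1.order.toNat : ℝ) = s * (i : ℕ) + c ∧
        ((a j).1.order.toNat : ℝ) = s * (j : ℕ) + c := by
  constructor
  · rintro ⟨c, hc, p, hp, p', hp', hlt, h1, h2⟩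
    have hc' : ∀ i, a i ≠ 0 → s * (i : ℕ) + c ≤ ((a i).1.order.toNat : ℝ) := fun i hi =>
      hc (((i : ℕ) : ℝ), ((a i).1.order.toNat : ℝ))
        (subset_convexHull ℝ _ ⟨i, hi, rfl, le_rfl⟩)
    refine ⟨c, hc', ?_⟩
    by_contra hno
    have huniq : ∀ i j : Fin (n + 1), a i ≠ 0 → a j ≠ 0 →
        ((a i).1.order.toNat : ℝ) = s * (i : ℕ) + c →
        ((a j).1.order.toNat : ℝ) = s * (j : ℕ) + c → i = j := by
      intro i j hi hj e1 e2
      rcases lt_trichotomy i j with h | h | h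
      · exact absurd ⟨i, j, h, hi, hj, e1, e2⟩ hno
      · exact h
      · exact absurd ⟨j, i, h, hj, hi, e2, e1⟩ hno
    obtain ⟨t, ht⟩ : ∃ t : ℝ, ∀ i, a i ≠ 0 →
        ((a i).1.order.toNat : ℝ) = s * (i : ℕ) + c → ((i : ℕ) : ℝ) = t := by
      by_cases hex : ∃ i, a i ≠ 0 ∧ ((a i).1.order.toNat : ℝ) = s * (i : ℕ) + c
      · obtain ⟨i, hi, e⟩ := hex
        exact ⟨(i : ℕ), fun j hj e' => by rw [huniq j i hj hi e' e]⟩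
      · exact ⟨0, fun i hi e => absurd ⟨i, hi, e⟩ hex⟩
    let T : Set (ℝ × ℝ) := {z | s * z.1 + c ≤ z.2 ∧ (z.2 = s * z.1 + c → z.1 = t)}
    have hT : Convex ℝ T := by
      rw [convex_iff_forall_pos]
      rintro x ⟨hx, hx'⟩ y ⟨hy, hy'⟩ α β hα hβ hαβ
      have e1 : (α • x + β • y).1 = α * x.1 + β * y.1 := by simp
      have e2 : (α • x + β • y).2 = α * x.2 + β * y.2 := by simp
      have ec : c = α * c + β * c := by rw [← add_mul, hαβ, one_mul]
      have f1 := mul_nonneg hα.le (sub_nonneg.2 hx)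
      have f2 := mul_nonneg hβ.le (sub_nonneg.2 hy)
      refine ⟨by rw [e1, e2]; linarith, fun h => ?_⟩
      rw [e1, e2] at h
      have g1 : α * (x.2 - (s * x.1 + c)) = 0 := by linarith
      have g2 : β * (y.2 - (s * y.1 + c)) = 0 := by linarith
      have k1 := hx' (sub_eq_zero.1 ((mul_eq_zero.1 g1).resolve_left hα.ne'))
      have k2 := hy' (sub_eq_zero.1 ((mul_eq_zero.1 g2).resolve_left hβ.ne'))
      rw [e1, k1, k2, ← add_mul, hαβ, one_mul]
    have hsub : newtonPolygon a ⊆ T := by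
      refine convexHull_min ?_ hT
      rintro z ⟨i, hi, hz1, hz2⟩
      have := hc' i hi
      refine ⟨by rw [hz1]; linarith, fun h => ?_⟩
      rw [hz1]
      rw [hz1] at h
      exact ht i hi (by linarith)
    have k1 := (hsub hp).2 h1
    have k2 := (hsub hp').2 h2
    linarith
  · rintro ⟨c, hc, i, j, hij, hi, hj, e1, e2⟩
    refine ⟨c, fun p hp => ?_, (((i : ℕ) : ℝ), ((a i).1.order.toNat : ℝ)),
      subset_convexHull ℝ _ ⟨i, hi, rfl, le_rfl⟩, (((j : ℕ) : ℝ), ((a j).1.order.toNat : ℝ)),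
      subset_convexHull ℝ _ ⟨j, hj, rfl, le_rfl⟩, Nat.cast_lt.2 hij, e1, e2⟩
    have hT : Convex ℝ {z : ℝ × ℝ | s * z.1 + c ≤ z.2} := by
      rw [convex_iff_forall_pos]
      intro x hx y hy α β hα hβ hαβ
      have e1 : (α • x + β • y).1 = α * x.1 + β * y.1 := by simp
      have e2 : (α • x + β • y).2 = α * x.2 + β * y.2 := by simp
      have ec : c = α * c + β * c := by rw [← add_mul, hαβ, one_mul]
      have f1 := mul_nonneg hα.le (sub_nonneg.2 hx)
      have f2 := mul_nonneg hβ.le (sub_nonneg.2 hy)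
      change s * (α • x + β • y).1 + c ≤ (α • x + β • y).2
      rw [e1, e2]
      linarith
    have hsub : newtonPolygon a ⊆ {z : ℝ × ℝ | s * z.1 + c ≤ z.2} := by
      refine convexHull_min ?_ hT
      rintro z ⟨i, hi, hz1, hz2⟩
      have := hc i hi
      change s * z.1 + c ≤ z.2
      rw [hz1]
      linarith
    exact hsub hp

end NewtonPolygon

section Categories

variable {C : Type u} [NormedField C] (q : Cˣ)

/-- The category `B_q` of analytic `q`-difference modules, over `C({x})`. -/
abbrev Bq : Type (u + 1) := QDiffModule.{u, u} (germField C) (germShift q)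

/-- The category of formal `q`-difference modules, over `C((x))`. -/
abbrev BqHat : Type (u + 1) := QDiffModule.{u, u} (LaurentSeries C) (shift q)

/-- The formal module `C((x)) ⊗ M` attached to an analytic module `M`. -/
def formalization (M : Bq q) : BqHat q :=
  M.baseChange (shift q) fun _ => rfl

/-- `M` is isomorphic to every analytic module to which it is formally isomorphic. -/
def isIsoObj : ObjectProperty (Bq q) := fun M =>
  ∀ N : Bq q, Nonempty (formalization q N ≅ formalization q M) → Nonempty (N ≅ M)

/-- `M` is associated, through a cyclic vector `m`, to an operator `L = ∑ a_i(x) σ_q^i` with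
coefficients in `C{x}` and order `rank M` (so `L · m = 0` and `M ≅ K[σ_q] / K[σ_q] L`), all of
whose slopes are equal to `μ`. If `M ≠ 0` then `L` has at least one slope, so this means that `μ`
is the only slope; the zero module is pure of every slope. -/
def isPure (μ : ℚ) : ObjectProperty (Bq q) := fun M =>
  ∃ (m : M.carrier) (a : Fin (Module.finrank (germField C) M.carrier + 1) → germRing C),
    LinearIndependent (germField C)
      (fun i : Fin (Module.finrank (germField C) M.carrier) => M.Φ^[i] m) ∧
    a (Fin.last _) ≠ 0 ∧
    ∑ i, toGermField (a i) • M.Φ^[i] m = 0 ∧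
    ∀ s : ℝ, IsSlope a s → s = μ

/-- The full subcategory `B_q^iso` of `B_q`. -/
abbrev Biso : Type (u + 1) := (isIsoObj q).FullSubcategory

/-- The full subcategory `B_q^{iso,f}` of pure modules of slope zero in `B_q^iso`. -/
abbrev BisoF : Type (u + 1) := (isIsoObj q ⊓ isPure q 0).FullSubcategory

/-- The category of `ℚ`-graded objects of `B_q^{iso,f}`: families indexed by `ℚ` with only
finitely many nonzero members. -/
abbrev GradedBisoF : Type (u + 1) :=
  ObjectProperty.FullSubcategory (C := GradedObject ℚ (BisoF q)) fun X =>
    {μ : ℚ | Nontrivial (X μ).obj.carrier}.Finite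

/-- `W` is a decomposition of `M` as a direct sum of submodules `W μ`, `μ ∈ ℚ`, where `W μ` is an
object of `B_q^iso` that is pure of slope `μ`. -/
def IsSlopeGrading (M : Bq q) (W : ℚ → Submodule (germField C) M.carrier) : Prop :=
  DirectSum.IsInternal W ∧
    ∀ μ, ∃ h : M.IsStable (W μ), isIsoObj q (M.sub (W μ) h) ∧ isPure q μ (M.sub (W μ) h)

end Categories

end QDiff

end

noncomputable section
namespace QDiff

section LaurentAbs

variable {C : Type u} [NormedField C]

/-- The `x`-adic absolute value `2 ^ (-ord f)` on `C((x))`. -/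
def labs (f : LaurentSeries C) : ℝ :=
  open Classical in if f = 0 then 0 else (2 : ℝ) ^ (-f.order)

@[simp] theorem labs_zero : labs (0 : LaurentSeries C) = 0 := by simp [labs]

theorem labs_of_ne {f : LaurentSeries C} (hf : f ≠ 0) : labs f = (2 : ℝ) ^ (-f.order) := by
  simp [labs, hf]

theorem labs_nonneg (f : LaurentSeries C) : 0 ≤ labs f := by
  unfold labs; split_ifs <;> positivity

theorem labs_pos {f : LaurentSeries C} (hf : f ≠ 0) : 0 < labs f := by
  rw [labs_of_ne hf]; positivity

theorem labs_eq_zero {f : LaurentSeries C} : labs f = 0 ↔ f = 0 :=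
  ⟨fun h => by_contra fun hf => (labs_pos hf).ne' h, fun h => by simp [h]⟩

theorem labs_le_iff {f : LaurentSeries C} {K : ℤ} :
    labs f ≤ (2 : ℝ) ^ (-K) ↔ ∀ k < K, f.coeff k = 0 := by
  rcases eq_or_ne f 0 with rfl | hf
  · simp only [labs_zero, HahnSeries.coeff_zero, implies_true, iff_true]; positivity
  · rw [labs_of_ne hf, zpow_le_zpow_iff_right₀ one_lt_two, neg_le_neg_iff,
      HahnSeries.le_order_iff_forall hf]

theorem labs_mul (f g : LaurentSeries C) : labs (f * g) = labs f * labs g := by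
  rcases eq_or_ne f 0 with rfl | hf
  · simp
  rcases eq_or_ne g 0 with rfl | hg
  · simp
  rw [labs_of_ne hf, labs_of_ne hg, labs_of_ne (mul_ne_zero hf hg), HahnSeries.order_mul hf hg,
    neg_add, zpow_add₀ two_ne_zero]

theorem labs_neg (f : LaurentSeries C) : labs (-f) = labs f := by
  rcases eq_or_ne f 0 with rfl | hf
  · simp
  · rw [labs_of_ne hf, labs_of_ne (neg_ne_zero.2 hf), HahnSeries.order_neg]

theorem labs_single (n : ℤ) {c : C} (hc : c ≠ 0) :
    labs (HahnSeries.single n c) = (2 : ℝ) ^ (-n) := by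
  rw [labs_of_ne (by simpa using hc), HahnSeries.order_single hc]

theorem labs_one : labs (1 : LaurentSeries C) = 1 := by
  rw [labs_of_ne one_ne_zero]; simp

theorem labs_add_le (f g : LaurentSeries C) : labs (f + g) ≤ max (labs f) (labs g) := by
  rcases eq_or_ne f 0 with rfl | hf
  · simp
  rcases eq_or_ne g 0 with rfl | hg
  · simp
  have : max (labs f) (labs g) = (2 : ℝ) ^ (-(min f.order g.order)) := by
    rw [labs_of_ne hf, labs_of_ne hg]
    rcases le_total f.order g.order with h | h
    · rw [min_eq_left h, max_eq_left]; exact zpow_le_zpow_right₀ one_le_two (by omega)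
    · rw [min_eq_right h, max_eq_right]; exact zpow_le_zpow_right₀ one_le_two (by omega)
  rw [this, labs_le_iff]
  intro k hk
  rw [HahnSeries.coeff_add, HahnSeries.coeff_eq_zero_of_lt_order (hk.trans_le (min_le_left _ _)),
    HahnSeries.coeff_eq_zero_of_lt_order (hk.trans_le (min_le_right _ _)), add_zero]

@[simp] theorem shift_coeff (q : Cˣ) (f : LaurentSeries C) (n : ℤ) :
    (shift q f).coeff n = ((q ^ n : Cˣ) : C) * f.coeff n := rfl

theorem shift_order (q : Cˣ) (f : LaurentSeries C) : labs (shift q f) = labs f := by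
  have key : ∀ (q : Cˣ) (f : LaurentSeries C), labs (shift q f) ≤ labs f := by
    intro q f
    rcases eq_or_ne f 0 with rfl | hf
    · simp
    · rw [labs_of_ne hf, labs_le_iff]
      intro k hk
      rw [shift_coeff, HahnSeries.coeff_eq_zero_of_lt_order hk, mul_zero]
  refine le_antisymm (key q f) ?_
  have := key q⁻¹ (shift q f)
  rwa [show shift q⁻¹ (shift q f) = f from (shift q).left_inv f] at this

theorem shift_shift (q r : Cˣ) (f : LaurentSeries C) : shift q (shift r f) = shift (q * r) f := by
  ext n
  simp only [shift_coeff, mul_zpow, Units.val_mul]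
  ring

theorem shift_one (f : LaurentSeries C) : shift 1 f = f := by
  ext n; simp

theorem shift_single (q : Cˣ) (n : ℤ) (c : C) :
    shift q (HahnSeries.single n c) = HahnSeries.single n (((q ^ n : Cˣ) : C) * c) := by
  ext k
  rw [shift_coeff]
  rcases eq_or_ne k n with rfl | h
  · simp
  · rw [HahnSeries.coeff_single_of_ne h, HahnSeries.coeff_single_of_ne h, mul_zero]

end LaurentAbs

section RNorm

variable {C : Type u} [NormedField C] (ν : AbsoluteValue C ℝ)

/-- The weighted `ℓ¹` norm `∑ |f_k| ρ^k`. -/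
def rnorm (ρ : ℝ) (f : LaurentSeries C) : ENNReal :=
  ∑' k : ℤ, ENNReal.ofReal (ν (f.coeff k) * ρ ^ k)

variable {ν}

theorem rnorm_zero (ρ : ℝ) : rnorm ν ρ (0 : LaurentSeries C) = 0 := by simp [rnorm]

theorem rnorm_add_le {ρ : ℝ} (hρ : 0 < ρ) (f g : LaurentSeries C) :
    rnorm ν ρ (f + g) ≤ rnorm ν ρ f + rnorm ν ρ g := by
  unfold rnorm
  rw [← ENNReal.tsum_add]
  refine ENNReal.tsum_le_tsum fun k => ?_
  rw [← ENNReal.ofReal_add (by positivity) (by positivity), ← add_mul]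
  exact ENNReal.ofReal_le_ofReal (mul_le_mul_of_nonneg_right (ν.add_le _ _) (by positivity))

theorem rnorm_sum_le {ρ : ℝ} (hρ : 0 < ρ) {α : Type*} (s : Finset α) (f : α → LaurentSeries C) :
    rnorm ν ρ (∑ i ∈ s, f i) ≤ ∑ i ∈ s, rnorm ν ρ (f i) := by
  classical
  induction s using Finset.induction_on with
  | empty => simp [rnorm_zero]
  | insert a s ha ih =>
    rw [Finset.sum_insert ha, Finset.sum_insert ha]
    exact (rnorm_add_le hρ _ _).trans (by gcongr)

theorem rnorm_mul_le {ρ : ℝ} (hρ : 0 < ρ) (f g : LaurentSeries C) :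
    rnorm ν ρ (f * g) ≤ rnorm ν ρ f * rnorm ν ρ g := by
  have key : ∀ n : ℤ, ENNReal.ofReal (ν ((f * g).coeff n) * ρ ^ n) ≤
      ∑' i : ℤ, ENNReal.ofReal (ν (f.coeff i) * ρ ^ i) *
        ENNReal.ofReal (ν (g.coeff (n - i)) * ρ ^ (n - i)) := by
    intro n
    rw [HahnSeries.coeff_mul]
    set s := Finset.antidiagonal f.isPWO_support g.isPWO_support n with hs
    have hinj : Set.InjOn Prod.fst (s : Set (ℤ × ℤ)) := by
      intro a ha b hb hab
      rw [Finset.mem_coe, Finset.mem_antidiagonal] at ha hb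
      have : a.2 = b.2 := by have := ha.2.2; have := hb.2.2; omega
      exact Prod.ext hab this
    calc ENNReal.ofReal (ν (∑ p ∈ s, f.coeff p.1 * g.coeff p.2) * ρ ^ n)
        ≤ ENNReal.ofReal ((∑ p ∈ s, ν (f.coeff p.1 * g.coeff p.2)) * ρ ^ n) := by
          refine ENNReal.ofReal_le_ofReal (mul_le_mul_of_nonneg_right ?_ (by positivity))
          exact ν.sum_le _ _
      _ = ∑ p ∈ s, ENNReal.ofReal (ν (f.coeff p.1 * g.coeff p.2) * ρ ^ n) := by
          rw [Finset.sum_mul, ENNReal.ofReal_sum_of_nonneg (fun _ _ => by positivity)]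
      _ = ∑ p ∈ s, ENNReal.ofReal (ν (f.coeff p.1) * ρ ^ p.1) *
            ENNReal.ofReal (ν (g.coeff (n - p.1)) * ρ ^ (n - p.1)) := by
          refine Finset.sum_congr rfl fun p hp => ?_
          rw [hs, Finset.mem_antidiagonal] at hp
          have h2 : p.2 = n - p.1 := by have := hp.2.2; omega
          rw [← h2, ← ENNReal.ofReal_mul (by positivity), map_mul, ← hp.2.2, zpow_add₀ hρ.ne']
          congr 1; ring
      _ = ∑ i ∈ s.image Prod.fst, ENNReal.ofReal (ν (f.coeff i) * ρ ^ i) *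
            ENNReal.ofReal (ν (g.coeff (n - i)) * ρ ^ (n - i)) := by
          rw [Finset.sum_image hinj]
      _ ≤ _ := ENNReal.sum_le_tsum _
  calc rnorm ν ρ (f * g) ≤ ∑' n : ℤ, ∑' i : ℤ, ENNReal.ofReal (ν (f.coeff i) * ρ ^ i) *
        ENNReal.ofReal (ν (g.coeff (n - i)) * ρ ^ (n - i)) := ENNReal.tsum_le_tsum key
    _ = ∑' i : ℤ, ENNReal.ofReal (ν (f.coeff i) * ρ ^ i) * rnorm ν ρ g := by
        rw [ENNReal.tsum_comm]
        refine tsum_congr fun i => ?_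
        rw [ENNReal.tsum_mul_left]
        congr 1
        exact (Equiv.subRight i).tsum_eq (fun m => ENNReal.ofReal (ν (g.coeff m) * ρ ^ m))
    _ = _ := by rw [ENNReal.tsum_mul_right]; rfl

theorem rnorm_shift {q : Cˣ} (hq : ν (q : C) = 1) (ρ : ℝ) (f : LaurentSeries C) :
    rnorm ν ρ (shift q f) = rnorm ν ρ f := by
  unfold rnorm
  refine tsum_congr fun k => ?_
  rw [shift_coeff, map_mul, Units.val_zpow_eq_zpow_val, map_zpow₀, hq, one_zpow, one_mul]

theorem coeff_le_rnorm {ρ : ℝ} (hρ : 0 < ρ) (f : LaurentSeries C) (k : ℤ) :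
    ENNReal.ofReal (ν (f.coeff k)) ≤ ENNReal.ofReal (ρ ^ (-k)) * rnorm ν ρ f := by
  have h1 : ENNReal.ofReal (ν (f.coeff k) * ρ ^ k) ≤ rnorm ν ρ f :=
    ENNReal.le_tsum (f := fun k : ℤ => ENNReal.ofReal (ν (f.coeff k) * ρ ^ k)) k
  calc ENNReal.ofReal (ν (f.coeff k))
      = ENNReal.ofReal (ρ ^ (-k)) * ENNReal.ofReal (ν (f.coeff k) * ρ ^ k) := by
        rw [← ENNReal.ofReal_mul (by positivity), zpow_neg]
        congr 1; field_simp
    _ ≤ _ := by gcongr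

theorem rnorm_le_of_coeff {ρ ρ₀ : ℝ} (hρ : 0 < ρ) (h : ρ ≤ ρ₀) {K : ℤ} {f : LaurentSeries C}
    (hf : ∀ k < K, f.coeff k = 0) :
    rnorm ν ρ f ≤ ENNReal.ofReal ((ρ / ρ₀) ^ K) * rnorm ν ρ₀ f := by
  have h0 : 0 < ρ₀ := hρ.trans_le h
  unfold rnorm
  rw [← ENNReal.tsum_mul_left]
  refine ENNReal.tsum_le_tsum fun k => ?_
  rcases lt_or_ge k K with hk | hk
  · simp [hf k hk]
  rw [← ENNReal.ofReal_mul (by positivity)]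
  refine ENNReal.ofReal_le_ofReal ?_
  have e : ρ ^ k = (ρ / ρ₀) ^ k * ρ₀ ^ k := by rw [div_zpow]; field_simp
  have h1 : (ρ / ρ₀) ^ k ≤ (ρ / ρ₀) ^ K :=
    zpow_le_zpow_right_of_le_one₀ (by positivity) ((div_le_one h0).2 h) hk
  rw [e]
  calc ν (f.coeff k) * ((ρ / ρ₀) ^ k * ρ₀ ^ k) = (ρ / ρ₀) ^ k * (ν (f.coeff k) * ρ₀ ^ k) := by ring
    _ ≤ _ := by gcongr

theorem growth_iff (f : LaurentSeries C) :
    (∃ A B : ℝ, 0 < B ∧ ∀ k : ℤ, ν (f.coeff k) ≤ A * B ^ k) ↔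
      ∀ᶠ ρ in nhdsWithin (0 : ℝ) (Set.Ioi 0), rnorm ν ρ f < ⊤ := by
  constructor
  · rintro ⟨A, B, hB, h⟩
    have hA : 0 ≤ A := by have := (ν.nonneg _).trans (h 0); simpa using this
    have h2 : rnorm ν (1 / (2 * B)) f < ⊤ := by
      unfold rnorm
      have hs : Summable fun k : ℤ => ν (f.coeff k) * (1 / (2 * B)) ^ k := by
        rw [← (Equiv.addRight f.order).summable_iff]
        refine Summable.of_nat_of_neg (f := (fun k : ℤ => ν (f.coeff k) * (1 / (2 * B)) ^ k) ∘
          (Equiv.addRight f.order)) ?_ ?_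
        · refine Summable.of_nonneg_of_le (fun n => by simp only [Function.comp]; positivity) ?_
            ((summable_geometric_of_lt_one (r := 1/2) (by norm_num) (by norm_num)).mul_left
              (A * (1/2 : ℝ) ^ f.order))
          intro n
          simp only [Function.comp, Equiv.coe_addRight]
          calc _ ≤ (A * B ^ ((n : ℤ) + f.order)) * (1 / (2 * B)) ^ ((n : ℤ) + f.order) := by
                gcongr; exact h _
            _ = A * (1 / 2) ^ ((n : ℤ) + f.order) := by
                rw [mul_assoc, ← mul_zpow]; congr 2; field_simp
            _ = _ := by rw [zpow_add₀ (by norm_num), zpow_natCast]; ring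
        · refine summable_of_ne_finset_zero (s := {0}) fun n hn => ?_
          simp only [Function.comp, Equiv.coe_addRight]
          rw [HahnSeries.coeff_eq_zero_of_lt_order]
          · simp
          · have : n ≠ 0 := by simpa using hn
            omega
      rw [← ENNReal.ofReal_tsum_of_nonneg (fun k => by positivity) hs]
      exact ENNReal.ofReal_lt_top
    have : Set.Ioc (0 : ℝ) (1 / (2 * B)) ∈ nhdsWithin (0 : ℝ) (Set.Ioi 0) :=
      Ioc_mem_nhdsGT (by positivity)
    filter_upwards [this] with ρ hρ
    refine (rnorm_le_of_coeff hρ.1 hρ.2 (K := f.order)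
      fun k hk => HahnSeries.coeff_eq_zero_of_lt_order hk).trans_lt ?_
    exact ENNReal.mul_lt_top ENNReal.ofReal_lt_top h2
  · intro h
    obtain ⟨ρ, hρ, h0⟩ := (h.and self_mem_nhdsWithin).exists
    have h0 : 0 < ρ := h0
    refine ⟨(rnorm ν ρ f).toReal, ρ⁻¹, inv_pos.2 h0, fun k => ?_⟩
    have := coeff_le_rnorm (ν := ν) h0 f k
    rw [← ENNReal.ofReal_toReal hρ.ne, ← ENNReal.ofReal_mul (by positivity),
      ENNReal.ofReal_le_ofReal_iff (by positivity)] at this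
    rw [inv_zpow', mul_comm]; exact this

theorem rnorm_small {f : LaurentSeries C} (hf : labs f ≤ 1 / 2)
    (hr : ∀ᶠ ρ in nhdsWithin (0 : ℝ) (Set.Ioi 0), rnorm ν ρ f < ⊤) {ε : ENNReal} (hε : 0 < ε) :
    ∀ᶠ ρ in nhdsWithin (0 : ℝ) (Set.Ioi 0), rnorm ν ρ f ≤ ε := by
  have hf' : ∀ k < 1, f.coeff k = 0 := labs_le_iff.1 (by simpa using hf)
  obtain ⟨ρ₀, h1, h0⟩ := (hr.and self_mem_nhdsWithin).exists
  have h0 : 0 < ρ₀ := h0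
  have ht : Filter.Tendsto (fun ρ : ℝ => ENNReal.ofReal ((ρ / ρ₀)) * rnorm ν ρ₀ f)
      (nhdsWithin (0 : ℝ) (Set.Ioi 0)) (nhds (ENNReal.ofReal (0 / ρ₀) * rnorm ν ρ₀ f)) := by
    refine ENNReal.Tendsto.mul_const ?_ (Or.inr h1.ne)
    refine ENNReal.tendsto_ofReal (tendsto_nhdsWithin_of_tendsto_nhds ?_)
    exact (continuous_id.div_const ρ₀).tendsto 0
  simp only [zero_div, ENNReal.ofReal_zero, zero_mul] at ht
  filter_upwards [ht.eventually (ge_mem_nhds hε), Ioc_mem_nhdsGT h0] with ρ h2 h3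
  refine (rnorm_le_of_coeff h3.1 h3.2 hf').trans ?_
  simpa using h2

end RNorm

/-- A field `F` with an embedding in `C((x))`, whose range consists of the series whose
coefficients grow at most geometrically with respect to the absolute value `ν`. -/
class GrowthField (C : Type u) [NormedField C] (F : Type w) [Field F] where
  ν : AbsoluteValue C ℝ
  ι : F →+* LaurentSeries C
  mem_range_iff : ∀ f : LaurentSeries C,
    f ∈ ι.range ↔ ∃ A B : ℝ, 0 < B ∧ ∀ k : ℤ, ν (f.coeff k) ≤ A * B ^ k

/-- The automorphism `σ` of `F` is induced by `f(x) ↦ f(qx)`, where `|q| = 1`. -/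
class IsShift {C : Type u} [NormedField C] (q : Cˣ) {F : Type w} [Field F] [GrowthField C F]
    (σ : F ≃+* F) : Prop where
  map_shift : ∀ f : F, (GrowthField.ι : F →+* LaurentSeries C) (σ f) = shift q (GrowthField.ι f)
  ν_eq : (GrowthField.ν F : AbsoluteValue C ℝ) (q : C) = 1

open GrowthField

section GrowthField

variable (C : Type u) [NormedField C] {F : Type w} [Field F] [GrowthField C F]

/-- The `x`-adic absolute value on `F`. -/
def fabs (f : F) : ℝ := labs (ι f : LaurentSeries C)

variable {C}

theorem ι_injective : Function.Injective (ι : F →+* LaurentSeries C) := RingHom.injective _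

@[simp] theorem fabs_zero : fabs C (0 : F) = 0 := by simp [fabs]
@[simp] theorem fabs_one : fabs C (1 : F) = 1 := by simp [fabs, labs_one]
theorem fabs_nonneg (f : F) : 0 ≤ fabs C f := labs_nonneg _
theorem fabs_eq_zero {f : F} : fabs C f = 0 ↔ f = 0 := by
  rw [fabs, labs_eq_zero, map_eq_zero_iff _ ι_injective]
theorem fabs_pos {f : F} (hf : f ≠ 0) : 0 < fabs C f :=
  (fabs_nonneg f).lt_of_ne' (fabs_eq_zero.not.2 hf)
@[simp] theorem fabs_mul (f g : F) : fabs C (f * g) = fabs C f * fabs C g := by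
  simp [fabs, labs_mul]
@[simp] theorem fabs_neg (f : F) : fabs C (-f) = fabs C f := by simp [fabs, labs_neg]
theorem fabs_add_le (f g : F) : fabs C (f + g) ≤ max (fabs C f) (fabs C g) := by
  simpa [fabs] using labs_add_le (C := C) _ _
theorem fabs_inv (f : F) : fabs C f⁻¹ = (fabs C f)⁻¹ := by
  rcases eq_or_ne f 0 with rfl | hf
  · simp
  · refine eq_inv_of_mul_eq_one_left ?_
    rw [← fabs_mul, inv_mul_cancel₀ hf, fabs_one]
theorem fabs_div (f g : F) : fabs C (f / g) = fabs C f / fabs C g := by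
  rw [div_eq_mul_inv, fabs_mul, fabs_inv, div_eq_mul_inv]

theorem fabs_sum_le {α : Type*} (s : Finset α) (f : α → F) {D : ℝ} (hD : 0 ≤ D)
    (h : ∀ i ∈ s, fabs C (f i) ≤ D) : fabs C (∑ i ∈ s, f i) ≤ D := by
  classical
  induction s using Finset.induction_on with
  | empty => simpa
  | insert a s ha ih =>
    rw [Finset.sum_insert ha]
    exact (fabs_add_le _ _).trans (max_le (h a (Finset.mem_insert_self _ _))
      (ih fun i hi => h i (Finset.mem_insert_of_mem hi)))

theorem exists_ι_eq {f : LaurentSeries C} {A B : ℝ} (hB : 0 < B)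
    (h : ∀ k : ℤ, ν F (f.coeff k) ≤ A * B ^ k) : ∃ g : F, ι g = f :=
  (mem_range_iff f).2 ⟨A, B, hB, h⟩

theorem eventually_rnorm (f : F) :
    ∀ᶠ ρ in nhdsWithin (0 : ℝ) (Set.Ioi 0), rnorm (ν F) ρ (ι f : LaurentSeries C) < ⊤ :=
  (growth_iff _).1 ((mem_range_iff _).1 ⟨f, rfl⟩)

theorem exists_ι_eq_of_rnorm {f : LaurentSeries C} {ρ : ℝ} (h0 : 0 < ρ)
    (h : rnorm (ν F) ρ f < ⊤) : ∃ g : F, ι g = f := by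
  refine (mem_range_iff f).2 ((growth_iff f).2 ?_)
  filter_upwards [Ioc_mem_nhdsGT h0] with ρ' hρ'
  exact (rnorm_le_of_coeff hρ'.1 hρ'.2 (K := f.order)
      fun k hk => HahnSeries.coeff_eq_zero_of_lt_order hk).trans_lt
    (ENNReal.mul_lt_top ENNReal.ofReal_lt_top h)

theorem exists_ι_eq_single (n : ℤ) (c : C) : ∃ g : F, ι g = (HahnSeries.single n c) := by
  refine exists_ι_eq_of_rnorm (ρ := 1) one_pos ?_
  unfold rnorm
  rw [tsum_eq_single n]
  · exact ENNReal.ofReal_lt_top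
  · intro k hk
    simp [HahnSeries.coeff_single_of_ne hk]

variable (F) in
/-- The constants in `F`. -/
def cst : C →+* F where
  toFun c := (exists_ι_eq_single (F := F) 0 c).choose
  map_one' := by
    apply ι_injective (C := C)
    rw [(exists_ι_eq_single (F := F) 0 (1 : C)).choose_spec, RingHom.map_one]; rfl
  map_zero' := by
    apply ι_injective (C := C)
    rw [(exists_ι_eq_single (F := F) 0 (0 : C)).choose_spec, map_zero]; simp
  map_mul' a b := by
    apply ι_injective (C := C)
    rw [(exists_ι_eq_single (F := F) 0 (a * b)).choose_spec, RingHom.map_mul,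
      (exists_ι_eq_single (F := F) 0 a).choose_spec, (exists_ι_eq_single (F := F) 0 b).choose_spec]
    simp
  map_add' a b := by
    apply ι_injective (C := C)
    rw [(exists_ι_eq_single (F := F) 0 (a + b)).choose_spec, RingHom.map_add,
      (exists_ι_eq_single (F := F) 0 a).choose_spec, (exists_ι_eq_single (F := F) 0 b).choose_spec]
    simp

theorem ι_cst (c : C) : ι (cst F c) = (HahnSeries.single 0 c : LaurentSeries C) :=
  (exists_ι_eq_single (F := F) 0 c).choose_spec

variable (C F) in
/-- The variable `x` in `F`. -/
def xvar : F := (exists_ι_eq_single (F := F) 1 (1 : C)).choose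

theorem ι_xvar : ι (xvar C F) = (HahnSeries.single 1 1 : LaurentSeries C) :=
  (exists_ι_eq_single (F := F) 1 (1 : C)).choose_spec

theorem xvar_ne_zero : xvar C F ≠ 0 := by
  intro h
  have := ι_xvar (C := C) (F := F)
  rw [h, map_zero] at this
  simpa using this.symm

theorem ι_xvar_zpow (n : ℤ) : ι (xvar C F ^ n) = (HahnSeries.single n 1 : LaurentSeries C) := by
  have hp : ∀ n : ℕ, ι (xvar C F ^ n) = (HahnSeries.single (n : ℤ) 1 : LaurentSeries C) := by
    intro n
    rw [map_pow, ι_xvar, HahnSeries.single_pow]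
    simp
  rcases Int.eq_nat_or_neg n with ⟨m, rfl | rfl⟩
  · rw [zpow_natCast, hp]
  · rw [zpow_neg, zpow_natCast, map_inv₀, hp]
    rw [inv_eq_iff_eq_inv, eq_comm, inv_eq_of_mul_eq_one_left]
    rw [HahnSeries.single_mul_single]
    simp

theorem ι_cst_mul_xvar_zpow (c : C) (n : ℤ) :
    ι (cst F c * xvar C F ^ n) = (HahnSeries.single n c : LaurentSeries C) := by
  rw [map_mul, ι_cst, ι_xvar_zpow, HahnSeries.single_mul_single]; simp

theorem fabs_cst {c : C} (hc : c ≠ 0) : fabs C (cst F c) = 1 := by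
  rw [fabs, ι_cst, labs_single _ hc]; simp

theorem fabs_xvar_zpow (n : ℤ) : fabs C (xvar C F ^ n) = (2 : ℝ) ^ (-n) := by
  rw [fabs, ι_xvar_zpow, labs_single _ one_ne_zero]

theorem fabs_xvar : fabs C (xvar C F) = 1 / 2 := by
  simpa using fabs_xvar_zpow (C := C) (F := F) 1

/-- The values of the absolute value are powers of `2`. -/
theorem exists_fabs_eq {f : F} (hf : f ≠ 0) : ∃ n : ℤ, fabs C f = (2 : ℝ) ^ n :=
  ⟨_, labs_of_ne ((map_ne_zero_iff _ ι_injective).2 hf)⟩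

theorem exists_ι_eq_shift {u : Cˣ} (hu : ν F (u : C) = 1) (f : F) :
    ∃ g : F, ι g = shift u (ι f : LaurentSeries C) := by
  obtain ⟨A, B, hB, h⟩ := (mem_range_iff (ι f : LaurentSeries C)).1 ⟨f, rfl⟩
  refine exists_ι_eq (A := A) hB fun k => ?_
  rw [shift_coeff, map_mul, Units.val_zpow_eq_zpow_val, map_zpow₀, hu, one_zpow, one_mul]
  exact h k

section Shift
variable {q : Cˣ} {σ : F ≃+* F} [hσ : IsShift q σ]

theorem fabs_shift (q : Cˣ) {σ : F ≃+* F} [hσ : IsShift q σ] (f : F) :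
    fabs C (σ f) = fabs C f := by
  rw [fabs, hσ.map_shift, shift_order, fabs]

theorem shift_cst (q : Cˣ) {σ : F ≃+* F} [hσ : IsShift q σ] (c : C) : σ (cst F c) = cst F c := by
  apply ι_injective (C := C)
  rw [hσ.map_shift, ι_cst, shift_single]; simp

theorem shift_xvar (q : Cˣ) {σ : F ≃+* F} [hσ : IsShift q σ] :
    σ (xvar C F) = cst F (q : C) * xvar C F := by
  apply ι_injective (C := C)
  rw [hσ.map_shift, ι_xvar, shift_single, RingHom.map_mul, ι_xvar, ι_cst, HahnSeries.single_mul_single]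
  simp

end Shift

end GrowthField

section Instances

variable {C : Type u} [NormedField C]

open Classical in
instance : GrowthField C (LaurentSeries C) where
  ν := AbsoluteValue.trivial
  ι := RingHom.id _
  mem_range_iff f := by
    refine ⟨fun _ => ⟨2 ^ (-f.order), 2, two_pos, fun k => ?_⟩, fun _ => ⟨f, rfl⟩⟩
    by_cases hk : f.coeff k = 0
    · rw [hk, map_zero]; positivity
    · rw [AbsoluteValue.trivial_apply hk, ← zpow_add₀ two_ne_zero]
      refine one_le_zpow₀ one_le_two ?_
      have := HahnSeries.order_le_of_coeff_ne_zero hk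
      omega

open Classical in
instance (q : Cˣ) : IsShift q (shift q) where
  map_shift _ := rfl
  ν_eq := AbsoluteValue.trivial_apply q.ne_zero

theorem germRing_inv {f g : PowerSeries C} (hf : f ∈ germRing C)
    (h0 : PowerSeries.coeff 0 f = 1) (hfg : f * g = 1) : g ∈ germRing C := by
  obtain ⟨A, B, hA, hB, h⟩ := IsConvergent.exists_pos hf
  refine ⟨1, B * (1 + A), fun n => ?_⟩
  induction n using Nat.strong_induction_on with
  | _ n ih =>
    rcases Nat.eq_zero_or_pos n with rfl | hn
    · have := congrArg (PowerSeries.coeff 0) hfg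
      rw [PowerSeries.coeff_mul] at this
      simp only [Finset.Nat.antidiagonal_zero, Finset.sum_singleton, h0, one_mul] at this
      rw [this]; simp
    · obtain ⟨n, rfl⟩ : ∃ m, n = m + 1 := ⟨n - 1, by omega⟩
      have := congrArg (PowerSeries.coeff (n + 1)) hfg
      rw [PowerSeries.coeff_mul, Finset.Nat.antidiagonal_succ] at this
      simp only [Finset.sum_cons, h0, one_mul, Finset.sum_map, PowerSeries.coeff_one] at this
      simp only [Nat.succ_ne_zero, if_false, Function.Embedding.prodMap,
        Function.Embedding.coeFn_mk, Prod.map_fst, Prod.map_snd, Function.Embedding.refl_apply] at this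
      rw [eq_neg_of_add_eq_zero_left this, norm_neg]
      rw [Finset.Nat.sum_antidiagonal_eq_sum_range_succ
        (fun i j => PowerSeries.coeff (i.succ) f * PowerSeries.coeff j g)]
      calc _ ≤ ∑ k ∈ Finset.range (n + 1), (A * B ^ (k + 1)) * (B * (1 + A)) ^ (n - k) := by
            refine (norm_sum_le _ _).trans (Finset.sum_le_sum fun k hk => ?_)
            rw [norm_mul]
            have hk := Finset.mem_range.1 hk
            have := ih (n - k) (by omega)
            rw [one_mul] at this
            exact mul_le_mul (h _) this (norm_nonneg _) (by positivity)
        _ = B ^ (n + 1) * (A * ∑ k ∈ Finset.range (n + 1), (1 + A) ^ (n - k)) := by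
            rw [Finset.mul_sum, Finset.mul_sum]
            refine Finset.sum_congr rfl fun k hk => ?_
            have hk := Finset.mem_range.1 hk
            rw [mul_pow, show B ^ (n + 1) = B ^ (k + 1) * B ^ (n - k) by rw [← pow_add]; congr 1; omega]
            ring
        _ = B ^ (n + 1) * ((1 + A) ^ (n + 1) - 1) := by
            have e := Finset.sum_range_reflect (fun k => (1 + A) ^ k) (n + 1)
            have e2 : ∑ k ∈ Finset.range (n + 1), (1 + A) ^ (n - k) =
                ∑ k ∈ Finset.range (n + 1), (1 + A) ^ k := by
              rw [← e]; exact Finset.sum_congr rfl fun k hk => by congr 1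
            have := geom_sum_mul (1 + A) (n + 1)
            rw [e2, ← this]; ring
        _ ≤ 1 * (B * (1 + A)) ^ (n + 1) := by
            rw [mul_pow, one_mul]; gcongr; linarith

theorem ofPowerSeries_mem_germField {g : PowerSeries C} (hg : g ∈ germRing C) :
    HahnSeries.ofPowerSeries ℤ C g ∈ germField C :=
  ⟨g, hg, 1, one_mem _, one_ne_zero, by simp⟩

theorem X_mem_germRing : (PowerSeries.X : PowerSeries C) ∈ germRing C := by
  refine ⟨1, 1, fun n => ?_⟩
  rw [PowerSeries.coeff_X]
  split_ifs <;> simp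

/-- Series with geometric growth. -/
def Growth (f : LaurentSeries C) : Prop :=
  ∃ A B : ℝ, 0 < B ∧ ∀ k : ℤ, ‖f.coeff k‖ ≤ A * B ^ k

theorem growth_iff_rnorm (f : LaurentSeries C) :
    Growth f ↔ ∀ᶠ ρ in nhdsWithin (0 : ℝ) (Set.Ioi 0),
      rnorm (NormedField.toAbsoluteValue C) ρ f < ⊤ :=
  growth_iff (ν := NormedField.toAbsoluteValue C) f

theorem Growth.mul {f g : LaurentSeries C} (hf : Growth f) (hg : Growth g) : Growth (f * g) := by
  rw [growth_iff_rnorm] at *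
  filter_upwards [hf, hg, self_mem_nhdsWithin] with ρ h1 h2 h0
  exact (rnorm_mul_le h0 f g).trans_lt (ENNReal.mul_lt_top h1 h2)

theorem growth_ofPowerSeries {g : PowerSeries C} (hg : g ∈ germRing C) :
    Growth (HahnSeries.ofPowerSeries ℤ C g) := by
  obtain ⟨A, B, hA, hB, h⟩ := IsConvergent.exists_pos hg
  refine ⟨A, B, hB, fun k => ?_⟩
  rw [PowerSeries.coeff_coe]
  split_ifs with hk
  · rw [norm_zero]; positivity
  · lift k to ℕ using (not_lt.1 hk)
    simpa using h k

theorem growth_single (n : ℤ) (c : C) : Growth (HahnSeries.single n c) := by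
  refine ⟨‖c‖, 1, one_pos, fun k => ?_⟩
  rcases eq_or_ne k n with rfl | h
  · simp
  · rw [HahnSeries.coeff_single_of_ne h]; simp

theorem growth_inv_ofPowerSeries {h : PowerSeries C} (hh : h ∈ germRing C) (h0 : h ≠ 0) :
    Growth (HahnSeries.ofPowerSeries ℤ C h)⁻¹ := by
  set n := h.order.toNat
  have hn : PowerSeries.coeff n h ≠ 0 := PowerSeries.coeff_order h0
  set c := PowerSeries.coeff n h
  let p : PowerSeries C := PowerSeries.mk fun k => c⁻¹ * PowerSeries.coeff (n + k) h
  have e : h = PowerSeries.X ^ n * (PowerSeries.C c * p) := by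
    ext k
    rw [PowerSeries.coeff_X_pow_mul']
    split_ifs with hk
    · rw [PowerSeries.coeff_C_mul, PowerSeries.coeff_mk, ← mul_assoc, mul_inv_cancel₀ hn, one_mul]
      congr 2; exact (Nat.add_sub_cancel' hk).symm
    · exact PowerSeries.coeff_of_lt_order_toNat k (by simpa using hk)
  have hp : p ∈ germRing C := by
    obtain ⟨A, B, hA, hB, h⟩ := IsConvergent.exists_pos hh
    refine ⟨‖c⁻¹‖ * (A * B ^ n), B, fun k => ?_⟩
    rw [PowerSeries.coeff_mk, norm_mul, mul_assoc, mul_assoc, ← pow_add]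
    gcongr; exact h _
  have hp0 : PowerSeries.coeff 0 p = 1 := by
    rw [PowerSeries.coeff_mk, add_zero]; exact inv_mul_cancel₀ hn
  have hpu : p * p⁻¹ = 1 := by
    refine PowerSeries.mul_inv_cancel p ?_
    rw [← PowerSeries.coeff_zero_eq_constantCoeff_apply, hp0]; exact one_ne_zero
  have hpi := germRing_inv hp hp0 hpu
  have e2 : (HahnSeries.ofPowerSeries ℤ C h)⁻¹ =
      HahnSeries.single (-(n : ℤ)) c⁻¹ * HahnSeries.ofPowerSeries ℤ C p⁻¹ := by
    refine inv_eq_of_mul_eq_one_right ?_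
    rw [e, map_mul, map_mul, HahnSeries.ofPowerSeries_X_pow, HahnSeries.ofPowerSeries_C]
    have h1 : HahnSeries.ofPowerSeries ℤ C p * HahnSeries.ofPowerSeries ℤ C p⁻¹ = 1 := by
      rw [← map_mul, hpu, map_one]
    calc _ = (HahnSeries.single (n : ℤ) (1 : C) * HahnSeries.C c * HahnSeries.single (-(n : ℤ)) c⁻¹) *
        (HahnSeries.ofPowerSeries ℤ C p * HahnSeries.ofPowerSeries ℤ C p⁻¹) := by ring
      _ = 1 := by
        rw [h1, mul_one, HahnSeries.C_apply, HahnSeries.single_mul_single,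
          HahnSeries.single_mul_single]
        simp [mul_inv_cancel₀ hn]
  rw [e2]
  exact (growth_single _ _).mul (growth_ofPowerSeries hpi)

theorem mem_germField_iff (f : LaurentSeries C) : f ∈ germField C ↔ Growth f := by
  constructor
  · rintro ⟨g, hg, h, hh, h0, rfl⟩
    rw [div_eq_mul_inv]
    exact (growth_ofPowerSeries hg).mul (growth_inv_ofPowerSeries hh h0)
  · rintro ⟨A, B, hB, h⟩
    have hp : f.powerSeriesPart ∈ germRing C := by
      refine ⟨A * B ^ f.order, B, fun k => ?_⟩
      rw [LaurentSeries.powerSeriesPart_coeff, mul_assoc, ← zpow_natCast, ← zpow_add₀ hB.ne']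
      exact h _
    have hX : HahnSeries.single 1 1 ∈ germField C := by
      have := ofPowerSeries_mem_germField (C := C) X_mem_germRing
      rwa [HahnSeries.ofPowerSeries_X] at this
    have hs : HahnSeries.single f.order (1 : C) ∈ germField C := by
      have := zpow_mem hX f.order
      have e : (HahnSeries.single (1 : ℤ) (1 : C)) ^ f.order = HahnSeries.single f.order (1 : C) := by
        have := ι_xvar_zpow (C := C) (F := LaurentSeries C) f.order
        rw [map_zpow₀, ι_xvar] at this
        exact this
      rwa [e] at this
    rw [← LaurentSeries.single_order_mul_powerSeriesPart f]
    exact mul_mem hs (ofPowerSeries_mem_germField hp)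

instance : GrowthField C (germField C) where
  ν := NormedField.toAbsoluteValue C
  ι := (germField C).subtype
  mem_range_iff f := by
    rw [show f ∈ (germField C).subtype.range ↔ f ∈ germField C by simp]
    exact mem_germField_iff f

theorem isShift_germShift {q : Cˣ} (hq : ‖(q : C)‖ = 1) : IsShift q (germShift q) where
  map_shift _ := rfl
  ν_eq := hq

end Instances

open GrowthField

section Adm

variable (C : Type u) [NormedField C] (F : Type w) [Field F] [GrowthField C F]

/-- An admissible norm on an `F`-vector space: ultrametric, homogeneous for the `x`-adic absolute
value, and such that all linear functionals are bounded. -/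
structure IsAdm {V : Type v} [AddCommGroup V] [Module F V] (N : V → ℝ) : Prop where
  nonneg : ∀ v, 0 ≤ N v
  add_le : ∀ v w, N (v + w) ≤ max (N v) (N w)
  smul : ∀ (f : F) v, N (f • v) = fabs C f * N v
  bdd : ∀ φ : V →ₗ[F] F, ∃ D : ℝ, ∀ v, fabs C (φ v) ≤ D * N v

variable {C F} {V : Type v} [AddCommGroup V] [Module F V] {W : Type*} [AddCommGroup W] [Module F W]

namespace IsAdm

variable {N : V → ℝ} (hN : IsAdm C F N)
include hN

theorem map_zero : N 0 = 0 := by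
  have := hN.smul 0 0
  simpa using this

theorem map_neg (v : V) : N (-v) = N v := by
  have := hN.smul (-1) v
  simpa using this

theorem sub_le (v w : V) : N (v - w) ≤ max (N v) (N w) := by
  rw [sub_eq_add_neg, ← hN.map_neg w]
  exact hN.add_le _ _

theorem sum_le {α : Type*} (s : Finset α) (f : α → V) {D : ℝ} (hD : 0 ≤ D)
    (h : ∀ i ∈ s, N (f i) ≤ D) : N (∑ i ∈ s, f i) ≤ D := by
  classical
  induction s using Finset.induction_on with
  | empty => simpa [hN.map_zero]
  | insert a s ha ih =>
    rw [Finset.sum_insert ha]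
    exact (hN.add_le _ _).trans (max_le (h a (Finset.mem_insert_self _ _))
      (ih fun i hi => h i (Finset.mem_insert_of_mem hi)))

theorem sum_le_sum {α : Type*} (s : Finset α) (f : α → V) : N (∑ i ∈ s, f i) ≤ ∑ i ∈ s, N (f i) :=
  hN.sum_le s f (Finset.sum_nonneg fun _ _ => hN.nonneg _) fun _ hi =>
    Finset.single_le_sum (f := fun i => N (f i)) (fun _ _ => hN.nonneg _) hi

theorem eq_zero {v : V} (h : N v = 0) : v = 0 := by
  rw [← Module.forall_dual_apply_eq_zero_iff F]
  intro φ
  obtain ⟨D, hD⟩ := hN.bdd φ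
  have := hD v
  rw [h, mul_zero] at this
  exact fabs_eq_zero.1 (le_antisymm this (fabs_nonneg _))

theorem pos {v : V} (h : v ≠ 0) : 0 < N v :=
  (hN.nonneg v).lt_of_ne' fun h' => h (hN.eq_zero h')

/-- Semilinear maps are bounded. -/
theorem exists_bound [FiniteDimensional F V] {N' : W → ℝ} (hN' : IsAdm C F N') (g : V →+ W)
    (hg : ∀ (f : F) v, ∃ f' : F, fabs C f' = fabs C f ∧ g (f • v) = f' • g v) :
    ∃ D : ℝ, 0 < D ∧ ∀ v, N' (g v) ≤ D * N v := by
  set b := Module.finBasis F V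
  choose D hD using fun i => hN.bdd (b.coord i)
  have hD0 : ∀ i, 0 ≤ D i * N (b i) := fun i => (fabs_nonneg _).trans (hD i _)
  refine ⟨∑ i, |D i| * N' (g (b i)) + 1,
    by have := Finset.sum_nonneg (s := Finset.univ) (f := fun i => |D i| * N' (g (b i)))
        fun i _ => mul_nonneg (abs_nonneg _) (hN'.nonneg _)
       linarith, fun v => ?_⟩
  have e : g v = ∑ i, g (b.repr v i • b i) := by
    conv_lhs => rw [← b.sum_repr v]
    exact map_sum _ _ _
  rw [e, add_mul, Finset.sum_mul]
  refine (hN'.sum_le_sum _ _).trans ?_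
  refine (Finset.sum_le_sum fun i _ => ?_).trans (le_add_of_nonneg_right (by simpa using hN.nonneg v))
  obtain ⟨f', h1, h2⟩ := hg (b.repr v i) (b i)
  rw [h2, hN'.smul, h1]
  have h3 := hD i v
  rw [Module.Basis.coord_apply] at h3
  calc fabs C (b.repr v i) * N' (g (b i)) ≤ (D i * N v) * N' (g (b i)) :=
        mul_le_mul_of_nonneg_right h3 (hN'.nonneg _)
    _ ≤ (|D i| * N v) * N' (g (b i)) :=
        mul_le_mul_of_nonneg_right (mul_le_mul_of_nonneg_right (le_abs_self _) (hN.nonneg _))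
          (hN'.nonneg _)
    _ = _ := by ring

theorem exists_bound_linear [FiniteDimensional F V] {N' : W → ℝ} (hN' : IsAdm C F N')
    (g : V →ₗ[F] W) : ∃ D : ℝ, 0 < D ∧ ∀ v, N' (g v) ≤ D * N v :=
  hN.exists_bound hN' g.toAddMonoidHom fun f v => ⟨f, rfl, map_smul g f v⟩

theorem comp_injective (g : W →ₗ[F] V) (hg : Function.Injective g) :
    IsAdm C F (N ∘ g) where
  nonneg v := hN.nonneg _
  add_le v w := by simpa using hN.add_le _ _
  smul f v := by simpa using hN.smul _ _
  bdd φ := by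
    obtain ⟨h, hh⟩ := LinearMap.exists_leftInverse_of_injective g (LinearMap.ker_eq_bot.2 hg)
    obtain ⟨D, hD⟩ := hN.bdd (φ ∘ₗ h)
    refine ⟨D, fun v => ?_⟩
    have := hD (g v)
    rwa [LinearMap.comp_apply, ← LinearMap.comp_apply h g, hh] at this

omit hN in
theorem of_le (hN : IsAdm C F N) {N' : V → ℝ} (nonneg : ∀ v, 0 ≤ N' v)
    (add_le : ∀ v w, N' (v + w) ≤ max (N' v) (N' w))
    (smul : ∀ (f : F) v, N' (f • v) = fabs C f * N' v) {D : ℝ}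
    (le : ∀ v, N v ≤ D * N' v) :
    IsAdm C F N' := by
  refine ⟨nonneg, add_le, smul, fun φ => ?_⟩
  obtain ⟨D', hD'⟩ := hN.bdd φ
  refine ⟨|D'| * D, fun v => (hD' v).trans ?_⟩
  calc D' * N v ≤ |D'| * N v := mul_le_mul_of_nonneg_right (le_abs_self _) (hN.nonneg _)
    _ ≤ |D'| * (D * N' v) := mul_le_mul_of_nonneg_left (le v) (abs_nonneg _)
    _ = _ := by ring

end IsAdm

variable (C) in
/-- The weighted maximum norm attached to a basis. -/
def basisNorm {n : ℕ} (b : Module.Basis (Fin n) F V) (r : Fin n → ℝ) (v : V) : ℝ :=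
  ⨆ i, fabs C (b.repr v i) * r i

theorem le_basisNorm {n : ℕ} (b : Module.Basis (Fin n) F V) (r : Fin n → ℝ) (v : V) (i : Fin n) :
    fabs C (b.repr v i) * r i ≤ basisNorm C b r v :=
  le_ciSup (f := fun i => fabs C (b.repr v i) * r i) (Set.finite_range _).bddAbove i

theorem basisNorm_le {n : ℕ} (b : Module.Basis (Fin n) F V) (r : Fin n → ℝ) (v : V) {D : ℝ}
    (hD : 0 ≤ D) (h : ∀ i, fabs C (b.repr v i) * r i ≤ D) : basisNorm C b r v ≤ D :=
  Real.iSup_le h hD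

theorem basisNorm_isAdm {n : ℕ} (b : Module.Basis (Fin n) F V) {r : Fin n → ℝ}
    (hr : ∀ i, 0 < r i) : IsAdm C F (basisNorm C b r) := by
  have h0 : ∀ v, 0 ≤ basisNorm C b r v := fun v =>
    Real.iSup_nonneg fun i => mul_nonneg (fabs_nonneg _) (hr i).le
  refine ⟨h0, fun v w => ?_, fun f v => ?_, fun φ => ?_⟩
  · refine basisNorm_le _ _ _ (le_max_of_le_left (h0 v)) fun i => ?_
    rw [map_add, Finsupp.add_apply]
    refine (mul_le_mul_of_nonneg_right (fabs_add_le _ _) (hr i).le).trans ?_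
    rw [max_mul_of_nonneg _ _ (hr i).le]
    exact max_le_max (le_basisNorm _ _ _ _) (le_basisNorm _ _ _ _)
  · rw [basisNorm, basisNorm, Real.mul_iSup_of_nonneg (fabs_nonneg _)]
    refine congrArg _ (funext fun i => ?_)
    rw [map_smul, Finsupp.smul_apply, smul_eq_mul, fabs_mul, mul_assoc]
  · refine ⟨∑ i, fabs C (φ (b i)) / r i, fun v => ?_⟩
    have hnn : ∀ i, 0 ≤ fabs C (φ (b i)) / r i := fun i => div_nonneg (fabs_nonneg _) (hr i).le
    conv_lhs => rw [← b.sum_repr v, map_sum]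
    refine fabs_sum_le _ _ (mul_nonneg (Finset.sum_nonneg fun i _ => hnn i) (h0 v)) fun i _ => ?_
    rw [map_smul, smul_eq_mul, fabs_mul]
    calc fabs C (b.repr v i) * fabs C (φ (b i))
        = (fabs C (φ (b i)) / r i) * (fabs C (b.repr v i) * r i) := by
          have := (hr i).ne'; field_simp
      _ ≤ (fabs C (φ (b i)) / r i) * basisNorm C b r v :=
          mul_le_mul_of_nonneg_left (le_basisNorm _ _ _ _) (hnn i)
      _ ≤ _ := mul_le_mul_of_nonneg_right
          (Finset.single_le_sum (f := fun i => fabs C (φ (b i)) / r i) (fun i _ => hnn i)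
            (Finset.mem_univ i)) (h0 v)

variable (C F V) in
/-- An admissible norm on a finite-dimensional space. -/
def stdNorm [FiniteDimensional F V] : V → ℝ :=
  basisNorm C (Module.finBasis F V) fun _ => 1

theorem stdNorm_isAdm [FiniteDimensional F V] : IsAdm C F (stdNorm C F V) :=
  basisNorm_isAdm _ fun _ => one_pos

end Adm

section Semi

/-- The group of automorphisms of an additive group, in multiplicative notation. -/
abbrev AAut (V : Type v) [AddCommGroup V] : Type v := (AddMonoid.End V)ˣ

variable {C : Type u} [NormedField C] {F : Type w} [Field F] [GrowthField C F]
  {V : Type v} [AddCommGroup V] [Module F V]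

variable (F) in
/-- The additive automorphism `z` is semilinear for `f(x) ↦ f(ux)`. -/
def IsSemi (u : Cˣ) (z : AAut V) : Prop :=
  ∀ (f g : F), (ι g : LaurentSeries C) = shift u (ι f) → ∀ v : V, z • (f • v) = g • (z • v)

theorem IsSemi.exists {u : Cˣ} (hu : ν F (u : C) = 1) {z : AAut V} (hz : IsSemi F u z) (f : F)
    (v : V) : ∃ g : F, ι g = shift u (ι f : LaurentSeries C) ∧ fabs C g = fabs C f ∧
      z • (f • v) = g • (z • v) := by
  obtain ⟨g, hg⟩ := exists_ι_eq_shift hu f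
  exact ⟨g, hg, by rw [fabs, hg, shift_order, fabs], hz f g hg v⟩

theorem IsSemi.one : IsSemi F (1 : Cˣ) (1 : AAut V) := by
  intro f g h v
  rw [shift_one] at h
  rw [ι_injective h, one_smul, one_smul]

theorem IsSemi.mul {u u' : Cˣ} (hu' : ν F (u' : C) = 1) {z z' : AAut V} (hz : IsSemi F u z)
    (hz' : IsSemi F u' z') : IsSemi F (u * u') (z * z') := by
  intro f g h v
  obtain ⟨f', hf'⟩ := exists_ι_eq_shift hu' f
  rw [mul_smul, mul_smul, hz' f f' hf', hz f' g (by rw [h, hf', shift_shift])]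

theorem IsSemi.inv {u : Cˣ} {z : AAut V} (hz : IsSemi F u z) : IsSemi F u⁻¹ z⁻¹ := by
  intro f g h v
  rw [inv_smul_eq_iff, hz g f (by rw [h, shift_shift, mul_inv_cancel, shift_one]), smul_inv_smul]

theorem ν_zpow {u : Cˣ} (hu : ν F (u : C) = 1) (k : ℤ) : ν F ((u ^ k : Cˣ) : C) = 1 := by
  rw [Units.val_zpow_eq_zpow_val, map_zpow₀, hu, one_zpow]

theorem IsSemi.zpow {u : Cˣ} (hu : ν F (u : C) = 1) {z : AAut V} (hz : IsSemi F u z) (k : ℤ) :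
    IsSemi F (u ^ k) (z ^ k) := by
  have hp : ∀ k : ℕ, IsSemi F (u ^ k) (z ^ k) := by
    intro k
    induction k with
    | zero => simpa using IsSemi.one
    | succ k ih => rw [pow_succ, pow_succ]; exact ih.mul hu hz
  rcases Int.eq_nat_or_neg k with ⟨m, rfl | rfl⟩
  · rw [zpow_natCast, zpow_natCast]; exact hp m
  · rw [zpow_neg, zpow_neg, zpow_natCast, zpow_natCast]; exact (hp m).inv

end Semi

section Slope

variable {C : Type u} [NormedField C] (q : Cˣ) {F : Type w} [Field F] [GrowthField C F]
  {σ : F ≃+* F}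

/-- The operator of a `q`-difference module as an additive automorphism. -/
def phi (M : QDiffModule.{w, v} F σ) : AAut M.carrier where
  val := M.Φ.toAddMonoidHom
  inv := (AddEquiv.ofBijective M.Φ.toAddMonoidHom M.bijective).symm.toAddMonoidHom
  val_inv := by
    ext v
    exact (AddEquiv.ofBijective M.Φ.toAddMonoidHom M.bijective).apply_symm_apply v
  inv_val := by
    ext v
    exact (AddEquiv.ofBijective M.Φ.toAddMonoidHom M.bijective).symm_apply_apply v

theorem phi_smul (M : QDiffModule.{w, v} F σ) (v : M.carrier) : phi M • v = M.Φ v := rfl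

theorem lin_Φ {M N : QDiffModule.{w, v} F σ} (f : M ⟶ N) (v : M.carrier) :
    QDiffModule.lin f (M.Φ v) = N.Φ (QDiffModule.lin f v) := f.comm v

theorem semiconj_zpow {V V' : Type*} [AddCommGroup V] [AddCommGroup V'] {z : AAut V} {z' : AAut V'}
    (g : V → V') (h : ∀ v, g (z • v) = z' • g v) (k : ℤ) (v : V) :
    g (z ^ k • v) = z' ^ k • g v := by
  have hp : ∀ (k : ℕ) v, g (z ^ k • v) = z' ^ k • g v := by
    intro k
    induction k with
    | zero => simp
    | succ k ih => intro v; rw [pow_succ, pow_succ, mul_smul, mul_smul, ih, h]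
  rcases Int.eq_nat_or_neg k with ⟨m, rfl | rfl⟩
  · rw [zpow_natCast, zpow_natCast, hp]
  · rw [zpow_neg, zpow_neg, zpow_natCast, zpow_natCast, eq_inv_smul_iff, ← hp, smul_inv_smul]

theorem lin_phi_zpow {M N : QDiffModule.{w, v} F σ} (f : M ⟶ N) (k : ℤ) (v : M.carrier) :
    QDiffModule.lin f (phi M ^ k • v) = phi N ^ k • QDiffModule.lin f v :=
  semiconj_zpow _ (lin_Φ f) k v

variable [hσ : IsShift q σ]
include hσ

theorem phi_semi (M : QDiffModule.{w, v} F σ) : IsSemi F q (phi M) := by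
  intro f g h v
  have : g = σ f := ι_injective (C := C) (by rw [h, hσ.map_shift])
  rw [this]
  exact M.Φ.map_smulₛₗ f v

theorem phi_zpow_exists (M : QDiffModule.{w, v} F σ) (k : ℤ) (f : F) (v : M.carrier) :
    ∃ g : F, ι g = shift (q ^ k) (ι f : LaurentSeries C) ∧ fabs C g = fabs C f ∧
      phi M ^ k • (f • v) = g • (phi M ^ k • v) :=
  ((phi_semi q M).zpow hσ.ν_eq k).exists (ν_zpow hσ.ν_eq k) f v

theorem adm_phi_smul (M : QDiffModule.{w, v} F σ) {N : M.carrier → ℝ} (hN : IsAdm C F N) (k : ℤ)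
    (f : F) (v : M.carrier) : N (phi M ^ k • (f • v)) = fabs C f * N (phi M ^ k • v) := by
  obtain ⟨g, -, hg, e⟩ := phi_zpow_exists q M k f v
  rw [e, hN.smul, hg]

/-- The vectors `v` such that `Φ^k v` grows at most like `2 ^ (μ k)`, for all integers `k`. -/
def slopePart (M : QDiffModule.{w, v} F σ) (μ : ℝ) : Submodule F M.carrier where
  carrier := {v | ∃ D : ℝ, ∀ k : ℤ, stdNorm C F M.carrier (phi M ^ k • v) ≤ D * (2 : ℝ) ^ (μ * k)}
  zero_mem' := ⟨0, fun k => by simp [(stdNorm_isAdm (C := C) (F := F) (V := M.carrier)).map_zero]⟩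
  add_mem' := by
    rintro v w ⟨D, h⟩ ⟨D', h'⟩
    refine ⟨max D D', fun k => ?_⟩
    rw [smul_add, max_mul_of_nonneg _ _ (by positivity)]
    exact (stdNorm_isAdm.add_le _ _).trans (max_le_max (h k) (h' k))
  smul_mem' := by
    rintro f v ⟨D, h⟩
    refine ⟨fabs C f * D, fun k => ?_⟩
    rw [adm_phi_smul q M stdNorm_isAdm, mul_assoc]
    exact mul_le_mul_of_nonneg_left (h k) (fabs_nonneg _)

theorem mem_slopePart_iff {M : QDiffModule.{w, v} F σ} {N : M.carrier → ℝ} (hN : IsAdm C F N)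
    (μ : ℝ) (v : M.carrier) :
    v ∈ slopePart q M μ ↔ ∃ D : ℝ, ∀ k : ℤ, N (phi M ^ k • v) ≤ D * (2 : ℝ) ^ (μ * k) := by
  have key : ∀ {N N' : M.carrier → ℝ}, IsAdm C F N → IsAdm C F N' →
      (∃ D : ℝ, ∀ k : ℤ, N (phi M ^ k • v) ≤ D * (2 : ℝ) ^ (μ * k)) →
      (∃ D : ℝ, ∀ k : ℤ, N' (phi M ^ k • v) ≤ D * (2 : ℝ) ^ (μ * k)) := by
    rintro N N' hN hN' ⟨D, h⟩
    obtain ⟨D', hD', h'⟩ := hN.exists_bound_linear hN' LinearMap.id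
    refine ⟨D' * D, fun k => (h' _).trans ?_⟩
    rw [mul_assoc]
    exact mul_le_mul_of_nonneg_left (h k) hD'.le
  exact ⟨key stdNorm_isAdm hN, key hN stdNorm_isAdm⟩

theorem slopePart_stable (M : QDiffModule.{w, v} F σ) (μ : ℝ) : M.IsStable (slopePart q M μ) := by
  have e : ∀ (k j : ℤ) (D : ℝ), D * (2 : ℝ) ^ (μ * (k + j : ℤ)) =
      (D * (2 : ℝ) ^ (μ * j)) * (2 : ℝ) ^ (μ * k) := by
    intro k j D
    rw [mul_assoc, ← Real.rpow_add two_pos]; congr 2; push_cast; ring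
  intro v
  rw [← phi_smul]
  constructor
  · rintro ⟨D, h⟩
    refine ⟨D * (2 : ℝ) ^ (μ * (-1 : ℤ)), fun k => ?_⟩
    have := h (k + -1)
    rwa [← mul_smul, ← zpow_add_one, neg_add_cancel_right, e] at this
  · rintro ⟨D, h⟩
    refine ⟨D * (2 : ℝ) ^ (μ * (1 : ℤ)), fun k => ?_⟩
    have := h (k + 1)
    rwa [e, zpow_add_one, mul_smul] at this

theorem slopePart_map {M N : QDiffModule.{w, v} F σ} (f : M ⟶ N) (μ : ℝ) {v : M.carrier}
    (hv : v ∈ slopePart q M μ) : QDiffModule.lin f v ∈ slopePart q N μ := by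
  obtain ⟨D, h⟩ := hv
  obtain ⟨D', hD', h'⟩ := stdNorm_isAdm.exists_bound_linear
    (stdNorm_isAdm (C := C) (F := F) (V := N.carrier)) (QDiffModule.lin f)
  refine ⟨D' * D, fun k => ?_⟩
  rw [← lin_phi_zpow, mul_assoc]
  exact (h' _).trans (mul_le_mul_of_nonneg_left (h k) hD'.le)

omit hσ in
/-- The inclusion of a stable subspace. -/
def subIncl (M : QDiffModule.{w, v} F σ) {W : Submodule F M.carrier} (hW : M.IsStable W) :
    M.sub W hW ⟶ M where
  toLinearMap := W.subtype
  comm _ := rfl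

omit hσ in
theorem lin_subIncl_injective (M : QDiffModule.{w, v} F σ) {W : Submodule F M.carrier}
    (hW : M.IsStable W) : Function.Injective (QDiffModule.lin (subIncl M hW)) :=
  W.injective_subtype

theorem mem_slopePart_sub {M : QDiffModule.{w, v} F σ} {W : Submodule F M.carrier}
    (hW : M.IsStable W) (μ : ℝ) (v : (M.sub W hW).carrier) :
    v ∈ slopePart q (M.sub W hW) μ ↔ QDiffModule.lin (subIncl M hW) v ∈ slopePart q M μ := by
  have hN := (stdNorm_isAdm (C := C) (F := F) (V := M.carrier)).comp_injective _
    (lin_subIncl_injective M hW)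
  rw [mem_slopePart_iff q hN]
  refine exists_congr fun D => forall_congr' fun k => ?_
  rw [← lin_phi_zpow]; rfl

omit hσ in
variable (C) in
/-- `M` is pure of slope `μ`, in terms of norms. -/
def NormPure (M : QDiffModule.{w, v} F σ) (μ : ℝ) : Prop :=
  ∃ N : M.carrier → ℝ, IsAdm C F N ∧ ∀ v, N (M.Φ v) = (2 : ℝ) ^ μ * N v

omit hσ in
theorem norm_phi_zpow {M : QDiffModule.{w, v} F σ} {μ : ℝ} {N : M.carrier → ℝ}
    (h : ∀ v, N (M.Φ v) = (2 : ℝ) ^ μ * N v) (k : ℤ) (v : M.carrier) :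
    N (phi M ^ k • v) = (2 : ℝ) ^ (μ * k) * N v := by
  have hp : ∀ (k : ℕ) v, N (phi M ^ k • v) = (2 : ℝ) ^ (μ * k) * N v := by
    intro k
    induction k with
    | zero => simp
    | succ k ih =>
      intro v
      rw [pow_succ, mul_smul, ih, phi_smul, h, ← mul_assoc, ← Real.rpow_add two_pos]
      congr 2; push_cast; ring
  rcases Int.eq_nat_or_neg k with ⟨m, rfl | rfl⟩
  · rw [zpow_natCast, hp]; simp
  · have := hp m (phi M ^ (-(m : ℤ)) • v)
    rw [← zpow_natCast, ← mul_smul, ← zpow_add, add_neg_cancel, zpow_zero, one_smul] at this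
    rw [this, ← mul_assoc, ← Real.rpow_add two_pos]
    simp

theorem normPure_iff (M : QDiffModule.{w, v} F σ) (μ : ℝ) :
    NormPure C M μ ↔ slopePart q M μ = ⊤ := by
  constructor
  · rintro ⟨N, hN, h⟩
    rw [eq_top_iff]
    intro v _
    rw [mem_slopePart_iff q hN]
    exact ⟨N v, fun k => by rw [norm_phi_zpow h, mul_comm]⟩
  · intro h
    set N₀ := stdNorm C F M.carrier
    have hN₀ : IsAdm C F N₀ := stdNorm_isAdm
    let g : M.carrier → ℤ → ℝ := fun v k => (2 : ℝ) ^ (-(μ * k)) * N₀ (phi M ^ k • v)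
    have hb : ∀ v, BddAbove (Set.range (g v)) := by
      intro v
      obtain ⟨D, hD⟩ : v ∈ slopePart q M μ := h ▸ Submodule.mem_top
      refine ⟨D, ?_⟩
      rintro _ ⟨k, rfl⟩
      calc g v k ≤ (2 : ℝ) ^ (-(μ * k)) * (D * (2 : ℝ) ^ (μ * k)) :=
            mul_le_mul_of_nonneg_left (hD k) (by positivity)
        _ = D * ((2 : ℝ) ^ (-(μ * k)) * (2 : ℝ) ^ (μ * k)) := by ring
        _ = D := by rw [← Real.rpow_add two_pos]; simp
    have hg : ∀ v k, 0 ≤ g v k := fun v k => mul_nonneg (by positivity) (hN₀.nonneg _)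
    refine ⟨fun v => ⨆ k, g v k, hN₀.of_le (D := 1) (fun v => Real.iSup_nonneg (hg v)) ?_ ?_ ?_, ?_⟩
    · intro v w
      refine ciSup_le fun k => ?_
      simp only [g]
      rw [smul_add]
      refine (mul_le_mul_of_nonneg_left (hN₀.add_le _ _) (by positivity)).trans ?_
      rw [mul_max_of_nonneg _ _ (by positivity)]
      exact max_le_max (le_ciSup (hb v) k) (le_ciSup (hb w) k)
    · intro f v
      rw [Real.mul_iSup_of_nonneg (fabs_nonneg _)]
      refine congrArg _ (funext fun k => ?_)
      simp only [g]
      rw [adm_phi_smul q M hN₀]; ring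
    · intro v
      have := le_ciSup (hb v) 0
      simpa [g] using this
    · intro v
      rw [Real.mul_iSup_of_nonneg (by positivity), ← (Equiv.addRight (1 : ℤ)).iSup_comp]
      refine congrArg _ (funext fun k => ?_)
      simp only [g, Equiv.coe_addRight]
      rw [← phi_smul, ← mul_smul, ← zpow_add_one, ← mul_assoc,
        ← Real.rpow_add two_pos]
      congr 2; push_cast; ring

theorem slopePart_normPure (M : QDiffModule.{w, v} F σ) (μ : ℝ) :
    NormPure C (M.sub _ (slopePart_stable q M μ)) μ := by
  rw [normPure_iff q, eq_top_iff]
  intro v _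
  exact (mem_slopePart_sub q (slopePart_stable q M μ) μ v).2 v.2

theorem slopePart_lower (M : QDiffModule.{w, v} F σ) (μ : ℝ) {v : M.carrier}
    (hv : v ∈ slopePart q M μ) (h0 : v ≠ 0) :
    ∃ d : ℝ, 0 < d ∧ ∀ k : ℤ, d * (2 : ℝ) ^ (μ * k) ≤ stdNorm C F M.carrier (phi M ^ k • v) := by
  obtain ⟨N, hN, h⟩ := slopePart_normPure q M μ
  have hN' := (stdNorm_isAdm (C := C) (F := F) (V := M.carrier)).comp_injective _
    (lin_subIncl_injective M (slopePart_stable q M μ))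
  obtain ⟨D, hD, hb⟩ := hN'.exists_bound_linear hN LinearMap.id
  obtain ⟨v', rfl⟩ : ∃ v', QDiffModule.lin (subIncl M (slopePart_stable q M μ)) v' = v :=
    ⟨(⟨v, hv⟩ : slopePart q M μ), rfl⟩
  have hv0 : v' ≠ 0 := fun h' => h0 (by rw [h', map_zero])
  refine ⟨D⁻¹ * N v', mul_pos (inv_pos.2 hD) (hN.pos hv0), fun k => ?_⟩
  have h1 := hb (phi (M.sub _ (slopePart_stable q M μ)) ^ k • v')
  rw [LinearMap.id_apply, norm_phi_zpow h, Function.comp_apply, lin_phi_zpow] at h1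
  rwa [mul_assoc, inv_mul_le_iff₀ hD, mul_comm (N v')]

theorem slopePart_sum_eq_zero (M : QDiffModule.{w, v} F σ) (s : Finset ℝ) (v : ℝ → M.carrier)
    (hv : ∀ μ ∈ s, v μ ∈ slopePart q M μ) (h0 : ∑ μ ∈ s, v μ = 0) : ∀ μ ∈ s, v μ = 0 := by
  induction s using Finset.induction_on_max with
  | empty => simp
  | insert a s ha ih =>
    have has : a ∉ s := fun h => lt_irrefl _ (ha a h)
    rw [Finset.sum_insert has] at h0
    have hva : v a = 0 := by
      by_contra hne
      obtain ⟨d, hd, h⟩ := slopePart_lower q M a (hv a (Finset.mem_insert_self _ _)) hne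
      have hD : ∀ μ ∈ s, ∃ D : ℝ, ∀ k : ℤ,
          stdNorm C F M.carrier (phi M ^ k • v μ) ≤ D * (2 : ℝ) ^ (μ * k) :=
        fun μ hμ => hv μ (Finset.mem_insert_of_mem hμ)
      choose! D hD using hD
      have hle : ∀ k : ℕ, d ≤ ∑ μ ∈ s, D μ * ((2 : ℝ) ^ (μ - a)) ^ k := by
        intro k
        have h1 := h k
        rw [eq_neg_of_add_eq_zero_left h0, smul_neg, stdNorm_isAdm.map_neg, Finset.smul_sum] at h1
        have h2 := h1.trans ((stdNorm_isAdm.sum_le_sum _ _).trans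
          (Finset.sum_le_sum fun μ hμ => hD μ hμ k))
        rw [← le_div_iff₀ (by positivity), Finset.sum_div] at h2
        refine h2.trans_eq (Finset.sum_congr rfl fun μ hμ => ?_)
        rw [mul_div_assoc, ← Real.rpow_sub two_pos, ← Real.rpow_natCast,
          ← Real.rpow_mul two_pos.le]
        congr 2; push_cast; ring
      have ht : Filter.Tendsto (fun k : ℕ => ∑ μ ∈ s, D μ * ((2 : ℝ) ^ (μ - a)) ^ k)
          Filter.atTop (nhds (∑ μ ∈ s, D μ * 0)) := by
        refine tendsto_finsetSum _ fun μ hμ => ?_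
        refine Filter.Tendsto.const_mul _ (tendsto_pow_atTop_nhds_zero_of_lt_one (by positivity) ?_)
        exact Real.rpow_lt_one_of_one_lt_of_neg one_lt_two (sub_neg.2 (ha μ hμ))
      simp only [mul_zero, Finset.sum_const_zero] at ht
      exact absurd (ge_of_tendsto' ht hle) (not_le.2 hd)
    rw [hva, zero_add] at h0
    intro μ hμ
    rcases Finset.mem_insert.1 hμ with rfl | hμ
    · exact hva
    · exact ih (fun μ hμ => hv μ (Finset.mem_insert_of_mem hμ)) h0 μ hμ

theorem slopePart_iSupIndep (M : QDiffModule.{w, v} F σ) :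
    iSupIndep fun μ : ℚ => slopePart q M (μ : ℝ) := by
  have h : iSupIndep fun μ : ℝ => slopePart q M μ :=
    (iSupIndep_iff_finsetSum_eq_zero_imp_eq_zero _).2 (slopePart_sum_eq_zero q M)
  exact h.comp (f := fun μ : ℚ => (μ : ℝ)) Rat.cast_injective

theorem slopePart_disjoint (M : QDiffModule.{w, v} F σ) {μ ν : ℝ} (h : μ ≠ ν) :
    Disjoint (slopePart q M μ) (slopePart q M ν) := by
  have h' : iSupIndep fun μ : ℝ => slopePart q M μ :=
    (iSupIndep_iff_finsetSum_eq_zero_imp_eq_zero _).2 (slopePart_sum_eq_zero q M)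
  exact h'.pairwiseDisjoint h

theorem NormPure.lin_eq_zero {M N : QDiffModule.{w, v} F σ} {μ ν : ℝ} (h : μ ≠ ν)
    (hM : NormPure C M μ) (hN : NormPure C N ν) (f : M ⟶ N) : QDiffModule.lin f = 0 := by
  ext v
  rw [normPure_iff q] at hM hN
  exact Submodule.disjoint_def.1 (slopePart_disjoint q N h) _
    (slopePart_map q f μ (hM ▸ Submodule.mem_top)) (hN ▸ Submodule.mem_top)

theorem NormPure.of_iso {M N : QDiffModule.{w, v} F σ} (e : M ≅ N) {μ : ℝ} (h : NormPure C M μ) :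
    NormPure C N μ := by
  rw [normPure_iff q, eq_top_iff] at *
  intro v _
  have := slopePart_map q e.hom μ (h (Submodule.mem_top (x := QDiffModule.lin e.inv v)))
  have e2 : QDiffModule.lin e.hom (QDiffModule.lin e.inv v) = v :=
    DFunLike.congr_fun (congrArg QDiffModule.lin e.inv_hom_id) v
  rwa [e2] at this

end Slope

section Cyclic

variable {C : Type u} [NormedField C] (q : Cˣ) {F : Type w} [Field F] [GrowthField C F]
  {σ : F ≃+* F}

theorem phi_pow_smul (M : QDiffModule.{w, v} F σ) (k : ℕ) (v : M.carrier) :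
    phi M ^ k • v = M.Φ^[k] v := by
  induction k with
  | zero => simp
  | succ k ih => rw [pow_succ', mul_smul, ih, phi_smul, Function.iterate_succ_apply']

theorem infinite_of_not_root (hroot : ∀ n : ℕ, 0 < n → q ^ n ≠ 1) : Infinite C := by
  have hinj : Function.Injective fun n : ℕ => ((q ^ n : Cˣ) : C) := by
    intro a b hab
    have hab : q ^ a = q ^ b := Units.ext hab
    by_contra hne
    rcases lt_or_gt_of_ne hne with h | h
    · refine hroot (b - a) (by omega) ?_
      rw [pow_sub _ h.le, ← hab, mul_inv_cancel]
    · refine hroot (a - b) (by omega) ?_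
      rw [pow_sub _ h.le, hab, mul_inv_cancel]
  exact Infinite.of_injective _ hinj

variable [hσ : IsShift q σ]
include hσ

theorem shift_xvar_iterate (j : ℕ) (M : QDiffModule.{w, v} F σ) (c : C) (k : ℕ) (v : M.carrier) :
    phi M ^ k • ((cst F c * xvar C F ^ j) • v) =
      (cst F c * (cst F (q : C) ^ k) ^ j * xvar C F ^ j) • (phi M ^ k • v) := by
  have h := ((phi_semi (C := C) q M).zpow hσ.ν_eq k) (cst F c * xvar C F ^ j)
    (cst F c * (cst F (q : C) ^ k) ^ j * xvar C F ^ j)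
  rw [zpow_natCast] at h
  refine h ?_ v
  have e := ι_cst_mul_xvar_zpow (F := F) c j
  rw [zpow_natCast] at e
  have e2 := ι_cst_mul_xvar_zpow (F := F) (c * ((q : C) ^ k) ^ j) j
  rw [zpow_natCast, (cst F).map_mul, (cst F).map_pow, (cst F).map_pow] at e2
  rw [e, e2, shift_single, zpow_natCast]
  push_cast; congr 1; ring

/-- The cyclic vector lemma. -/
theorem exists_cyclic (hroot : ∀ n : ℕ, 0 < n → q ^ n ≠ 1) (M : QDiffModule.{w, v} F σ) :
    ∃ m : M.carrier, LinearIndependent F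
      (fun i : Fin (Module.finrank F M.carrier) => phi M ^ (i : ℕ) • m) := by
  suffices H : ∀ k ≤ Module.finrank F M.carrier, ∃ m : M.carrier,
      LinearIndependent F (fun i : Fin k => phi M ^ (i : ℕ) • m) from H _ le_rfl
  intro k
  induction k with
  | zero => intro _; exact ⟨0, linearIndependent_empty_type⟩
  | succ k ih =>
    intro hk
    obtain ⟨m, hm⟩ := ih (by omega)
    by_contra hno
    push Not at hno
    obtain ⟨w, hw⟩ : ∃ w, w ∉ Submodule.span F (Set.range fun i : Fin k => phi M ^ (i : ℕ) • m) := by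
      by_contra hall
      push Not at hall
      have htop : Submodule.span F (Set.range fun i : Fin k => phi M ^ (i : ℕ) • m) = ⊤ :=
        eq_top_iff.2 fun w _ => hall w
      have h1 := finrank_span_eq_card hm
      rw [htop, finrank_top, Fintype.card_fin] at h1
      omega
    obtain ⟨u, rfl⟩ : ∃ u, phi M ^ k • u = w := ⟨(phi M ^ k)⁻¹ • w, smul_inv_smul _ _⟩
    have hfam := hm.finSnoc hw
    set fam : Fin (k + 1) → M.carrier :=
      Fin.snoc (α := fun _ => M.carrier) (fun i : Fin k => phi M ^ (i : ℕ) • m) (phi M ^ k • u)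
    obtain ⟨π, hπ⟩ : ∃ π : M.carrier →ₗ[F] (Fin (k + 1) → F),
        ∀ i, π (fam i) = Pi.single i 1 := by
      obtain ⟨π, hπ⟩ := LinearMap.exists_leftInverse_of_injective
        (Fintype.linearCombination F fam) (LinearMap.ker_eq_bot.2
          (linearIndependent_iff_injective_fintypeLinearCombination.1 hfam))
      refine ⟨π, fun i => ?_⟩
      have := LinearMap.congr_fun hπ (Pi.single i 1)
      rw [LinearMap.comp_apply, Fintype.linearCombination_apply_single, one_smul] at this
      exact this
    let ω : MultilinearMap F (fun _ : Fin (k + 1) => M.carrier) F :=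
      ((Matrix.detRowAlternating (n := Fin (k + 1)) (R := F)).compLinearMap π).toMultilinearMap
    have hω : ∀ v : M.carrier, ω (fun i => phi M ^ (i : ℕ) • v) = 0 := by
      intro v
      exact AlternatingMap.map_linearDependent
        ((Matrix.detRowAlternating (n := Fin (k + 1)) (R := F)).compLinearMap π) _ (hno v)
    have hfam1 : ω fam = 1 := by
      have : (fun i => π (fam i)) = (1 : Matrix (Fin (k + 1)) (Fin (k + 1)) F) := by
        ext i j
        rw [hπ, Matrix.one_apply, Pi.single_apply]
        simp [eq_comm]
      change Matrix.det (fun i => π (fam i)) = 1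
      rw [this, Matrix.det_one]
    let A : Fin (k + 1) → M.carrier := fun i => phi M ^ (i : ℕ) • m
    let B : Fin (k + 1) → M.carrier := fun i => phi M ^ (i : ℕ) • u
    let d : Fin (k + 1) → F := fun i => ω (Function.update A i (B i))
    have hlin : ∀ j : ℕ, ∑ i : Fin (k + 1), (cst F (q : C) ^ (i : ℕ)) ^ j * d i = 0 := by
      intro j
      let B' : Fin (k + 1) → M.carrier := fun i =>
        ((cst F (q : C) ^ (i : ℕ)) ^ j * xvar C F ^ j) • B i
      let p : Polynomial F := ∑ s : Finset (Fin (k + 1)),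
        Polynomial.C (ω (s.piecewise B' A)) * Polynomial.X ^ s.card
      have heval : ∀ c : C, p.eval (cst F c) = 0 := by
        intro c
        have h1 := hω ((cst F c * xvar C F ^ j) • u + m)
        have e : (fun i : Fin (k + 1) => phi M ^ (i : ℕ) • ((cst F c * xvar C F ^ j) • u + m)) =
            (fun i => cst F c • B' i) + A := by
          funext i
          rw [smul_add, shift_xvar_iterate q, Pi.add_apply]
          simp only [B', B, A, smul_smul, mul_assoc]
        rw [e, MultilinearMap.map_add_univ] at h1
        rw [← h1, Polynomial.eval_finsetSum]
        refine Finset.sum_congr rfl fun s _ => ?_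
        have e2 : s.piecewise (fun i => cst F c • B' i) A =
            s.piecewise (fun i => (fun _ => cst F c : Fin (k + 1) → F) i • s.piecewise B' A i)
              (s.piecewise B' A) := by
          funext i
          by_cases hi : i ∈ s <;> simp [hi]
        rw [e2, ω.map_piecewise_smul]
        rw [Finset.prod_const, Polynomial.eval_mul, Polynomial.eval_C, Polynomial.eval_pow,
          Polynomial.eval_X, smul_eq_mul, mul_comm]
      have hp : p = 0 := by
        have := infinite_of_not_root q hroot
        refine Polynomial.eq_zero_of_infinite_isRoot p ?_
        refine (Set.infinite_range_of_injective (cst F : C →+* F).injective).mono ?_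
        rintro _ ⟨c, rfl⟩
        exact heval c
      have hc : p.coeff 1 = 0 := by rw [hp, Polynomial.coeff_zero]
      simp only [p, Polynomial.finsetSum_coeff, Polynomial.coeff_C_mul, Polynomial.coeff_X_pow] at hc
      have e3 : ∑ s : Finset (Fin (k + 1)), ω (s.piecewise B' A) * (if 1 = s.card then 1 else 0) =
          ∑ i : Fin (k + 1), ω (Function.update A i (B' i)) := by
        simp only [mul_ite, mul_one, mul_zero]
        rw [← Finset.sum_filter]
        have e4 : (Finset.univ.filter fun s : Finset (Fin (k + 1)) => 1 = s.card) =
            Finset.powersetCard 1 Finset.univ := by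
          ext s; simp [Finset.mem_powersetCard, eq_comm]
        rw [e4, Finset.powersetCard_one, Finset.sum_map]
        refine Finset.sum_congr rfl fun i _ => ?_
        rw [Function.Embedding.coeFn_mk, Finset.piecewise_singleton]
      rw [e3] at hc
      have e5 : ∀ i, ω (Function.update A i (B' i)) =
          xvar C F ^ j * ((cst F (q : C) ^ (i : ℕ)) ^ j * d i) := by
        intro i
        simp only [B', MultilinearMap.map_update_smul, smul_eq_mul, d]
        ring
      rw [Finset.sum_congr rfl fun i _ => e5 i, ← Finset.mul_sum] at hc
      exact (mul_eq_zero.1 hc).resolve_left (pow_ne_zero _ xvar_ne_zero)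
    have hd : d = 0 := by
      refine Matrix.eq_zero_of_forall_pow_sum_mul_pow_eq_zero
        (f := fun i : Fin (k + 1) => cst F (q : C) ^ (i : ℕ)) ?_ fun j => ?_
      · intro a b hab
        have hab : (q : C) ^ (a : ℕ) = (q : C) ^ (b : ℕ) := by
          apply (cst F : C →+* F).injective; simpa using hab
        have hab : q ^ (a : ℕ) = q ^ (b : ℕ) := Units.ext (by simpa using hab)
        by_contra hne
        have hne : (a : ℕ) ≠ b := fun h => hne (Fin.ext h)
        rcases lt_or_gt_of_ne hne with h | h
        · refine hroot (b - a) (by omega) ?_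
          rw [pow_sub _ h.le, ← hab, mul_inv_cancel]
        · refine hroot (a - b) (by omega) ?_
          rw [pow_sub _ h.le, hab, mul_inv_cancel]
      · rw [← hlin j]
        exact Finset.sum_congr rfl fun i _ => mul_comm _ _
    have h1 : d (Fin.last k) = 1 := by
      rw [← hfam1]
      change ω _ = ω _
      congr 1
      funext i
      refine Fin.lastCases ?_ (fun i => ?_) i
      · simp [fam, B]
      · rw [Function.update_of_ne (Fin.castSucc_lt_last i).ne]
        simp [fam, A]
    rw [hd] at h1
    exact zero_ne_one h1

end Cyclic

section InitialForm

variable {C : Type u} [NormedField C] (q : Cˣ) {F : Type w} [Field F] [GrowthField C F]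
  {σ : F ≃+* F} [hσ : IsShift q σ]
include hσ

theorem ι_sig (j : ℤ) (f : F) :
    ι ((σ ^ j : RingAut F) f) = shift (q ^ j) (ι f : LaurentSeries C) := by
  have hp : ∀ (j : ℕ) (f : F), ι ((σ ^ j : RingAut F) f) = shift (q ^ j) (ι f : LaurentSeries C) := by
    intro j
    induction j with
    | zero => intro f; rw [pow_zero, pow_zero, shift_one]; rfl
    | succ j ih => intro f; rw [pow_succ, RingAut.mul_apply, ih, hσ.map_shift, shift_shift, pow_succ]
  rcases Int.eq_nat_or_neg j with ⟨m, rfl | rfl⟩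
  · rw [zpow_natCast, zpow_natCast, hp]
  · have h := hp m ((σ ^ (-(m : ℤ)) : RingAut F) f)
    rw [← RingAut.mul_apply, ← zpow_natCast, ← zpow_add, add_neg_cancel, zpow_zero,
      RingAut.one_apply] at h
    rw [h, shift_shift, ← zpow_natCast q m, ← zpow_add, neg_add_cancel, zpow_zero, shift_one]

theorem fabs_sig (j : ℤ) (f : F) : fabs C ((σ ^ j : RingAut F) f) = fabs C f := by
  rw [fabs, ι_sig q, shift_order, fabs]

theorem phi_zpow_smul_sig (M : QDiffModule.{w, v} F σ) (j : ℤ) (f : F) (v : M.carrier) :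
    phi M ^ j • (f • v) = (σ ^ j : RingAut F) f • (phi M ^ j • v) :=
  (phi_semi (C := C) q M).zpow hσ.ν_eq j f _ (ι_sig q j f) v

/-- Operators that annihilate a cyclic vector are left multiples of the minimal one. -/
theorem exists_left_multiple (M : QDiffModule.{w, v} F σ) {n : ℕ}
    (b : Module.Basis (Fin n) F M.carrier) {m : M.carrier} (hb : ∀ i, b i = phi M ^ (i : ℕ) • m)
    {a : Fin (n + 1) → F} (han : a (Fin.last n) ≠ 0)
    (ha : ∑ i, a i • (phi M ^ (i : ℕ) • m) = 0) (P : ℤ →₀ F)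
    (hP : Finsupp.linearCombination F (fun k : ℤ => phi M ^ k • m) P = 0) :
    ∃ Q : ℤ →₀ F, P = Finsupp.linearCombination F (fun j : ℤ =>
      ∑ i : Fin (n + 1), Finsupp.single (j + (i : ℤ)) ((σ ^ j : RingAut F) (a i))) Q := by
  set ev := Finsupp.linearCombination F (fun k : ℤ => phi M ^ k • m)
  set L : ℤ → ℤ →₀ F := fun j =>
      ∑ i : Fin (n + 1), Finsupp.single (j + (i : ℤ)) ((σ ^ j : RingAut F) (a i)) with hL
  have hLev : ∀ j, ev (L j) = 0 := by
    intro j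
    have h := congrArg (fun v => phi M ^ j • v) ha
    simp only [smul_zero, Finset.smul_sum] at h
    rw [map_sum, ← h]
    refine Finset.sum_congr rfl fun i _ => ?_
    rw [Finsupp.linearCombination_single, phi_zpow_smul_sig q, zpow_add, mul_smul, zpow_natCast]
  suffices H : ∀ (d : ℕ) (lo : ℤ) (P : ℤ →₀ F), (∀ k, P k ≠ 0 → lo ≤ k ∧ k < lo + n + d) →
      ev P = 0 → ∃ Q : ℤ →₀ F, P = Finsupp.linearCombination F L Q by
    obtain ⟨lo, hlo⟩ : ∃ lo, ∀ k ∈ P.support, lo ≤ k := P.support.bddBelow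
    obtain ⟨hi, hhi⟩ : ∃ hi, ∀ k ∈ P.support, k ≤ hi := P.support.bddAbove
    refine H (hi + 1 - lo).toNat lo P (fun k hk => ⟨hlo k (by simpa using hk), ?_⟩) hP
    have := hhi k (by simpa using hk)
    have := hlo k (by simpa using hk)
    omega
  intro d
  induction d with
  | zero =>
    intro lo P hsupp hev
    refine ⟨0, ?_⟩
    rw [map_zero]
    have e : P = ∑ i : Fin n, Finsupp.single (lo + (i : ℤ)) (P (lo + (i : ℤ))) := by
      ext k
      rw [Finsupp.finsetSum_apply]
      by_cases hk : P k = 0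
      · rw [hk, eq_comm]
        refine Finset.sum_eq_zero fun i _ => ?_
        rw [Finsupp.single_apply]
        split_ifs with h
        · rw [h, hk]
        · rfl
      · obtain ⟨h1, h2⟩ := hsupp k hk
        rw [Finset.sum_eq_single (⟨(k - lo).toNat, by omega⟩ : Fin n)]
        · have : lo + ((k - lo).toNat : ℤ) = k := by omega
          change P k = Finsupp.single (lo + ((k - lo).toNat : ℤ)) (P (lo + ((k - lo).toNat : ℤ))) k
          rw [this, Finsupp.single_eq_same]
        · intro i _ hi
          rw [Finsupp.single_apply, if_neg]
          intro h
          apply hi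
          ext
          simp only
          omega
        · simp
    have h1 := hev
    rw [e, map_sum] at h1
    have h2 : ∑ i : Fin n, (σ ^ (-lo) : RingAut F) (P (lo + (i : ℤ))) • b i = 0 := by
      have h := congrArg (fun v => phi M ^ (-lo) • v) h1
      simp only [smul_zero, Finset.smul_sum] at h
      rw [← h]
      refine Finset.sum_congr rfl fun i _ => ?_
      rw [Finsupp.linearCombination_single, phi_zpow_smul_sig q, ← mul_smul, ← zpow_add,
        neg_add_cancel_left, hb, zpow_natCast]
    have h3 := Fintype.linearIndependent_iff.1 b.linearIndependent _ h2
    rw [e]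
    refine Finset.sum_eq_zero fun i _ => ?_
    have := h3 i
    rw [EmbeddingLike.map_eq_zero_iff] at this
    rw [this, Finsupp.single_zero]
  | succ d ih =>
    intro lo P hsupp hev
    have hne : (σ ^ (lo + d) : RingAut F) (a (Fin.last n)) ≠ 0 := by
      rwa [Ne, EmbeddingLike.map_eq_zero_iff]
    set c := P (lo + n + d) / (σ ^ (lo + d) : RingAut F) (a (Fin.last n)) with hc
    have hLk : ∀ k, L (lo + d) k ≠ 0 → lo + d ≤ k ∧ k ≤ lo + n + d := by
      intro k hk
      simp only [hL, Finsupp.finsetSum_apply] at hk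
      obtain ⟨i, -, hi⟩ := Finset.exists_ne_zero_of_sum_ne_zero hk
      rw [Finsupp.single_apply] at hi
      have : lo + d + (i : ℤ) = k := by
        by_contra h
        rw [if_neg h] at hi
        exact hi rfl
      have := i.2
      omega
    have hLtop : L (lo + d) (lo + n + d) = (σ ^ (lo + d) : RingAut F) (a (Fin.last n)) := by
      simp only [hL, Finsupp.finsetSum_apply]
      rw [Finset.sum_eq_single (Fin.last n)]
      · rw [Finsupp.single_apply, if_pos]
        simp; ring
      · intro i _ hi
        rw [Finsupp.single_apply, if_neg]
        intro h
        apply hi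
        ext
        simp only [Fin.val_last]
        omega
      · simp
    obtain ⟨Q, hQ⟩ := ih lo (P - c • L (lo + d)) (by
      intro k hk
      have hk' : P k ≠ 0 ∨ L (lo + d) k ≠ 0 := by
        by_contra h
        push Not at h
        apply hk
        simp [h.1, h.2]
      have hb : lo ≤ k ∧ k < lo + n + (d + 1 : ℕ) := by
        rcases hk' with h | h
        · exact hsupp k h
        · have := hLk k h
          push_cast; omega
      refine ⟨hb.1, ?_⟩
      by_contra hge
      have hk2 : k = lo + n + d := by
        have := hb.2
        push_cast at this; omega
      apply hk
      rw [hk2, Finsupp.sub_apply, Finsupp.smul_apply, hLtop, smul_eq_mul, hc, div_mul_cancel₀ _ hne,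
        sub_self]) (by rw [map_sub, map_smul, hLev, hev, smul_zero, sub_zero])
    refine ⟨Q + Finsupp.single (lo + d) c, ?_⟩
    rw [map_add, ← hQ, Finsupp.linearCombination_single, sub_add_cancel]

omit hσ in
theorem fabs_sum_eq {α : Type*} (s : Finset α) (f : α → F) {i₀ : α} (hi : i₀ ∈ s)
    (h0 : f i₀ ≠ 0) (h : ∀ i ∈ s, i ≠ i₀ → fabs C (f i) < fabs C (f i₀)) :
    fabs C (∑ i ∈ s, f i) = fabs C (f i₀) := by
  classical
  rw [← Finset.add_sum_erase s f hi]
  set r := ∑ i ∈ s.erase i₀, f i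
  have hr : fabs C r < fabs C (f i₀) := by
    rcases (s.erase i₀).eq_empty_or_nonempty with he | hne
    · simp only [r, he, Finset.sum_empty, fabs_zero]
      exact fabs_pos h0
    · obtain ⟨j, hj, hmax⟩ := Finset.exists_max_image (s.erase i₀) (fun i => fabs C (f i)) hne
      exact (fabs_sum_le _ _ (fabs_nonneg _) hmax).trans_lt
        (h j (Finset.mem_of_mem_erase hj) (Finset.ne_of_mem_erase hj))
  refine le_antisymm ((fabs_add_le _ _).trans (max_le le_rfl hr.le)) ?_
  by_contra hlt
  have := fabs_add_le (C := C) (f i₀ + r) (-r)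
  rw [add_neg_cancel_right, fabs_neg] at this
  exact absurd this (not_le.2 (max_lt (not_le.1 hlt) hr))

/-- If the line of slope `s` touches the Newton polygon of `L` in two points, the `s`-norm of
`Φ^k m` is not smaller than expected. -/
theorem initial_form (M : QDiffModule.{w, v} F σ) {n : ℕ}
    (b : Module.Basis (Fin n) F M.carrier) {m : M.carrier} (hb : ∀ i, b i = phi M ^ (i : ℕ) • m)
    {a : Fin (n + 1) → F} (han : a (Fin.last n) ≠ 0)
    (ha : ∑ i, a i • (phi M ^ (i : ℕ) • m) = 0) {s c : ℝ} (hc : 0 < c)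
    (hle : ∀ i, fabs C (a i) * (2 : ℝ) ^ (s * (i : ℕ)) ≤ c) {i₀ j₀ : Fin (n + 1)} (hij : i₀ < j₀)
    (hi₀ : fabs C (a i₀) * (2 : ℝ) ^ (s * (i₀ : ℕ)) = c)
    (hj₀ : fabs C (a j₀) * (2 : ℝ) ^ (s * (j₀ : ℕ)) = c) (k : ℤ) :
    ∃ i, (2 : ℝ) ^ (s * k) ≤ fabs C (b.repr (phi M ^ k • m) i) * (2 : ℝ) ^ (s * (i : ℕ)) := by
  by_contra hno
  push Not at hno
  set g := b.repr (phi M ^ k • m)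
  let P : ℤ →₀ F := Finsupp.single k 1 - ∑ i : Fin n, Finsupp.single (i : ℤ) (g i)
  have hPev : Finsupp.linearCombination F (fun k : ℤ => phi M ^ k • m) P = 0 := by
    simp only [P, map_sub, map_sum, Finsupp.linearCombination_single, one_smul, zpow_natCast, ← hb]
    rw [b.sum_repr, sub_self]
  obtain ⟨Q, hQ⟩ := exists_left_multiple q M b hb han ha P hPev
  let wt : F → ℤ → ℝ := fun f j => fabs C f * (2 : ℝ) ^ (s * j)
  have hwt0 : ∀ f j, 0 ≤ wt f j := fun f j => mul_nonneg (fabs_nonneg _) (by positivity)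
  have hwtP : ∀ j, j ≠ k → wt (P j) j < wt (P k) k := by
    have h1 : ∀ j, wt ((∑ i : Fin n, Finsupp.single (i : ℤ) (g i)) j) j < (2 : ℝ) ^ (s * k) := by
      intro j
      rw [Finsupp.finsetSum_apply]
      by_cases hj : ∃ i : Fin n, (i : ℤ) = j
      · obtain ⟨i, rfl⟩ := hj
        rw [Finset.sum_eq_single i]
        · simpa [wt] using hno i
        · intro i' _ hi'
          rw [Finsupp.single_apply, if_neg]
          intro h; exact hi' (Fin.ext (by omega))
        · simp
      · rw [Finset.sum_eq_zero]
        · simp only [wt, fabs_zero, zero_mul]; positivity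
        · intro i _
          rw [Finsupp.single_apply, if_neg fun h => hj ⟨i, h⟩]
    have h2 : wt (P k) k = (2 : ℝ) ^ (s * k) := by
      have e : P k = ∑ t : Bool, if t then 1 else
          - (∑ i : Fin n, Finsupp.single (i : ℤ) (g i)) k := by
        simp [P, sub_eq_add_neg]
      have h3 := h1 k
      simp only [wt] at h3 ⊢
      rw [mul_lt_iff_lt_one_left (by positivity)] at h3
      rw [e, fabs_sum_eq (C := C) Finset.univ _ (i₀ := true) (Finset.mem_univ _) (by simp)]
      · simp
      · intro t _ ht
        have : t = false := by simpa using ht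
        subst this
        simpa using h3
    intro j hj
    rw [h2]
    have : P j = - (∑ i : Fin n, Finsupp.single (i : ℤ) (g i)) j := by
      simp [P, Finsupp.single_apply, Ne.symm hj]
    rw [this]
    simpa [wt] using h1 j
  have hPk : P k ≠ 0 := by
    intro h
    have := (hwt0 _ _).trans_lt (hwtP (k + 1) (by omega))
    simp only [wt, h, fabs_zero, zero_mul] at this
    exact lt_irrefl _ this
  have hQne : Q.support.Nonempty := by
    rw [Finsupp.support_nonempty_iff]
    rintro rfl
    rw [map_zero] at hQ
    exact hPk (by rw [hQ]; rfl)
  obtain ⟨jm, hjm, hmax⟩ := Finset.exists_max_image Q.support (fun j => wt (Q j) j) hQne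
  set W := wt (Q jm) jm
  have hW : 0 < W := mul_pos (fabs_pos (by simpa using hjm)) (by positivity)
  have hmax' : ∀ j, wt (Q j) j ≤ W := by
    intro j
    by_cases hj : j ∈ Q.support
    · exact hmax j hj
    · rw [Finsupp.notMem_support_iff.1 hj]; simp only [wt, fabs_zero, zero_mul]; exact hW.le
  -- the coefficients of the product
  have hcoef : ∀ t : ℤ, P t = ∑ p ∈ Q.support ×ˢ (Finset.univ : Finset (Fin (n + 1))),
      if p.1 + (p.2 : ℤ) = t then Q p.1 * (σ ^ p.1 : RingAut F) (a p.2) else 0 := by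
    intro t
    conv_lhs => rw [hQ]
    rw [Finsupp.linearCombination_apply, Finsupp.sum, Finsupp.finsetSum_apply, Finset.sum_product]
    refine Finset.sum_congr rfl fun j _ => ?_
    rw [Finsupp.smul_apply, Finsupp.finsetSum_apply, smul_eq_mul, Finset.mul_sum]
    refine Finset.sum_congr rfl fun i _ => ?_
    rw [Finsupp.single_apply]
    split_ifs <;> simp
  have hterm : ∀ (j : ℤ) (i : Fin (n + 1)),
      wt (Q j * (σ ^ j : RingAut F) (a i)) (j + (i : ℤ)) =
        wt (Q j) j * (fabs C (a i) * (2 : ℝ) ^ (s * (i : ℕ))) := by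
    intro j i
    simp only [wt]
    rw [fabs_mul, fabs_sig q]
    have : (2 : ℝ) ^ (s * ((j + (i : ℤ) : ℤ) : ℝ)) = (2 : ℝ) ^ (s * (j : ℝ)) * (2 : ℝ) ^ (s * (i : ℕ)) := by
      rw [← Real.rpow_add two_pos]; congr 1; push_cast; ring
    rw [this]; ring
  have hdom : ∀ (j : ℤ) (i : Fin (n + 1)), wt (Q j) j = W →
      fabs C (a i) * (2 : ℝ) ^ (s * (i : ℕ)) = c →
      (∀ (j' : ℤ) (i' : Fin (n + 1)), j' + (i' : ℤ) = j + (i : ℤ) → j' ≠ j →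
        wt (Q j') j' < W ∨ fabs C (a i') * (2 : ℝ) ^ (s * (i' : ℕ)) < c) →
      wt (P (j + (i : ℤ))) (j + (i : ℤ)) = W * c := by
    intro j i hj hi hlt
    have hne : Q j ≠ 0 := by
      intro h
      rw [h] at hj
      simp only [wt, fabs_zero, zero_mul] at hj
      exact hW.ne hj
    have hne' : a i ≠ 0 := by
      intro h
      rw [h, fabs_zero, zero_mul] at hi
      exact hc.ne hi
    have hpos : (0 : ℝ) < (2 : ℝ) ^ (s * ((j + (i : ℤ) : ℤ) : ℝ)) := by positivity
    have hWc : wt (Q j * (σ ^ j : RingAut F) (a i)) (j + (i : ℤ)) = W * c := by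
      rw [hterm, hj, hi]
    rw [hcoef, ← hWc]
    simp only [wt]
    congr 1
    have key := fabs_sum_eq (C := C) (Q.support ×ˢ (Finset.univ : Finset (Fin (n + 1))))
      (fun p => if p.1 + (p.2 : ℤ) = j + (i : ℤ) then Q p.1 * (σ ^ p.1 : RingAut F) (a p.2) else 0)
      (i₀ := (j, i)) (by simpa using hne) (by simp [hne, hne']) ?_
    · rw [key, if_pos rfl]
    · rintro ⟨j', i'⟩ - hp
      simp only [if_true]
      split_ifs with h
      · have hj' : j' ≠ j := by
          rintro rfl
          exact hp (Prod.ext rfl (Fin.ext (by simp only at h ⊢; omega)))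
        have h5 : wt (Q j' * (σ ^ j' : RingAut F) (a i')) (j' + (i' : ℤ)) < W * c := by
          rw [hterm]
          rcases hlt j' i' h hj' with h6 | h6
          · exact mul_lt_mul_of_lt_of_le_of_nonneg_of_pos h6 (hle _) (hwt0 _ _) hc
          · exact mul_lt_mul_of_le_of_lt_of_nonneg_of_pos (hmax' _) h6
              (mul_nonneg (fabs_nonneg _) (by positivity)) hW
        rw [← hWc] at h5
        simp only [h] at h5
        exact lt_of_mul_lt_mul_right h5 hpos.le
      · rw [fabs_zero]; exact fabs_pos (mul_ne_zero hne (by simpa using hne'))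
  have hJ : (Q.support.filter fun j => wt (Q j) j = W).Nonempty := ⟨jm, by simpa [W] using hjm⟩
  have hI : ((Finset.univ : Finset (Fin (n + 1))).filter fun i =>
    fabs C (a i) * (2 : ℝ) ^ (s * (i : ℕ)) = c).Nonempty := ⟨i₀, by simp [hi₀]⟩
  obtain ⟨j1, hj1, hj1'⟩ := Finset.exists_min_image _ id hJ
  obtain ⟨j2, hj2, hj2'⟩ := Finset.exists_max_image _ id hJ
  obtain ⟨i1, hi1, hi1'⟩ := Finset.exists_min_image _ id hI
  obtain ⟨i2, hi2, hi2'⟩ := Finset.exists_max_image _ id hI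
  simp only [Finset.mem_filter, Finset.mem_univ, true_and, id] at hj1 hj2 hi1 hi2 hj1' hj2' hi1' hi2'
  have hmem : ∀ j, wt (Q j) j = W → j ∈ Q.support := by
    intro j hj
    by_contra h
    rw [Finsupp.notMem_support_iff.1 h] at hj
    simp only [wt, fabs_zero, zero_mul] at hj
    exact hW.ne hj
  have e1 := hdom j1 i1 hj1.2 hi1 (by
    intro j' i' h hne
    by_contra hcon
    push Not at hcon
    have g1 := hj1' j' ⟨hmem _ (le_antisymm (hmax' _) hcon.1), le_antisymm (hmax' _) hcon.1⟩
    have g2 := hi1' i' (le_antisymm (hle _) hcon.2)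
    have g2 : (i1 : ℕ) ≤ i' := g2
    omega)
  have e2 := hdom j2 i2 hj2.2 hi2 (by
    intro j' i' h hne
    by_contra hcon
    push Not at hcon
    have g1 := hj2' j' ⟨hmem _ (le_antisymm (hmax' _) hcon.1), le_antisymm (hmax' _) hcon.1⟩
    have g2 := hi2' i' (le_antisymm (hle _) hcon.2)
    have g2 : (i' : ℕ) ≤ i2 := g2
    omega)
  have h12 : j1 + (i1 : ℤ) < j2 + (i2 : ℤ) := by
    have g1 := hj1' j2 hj2
    have g2 : (i1 : ℕ) ≤ i₀ := hi1' i₀ hi₀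
    have g3 : (j₀ : ℕ) ≤ i2 := hi2' j₀ hj₀
    have g4 : (i₀ : ℕ) < j₀ := hij
    omega
  have hall : ∀ t, wt (P t) t ≤ wt (P k) k := by
    intro t
    rcases eq_or_ne t k with rfl | h
    · exact le_rfl
    · exact (hwtP t h).le
  rcases eq_or_ne (j1 + (i1 : ℤ)) k with h | h
  · have h' : j2 + (i2 : ℤ) ≠ k := by omega
    have := hwtP _ h'
    rw [e2, ← h, e1] at this
    exact lt_irrefl _ this
  · have := hwtP _ h
    rw [e1, ← e2] at this
    exact absurd this (not_lt.2 (by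
      rcases eq_or_ne (j2 + (i2 : ℤ)) k with h' | h'
      · rw [h']
      · exfalso
        have h7 : wt (P k) k ≤ W * c := by
          rw [hcoef]
          simp only [wt]
          rw [← le_div_iff₀ (by positivity)]
          refine fabs_sum_le _ _ (div_nonneg (mul_nonneg hW.le hc.le) (by positivity)) ?_
          rintro ⟨j', i'⟩ -
          rw [le_div_iff₀ (by positivity)]
          simp only
          split_ifs with h8
          · rw [← h8]
            have := hterm j' i'
            simp only [wt] at this
            rw [this]
            exact mul_le_mul (hmax' j') (hle i') (mul_nonneg (fabs_nonneg _) (by positivity)) hW.le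
          · rw [fabs_zero, zero_mul]; exact mul_nonneg hW.le hc.le
        have := hwtP _ h'
        rw [e2] at this
        exact absurd h7 (not_le.2 this)))

end InitialForm

section Weights

variable {C : Type u} [NormedField C] (q : Cˣ) {F : Type w} [Field F] [GrowthField C F]
  {σ : F ≃+* F} [hσ : IsShift q σ]
include hσ

section Operator

variable (M : QDiffModule.{w, v} F σ) {n : ℕ}
    (b : Module.Basis (Fin n) F M.carrier) {m : M.carrier} (hb : ∀ i, b i = phi M ^ (i : ℕ) • m)
    {a : Fin (n + 1) → F} (han : a (Fin.last n) ≠ 0)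
    (ha : ∑ i, a i • (phi M ^ (i : ℕ) • m) = 0)
include hb han ha

theorem coeff_zero_ne_zero (hn : 0 < n) : a 0 ≠ 0 := by
  intro h0
  rw [Fin.sum_univ_succ, h0, zero_smul, zero_add] at ha
  have h := congrArg (fun v => phi M ^ (-1 : ℤ) • v) ha
  simp only [smul_zero, Finset.smul_sum] at h
  have h2 : ∑ i : Fin n, (σ ^ (-1 : ℤ) : RingAut F) (a i.succ) • b i = 0 := by
    rw [← h]
    refine Finset.sum_congr rfl fun i _ => ?_
    rw [phi_zpow_smul_sig q, ← zpow_natCast, ← mul_smul, ← zpow_add, hb, Fin.val_succ,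
      ← zpow_natCast]
    congr 3; push_cast; ring
  have h3 := Fintype.linearIndependent_iff.1 b.linearIndependent _ h2 ⟨n - 1, by omega⟩
  rw [EmbeddingLike.map_eq_zero_iff] at h3
  apply han
  rw [← h3]; congr 1; ext; simp; omega

theorem slope_eq_of_normPure {μ : ℝ} (hM : NormPure C M μ) {s c : ℝ} (hc : 0 < c)
    (hle : ∀ i, fabs C (a i) * (2 : ℝ) ^ (s * (i : ℕ)) ≤ c) {i₀ j₀ : Fin (n + 1)} (hij : i₀ < j₀)
    (hi₀ : fabs C (a i₀) * (2 : ℝ) ^ (s * (i₀ : ℕ)) = c)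
    (hj₀ : fabs C (a j₀) * (2 : ℝ) ^ (s * (j₀ : ℕ)) = c) : s = μ := by
  obtain ⟨N, hN, hΦ⟩ := hM
  choose D hD using fun i => hN.bdd (b.coord i)
  have key : ∀ k : ℤ, ((2 : ℝ) ^ (s - μ)) ^ k ≤ ∑ i, |D i| * N m * (2 : ℝ) ^ (s * (i : ℕ)) := by
    intro k
    obtain ⟨i, hi⟩ := initial_form q M b hb han ha hc hle hij hi₀ hj₀ k
    have h1 := hD i (phi M ^ k • m)
    rw [norm_phi_zpow hΦ, Module.Basis.coord_apply] at h1
    have h2 : (2 : ℝ) ^ (s * k) ≤ |D i| * N m * (2 : ℝ) ^ (s * (i : ℕ)) * (2 : ℝ) ^ (μ * k) := by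
      refine hi.trans ?_
      calc _ ≤ (D i * ((2 : ℝ) ^ (μ * k) * N m)) * (2 : ℝ) ^ (s * (i : ℕ)) := by gcongr
        _ ≤ (|D i| * ((2 : ℝ) ^ (μ * k) * N m)) * (2 : ℝ) ^ (s * (i : ℕ)) := by
          have := hN.nonneg m
          gcongr; exact le_abs_self _
        _ = _ := by ring
    rw [← div_le_iff₀ (by positivity), ← Real.rpow_sub two_pos, ← sub_mul, Real.rpow_mul two_pos.le,
      Real.rpow_intCast] at h2
    refine h2.trans ?_
    exact Finset.single_le_sum (f := fun i : Fin n => |D i| * N m * (2 : ℝ) ^ (s * (i : ℕ)))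
      (fun i _ => mul_nonneg (mul_nonneg (abs_nonneg _) (hN.nonneg _)) (by positivity))
      (Finset.mem_univ i)
  rcases lt_trichotomy s μ with h | h | h
  · exfalso
    have h1 : 1 < ((2 : ℝ) ^ (s - μ))⁻¹ :=
      (one_lt_inv₀ (by positivity)).2 (Real.rpow_lt_one_of_one_lt_of_neg one_lt_two (by linarith))
    obtain ⟨k, hk⟩ := pow_unbounded_of_one_lt _ h1
    have := key (-(k : ℤ))
    rw [zpow_neg, zpow_natCast, ← inv_pow] at this
    exact absurd this (not_le.2 hk)
  · exact h
  · exfalso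
    have h1 : 1 < (2 : ℝ) ^ (s - μ) := Real.one_lt_rpow one_lt_two (by linarith)
    obtain ⟨k, hk⟩ := pow_unbounded_of_one_lt _ h1
    have := key k
    rw [zpow_natCast] at this
    exact absurd this (not_le.2 hk)

omit han ha hσ in
theorem basisNorm_phi_pow (μ : ℝ) (i : ℕ) (hi : i < n) :
    basisNorm C b (fun i => (2 : ℝ) ^ (μ * (i : ℕ))) (phi M ^ i • m) ≤ (2 : ℝ) ^ (μ * i) := by
  refine basisNorm_le _ _ _ (by positivity) fun j => ?_
  have := hb ⟨i, hi⟩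
  simp only at this
  rw [← this, b.repr_self, Finsupp.single_apply]
  split_ifs with h
  · rw [← h, fabs_one, one_mul]
  · rw [fabs_zero, zero_mul]; positivity

theorem basisNorm_Φ_le {μ : ℝ}
    (hr : ∀ i, fabs C (a i) * (2 : ℝ) ^ (μ * (i : ℕ)) ≤
      fabs C (a (Fin.last n)) * (2 : ℝ) ^ (μ * n)) (v : M.carrier) :
    basisNorm C b (fun i => (2 : ℝ) ^ (μ * (i : ℕ))) (M.Φ v) ≤
      (2 : ℝ) ^ μ * basisNorm C b (fun i => (2 : ℝ) ^ (μ * (i : ℕ))) v := by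
  set N := basisNorm C b (fun i => (2 : ℝ) ^ (μ * (i : ℕ)))
  have hN : IsAdm C F N := basisNorm_isAdm b fun i => by positivity
  have htop : ∀ i ≤ n, N (phi M ^ i • m) ≤ (2 : ℝ) ^ (μ * i) := by
    intro i hi
    rcases hi.lt_or_eq with hi | rfl
    · exact basisNorm_phi_pow M b hb μ i hi
    · have e : phi M ^ i • m = ∑ j : Fin i, (-(a j.castSucc) / a (Fin.last i)) • b j := by
        rw [Fin.sum_univ_castSucc] at ha
        have h1 := eq_neg_of_add_eq_zero_right ha
        rw [Fin.val_last] at h1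
        have h2 : phi M ^ i • m = (a (Fin.last i))⁻¹ • (a (Fin.last i) • phi M ^ i • m) := by
          rw [smul_smul, inv_mul_cancel₀ han, one_smul]
        rw [h2, h1, smul_neg, Finset.smul_sum, ← Finset.sum_neg_distrib]
        refine Finset.sum_congr rfl fun j _ => ?_
        rw [hb, smul_smul, Fin.val_castSucc, ← neg_smul]
        congr 1; ring
      rw [e]
      refine hN.sum_le _ _ (by positivity) fun j _ => ?_
      rw [hN.smul, fabs_div, fabs_neg, hb]
      refine (mul_le_mul_of_nonneg_left (basisNorm_phi_pow M b hb μ j j.2)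
        (div_nonneg (fabs_nonneg _) (fabs_nonneg _))).trans ?_
      rw [div_mul_eq_mul_div, div_le_iff₀ (fabs_pos han), mul_comm ((2 : ℝ) ^ (μ * i))]
      exact hr j.castSucc
  have e : M.Φ v = ∑ i, σ (b.repr v i) • (phi M ^ ((i : ℕ) + 1) • m) := by
    conv_lhs => rw [← b.sum_repr v, map_sum]
    refine Finset.sum_congr rfl fun i _ => ?_
    rw [M.Φ.map_smulₛₗ, hb, pow_succ', mul_smul, phi_smul]; rfl
  rw [e]
  refine hN.sum_le _ _ (mul_nonneg (by positivity) (hN.nonneg _)) fun i _ => ?_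
  rw [hN.smul, fabs_shift q]
  calc fabs C (b.repr v i) * N (phi M ^ ((i : ℕ) + 1) • m)
      ≤ fabs C (b.repr v i) * (2 : ℝ) ^ (μ * ((i : ℕ) + 1 : ℕ)) :=
        mul_le_mul_of_nonneg_left (htop _ i.2) (fabs_nonneg _)
    _ = (2 : ℝ) ^ μ * (fabs C (b.repr v i) * (2 : ℝ) ^ (μ * (i : ℕ))) := by
        have : (2 : ℝ) ^ (μ * ((i : ℕ) + 1 : ℕ)) = (2 : ℝ) ^ μ * (2 : ℝ) ^ (μ * (i : ℕ)) := by
          rw [← Real.rpow_add two_pos]; congr 1; push_cast; ring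
        rw [this]; ring
    _ ≤ _ := mul_le_mul_of_nonneg_left (le_basisNorm (C := C) b (fun i => (2 : ℝ) ^ (μ * (i : ℕ))) v i) (by positivity)

omit han in
theorem basisNorm_inv_le {μ : ℝ} (ha0 : a 0 ≠ 0)
    (hl : ∀ i, fabs C (a i) * (2 : ℝ) ^ (μ * (i : ℕ)) ≤ fabs C (a 0)) (v : M.carrier) :
    basisNorm C b (fun i => (2 : ℝ) ^ (μ * (i : ℕ))) v ≤
      (2 : ℝ) ^ (-μ) * basisNorm C b (fun i => (2 : ℝ) ^ (μ * (i : ℕ))) (M.Φ v) := by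
  set N := basisNorm C b (fun i => (2 : ℝ) ^ (μ * (i : ℕ)))
  have hN : IsAdm C F N := basisNorm_isAdm b fun i => by positivity
  have hbot : N (phi M ^ (-1 : ℤ) • m) ≤ (2 : ℝ) ^ (-μ) := by
    have h1 := ha
    rw [Fin.sum_univ_succ] at h1
    have h := congrArg (fun v => phi M ^ (-1 : ℤ) • v) h1
    simp only [smul_zero, Finset.smul_sum, smul_add, phi_zpow_smul_sig q] at h
    set α : Fin (n + 1) → F := fun i => (σ ^ (-1 : ℤ) : RingAut F) (a i) with hα
    have hα0 : α 0 ≠ 0 := by rwa [hα, Ne, EmbeddingLike.map_eq_zero_iff]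
    have hαa : ∀ i, fabs C (α i) = fabs C (a i) := fun i => fabs_sig q _ _
    have e : phi M ^ (-1 : ℤ) • m = ∑ j : Fin n, (-(α j.succ) / α 0) • b j := by
      have h2 := eq_neg_of_add_eq_zero_left h
      have h3 : phi M ^ (-1 : ℤ) • m = (α 0)⁻¹ • (α 0 • phi M ^ (-1 : ℤ) • phi M ^ ((0 : Fin (n + 1)) : ℕ) • m) := by
        rw [smul_smul, inv_mul_cancel₀ hα0, one_smul]; simp
      rw [h3, h2, smul_neg, Finset.smul_sum, ← Finset.sum_neg_distrib]
      refine Finset.sum_congr rfl fun j _ => ?_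
      rw [smul_smul, ← neg_smul, ← zpow_natCast, ← mul_smul, ← zpow_add, hb, ← zpow_natCast]
      congr 1
      · simp only [hα]; ring
      · congr 2; rw [Fin.val_succ]; push_cast; ring
    rw [e]
    refine hN.sum_le _ _ (by positivity) fun j _ => ?_
    rw [hN.smul, fabs_div, fabs_neg, hb, hαa, hαa]
    refine (mul_le_mul_of_nonneg_left (basisNorm_phi_pow M b hb μ j j.2)
      (div_nonneg (fabs_nonneg _) (fabs_nonneg _))).trans ?_
    rw [div_mul_eq_mul_div, div_le_iff₀ (fabs_pos ha0)]
    have h4 := hl j.succ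
    have : (2 : ℝ) ^ (μ * (j.succ : ℕ)) = (2 : ℝ) ^ μ * (2 : ℝ) ^ (μ * (j : ℕ)) := by
      rw [← Real.rpow_add two_pos]; congr 1; rw [Fin.val_succ]; push_cast; ring
    rw [this] at h4
    rw [Real.rpow_neg two_pos.le, inv_mul_eq_div, le_div_iff₀ (by positivity)]
    linarith
  obtain ⟨w, rfl⟩ : ∃ w, phi M ^ (-1 : ℤ) • w = v := ⟨phi M • v, by
    rw [zpow_neg_one, inv_smul_smul]⟩
  rw [← phi_smul, ← mul_smul, ← zpow_one_add, add_neg_cancel, zpow_zero, one_smul]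
  have e : phi M ^ (-1 : ℤ) • w =
      ∑ i : Fin n, (σ ^ (-1 : ℤ) : RingAut F) (b.repr w i) • (phi M ^ ((i : ℤ) - 1) • m) := by
    conv_lhs => rw [← b.sum_repr w, Finset.smul_sum]
    refine Finset.sum_congr rfl fun i _ => ?_
    rw [phi_zpow_smul_sig q, hb, ← zpow_natCast, ← mul_smul, ← zpow_add]
    congr 3
  rw [e]
  refine hN.sum_le _ _ (mul_nonneg (by positivity) (hN.nonneg _)) fun i _ => ?_
  rw [hN.smul, fabs_sig q]
  have hi : N (phi M ^ ((i : ℤ) - 1) • m) ≤ (2 : ℝ) ^ (μ * ((i : ℝ) - 1)) := by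
    rcases Nat.eq_zero_or_pos (i : ℕ) with h0 | h0
    · rw [h0]; simpa using hbot
    · have := basisNorm_phi_pow (C := C) M b hb μ ((i : ℕ) - 1) (by omega)
      rw [← zpow_natCast, Nat.cast_sub h0, Nat.cast_sub h0] at this
      simpa using this
  calc fabs C (b.repr w i) * N (phi M ^ ((i : ℤ) - 1) • m)
      ≤ fabs C (b.repr w i) * (2 : ℝ) ^ (μ * ((i : ℝ) - 1)) :=
        mul_le_mul_of_nonneg_left hi (fabs_nonneg _)
    _ = (2 : ℝ) ^ (-μ) * (fabs C (b.repr w i) * (2 : ℝ) ^ (μ * (i : ℕ))) := by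
        have : (2 : ℝ) ^ (μ * ((i : ℝ) - 1)) = (2 : ℝ) ^ (-μ) * (2 : ℝ) ^ (μ * (i : ℕ)) := by
          rw [← Real.rpow_add two_pos]; congr 1; ring
        rw [this]; ring
    _ ≤ _ := mul_le_mul_of_nonneg_left (le_basisNorm (C := C) b (fun i => (2 : ℝ) ^ (μ * (i : ℕ))) w i) (by positivity)

theorem normPure_of_weights {μ : ℝ} (ha0 : a 0 ≠ 0)
    (hl : ∀ i, fabs C (a i) * (2 : ℝ) ^ (μ * (i : ℕ)) ≤ fabs C (a 0))
    (hr : ∀ i, fabs C (a i) * (2 : ℝ) ^ (μ * (i : ℕ)) ≤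
      fabs C (a (Fin.last n)) * (2 : ℝ) ^ (μ * n)) : NormPure C M μ := by
  refine ⟨_, basisNorm_isAdm b (r := fun i => (2 : ℝ) ^ (μ * (i : ℕ))) fun i => by positivity,
    fun v => le_antisymm (basisNorm_Φ_le q M b hb han ha hr v) ?_⟩
  have := basisNorm_inv_le q M b hb ha ha0 hl v
  rwa [Real.rpow_neg two_pos.le, inv_mul_eq_div, le_div_iff₀ (by positivity), mul_comm] at this

omit hσ hb han ha in
/-- The last slope of the Newton polygon. -/
theorem exists_last_slope (a : Fin (n + 1) → F) (han : a (Fin.last n) ≠ 0) (ha0 : a 0 ≠ 0)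
    (hn : 0 < n) :
    ∃ s : ℚ, (∀ i, fabs C (a i) * (2 : ℝ) ^ ((s : ℝ) * (i : ℕ)) ≤
      fabs C (a (Fin.last n)) * (2 : ℝ) ^ ((s : ℝ) * n)) ∧
      ∃ i < Fin.last n, fabs C (a i) * (2 : ℝ) ^ ((s : ℝ) * (i : ℕ)) =
        fabs C (a (Fin.last n)) * (2 : ℝ) ^ ((s : ℝ) * n) := by
  classical
  have ho : ∀ i, ∃ o : ℤ, a i ≠ 0 → fabs C (a i) = (2 : ℝ) ^ o := by
    intro i
    by_cases h : a i = 0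
    · exact ⟨0, fun h' => absurd h h'⟩
    · obtain ⟨o, ho⟩ := exists_fabs_eq (C := C) h
      exact ⟨o, fun _ => ho⟩
  choose o ho using ho
  have hlog : ∀ (i : Fin (n + 1)) (s : ℝ), a i ≠ 0 →
      fabs C (a i) * (2 : ℝ) ^ (s * (i : ℕ)) = (2 : ℝ) ^ ((o i : ℝ) + s * (i : ℕ)) := by
    intro i s hi
    rw [ho i hi, Real.rpow_add two_pos, Real.rpow_intCast]
  have hS : ((Finset.univ : Finset (Fin (n + 1))).filter fun i => i < Fin.last n ∧ a i ≠ 0).Nonempty :=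
    ⟨0, by simpa [ha0, Fin.lt_def] using hn⟩
  obtain ⟨i₀, hi₀, hmax⟩ := Finset.exists_max_image _
    (fun i : Fin (n + 1) => ((o i - o (Fin.last n) : ℤ) : ℚ) / ((n : ℚ) - (i : ℕ))) hS
  simp only [Finset.mem_filter, Finset.mem_univ, true_and] at hi₀ hmax
  have hpos : ∀ i : Fin (n + 1), i < Fin.last n → (0 : ℚ) < (n : ℚ) - (i : ℕ) := by
    intro i hi
    rw [sub_pos]; exact_mod_cast hi
  refine ⟨((o i₀ - o (Fin.last n) : ℤ) : ℚ) / ((n : ℚ) - (i₀ : ℕ)), fun i => ?_, i₀, hi₀.1, ?_⟩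
  · by_cases hai : a i = 0
    · rw [hai, fabs_zero, zero_mul]
      exact mul_nonneg (fabs_nonneg _) (by positivity)
    rcases (Fin.le_last i).lt_or_eq with hi | rfl
    · have h1 := hmax i ⟨hi, hai⟩
      set s := ((o i₀ - o (Fin.last n) : ℤ) : ℚ) / ((n : ℚ) - (i₀ : ℕ))
      rw [div_le_iff₀ (hpos i hi)] at h1
      have h2 := hlog (Fin.last n) s han
      rw [Fin.val_last] at h2
      rw [hlog i s hai, h2]
      refine Real.rpow_le_rpow_of_exponent_le one_le_two ?_
      have h3 : (((o i - o (Fin.last n) : ℤ) : ℚ) : ℝ) ≤ ((s * ((n : ℚ) - (i : ℕ)) : ℚ) : ℝ) := by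
        exact_mod_cast h1
      push_cast at h3
      linarith
    · rw [Fin.val_last]
  · set s := ((o i₀ - o (Fin.last n) : ℤ) : ℚ) / ((n : ℚ) - (i₀ : ℕ)) with hs
    have h2 := hlog (Fin.last n) s han
    rw [Fin.val_last] at h2
    rw [hlog i₀ s hi₀.2, h2]
    congr 1
    rw [eq_div_iff (hpos i₀ hi₀.1).ne'] at hs
    have h3 : (((o i₀ - o (Fin.last n) : ℤ) : ℚ) : ℝ) = ((s * ((n : ℚ) - (i₀ : ℕ)) : ℚ) : ℝ) := by
      exact_mod_cast hs.symm
    push_cast at h3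
    linarith

omit hσ hb han ha in
/-- The first slope of the Newton polygon. -/
theorem exists_first_slope (a : Fin (n + 1) → F) (han : a (Fin.last n) ≠ 0) (ha0 : a 0 ≠ 0)
    (hn : 0 < n) :
    ∃ s : ℚ, (∀ i, fabs C (a i) * (2 : ℝ) ^ ((s : ℝ) * (i : ℕ)) ≤ fabs C (a 0)) ∧
      ∃ i : Fin (n + 1), 0 < i ∧ fabs C (a i) * (2 : ℝ) ^ ((s : ℝ) * (i : ℕ)) = fabs C (a 0) := by
  classical
  have ho : ∀ i, ∃ o : ℤ, a i ≠ 0 → fabs C (a i) = (2 : ℝ) ^ o := by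
    intro i
    by_cases h : a i = 0
    · exact ⟨0, fun h' => absurd h h'⟩
    · obtain ⟨o, ho⟩ := exists_fabs_eq (C := C) h
      exact ⟨o, fun _ => ho⟩
  choose o ho using ho
  have hlog : ∀ (i : Fin (n + 1)) (s : ℝ), a i ≠ 0 →
      fabs C (a i) * (2 : ℝ) ^ (s * (i : ℕ)) = (2 : ℝ) ^ ((o i : ℝ) + s * (i : ℕ)) := by
    intro i s hi
    rw [ho i hi, Real.rpow_add two_pos, Real.rpow_intCast]
  have h0 : fabs C (a 0) = (2 : ℝ) ^ (o 0 : ℝ) := by rw [ho 0 ha0, Real.rpow_intCast]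
  have hS : ((Finset.univ : Finset (Fin (n + 1))).filter fun i => 0 < i ∧ a i ≠ 0).Nonempty :=
    ⟨Fin.last n, Finset.mem_filter.2 ⟨Finset.mem_univ _, Fin.lt_def.2 (by simpa using hn), han⟩⟩
  obtain ⟨i₀, hi₀, hmin⟩ := Finset.exists_min_image _
    (fun i : Fin (n + 1) => ((o 0 - o i : ℤ) : ℚ) / ((i : ℕ) : ℚ)) hS
  simp only [Finset.mem_filter, Finset.mem_univ, true_and] at hi₀ hmin
  have hpos : ∀ i : Fin (n + 1), 0 < i → (0 : ℚ) < ((i : ℕ) : ℚ) := by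
    intro i hi
    exact_mod_cast hi
  refine ⟨((o 0 - o i₀ : ℤ) : ℚ) / ((i₀ : ℕ) : ℚ), fun i => ?_, i₀, hi₀.1, ?_⟩
  · by_cases hai : a i = 0
    · rw [hai, fabs_zero, zero_mul]
      exact fabs_nonneg _
    rcases (Fin.zero_le i).lt_or_eq with hi | rfl
    · have h1 := hmin i ⟨hi, hai⟩
      set s := ((o 0 - o i₀ : ℤ) : ℚ) / ((i₀ : ℕ) : ℚ)
      rw [le_div_iff₀ (hpos i hi)] at h1
      rw [hlog i s hai, h0]
      refine Real.rpow_le_rpow_of_exponent_le one_le_two ?_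
      have h3 : ((s * ((i : ℕ) : ℚ) : ℚ) : ℝ) ≤ (((o 0 - o i : ℤ) : ℚ) : ℝ) := by
        exact_mod_cast h1
      push_cast at h3
      linarith
    · simp
  · set s := ((o 0 - o i₀ : ℤ) : ℚ) / ((i₀ : ℕ) : ℚ) with hs
    rw [hlog i₀ s hi₀.2, h0]
    congr 1
    rw [eq_div_iff (hpos i₀ hi₀.1).ne'] at hs
    have h3 : (((o 0 - o i₀ : ℤ) : ℚ) : ℝ) = ((s * ((i₀ : ℕ) : ℚ) : ℚ) : ℝ) := by
      exact_mod_cast hs.symm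
    push_cast at h3
    linarith

theorem normPure_of_slopes (hn : 0 < n) {μ : ℝ}
    (h : ∀ s c : ℝ, 0 < c → (∀ i, fabs C (a i) * (2 : ℝ) ^ (s * (i : ℕ)) ≤ c) →
      ∀ i₀ j₀ : Fin (n + 1), i₀ < j₀ → fabs C (a i₀) * (2 : ℝ) ^ (s * (i₀ : ℕ)) = c →
        fabs C (a j₀) * (2 : ℝ) ^ (s * (j₀ : ℕ)) = c → s = μ) : NormPure C M μ := by
  have ha0 := coeff_zero_ne_zero q M b hb han ha hn
  obtain ⟨s, hs, i, hi, hsi⟩ := exists_last_slope (C := C) a han ha0 hn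
  obtain ⟨s', hs', i', hi', hsi'⟩ := exists_first_slope (C := C) a han ha0 hn
  have e1 : (s : ℝ) = μ := h s _ (mul_pos (fabs_pos han) (by positivity)) hs i (Fin.last n) hi hsi
    (by rw [Fin.val_last])
  have e2 : (s' : ℝ) = μ := h s' _ (fabs_pos ha0) hs' 0 i' hi' (by simp) hsi'
  rw [e1] at hs
  rw [e2] at hs'
  exact normPure_of_weights q M b hb han ha ha0 hs' hs

end Operator

end Weights

section Purity

variable {C : Type u} [NormedField C] (q : Cˣ)

theorem toGermField_ne_zero {a : germRing C} (h : a ≠ 0) : toGermField a ≠ 0 := by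
  intro h'
  apply h
  have h1 : HahnSeries.ofPowerSeries ℤ C a.1 = HahnSeries.ofPowerSeries ℤ C 0 := by
    rw [map_zero]; exact congrArg Subtype.val h'
  exact Subtype.ext (HahnSeries.ofPowerSeries_injective h1)

theorem fabs_toGermField {a : germRing C} (h : a ≠ 0) :
    fabs C (toGermField a) = (2 : ℝ) ^ (-(a.1.order.toNat : ℝ)) := by
  have h0 : a.1 ≠ 0 := fun h' => h (Subtype.ext h')
  have hne : (HahnSeries.ofPowerSeries ℤ C a.1) ≠ 0 :=
    (map_ne_zero_iff _ HahnSeries.ofPowerSeries_injective).2 h0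
  have ho : (HahnSeries.ofPowerSeries ℤ C a.1).order = (a.1.order.toNat : ℤ) := by
    refine le_antisymm ?_ ?_
    · refine HahnSeries.order_le_of_coeff_ne_zero ?_
      rw [PowerSeries.coeff_coe, if_neg (by omega), Int.natAbs_natCast]
      exact PowerSeries.coeff_order h0
    · rw [HahnSeries.le_order_iff_forall hne]
      intro k hk
      rw [PowerSeries.coeff_coe]
      split_ifs with h1
      · rfl
      · exact PowerSeries.coeff_of_lt_order_toNat _ (by omega)
  change labs (HahnSeries.ofPowerSeries ℤ C a.1) = _
  rw [labs_of_ne hne, ho, ← Real.rpow_intCast]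
  push_cast; rfl

theorem isSlope_iff_weights {n : ℕ} (a : Fin (n + 1) → germRing C) (s : ℝ) :
    IsSlope a s ↔ ∃ c : ℝ, 0 < c ∧
      (∀ i, fabs C (toGermField (a i)) * (2 : ℝ) ^ (s * (i : ℕ)) ≤ c) ∧
      ∃ i j : Fin (n + 1), i < j ∧ fabs C (toGermField (a i)) * (2 : ℝ) ^ (s * (i : ℕ)) = c ∧
        fabs C (toGermField (a j)) * (2 : ℝ) ^ (s * (j : ℕ)) = c := by
  have hw : ∀ i, a i ≠ 0 → fabs C (toGermField (a i)) * (2 : ℝ) ^ (s * (i : ℕ)) =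
      (2 : ℝ) ^ (s * (i : ℕ) - ((a i).1.order.toNat : ℝ)) := by
    intro i hi
    rw [fabs_toGermField hi, ← Real.rpow_add two_pos]; congr 1; ring
  have h0 : ∀ i, a i = 0 → fabs C (toGermField (a i)) * (2 : ℝ) ^ (s * (i : ℕ)) = 0 := by
    intro i hi
    have : toGermField (a i) = 0 := by
      rw [hi]; exact Subtype.ext (map_zero _)
    rw [this, fabs_zero, zero_mul]
  rw [isSlope_iff]
  constructor
  · rintro ⟨c, hle, i, j, hij, hi, hj, ei, ej⟩
    refine ⟨(2 : ℝ) ^ (-c), by positivity, fun k => ?_, i, j, hij, ?_, ?_⟩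
    · by_cases hk : a k = 0
      · rw [h0 k hk]; positivity
      · rw [hw k hk]
        exact Real.rpow_le_rpow_of_exponent_le one_le_two (by linarith [hle k hk])
    · rw [hw i hi, ei]; congr 1; ring
    · rw [hw j hj, ej]; congr 1; ring
  · rintro ⟨c, hc, hle, i, j, hij, ei, ej⟩
    have hi : a i ≠ 0 := fun h => by rw [h0 i h] at ei; exact hc.ne ei
    have hj : a j ≠ 0 := fun h => by rw [h0 j h] at ej; exact hc.ne ej
    have hcl : c = (2 : ℝ) ^ (Real.logb 2 c) := (Real.rpow_logb two_pos (by norm_num) hc).symm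
    have hinj : ∀ {x y : ℝ}, (2 : ℝ) ^ x = (2 : ℝ) ^ y → x = y := fun {x y} h =>
      le_antisymm ((Real.rpow_le_rpow_left_iff one_lt_two).1 h.le)
        ((Real.rpow_le_rpow_left_iff one_lt_two).1 h.ge)
    refine ⟨-Real.logb 2 c, fun k hk => ?_, i, j, hij, hi, hj, ?_, ?_⟩
    · have := hle k
      rw [hw k hk, hcl, Real.rpow_le_rpow_left_iff one_lt_two] at this
      linarith
    · rw [hw i hi, hcl] at ei
      linarith [hinj ei]
    · rw [hw j hj, hcl] at ej
      linarith [hinj ej]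

theorem normPure_of_subsingleton {F : Type w} [Field F] [GrowthField C F] {σ : F ≃+* F}
    (M : QDiffModule.{w, v} F σ) [Subsingleton M.carrier] (μ : ℝ) : NormPure C M μ :=
  ⟨stdNorm C F M.carrier, stdNorm_isAdm, fun v => by
    rw [Subsingleton.elim v 0, map_zero, stdNorm_isAdm.map_zero, mul_zero]⟩

theorem exists_common_denominator {n : ℕ} (g : Fin n → germField C) :
    ∃ (h : germField C) (a : Fin n → germRing C), h ≠ 0 ∧ ∀ i, toGermField (a i) = h * g i := by
  have hg : ∀ i, ∃ G H : germRing C, H ≠ 0 ∧ toGermField H * g i = toGermField G := by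
    intro i
    obtain ⟨G, hG, H, hH, h0, e⟩ := (g i).2
    refine ⟨⟨G, hG⟩, ⟨H, hH⟩, fun h => h0 (congrArg Subtype.val h), Subtype.ext ?_⟩
    change HahnSeries.ofPowerSeries ℤ C H * (g i).1 = HahnSeries.ofPowerSeries ℤ C G
    rw [e, mul_div_cancel₀]
    exact (map_ne_zero_iff _ HahnSeries.ofPowerSeries_injective).2 h0
  choose G H hH e using hg
  have hmul : ∀ a b : germRing C, toGermField (a * b) = toGermField a * toGermField b :=
    fun a b => Subtype.ext (map_mul _ _ _)
  refine ⟨toGermField (∏ j, H j), fun i => (∏ j ∈ Finset.univ.erase i, H j) * G i,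
    toGermField_ne_zero (Finset.prod_ne_zero_iff.2 fun j _ => hH j), fun i => ?_⟩
  rw [hmul, ← e, ← Finset.prod_erase_mul _ _ (Finset.mem_univ i), hmul]
  ring

variable {q}

theorem exists_operator (hq : ‖(q : C)‖ = 1) (hroot : ∀ n : ℕ, 0 < n → q ^ n ≠ 1) (M : Bq q) :
    ∃ (m : M.carrier) (a : Fin (Module.finrank (germField C) M.carrier + 1) → germRing C),
      LinearIndependent (germField C)
        (fun i : Fin (Module.finrank (germField C) M.carrier) => M.Φ^[i] m) ∧
      a (Fin.last _) ≠ 0 ∧ ∑ i, toGermField (a i) • M.Φ^[i] m = 0 := by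
  have := isShift_germShift hq
  obtain ⟨m, hm⟩ := exists_cyclic q hroot M
  simp only [phi_pow_smul] at hm
  set n := Module.finrank (germField C) M.carrier with hn
  set b := basisOfLinearIndependentOfCardEqFinrank' _ hm (by simp [hn]) with hb
  have hbi : ∀ i, b i = M.Φ^[i] m := fun i => by
    rw [hb, coe_basisOfLinearIndependentOfCardEqFinrank']
  let g : Fin (n + 1) → germField C := Fin.snoc (α := fun _ => germField C)
    (fun i => -b.repr (M.Φ^[n] m) i) 1
  have hg : ∑ i, g i • M.Φ^[i] m = 0 := by
    rw [Fin.sum_univ_castSucc]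
    simp only [g, Fin.snoc_castSucc, Fin.snoc_last, Fin.val_castSucc, Fin.val_last, one_smul,
      neg_smul, Finset.sum_neg_distrib, ← hbi]
    rw [b.sum_repr, neg_add_cancel]
  obtain ⟨h, a, h0, ha⟩ := exists_common_denominator g
  refine ⟨m, a, hm, fun h' => ?_, ?_⟩
  · have := ha (Fin.last n)
    rw [h'] at this
    simp only [g, Fin.snoc_last, mul_one] at this
    apply h0
    rw [← this]
    exact Subtype.ext (map_zero _)
  · simp only [ha, mul_smul, ← Finset.smul_sum, hg, smul_zero]

theorem isPure_iff_normPure (hq : ‖(q : C)‖ = 1) (hroot : ∀ n : ℕ, 0 < n → q ^ n ≠ 1) (M : Bq q)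
    (μ : ℚ) : isPure q μ M ↔ NormPure C M (μ : ℝ) := by
  have := isShift_germShift hq
  constructor
  · rintro ⟨m, a, hm, han, ha, hs⟩
    rcases Nat.eq_zero_or_pos (Module.finrank (germField C) M.carrier) with h0 | hn
    · have := Module.finrank_zero_iff.1 h0
      exact normPure_of_subsingleton M _
    refine normPure_of_slopes q M (basisOfLinearIndependentOfCardEqFinrank' _ hm (by simp)) (m := m)
      (a := fun i => toGermField (a i)) (fun i => ?_) (toGermField_ne_zero han) ?_ hn ?_
    · rw [coe_basisOfLinearIndependentOfCardEqFinrank', phi_pow_smul]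
    · simpa only [phi_pow_smul] using ha
    · intro s c hc hle i j hij hi hj
      exact hs s ((isSlope_iff_weights a s).2 ⟨c, hc, hle, i, j, hij, hi, hj⟩)
  · intro h
    obtain ⟨m, a, hm, han, ha⟩ := exists_operator hq hroot M
    refine ⟨m, a, hm, han, ha, fun s hs => ?_⟩
    obtain ⟨c, hc, hle, i, j, hij, hi, hj⟩ := (isSlope_iff_weights a s).1 hs
    refine slope_eq_of_normPure q M (basisOfLinearIndependentOfCardEqFinrank' _ hm (by simp))
      (m := m) (a := fun i => toGermField (a i)) (fun i => ?_) (toGermField_ne_zero han) ?_ h hc hle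
      hij hi hj
    · rw [coe_basisOfLinearIndependentOfCardEqFinrank', phi_pow_smul]
    · simpa only [phi_pow_smul] using ha

variable (q) in
/-- The map `v ↦ 1 ⊗ v` to the formalization. -/
def toFormal (M : Bq q) : M.carrier →+ (formalization q M).carrier where
  toFun v := ((1 : LaurentSeries C) ⊗ₜ[germField C] v : LaurentSeries C ⊗[germField C] M.carrier)
  map_zero' := TensorProduct.tmul_zero _ _
  map_add' := TensorProduct.tmul_add _

theorem toFormal_smul (M : Bq q) (f : germField C) (v : M.carrier) :
    toFormal q M (f • v) = f.1 • toFormal q M v :=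
  TensorProduct.tmul_smul f (1 : LaurentSeries C) v

theorem toFormal_Φ (M : Bq q) (v : M.carrier) :
    toFormal q M (M.Φ v) = (formalization q M).Φ (toFormal q M v) := by
  have e : (formalization q M).Φ (toFormal q M v) = ((shift q (1 : LaurentSeries C)) ⊗ₜ[germField C]
    M.Φ v : LaurentSeries C ⊗[germField C] M.carrier) := rfl
  rw [e, map_one]; rfl

theorem toFormal_phi_zpow (M : Bq q) (k : ℤ) (v : M.carrier) :
    toFormal q M (phi M ^ k • v) = phi (formalization q M) ^ k • toFormal q M v :=
  semiconj_zpow _ (toFormal_Φ M) k v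

variable (q) in
/-- The basis of the formalization attached to a basis. -/
def formalBasis (M : Bq q) {I : Type*} (b : Module.Basis I (germField C) M.carrier) :
    Module.Basis I (LaurentSeries C) (formalization q M).carrier :=
  b.baseChange (LaurentSeries C)

theorem formalBasis_apply (M : Bq q) {I : Type*} (b : Module.Basis I (germField C) M.carrier)
    (i : I) : formalBasis q M b i = toFormal q M (b i) :=
  Module.Basis.baseChange_apply _ _ _

theorem normPure_formalization_iff (hq : ‖(q : C)‖ = 1) (hroot : ∀ n : ℕ, 0 < n → q ^ n ≠ 1)
    (M : Bq q) (μ : ℝ) : NormPure C (formalization q M) μ ↔ NormPure C M μ := by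
  have := isShift_germShift hq
  obtain ⟨m, a, hm, han, ha⟩ := exists_operator hq hroot M
  rcases Nat.eq_zero_or_pos (Module.finrank (germField C) M.carrier) with h0 | hn
  · have := Module.finrank_zero_iff.1 h0
    have : Subsingleton (formalization q M).carrier := by
      have hb := formalBasis q M (Module.finBasis (germField C) M.carrier)
      rw [h0] at hb
      have := hb.repr.injective.subsingleton
      exact this
    exact ⟨fun _ => normPure_of_subsingleton M _, fun _ => normPure_of_subsingleton _ _⟩
  set b := basisOfLinearIndependentOfCardEqFinrank' _ hm (by simp) with hb
  have hbi : ∀ i, b i = phi M ^ (i : ℕ) • m := fun i => by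
    rw [hb, coe_basisOfLinearIndependentOfCardEqFinrank', phi_pow_smul]
  set b' := formalBasis q M b with hb'
  set m' := toFormal q M m with hm'
  have hbi' : ∀ i, b' i = phi (formalization q M) ^ (i : ℕ) • m' := fun i => by
    rw [hb', formalBasis_apply, hbi, hm', ← zpow_natCast, ← zpow_natCast, toFormal_phi_zpow]
  have ha1 : ∑ i, toGermField (a i) • phi M ^ (i : ℕ) • m = 0 := by
    simpa only [phi_pow_smul] using ha
  have ha' : ∑ i, (toGermField (a i)).1 • phi (formalization q M) ^ (i : ℕ) • m' = 0 := by
    have h1 := congrArg (toFormal q M) ha1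
    rw [map_sum, map_zero] at h1
    rw [← h1]
    refine Finset.sum_congr rfl fun i _ => ?_
    rw [toFormal_smul, ← zpow_natCast, ← zpow_natCast, toFormal_phi_zpow]
  have han' : (toGermField (a (Fin.last _))).1 ≠ 0 := fun h =>
    toGermField_ne_zero han (Subtype.ext h)
  constructor
  · intro h
    refine normPure_of_slopes q M b hbi (toGermField_ne_zero han) ha1 hn ?_
    intro s c hc hle i j hij hi hj
    exact slope_eq_of_normPure q (formalization q M) b' hbi' (a := fun i => (toGermField (a i)).1)
      han' ha' h hc hle hij hi hj
  · intro h
    refine normPure_of_slopes q (formalization q M) b' hbi' (a := fun i => (toGermField (a i)).1)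
      han' ha' hn ?_
    intro s c hc hle i j hij hi hj
    exact slope_eq_of_normPure q M b hbi (toGermField_ne_zero han) ha1 h hc hle hij hi hj

end Purity

section Limit

variable {C : Type u} [NormedField C] {F : Type w} [Field F] [GrowthField C F]

/-- Nets that are Cauchy for the `x`-adic absolute value and bounded in a weighted norm
converge. -/
theorem exists_limit {α : Type*} [SemilatticeSup α] {ρ : ℝ} (hρ : 0 < ρ) (y : α → F)
    (hy : ∀ K : ℤ, ∃ M, ∀ m ≥ M, fabs C (y m - y M) ≤ (2 : ℝ) ^ (-K)) {R : ENNReal} (hR : R < ⊤)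
    (hr : ∀ m, rnorm (ν F) ρ (ι (y m) : LaurentSeries C) ≤ R) :
    ∃ g : F, (∀ K : ℤ, ∃ M, ∀ m ≥ M, fabs C (g - y m) ≤ (2 : ℝ) ^ (-K)) ∧
      rnorm (ν F) ρ (ι g : LaurentSeries C) ≤ R := by
  choose M hM using hy
  have hcoef : ∀ K, ∀ m ≥ M K, ∀ k < K, (ι (y m) : LaurentSeries C).coeff k =
      (ι (y (M K)) : LaurentSeries C).coeff k := by
    intro K m hm k hk
    have := hM K m hm
    rw [fabs, labs_le_iff] at this
    have := this k hk
    rwa [map_sub, HahnSeries.coeff_sub, sub_eq_zero] at this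
  let c : ℤ → C := fun k => (ι (y (M (k + 1))) : LaurentSeries C).coeff k
  have hc : ∀ K, ∀ m ≥ M K, ∀ k < K, (ι (y m) : LaurentSeries C).coeff k = c k := by
    intro K m hm k hk
    rw [hcoef K m hm k hk, ← hcoef K (M K ⊔ M (k + 1)) le_sup_left k hk]
    exact hcoef (k + 1) _ le_sup_right k (by omega)
  have hbdd : BddBelow (Function.support c) := by
    refine ⟨min 0 (ι (y (M 0)) : LaurentSeries C).order, fun k hk => ?_⟩
    by_contra h
    push Not at h
    rw [lt_min_iff] at h
    apply hk
    rw [← hc 0 (M 0) le_rfl k h.1]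
    exact HahnSeries.coeff_eq_zero_of_lt_order h.2
  let f : LaurentSeries C := HahnSeries.ofSuppBddBelow c hbdd
  have hf : ∀ k, f.coeff k = c k := fun k => rfl
  have hfr : rnorm (ν F) ρ f ≤ R := by
    unfold rnorm
    rw [ENNReal.tsum_eq_iSup_sum]
    refine iSup_le fun s => ?_
    obtain ⟨K, hK⟩ := s.bddAbove
    refine le_trans ?_ (hr (M (K + 1)))
    refine le_trans (le_of_eq (Finset.sum_congr rfl fun k hk => ?_)) (ENNReal.sum_le_tsum s)
    have hk : k ≤ K := hK hk
    rw [hf, ← hc (K + 1) _ le_rfl k (by omega)]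
  obtain ⟨g, hg⟩ := exists_ι_eq_of_rnorm (F := F) hρ (hfr.trans_lt hR)
  refine ⟨g, fun K => ⟨M K, fun m hm => ?_⟩, hg ▸ hfr⟩
  rw [fabs, labs_le_iff]
  intro k hk
  rw [map_sub, HahnSeries.coeff_sub, hg, hf, hc K m hm k hk, sub_self]

end Limit

section MatrixNorm

variable {C : Type u} [NormedField C] {F : Type w} [Field F] [GrowthField C F] {n : ℕ}

variable (C) in
/-- The weighted norm of a matrix. -/
def mrn (ρ : ℝ) (A : Matrix (Fin n) (Fin n) F) : ENNReal :=
  ∑ i, ∑ j, rnorm (ν F) ρ (ι (A i j) : LaurentSeries C)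

theorem rnorm_le_mrn (ρ : ℝ) (A : Matrix (Fin n) (Fin n) F) (i j : Fin n) :
    rnorm (ν F) ρ (ι (A i j) : LaurentSeries C) ≤ mrn C ρ A :=
  (Finset.single_le_sum (f := fun j => rnorm (ν F) ρ (ι (A i j) : LaurentSeries C))
    (fun _ _ => zero_le) (Finset.mem_univ j)).trans
    (Finset.single_le_sum (f := fun i => ∑ j, rnorm (ν F) ρ (ι (A i j) : LaurentSeries C))
    (fun _ _ => zero_le) (Finset.mem_univ i))

theorem mrn_add_le {ρ : ℝ} (hρ : 0 < ρ) (A B : Matrix (Fin n) (Fin n) F) :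
    mrn C ρ (A + B) ≤ mrn C ρ A + mrn C ρ B := by
  unfold mrn
  rw [← Finset.sum_add_distrib]
  refine Finset.sum_le_sum fun i _ => ?_
  rw [← Finset.sum_add_distrib]
  refine Finset.sum_le_sum fun j _ => ?_
  rw [Matrix.add_apply, map_add]
  exact rnorm_add_le hρ _ _

theorem mrn_neg (ρ : ℝ) (A : Matrix (Fin n) (Fin n) F) : mrn C ρ (-A) = mrn C ρ A := by
  simp [mrn, rnorm]

theorem mrn_mul_le {ρ : ℝ} (hρ : 0 < ρ) (A B : Matrix (Fin n) (Fin n) F) :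
    mrn C ρ (A * B) ≤ mrn C ρ A * mrn C ρ B := by
  have h1 : mrn C ρ (A * B) ≤ ∑ i, ∑ j, ∑ k, rnorm (ν F) ρ (ι (A i k) : LaurentSeries C) *
      rnorm (ν F) ρ (ι (B k j) : LaurentSeries C) := by
    refine Finset.sum_le_sum fun i _ => Finset.sum_le_sum fun j _ => ?_
    rw [Matrix.mul_apply, map_sum]
    refine (rnorm_sum_le hρ _ _).trans (Finset.sum_le_sum fun k _ => ?_)
    rw [map_mul]
    exact rnorm_mul_le hρ _ _
  refine h1.trans ?_
  have h2 : ∀ i, ∑ j, ∑ k, rnorm (ν F) ρ (ι (A i k) : LaurentSeries C) *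
      rnorm (ν F) ρ (ι (B k j) : LaurentSeries C) =
      ∑ k, rnorm (ν F) ρ (ι (A i k) : LaurentSeries C) *
        ∑ j, rnorm (ν F) ρ (ι (B k j) : LaurentSeries C) := by
    intro i
    rw [Finset.sum_comm]
    simp only [Finset.mul_sum]
  simp only [h2]
  unfold mrn
  rw [Finset.sum_mul]
  refine Finset.sum_le_sum fun i _ => ?_
  rw [Finset.sum_mul]
  refine Finset.sum_le_sum fun k _ => ?_
  exact mul_le_mul' le_rfl
    (Finset.single_le_sum (f := fun k => ∑ j, rnorm (ν F) ρ (ι (B k j) : LaurentSeries C))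
    (fun _ _ => zero_le) (Finset.mem_univ k))

theorem mrn_map {u : Cˣ} {τ : F ≃+* F} (hτ : IsShift u τ) (ρ : ℝ) (A : Matrix (Fin n) (Fin n) F) :
    mrn C ρ (A.map τ) = mrn C ρ A := by
  simp only [mrn, Matrix.map_apply, hτ.map_shift, rnorm_shift hτ.ν_eq]

theorem mrn_cst_lt_top (A : Matrix (Fin n) (Fin n) C) :
    ∃ K : ENNReal, K ≠ ⊤ ∧ ∀ ρ, mrn C ρ (A.map (cst F)) = K := by
  have h : ∀ ρ i j, rnorm (ν F) ρ (ι (A.map (cst F) i j) : LaurentSeries C) =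
      ENNReal.ofReal (ν F (A i j)) := by
    intro ρ i j
    rw [Matrix.map_apply, ι_cst]
    unfold rnorm
    rw [tsum_eq_single 0]
    · simp
    · intro k hk
      simp [HahnSeries.coeff_single_of_ne hk]
  refine ⟨∑ i, ∑ j, ENNReal.ofReal (ν F (A i j)), ?_, fun ρ => ?_⟩
  · exact (ENNReal.sum_lt_top.2 fun i _ => ENNReal.sum_lt_top.2 fun j _ => ENNReal.ofReal_lt_top).ne
  · simp only [mrn, h]

theorem mrn_small {E : Matrix (Fin n) (Fin n) F} (hE : ∀ i j, fabs C (E i j) ≤ 1 / 2)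
    {ε : ENNReal} (hε : 0 < ε) :
    ∀ᶠ ρ in nhdsWithin (0 : ℝ) (Set.Ioi 0), mrn C ρ E ≤ ε := by
  rcases Nat.eq_zero_or_pos n with rfl | hn
  · simp [mrn]
  have hn' : (n : ENNReal) * n ≠ ⊤ := ENNReal.mul_ne_top (ENNReal.natCast_ne_top n)
    (ENNReal.natCast_ne_top n)
  have h1 : 0 < ε / (n * n) := ENNReal.div_pos hε.ne' hn'
  have h2 : ∀ i j, ∀ᶠ ρ in nhdsWithin (0 : ℝ) (Set.Ioi 0),
      rnorm (ν F) ρ (ι (E i j) : LaurentSeries C) ≤ ε / (n * n) := fun i j =>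
    rnorm_small (hE i j) (eventually_rnorm _) h1
  simp only [← Filter.eventually_all] at h2
  filter_upwards [h2] with ρ h
  calc mrn C ρ E ≤ ∑ i : Fin n, ∑ j : Fin n, ε / (n * n) :=
        Finset.sum_le_sum fun i _ => Finset.sum_le_sum fun j _ => h i j
    _ = (n * n) * (ε / (n * n)) := by simp [mul_assoc]
    _ ≤ ε := ENNReal.mul_div_le

theorem fabs_matrix_mul_le {A B : Matrix (Fin n) (Fin n) F} {s t : ℝ} (hs : 0 ≤ s) (ht : 0 ≤ t)
    (hA : ∀ i j, fabs C (A i j) ≤ s) (hB : ∀ i j, fabs C (B i j) ≤ t) (i j : Fin n) :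
    fabs C ((A * B) i j) ≤ s * t := by
  rw [Matrix.mul_apply]
  refine fabs_sum_le _ _ (mul_nonneg hs ht) fun k _ => ?_
  rw [fabs_mul]
  exact mul_le_mul (hA i k) (hB k j) (fabs_nonneg _) hs

theorem fabs_matrix_add_le {A B : Matrix (Fin n) (Fin n) F} {s : ℝ}
    (hA : ∀ i j, fabs C (A i j) ≤ s) (hB : ∀ i j, fabs C (B i j) ≤ s) (i j : Fin n) :
    fabs C ((A + B) i j) ≤ s := (fabs_add_le _ _).trans (max_le (hA i j) (hB i j))

theorem fabs_matrix_sub_le {A B : Matrix (Fin n) (Fin n) F} {s : ℝ}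
    (hA : ∀ i j, fabs C (A i j) ≤ s) (hB : ∀ i j, fabs C (B i j) ≤ s) (i j : Fin n) :
    fabs C ((A - B) i j) ≤ s := by
  rw [sub_eq_add_neg]
  exact fabs_matrix_add_le hA (fun i j => by rw [Matrix.neg_apply, fabs_neg]; exact hB i j) i j

theorem fabs_cst_le (c : C) : fabs C (cst F c) ≤ 1 := by
  rcases eq_or_ne c 0 with rfl | h
  · simp
  · exact (fabs_cst h).le

/-- Solution of a quadratic matrix equation by successive approximation. -/
theorem exists_matrix_fixedPoint {u₁ u₂ : Cˣ} {τ₁ τ₂ : F ≃+* F} (h₁ : IsShift u₁ τ₁)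
    (h₂ : IsShift u₂ τ₂) (L A₁ A₂ R : Matrix (Fin n) (Fin n) C) (E : Matrix (Fin n) (Fin n) F)
    (hE : ∀ i j, fabs C (E i j) ≤ 1 / 2) :
    ∃ Y : Matrix (Fin n) (Fin n) F, (∀ i j, fabs C (Y i j) ≤ 1 / 2) ∧
      Y = L.map (cst F) * (A₁.map (cst F) - Y.map τ₁) * E * (A₂.map (cst F) + Y.map τ₂) *
        R.map (cst F) := by
  set G : Matrix (Fin n) (Fin n) F → Matrix (Fin n) (Fin n) F := fun Y =>
    L.map (cst F) * (A₁.map (cst F) - Y.map τ₁) * E * (A₂.map (cst F) + Y.map τ₂) *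
        R.map (cst F) with hG
  have hc : ∀ (A : Matrix (Fin n) (Fin n) C) i j, fabs C (A.map (cst F) i j) ≤ 1 :=
    fun A i j => fabs_cst_le _
  have ht : ∀ {u : Cˣ} {τ : F ≃+* F} (hτ : IsShift u τ) {Y : Matrix (Fin n) (Fin n) F} {s : ℝ},
      (∀ i j, fabs C (Y i j) ≤ s) → ∀ i j, fabs C (Y.map τ i j) ≤ s := by
    intro u τ hτ Y s h i j
    rw [Matrix.map_apply, fabs_shift u]; exact h i j
  have hG1 : ∀ Y, (∀ i j, fabs C (Y i j) ≤ 1) → ∀ i j, fabs C (G Y i j) ≤ 1 / 2 := by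
    intro Y hY i j
    have := fabs_matrix_mul_le (by norm_num) zero_le_one (fabs_matrix_mul_le (by norm_num)
      zero_le_one (fabs_matrix_mul_le (by norm_num) (by norm_num) (fabs_matrix_mul_le zero_le_one
      zero_le_one (hc L) (fabs_matrix_sub_le (hc A₁) (ht h₁ hY))) hE)
      (fabs_matrix_add_le (hc A₂) (ht h₂ hY))) (hc R) i j
    simpa using this
  have hG2 : ∀ Y Y', (∀ i j, fabs C (Y i j) ≤ 1) → (∀ i j, fabs C (Y' i j) ≤ 1) → ∀ s, 0 ≤ s →
      (∀ i j, fabs C ((Y - Y') i j) ≤ s) → ∀ i j, fabs C ((G Y - G Y') i j) ≤ 1 / 2 * s := by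
    intro Y Y' hY hY' s hs h i j
    have e : G Y - G Y' =
        L.map (cst F) * (-(Y - Y').map τ₁) * E * (A₂.map (cst F) + Y.map τ₂) * R.map (cst F) +
        L.map (cst F) * (A₁.map (cst F) - Y'.map τ₁) * E * ((Y - Y').map τ₂) * R.map (cst F) := by
      have e1 : ∀ τ : F ≃+* F, (Y - Y').map τ = Y.map τ - Y'.map τ := fun τ => by
        ext; simp
      rw [hG, e1, e1]; noncomm_ring
    rw [e]
    refine fabs_matrix_add_le (fun i j => ?_) (fun i j => ?_) i j
    · have := fabs_matrix_mul_le (by positivity) zero_le_one (fabs_matrix_mul_le (by positivity)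
        zero_le_one (fabs_matrix_mul_le (by positivity) (by norm_num) (fabs_matrix_mul_le zero_le_one
        hs (hc L) (B := -(Y - Y').map τ₁)
        (fun i j => by rw [Matrix.neg_apply, fabs_neg]; exact ht h₁ h i j)) hE)
        (fabs_matrix_add_le (hc A₂) (ht h₂ hY))) (hc R) i j
      refine this.trans_eq (by ring)
    · have := fabs_matrix_mul_le (by positivity) zero_le_one (fabs_matrix_mul_le (by norm_num)
        hs (fabs_matrix_mul_le (by norm_num) (by norm_num) (fabs_matrix_mul_le zero_le_one
        zero_le_one (hc L) (fabs_matrix_sub_le (hc A₁) (ht h₁ hY'))) hE)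
        (ht h₂ h)) (hc R) i j
      refine this.trans_eq (by ring)
  obtain ⟨KL, hKL, eL⟩ := mrn_cst_lt_top (F := F) L
  obtain ⟨K1, hK1, e1⟩ := mrn_cst_lt_top (F := F) A₁
  obtain ⟨K2, hK2, e2⟩ := mrn_cst_lt_top (F := F) A₂
  obtain ⟨KR, hKR, eR⟩ := mrn_cst_lt_top (F := F) R
  set K := KL * (K1 + 1) * (K2 + 1) * KR with hK
  have hKt : K ≠ ⊤ := ENNReal.mul_ne_top (ENNReal.mul_ne_top (ENNReal.mul_ne_top hKL
    (ENNReal.add_ne_top.2 ⟨hK1, ENNReal.one_ne_top⟩)) (ENNReal.add_ne_top.2 ⟨hK2, ENNReal.one_ne_top⟩)) hKR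
  obtain ⟨ρ, hρE, hρ⟩ := ((mrn_small hE (ENNReal.inv_pos.2 hKt)).and self_mem_nhdsWithin).exists
  have hρ : 0 < ρ := hρ
  have hG3 : ∀ Y, mrn C ρ Y ≤ 1 → mrn C ρ (G Y) ≤ 1 := by
    intro Y hY
    have a1 : mrn C ρ (A₁.map (cst F) - Y.map τ₁) ≤ K1 + 1 := by
      rw [sub_eq_add_neg]
      refine (mrn_add_le hρ _ _).trans ?_
      rw [e1, mrn_neg, mrn_map h₁]; gcongr
    have a2 : mrn C ρ (A₂.map (cst F) + Y.map τ₂) ≤ K2 + 1 := by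
      refine (mrn_add_le hρ _ _).trans ?_
      rw [e2, mrn_map h₂]; gcongr
    calc mrn C ρ (G Y) ≤ KL * (K1 + 1) * K⁻¹ * (K2 + 1) * KR := by
          refine (mrn_mul_le hρ _ _).trans (mul_le_mul' ?_ (eR ρ).le)
          refine (mrn_mul_le hρ _ _).trans (mul_le_mul' ?_ a2)
          refine (mrn_mul_le hρ _ _).trans (mul_le_mul' ?_ hρE)
          exact (mrn_mul_le hρ _ _).trans (mul_le_mul' (eL ρ).le a1)
      _ = K * K⁻¹ := by rw [hK]; ring
      _ ≤ 1 := ENNReal.mul_inv_le_one _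
  let y : ℕ → Matrix (Fin n) (Fin n) F := fun m => G^[m] 0
  have hys : ∀ m, y (m + 1) = G (y m) := fun m => Function.iterate_succ_apply' _ _ _
  have hy1 : ∀ m i j, fabs C (y m i j) ≤ 1 / 2 := by
    intro m
    induction m with
    | zero => intro i j; simp [y]
    | succ m ih => rw [hys]; exact hG1 _ fun i j => (ih i j).trans (by norm_num)
  have hy1' : ∀ m i j, fabs C (y m i j) ≤ 1 := fun m i j => (hy1 m i j).trans (by norm_num)
  have hy2 : ∀ m, mrn C ρ (y m) ≤ 1 := by
    intro m
    induction m with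
    | zero => simp [y, mrn, rnorm_zero]
    | succ m ih => rw [hys]; exact hG3 _ ih
  have hy3 : ∀ m, ∀ k ≥ m, ∀ i j, fabs C ((y k - y m) i j) ≤ (1 / 2 : ℝ) ^ m := by
    intro m
    induction m with
    | zero =>
      intro k _ i j
      simpa using fabs_matrix_sub_le (hy1' k) (hy1' 0) i j
    | succ m ih =>
      intro k hk
      obtain ⟨k, rfl⟩ : ∃ k', k = k' + 1 := ⟨k - 1, by omega⟩
      intro i j
      rw [hys, hys, pow_succ']
      exact hG2 _ _ (hy1' _) (hy1' _) _ (by positivity) (ih k (by omega)) i j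
  have hpow : ∀ K : ℤ, (1 / 2 : ℝ) ^ K.toNat ≤ (2 : ℝ) ^ (-K) := by
    intro K
    rw [one_div, inv_pow, ← zpow_natCast, ← zpow_neg]
    exact zpow_le_zpow_right₀ one_le_two (by omega)
  have hlim : ∀ i j, ∃ g : F, ∀ K : ℤ, ∃ M, ∀ m ≥ M, fabs C (g - y m i j) ≤ (2 : ℝ) ^ (-K) := by
    intro i j
    obtain ⟨g, hg, -⟩ := exists_limit (C := C) hρ (fun m => y m i j)
      (fun K => ⟨K.toNat, fun m hm => (hy3 _ m hm i j).trans (hpow K)⟩) ENNReal.one_lt_top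
      fun m => (rnorm_le_mrn ρ (y m) i j).trans (hy2 m)
    exact ⟨g, hg⟩
  choose Y₀ hY using hlim
  set Y : Matrix (Fin n) (Fin n) F := Matrix.of Y₀ with hYdef
  replace hY : ∀ i j, ∀ K : ℤ, ∃ M, ∀ m ≥ M, fabs C (Y i j - y m i j) ≤ (2 : ℝ) ^ (-K) := hY
  have hYm : ∀ m i j, fabs C (Y i j - y m i j) ≤ (1 / 2 : ℝ) ^ m := by
    intro m i j
    obtain ⟨M, hM⟩ := hY i j m
    have h1 := hM (max M m) (le_max_left _ _)
    have h2 := hy3 m (max M m) (le_max_right _ _) i j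
    rw [zpow_neg, zpow_natCast, ← inv_pow, ← one_div] at h1
    have e : Y i j - y m i j = (Y i j - y (max M m) i j) + (y (max M m) - y m) i j := by
      rw [Matrix.sub_apply]; ring
    rw [e]
    exact (fabs_add_le _ _).trans (max_le h1 h2)
  have hY1 : ∀ i j, fabs C (Y i j) ≤ 1 / 2 := by
    intro i j
    have h1 := hYm 1 i j
    have e : Y i j = (Y i j - y 1 i j) + y 1 i j := by ring
    rw [e]
    exact (fabs_add_le _ _).trans (max_le (by simpa using h1) (hy1 1 i j))
  refine ⟨Y, hY1, ?_⟩
  have hfin : ∀ m i j, fabs C ((Y - G Y) i j) ≤ (1 / 2 : ℝ) ^ m := by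
    intro m i j
    have e : Y - G Y = (Y - y (m + 1)) - (G Y - G (y m)) := by rw [hys]; abel
    rw [e]
    refine fabs_matrix_sub_le (fun i j => ?_) (fun i j => ?_) i j
    · refine (hYm (m + 1) i j).trans ?_
      rw [pow_succ]
      have : (0 : ℝ) ≤ (1 / 2) ^ m := by positivity
      linarith
    · have := hG2 Y (y m) (fun i j => (hY1 i j).trans (by norm_num)) (hy1' m) ((1 / 2 : ℝ) ^ m)
        (by positivity) (hYm m) i j
      have h0 : (0 : ℝ) ≤ (1 / 2) ^ m := by positivity
      linarith
  rw [← sub_eq_zero]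
  ext i j
  refine fabs_eq_zero.1 (le_antisymm (ge_of_tendsto' (tendsto_pow_atTop_nhds_zero_of_lt_one
    (by norm_num) (by norm_num : (1 / 2 : ℝ) < 1)) fun m => hfin m i j) (fabs_nonneg _))

end MatrixNorm

section Fitting

open Polynomial in
/-- A power of a square matrix is invertible on a direct factor and zero on a complement. -/
theorem exists_fitting {K : Type*} [Field K] {n : ℕ} (A : Matrix (Fin n) (Fin n) K) :
    ∃ (k : ℕ) (p c : Matrix (Fin n) (Fin n) K), 0 < k ∧ p * p = p ∧ p * A ^ k = A ^ k ∧
      A ^ k * p = A ^ k ∧ c * A ^ k = p ∧ A ^ k * c = p ∧ c * p = c ∧ p * c = c := by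
  obtain ⟨h, hh, hd⟩ := exists_eq_pow_rootMultiplicity_mul_and_not_dvd A.charpoly
    A.charpoly_monic.ne_zero 0
  rw [Polynomial.C_0, sub_zero] at hh hd
  set k := A.charpoly.rootMultiplicity 0 + 1 with hk
  have hcop : IsCoprime (X ^ k) h := ((Polynomial.irreducible_X).coprime_iff_not_dvd.2 hd).pow_left
  obtain ⟨u, w, huw⟩ := hcop
  have hzero : aeval A (X ^ k * h) = 0 := by
    rw [hk, pow_succ', mul_assoc, ← hh, map_mul, Matrix.aeval_self_charpoly, mul_zero]
  have hXk : aeval A ((X : K[X]) ^ k) = A ^ k := by simp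
  have hcomm : ∀ f g : K[X], aeval A f * aeval A g = aeval A g * aeval A f := fun f g => by
    rw [← map_mul, mul_comm, map_mul]
  have h1 : aeval A (u * X ^ k) + aeval A (w * h) = 1 := by rw [← map_add, huw, map_one]
  have h2 : aeval A (w * h) * A ^ k = 0 := by
    rw [← hXk, ← map_mul, show w * h * X ^ k = w * (X ^ k * h) by ring, map_mul, hzero, mul_zero]
  have hp1 : aeval A (u * X ^ k) * A ^ k = A ^ k := by
    have := congrArg (· * A ^ k) h1
    simp only [add_mul, h2, add_zero, one_mul] at this
    exact this
  set p := aeval A (u * X ^ k) with hp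
  have hp2 : A ^ k * p = A ^ k := by rw [← hXk, hp, hcomm, hXk, ← hp, hp1]
  have hu : aeval A u * A ^ k = p := by rw [hp, map_mul, hXk]
  have hpp : p * p = p := by
    conv_lhs => enter [1]; rw [← hu]
    rw [mul_assoc, hp2, hu]
  refine ⟨k, p, aeval A u * p, by omega, hpp, hp1, hp2, ?_, ?_, ?_, ?_⟩
  · rw [mul_assoc, hp1, hu]
  · rw [← mul_assoc, ← hXk, hcomm, hXk, hu, hpp]
  · rw [mul_assoc, hpp]
  · rw [← mul_assoc, hp, hcomm, ← hp, mul_assoc, hpp]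

end Fitting

section Split

variable {C : Type u} [NormedField C] {F : Type w} [Field F] [GrowthField C F] {n : ℕ}
  {V : Type v} [AddCommGroup V] [Module F V]

/-- A subspace of finite dimension that is mapped into itself by a semilinear automorphism is mapped
onto itself. -/
theorem smul_mem_iff_of_forward [FiniteDimensional F V] {τ : F ≃+* F} {z : AAut V}
    (hz : ∀ (f : F) (v : V), z • (f • v) = τ f • (z • v)) {W : Submodule F V}
    (h : ∀ v ∈ W, z • v ∈ W) (v : V) : z • v ∈ W ↔ v ∈ W := by
  refine ⟨fun hv => ?_, h v⟩
  set b := Module.finBasis F W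
  have hli : LinearIndependent F (fun i => (⟨z • (b i : V), h _ (b i).2⟩ : W)) := by
    rw [Fintype.linearIndependent_iff]
    intro g hg
    have h1 : z • ∑ i, τ.symm (g i) • (b i : V) = 0 := by
      rw [Finset.smul_sum]
      have := congrArg (fun w : W => (w : V)) hg
      simp only [AddSubmonoidClass.coe_finsetSum, Submodule.coe_smul, Submodule.coe_zero] at this
      rw [← this]
      refine Finset.sum_congr rfl fun i _ => ?_
      rw [hz, RingEquiv.apply_symm_apply]
    have h2 : ∑ i, τ.symm (g i) • b i = 0 := by
      apply Subtype.ext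
      rw [← smul_zero z] at h1
      simpa using MulAction.injective z h1
    intro i
    have := Fintype.linearIndependent_iff.1 b.linearIndependent _ h2 i
    simpa using this
  have htop := hli.span_eq_top_of_card_eq_finrank' (by simp)
  have hmem : (⟨z • v, hv⟩ : W) ∈ Submodule.span F (Set.range fun i =>
    (⟨z • (b i : V), h _ (b i).2⟩ : W)) := htop ▸ Submodule.mem_top
  obtain ⟨g, hg⟩ := (Submodule.mem_span_range_iff_exists_fun F).1 hmem
  have h1 := congrArg (fun w : W => (w : V)) hg
  simp only [AddSubmonoidClass.coe_finsetSum, Submodule.coe_smul] at h1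
  have h2 : v = ∑ i, τ.symm (g i) • (b i : V) := by
    apply MulAction.injective z
    simp only
    rw [← h1, Finset.smul_sum]
    refine Finset.sum_congr rfl fun i _ => ?_
    rw [hz, RingEquiv.apply_symm_apply]
  rw [h2]
  exact Submodule.sum_mem _ fun i _ => Submodule.smul_mem _ _ (b i).2

variable (C F n) in
/-- The maximum norm on `F^n`. -/
def vabs : (Fin n → F) → ℝ := basisNorm C (Pi.basisFun F (Fin n)) fun _ => 1

theorem vabs_isAdm : IsAdm C F (vabs C F n) := basisNorm_isAdm _ fun _ => one_pos

theorem vabs_le {w : Fin n → F} {s : ℝ} (hs : 0 ≤ s) (h : ∀ i, fabs C (w i) ≤ s) :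
    vabs C F n w ≤ s :=
  basisNorm_le _ _ _ hs fun i => by simpa using h i

theorem fabs_le_vabs (w : Fin n → F) (i : Fin n) : fabs C (w i) ≤ vabs C F n w := by
  simpa [vabs] using le_basisNorm (C := C) (Pi.basisFun F (Fin n)) (fun _ => 1) w i

theorem vabs_mulVec_le {A : Matrix (Fin n) (Fin n) F} {s : ℝ} (hs : 0 ≤ s)
    (h : ∀ i j, fabs C (A i j) ≤ s) (w : Fin n → F) :
    vabs C F n (A.mulVec w) ≤ s * vabs C F n w := by
  have h0 : 0 ≤ s * vabs C F n w := mul_nonneg hs (vabs_isAdm.nonneg w)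
  refine vabs_le h0 fun i => ?_
  rw [Matrix.mulVec, dotProduct]
  refine fabs_sum_le _ _ h0 fun j _ => ?_
  rw [fabs_mul]
  exact mul_le_mul (h i j) (fabs_le_vabs w j) (fabs_nonneg _) hs

theorem vabs_shift {u : Cˣ} {τ : F ≃+* F} (hτ : IsShift u τ) (w : Fin n → F) :
    vabs C F n (τ ∘ w) = vabs C F n w := by
  unfold vabs basisNorm
  refine congrArg _ (funext fun i => ?_)
  simp [fabs_shift u]

theorem vabs_add_eq {w e : Fin n → F} (h : vabs C F n e ≤ 1 / 2 * vabs C F n w) :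
    vabs C F n (w + e) = vabs C F n w := by
  have h0 := (vabs_isAdm (C := C) (F := F)).nonneg w
  apply le_antisymm
  · exact (vabs_isAdm.add_le _ _).trans (max_le le_rfl (by linarith))
  · have h1 := (vabs_isAdm (C := C)).sub_le (w + e) e
    rw [add_sub_cancel_right] at h1
    rcases le_max_iff.1 h1 with h2 | h2
    · exact h2
    · have : vabs C F n w = 0 := by linarith
      rw [this]; exact vabs_isAdm.nonneg _

section Algebra

variable {R : Type*} [Ring R] {p c B E Y Z : R} {σ σ' : R →+* R}

theorem isometric_block (hpp : p * p = p) (hpB : p * B = B) (hBp : B * p = B) (hcB : c * B = p)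
    (hcp : c * p = c) (hσp : σ p = p)
    (hY : Y = (1 - p) * ((1 - p) - Y) * E * (p + σ Y) * c) :
    p * Y = 0 ∧ Y * p = Y ∧ (B + E) * (p + σ Y) = (p + Y) * (p * (B + E) * (p + σ Y)) ∧
      p * (B + E) * (p + σ Y) = B + p * E * (p + σ Y) := by
  have h0 : p * (1 - p) = 0 := by rw [mul_sub, mul_one, hpp, sub_self]
  have hpY : p * Y = 0 := by
    rw [hY]; simp only [← mul_assoc]; rw [h0]; simp only [zero_mul]
  have hYp : Y * p = Y := by
    conv_lhs => rw [hY]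
    rw [mul_assoc, hcp]; exact hY.symm
  have hpσY : p * σ Y = 0 := by
    have := congrArg σ hpY
    rwa [map_mul, hσp, map_zero] at this
  have hBσY : B * σ Y = 0 := by rw [← hBp, mul_assoc, hpσY, mul_zero]
  have hσYp : σ Y * p = σ Y := by
    have := congrArg σ hYp
    rwa [map_mul, hσp] at this
  have hY' : Y = ((1 - p) - Y) * E * (p + σ Y) * c := by
    have e1 : (1 - p) * ((1 - p) - Y) = (1 - p) - Y := by
      have : (1 - p) * ((1 - p) - Y) = 1 - p - p + p * p - Y + p * Y := by noncomm_ring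
      rw [this, hpp, hpY]; noncomm_ring
    rw [e1] at hY; exact hY
  have hYB : Y * B = ((1 - p) - Y) * E * (p + σ Y) := by
    conv_lhs => rw [hY']
    rw [mul_assoc, hcB, mul_assoc _ (p + σ Y) p, add_mul, hpp, hσYp]
  refine ⟨hpY, hYp, ?_, ?_⟩
  · have e1 : (p + Y) * (p * (B + E) * (p + σ Y)) =
        (p * p + Y * p) * (B + E) * (p + σ Y) := by noncomm_ring
    have e2 : (p + Y) * (B + E) * (p + σ Y) = p * B * p + p * (B * σ Y) + p * E * (p + σ Y) +
        Y * (B * p) + Y * (B * σ Y) + Y * E * (p + σ Y) := by noncomm_ring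
    have e3 : (B + E) * (p + σ Y) = B * p + B * σ Y + E * (p + σ Y) := by noncomm_ring
    rw [e1, hpp, hYp, e2, e3, hpB, hBσY, hBp, hYB]
    noncomm_ring
  · have : p * (B + E) * (p + σ Y) = p * B * p + p * (B * σ Y) + p * E * (p + σ Y) := by
      noncomm_ring
    rw [this, hpB, hBp, hBσY, mul_zero, add_zero]

theorem contracting_block (hpp : p * p = p) (hBp : B * p = B) (hBc : B * c = p)
    (hpc : p * c = c) (hσp : σ p = p) (hσc : σ c = c) (hσ : ∀ X, σ (σ' X) = X)
    (hZ : Z = -c * (p - σ' Z) * σ' E * ((1 - p) + Z) * (1 - p)) :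
    p * Z = Z ∧ Z * (1 - p) = Z ∧
      (B + E) * ((1 - p) + σ Z) = ((1 - p) + Z) * ((1 - p) * E * ((1 - p) + σ Z)) := by
  have h1 : (1 - p) * (1 - p) = 1 - p := by
    have : (1 - p) * (1 - p) = 1 - p - p + p * p := by noncomm_ring
    rw [this, hpp]; noncomm_ring
  have hpZ : p * Z = Z := by
    conv_lhs => rw [hZ]
    simp only [← mul_assoc]
    rw [mul_neg, hpc]; exact hZ.symm
  have hZp : Z * (1 - p) = Z := by
    conv_lhs => rw [hZ]
    rw [mul_assoc, h1]; exact hZ.symm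
  have hσZ1 : σ Z * (1 - p) = σ Z := by
    have := congrArg σ hZp
    rwa [map_mul, map_sub, map_one, hσp] at this
  have eσZ : σ Z = c * ((Z - p) * E * ((1 - p) + σ Z)) := by
    have h2 := congrArg σ hZ
    simp only [map_mul, map_sub, map_add, map_one, map_neg, hσ, hσp, hσc] at h2
    have h3 : ((1 - p) + σ Z) * (1 - p) = (1 - p) + σ Z := by rw [add_mul, h1, hσZ1]
    rw [mul_assoc _ _ (1 - p), h3] at h2
    conv_lhs => rw [h2]
    noncomm_ring
  have hBσZ : B * σ Z = (Z - p) * E * ((1 - p) + σ Z) := by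
    have e : p * (Z - p) = Z - p := by rw [mul_sub, hpZ, hpp]
    conv_lhs => rw [eσZ]
    rw [← mul_assoc, hBc]
    simp only [← mul_assoc]
    rw [e]
  have hZp0 : Z * p = 0 := by
    have := hZp
    rwa [mul_sub, mul_one, sub_eq_self] at this
  refine ⟨hpZ, hZp, ?_⟩
  have e1 : (B + E) * ((1 - p) + σ Z) = B - B * p + B * σ Z + E * ((1 - p) + σ Z) := by
    noncomm_ring
  have e2 : ((1 - p) + Z) * ((1 - p) * E * ((1 - p) + σ Z)) =
      ((1 - p) * (1 - p) + (Z * (1 - p))) * E * ((1 - p) + σ Z) := by noncomm_ring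
  rw [e1, e2, h1, hZp, hBp, hBσZ]
  noncomm_ring

end Algebra

/-- A semilinear operator whose reduction has index at most one splits as an isometry and a
contraction. -/
theorem exists_split (b : Module.Basis (Fin n) F V) {u : Cˣ} {τ : F ≃+* F} (hτ : IsShift u τ)
    {z : AAut V} (hz : ∀ (f : F) (v : V), z • (f • v) = τ f • (z • v))
    (B₀ p c : Matrix (Fin n) (Fin n) C) (E : Matrix (Fin n) (Fin n) F)
    (hE : ∀ i j, fabs C (E i j) ≤ 1 / 2)
    (hB : ∀ j, z • b j = ∑ i, (B₀.map (cst F) + E) i j • b i) (hpp : p * p = p)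
    (hpB : p * B₀ = B₀) (hBp : B₀ * p = B₀) (hcB : c * B₀ = p) (hBc : B₀ * c = p)
    (hcp : c * p = c) (hpc : p * c = c) :
    ∃ P Q : Submodule F V, P ⊔ Q = ⊤ ∧ (∀ v ∈ P, z • v ∈ P) ∧ (∀ v ∈ Q, z • v ∈ Q) ∧
      (∀ v ∈ P, basisNorm C b (fun _ => 1) (z • v) = basisNorm C b (fun _ => 1) v) ∧
      ∀ v ∈ Q, basisNorm C b (fun _ => 1) (z • v) ≤ 1 / 2 * basisNorm C b (fun _ => 1) v := by
  have hτ' : IsShift u⁻¹ τ.symm := by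
    refine ⟨fun f => ?_, by rw [Units.val_inv_eq_inv_val, map_inv₀, hτ.ν_eq, inv_one]⟩
    have := hτ.map_shift (τ.symm f)
    rw [RingEquiv.apply_symm_apply] at this
    rw [this, shift_shift, inv_mul_cancel, shift_one]
  have hτ1 : IsShift (1 : Cˣ) (RingEquiv.refl F) :=
    ⟨fun f => by rw [shift_one]; rfl, by rw [Units.val_one, map_one]⟩
  set κ : Matrix (Fin n) (Fin n) C →+* Matrix (Fin n) (Fin n) F := (cst F : C →+* F).mapMatrix with hκ
  set σ : Matrix (Fin n) (Fin n) F →+* Matrix (Fin n) (Fin n) F := (τ : F →+* F).mapMatrix with hσ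
  set σ' : Matrix (Fin n) (Fin n) F →+* Matrix (Fin n) (Fin n) F :=
    (τ.symm : F →+* F).mapMatrix with hσ'
  have hσκ : ∀ A, σ (κ A) = κ A := fun A => by
    ext i j; exact shift_cst u _
  have hκ1 : ∀ A i j, fabs C (κ A i j) ≤ 1 := fun A i j => fabs_cst_le _
  obtain ⟨Y, hY, eY⟩ : ∃ Y : Matrix (Fin n) (Fin n) F, (∀ i j, fabs C (Y i j) ≤ 1 / 2) ∧
      Y = κ (1 - p) * (κ (1 - p) - Y) * E * (κ p + σ Y) * κ c :=
    exists_matrix_fixedPoint hτ1 hτ (1 - p) (1 - p) p c E hE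
  obtain ⟨Z, hZ, eZ⟩ : ∃ Z : Matrix (Fin n) (Fin n) F, (∀ i j, fabs C (Z i j) ≤ 1 / 2) ∧
      Z = κ (-c) * (κ p - σ' Z) * σ' E * (κ (1 - p) + Z) * κ (1 - p) :=
    exists_matrix_fixedPoint hτ' hτ1 (-c) p (1 - p) (1 - p) (E.map τ.symm)
    (fun i j => by rw [Matrix.map_apply, fabs_shift u⁻¹]; exact hE i j)
  rw [map_sub, map_one] at eY eZ
  rw [map_neg] at eZ
  have kpp : κ p * κ p = κ p := by rw [← map_mul, hpp]
  have kpB : κ p * κ B₀ = κ B₀ := by rw [← map_mul, hpB]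
  have kBp : κ B₀ * κ p = κ B₀ := by rw [← map_mul, hBp]
  have kcB : κ c * κ B₀ = κ p := by rw [← map_mul, hcB]
  have kBc : κ B₀ * κ c = κ p := by rw [← map_mul, hBc]
  have kcp : κ c * κ p = κ c := by rw [← map_mul, hcp]
  have kpc : κ p * κ c = κ c := by rw [← map_mul, hpc]
  obtain ⟨hpY, hYp, hS, hD⟩ := isometric_block kpp kpB kBp kcB kcp (hσκ p) eY
  obtain ⟨hpZ, hZp, hS'⟩ := contracting_block (σ := σ) kpp kBp kBc kpc (hσκ p) (hσκ c)
    (fun X => by ext i j; exact τ.apply_symm_apply _) eZ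
  set S := κ p + Y
  set S' := (1 - κ p) + Z
  set D := κ p * (κ B₀ + E) * (κ p + σ Y)
  set D' := (1 - κ p) * E * ((1 - κ p) + σ Z)
  have hσS : σ S = κ p + σ Y := by rw [map_add, hσκ]
  have hσS' : σ S' = (1 - κ p) + σ Z := by rw [map_add, map_sub, map_one, hσκ]
  rw [← hσS] at hS
  rw [← hσS'] at hS'
  have hSp : S * κ p = S := by rw [add_mul, kpp, hYp]
  have hSp' : S' * (1 - κ p) = S' := by
    rw [add_mul, hZp]
    congr 1
    have : (1 - κ p) * (1 - κ p) = 1 - κ p - κ p + κ p * κ p := by noncomm_ring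
    rw [this, kpp]; noncomm_ring
  set e := b.equivFun
  have hN : ∀ v, basisNorm C b (fun _ => 1) v = vabs C F n (e v) := fun v => by
    simp [vabs, basisNorm, e]
  have hze : ∀ w : Fin n → F, z • e.symm w = e.symm ((κ B₀ + E).mulVec (τ ∘ w)) := by
    intro w
    simp only [e, Module.Basis.equivFun_symm_apply, Finset.smul_sum, hz, hB]
    rw [Finset.sum_comm]
    refine Finset.sum_congr rfl fun i _ => ?_
    rw [Matrix.mulVec, dotProduct, Finset.sum_smul]
    refine Finset.sum_congr rfl fun j _ => ?_
    rw [smul_smul, mul_comm]; rfl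
  have hσmul : ∀ (A : Matrix (Fin n) (Fin n) F) (w : Fin n → F),
      τ ∘ (A.mulVec w) = (σ A).mulVec (τ ∘ w) := fun A w => by
    funext i
    simp [Matrix.mulVec, dotProduct, hσ]
  let lin : Matrix (Fin n) (Fin n) F → (Fin n → F) →ₗ[F] V := fun A =>
    e.symm.toLinearMap ∘ₗ A.mulVecLin
  have hlin : ∀ A w, lin A w = e.symm (A.mulVec w) := fun A w => rfl
  have hzS : ∀ w, z • lin S w = lin S (D.mulVec (τ ∘ w)) := fun w => by
    rw [hlin, hlin, hze, hσmul, Matrix.mulVec_mulVec, hS, Matrix.mulVec_mulVec]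
  have hzS' : ∀ w, z • lin S' w = lin S' (D'.mulVec (τ ∘ w)) := fun w => by
    rw [hlin, hlin, hze, hσmul, Matrix.mulVec_mulVec, hS', Matrix.mulVec_mulVec]
  have hmem : ∀ v ∈ LinearMap.range (lin S), ∃ w, (κ p).mulVec w = w ∧ lin S w = v := by
    rintro _ ⟨w, rfl⟩
    exact ⟨(κ p).mulVec w, by rw [Matrix.mulVec_mulVec, kpp],
      by rw [hlin, Matrix.mulVec_mulVec, hSp, hlin]⟩
  have hmem' : ∀ v ∈ LinearMap.range (lin S'), ∃ w, (1 - κ p).mulVec w = w ∧ lin S' w = v := by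
    rintro _ ⟨w, rfl⟩
    exact ⟨(1 - κ p).mulVec w, by
      rw [Matrix.mulVec_mulVec, mul_sub, mul_one, sub_mul, one_mul, kpp, sub_self, sub_zero],
      by rw [hlin, Matrix.mulVec_mulVec, hSp', hlin]⟩
  have hhalf : ∀ {A : Matrix (Fin n) (Fin n) F}, (∀ i j, fabs C (A i j) ≤ 1 / 2) → ∀ w,
      vabs C F n (w + A.mulVec w) = vabs C F n w := fun hA w =>
    vabs_add_eq (vabs_mulVec_le (by norm_num) hA w)
  have hNS : ∀ w, (κ p).mulVec w = w →
      basisNorm C b (fun _ => 1) (lin S w) = vabs C F n w := fun w hw => by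
    rw [hN, hlin, LinearEquiv.apply_symm_apply, Matrix.add_mulVec, hw, hhalf hY]
  have hNS' : ∀ w, (1 - κ p).mulVec w = w →
      basisNorm C b (fun _ => 1) (lin S' w) = vabs C F n w := fun w hw => by
    rw [hN, hlin, LinearEquiv.apply_symm_apply, Matrix.add_mulVec, hw, hhalf hZ]
  have hτp : ∀ {w}, (κ p).mulVec w = w → (κ p).mulVec (τ ∘ w) = τ ∘ w := fun {w} hw => by
    conv_rhs => rw [← hw, hσmul, hσκ]
  have h1κ : ∀ i j, fabs C ((1 - κ p) i j) ≤ 1 := by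
    have := hκ1 (1 - p)
    rwa [map_sub, map_one] at this
  have hσY : ∀ i j, fabs C (σ S i j) ≤ 1 := by
    intro i j
    have : fabs C (σ S i j) = fabs C (S i j) := fabs_shift u _
    rw [this]
    exact fabs_matrix_add_le (hκ1 p) (fun i j => (hY i j).trans (by norm_num)) i j
  have hσZ : ∀ i j, fabs C (σ S' i j) ≤ 1 := by
    intro i j
    have : fabs C (σ S' i j) = fabs C (S' i j) := fabs_shift u _
    rw [this]
    exact fabs_matrix_add_le h1κ (fun i j => (hZ i j).trans (by norm_num)) i j
  have hDiso : ∀ w, (κ p).mulVec w = w → vabs C F n (D.mulVec w) = vabs C F n w := by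
    intro w hw
    have hB1 : vabs C F n ((κ B₀).mulVec w) = vabs C F n w := by
      apply le_antisymm
      · simpa using vabs_mulVec_le zero_le_one (hκ1 B₀) w
      · have := vabs_mulVec_le zero_le_one (hκ1 c) ((κ B₀).mulVec w)
        rwa [Matrix.mulVec_mulVec, kcB, hw, one_mul] at this
    rw [hD, ← hσS, Matrix.add_mulVec, vabs_add_eq, hB1]
    rw [hB1]
    refine vabs_mulVec_le (by norm_num) (fun i j => ?_) w
    have := fabs_matrix_mul_le (by norm_num) zero_le_one (fabs_matrix_mul_le zero_le_one
      (by norm_num) (hκ1 p) hE) hσY i j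
    simpa using this
  refine ⟨LinearMap.range (lin S), LinearMap.range (lin S'), ?_, ?_, ?_, ?_, ?_⟩
  · have hinj : Function.Injective (S + S').mulVecLin := by
      rw [← LinearMap.ker_eq_bot, LinearMap.ker_eq_bot']
      intro w hw
      have e1 : S + S' = 1 + (Y + Z) := by simp only [S, S']; abel
      rw [Matrix.mulVecLin_apply, e1, Matrix.add_mulVec, Matrix.one_mulVec] at hw
      have := hhalf (fabs_matrix_add_le hY hZ) w
      rw [hw, vabs_isAdm.map_zero] at this
      exact vabs_isAdm.eq_zero this.symm
    have hsurj := LinearMap.injective_iff_surjective.1 hinj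
    rw [eq_top_iff]
    intro v _
    obtain ⟨w, hw⟩ := hsurj (e v)
    rw [Matrix.mulVecLin_apply, Matrix.add_mulVec] at hw
    have : v = lin S w + lin S' w := by
      rw [hlin, hlin, ← map_add, hw, LinearEquiv.symm_apply_apply]
    rw [this]
    exact Submodule.add_mem_sup ⟨w, rfl⟩ ⟨w, rfl⟩
  · rintro _ ⟨w, rfl⟩
    rw [hzS]; exact ⟨_, rfl⟩
  · rintro _ ⟨w, rfl⟩
    rw [hzS']; exact ⟨_, rfl⟩
  · intro v hv
    obtain ⟨w, hw, rfl⟩ := hmem v hv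
    have hDp : (κ p).mulVec (D.mulVec (τ ∘ w)) = D.mulVec (τ ∘ w) := by
      rw [Matrix.mulVec_mulVec]
      congr 1
      simp only [D, ← mul_assoc, kpp]
    rw [hzS, hNS _ hDp, hNS _ hw, hDiso _ (hτp hw), vabs_shift hτ]
  · intro v hv
    obtain ⟨w, hw, rfl⟩ := hmem' v hv
    have hDp : (1 - κ p).mulVec (D'.mulVec (τ ∘ w)) = D'.mulVec (τ ∘ w) := by
      rw [Matrix.mulVec_mulVec]
      congr 1
      have : (1 - κ p) * (1 - κ p) = 1 - κ p := by
        rw [mul_sub, mul_one, sub_mul, one_mul, kpp, sub_self, sub_zero]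
      simp only [D', ← mul_assoc, this]
    rw [hzS', hNS' _ hDp, hNS' _ hw, ← vabs_shift hτ w]
    refine vabs_mulVec_le (by norm_num) (fun i j => ?_) _
    have := fabs_matrix_mul_le (by norm_num) zero_le_one (fabs_matrix_mul_le zero_le_one
      (by norm_num) h1κ hE) hσZ i j
    rw [hσS'] at this
    simpa using this

end Split

section Splitting

variable {C : Type u} [NormedField C] {F : Type w} [Field F] [GrowthField C F]

/-- Multiplication by a nonzero scalar as an additive automorphism. -/
def scalarAut (V : Type v) [AddCommGroup V] [Module F V] (f : Fˣ) : AAut V :=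
  Units.map (Module.toAddMonoidEnd F V).toMonoidHom f

theorem scalarAut_smul {V : Type v} [AddCommGroup V] [Module F V] (f : Fˣ) (v : V) :
    scalarAut V f • v = (f : F) • v := rfl

variable (C F) in
/-- The variable, as a unit. -/
def xunit : Fˣ := Units.mk0 (xvar C F) xvar_ne_zero

theorem coe_xunit_zpow (k : ℤ) : ((xunit C F ^ k : Fˣ) : F) = xvar C F ^ k := by
  rw [Units.val_zpow_eq_zpow_val]; rfl

theorem fabs_sub_cst_le {f : F} (h : fabs C f ≤ 1) :
    fabs C (f - cst F ((ι f : LaurentSeries C).coeff 0)) ≤ 1 / 2 := by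
  have h0 : fabs C f ≤ (2 : ℝ) ^ (-(0 : ℤ)) := by simpa using h
  rw [fabs, labs_le_iff] at h0
  have : (1 / 2 : ℝ) = (2 : ℝ) ^ (-(1 : ℤ)) := by norm_num
  rw [this, fabs, labs_le_iff]
  intro k hk
  rw [map_sub, HahnSeries.coeff_sub, ι_cst]
  rcases (show k ≤ 0 by omega).lt_or_eq with h1 | rfl
  · rw [h0 k h1, HahnSeries.coeff_single_of_ne h1.ne, sub_zero]
  · simp

variable (q : Cˣ) {σ : F ≃+* F} [hσ : IsShift q σ]
include hσ

theorem isShift_zpow (k : ℤ) : IsShift (q ^ k) (σ ^ k : RingAut F) :=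
  ⟨fun f => ι_sig q k f, ν_zpow hσ.ν_eq k⟩

theorem xphi_zpow (M : QDiffModule.{w, v} F σ) (r d : ℤ) (j : ℤ) :
    ∃ f : F, fabs C f = (2 : ℝ) ^ (-(r * j)) ∧ ∀ v : M.carrier,
      (scalarAut M.carrier (xunit C F ^ r) * phi M ^ d) ^ j • v = f • (phi M ^ (d * j) • v) := by
  set z := scalarAut M.carrier (xunit C F ^ r) * phi M ^ d with hz
  have hz1 : ∀ v : M.carrier, z • v = xvar C F ^ r • (phi M ^ d • v) := fun v => by
    rw [hz, mul_smul, scalarAut_smul, coe_xunit_zpow]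
  induction j using Int.induction_on with
  | zero => exact ⟨1, by simp, by simp⟩
  | succ j ih =>
    obtain ⟨f, hf, h⟩ := ih
    refine ⟨f * (σ ^ (d * j) : RingAut F) (xvar C F ^ r), ?_, fun v => ?_⟩
    · rw [fabs_mul, hf, fabs_sig q, fabs_xvar_zpow, ← zpow_add₀ two_ne_zero]; congr 1; ring
    · rw [zpow_add_one, mul_smul, h, hz1, phi_zpow_smul_sig q, ← mul_smul, ← mul_smul, ← zpow_add]
      congr 3; ring
  | pred j ih =>
    obtain ⟨f, hf, h⟩ := ih
    refine ⟨f * (σ ^ (d * (-(j : ℤ) - 1)) : RingAut F) (xvar C F ^ (-r)), ?_, fun v => ?_⟩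
    · rw [fabs_mul, hf, fabs_sig q, fabs_xvar_zpow, ← zpow_add₀ two_ne_zero]; congr 1; ring
    · have h1 : z⁻¹ • v = phi M ^ (-d) • (xvar C F ^ (-r) • v) := by
        rw [inv_smul_eq_iff, hz1, ← mul_smul (phi M ^ d), ← zpow_add, add_neg_cancel, zpow_zero,
          one_smul, smul_smul, ← zpow_add₀ xvar_ne_zero, add_neg_cancel, zpow_zero, one_smul]
      rw [zpow_sub_one, mul_smul, h, h1, ← mul_smul (phi M ^ (d * -(j : ℤ))), ← zpow_add,
        phi_zpow_smul_sig q, smul_smul]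
      congr 3
      · congr 2; ring
      · ring

theorem xphi_smul (M : QDiffModule.{w, v} F σ) (r d : ℤ) (f : F) (v : M.carrier) :
    (scalarAut M.carrier (xunit C F ^ r) * phi M ^ d) • (f • v) =
      (σ ^ d : RingAut F) f • ((scalarAut M.carrier (xunit C F ^ r) * phi M ^ d) • v) := by
  rw [mul_smul, mul_smul, scalarAut_smul, scalarAut_smul, phi_zpow_smul_sig q, smul_comm]

omit hσ in
theorem smul_pow_semilinear {V : Type v} [AddCommGroup V] [Module F V] {z : AAut V} {τ : RingAut F}
    (h : ∀ (f : F) (v : V), z • (f • v) = τ f • (z • v)) (k : ℕ) (f : F) (v : V) :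
    z ^ k • (f • v) = (τ ^ k : RingAut F) f • (z ^ k • v) := by
  induction k generalizing f v with
  | zero => simp
  | succ k ih => rw [pow_succ, pow_succ, mul_smul, h, ih, mul_smul, RingAut.mul_apply]

omit hσ in
/-- The reduction of the powers of an integral semilinear operator. -/
theorem exists_residue {V : Type v} [AddCommGroup V] [Module F V] {n : ℕ}
    (b : Module.Basis (Fin n) F V) {u : Cˣ} {τ : F ≃+* F} (hτ : IsShift u τ) {z : AAut V}
    (hz : ∀ (f : F) (v : V), z • (f • v) = τ f • (z • v))
    (hint : ∀ i j, fabs C (b.repr (z • b j) i) ≤ 1) :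
    ∃ A₀ : Matrix (Fin n) (Fin n) C, ∀ k : ℕ, ∃ E : Matrix (Fin n) (Fin n) F,
      (∀ i j, fabs C (E i j) ≤ 1 / 2) ∧
      ∀ j, z ^ k • b j = ∑ i, ((A₀ ^ k).map (cst F) + E) i j • b i := by
  set A : Matrix (Fin n) (Fin n) F := Matrix.of fun i j => b.repr (z • b j) i with hA
  have hA1 : ∀ i j, fabs C (A i j) ≤ 1 := hint
  have hzb : ∀ j, z • b j = ∑ i, A i j • b i := fun j => (b.sum_repr _).symm
  set A₀ : Matrix (Fin n) (Fin n) C := Matrix.of fun i j => (ι (A i j) : LaurentSeries C).coeff 0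
  have hE : ∀ i j, fabs C ((A - A₀.map (cst F)) i j) ≤ 1 / 2 := fun i j => fabs_sub_cst_le (hA1 i j)
  refine ⟨A₀, fun k => ?_⟩
  induction k with
  | zero =>
    refine ⟨0, by simp, fun j => ?_⟩
    rw [Finset.sum_eq_single j]
    · simp
    · intro i _ hij
      simp [Matrix.one_apply_ne hij]
    · simp
  | succ k ih =>
    obtain ⟨E, hE1, hEk⟩ := ih
    refine ⟨(A - A₀.map (cst F)) * (A₀ ^ k).map (cst F) + A * E.map τ, ?_, fun j => ?_⟩
    · refine fabs_matrix_add_le (fun i j => ?_) (fun i j => ?_)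
      · have := fabs_matrix_mul_le (by norm_num) zero_le_one hE
          (fun i j => fabs_cst_le ((A₀ ^ k) i j)) i j
        rw [mul_one] at this; exact this
      · have hEτ : ∀ i j, fabs C (E.map τ i j) ≤ 1 / 2 := fun i j => by
          rw [Matrix.map_apply, fabs_shift u]; exact hE1 i j
        have := fabs_matrix_mul_le zero_le_one (by norm_num) hA1 hEτ i j
        rwa [one_mul] at this
    · have e : (A₀ ^ (k + 1)).map (cst F) +
          ((A - A₀.map (cst F)) * (A₀ ^ k).map (cst F) + A * E.map τ) =
          A * ((A₀ ^ k).map (cst F) + E).map τ := by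
        have h1 : ((A₀ ^ k).map (cst F) + E).map τ = (A₀ ^ k).map (cst F) + E.map τ := by
          ext i j; simp [shift_cst u]
        rw [h1, pow_succ', Matrix.map_mul]; noncomm_ring
      rw [e, pow_succ', mul_smul, hEk, Finset.smul_sum]
      simp only [hz, hzb, Finset.smul_sum, Matrix.mul_apply, Finset.sum_smul]
      rw [Finset.sum_comm]
      refine Finset.sum_congr rfl fun i _ => Finset.sum_congr rfl fun l _ => ?_
      rw [smul_smul, mul_comm]; rfl

omit [NormedField C] [GrowthField C F] hσ in
theorem exists_relation (M : QDiffModule.{w, v} F σ) {n : ℕ} (b : Module.Basis (Fin n) F M.carrier)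
    {m : M.carrier} (hb : ∀ i, b i = phi M ^ (i : ℕ) • m) :
    ∃ a : Fin (n + 1) → F, a (Fin.last n) ≠ 0 ∧ ∑ i, a i • (phi M ^ (i : ℕ) • m) = 0 := by
  refine ⟨Fin.snoc (α := fun _ => F) (fun i => -b.repr (phi M ^ n • m) i) 1, by simp, ?_⟩
  rw [Fin.sum_univ_castSucc]
  simp only [Fin.snoc_castSucc, Fin.snoc_last, Fin.val_castSucc, Fin.val_last, one_smul,
    neg_smul, Finset.sum_neg_distrib, ← hb]
  rw [b.sum_repr, neg_add_cancel]

/-- The vectors `v` with `Φ^(ek) v = O(2^(tk))` for natural numbers `k`. -/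
def forwardPart (M : QDiffModule.{w, v} F σ) (e : ℕ) (t : ℝ) : Submodule F M.carrier where
  carrier := {v | ∃ D : ℝ, ∀ k : ℕ, stdNorm C F M.carrier (phi M ^ ((e * k : ℕ) : ℤ) • v) ≤
    D * (2 : ℝ) ^ (t * k)}
  zero_mem' := ⟨0, fun k => by simp [(stdNorm_isAdm (C := C) (F := F) (V := M.carrier)).map_zero]⟩
  add_mem' := by
    rintro v w ⟨D, h⟩ ⟨D', h'⟩
    refine ⟨max D D', fun k => ?_⟩
    rw [smul_add, max_mul_of_nonneg _ _ (by positivity)]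
    exact (stdNorm_isAdm.add_le _ _).trans (max_le_max (h k) (h' k))
  smul_mem' := by
    rintro f v ⟨D, h⟩
    refine ⟨fabs C f * D, fun k => ?_⟩
    rw [adm_phi_smul q M stdNorm_isAdm, mul_assoc]
    exact mul_le_mul_of_nonneg_left (h k) (fabs_nonneg _)

theorem exists_phi_bound (M : QDiffModule.{w, v} F σ) {N : M.carrier → ℝ} (hN : IsAdm C F N)
    (j : ℤ) : ∃ D : ℝ, 0 < D ∧ ∀ v, N (phi M ^ j • v) ≤ D * N v :=
  hN.exists_bound hN (DistribSMul.toAddMonoidHom M.carrier (phi M ^ j)) fun f v => by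
    obtain ⟨g, -, hg, e⟩ := phi_zpow_exists q M j f v
    exact ⟨g, hg, e⟩

theorem forwardPart_stable (M : QDiffModule.{w, v} F σ) (e : ℕ) (t : ℝ) :
    M.IsStable (forwardPart q M e t) := by
  have key : ∀ (j : ℤ) v, v ∈ forwardPart q M e t → phi M ^ j • v ∈ forwardPart q M e t := by
    rintro j v ⟨D, h⟩
    obtain ⟨D', hD', h'⟩ := exists_phi_bound q M (stdNorm_isAdm (C := C)) j
    refine ⟨D' * D, fun k => ?_⟩
    rw [← mul_smul, ← zpow_add, add_comm, zpow_add, mul_smul, mul_assoc]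
    exact (h' _).trans (mul_le_mul_of_nonneg_left (h k) hD'.le)
  intro v
  constructor
  · intro h
    have := key (-1) _ h
    rwa [← phi_smul, zpow_neg_one, inv_smul_smul] at this
  · intro h
    have := key 1 _ h
    rwa [zpow_one] at this

/-- The slope parts of a module span it. -/
theorem slopePart_iSup (hroot : ∀ n : ℕ, 0 < n → q ^ n ≠ 1) (M : QDiffModule.{w, v} F σ) :
    ⨆ μ : ℚ, slopePart q M (μ : ℝ) = ⊤ := by
  induction hn : Module.finrank F M.carrier using Nat.strong_induction_on generalizing M with
  | _ n ih =>
  rcases Nat.eq_zero_or_pos n with rfl | hpos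
  · have := Module.finrank_zero_iff.1 hn
    exact Subsingleton.elim _ _
  obtain ⟨m, hm⟩ := exists_cyclic q hroot M
  rw [hn] at hm
  set b := basisOfLinearIndependentOfCardEqFinrank' _ hm (by simp [hn]) with hb
  have hbi : ∀ i, b i = phi M ^ (i : ℕ) • m := fun i => by
    rw [hb, coe_basisOfLinearIndependentOfCardEqFinrank']
  obtain ⟨a, han, ha⟩ := exists_relation M b hbi
  have ha0 := coeff_zero_ne_zero q M b hbi han ha hpos
  obtain ⟨s, hs, i₀, hi₀, hsi⟩ := exists_last_slope (C := C) a han ha0 hpos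
  -- a lattice preserved by `x^r Φ^d`
  set N := basisNorm C b (fun i => (2 : ℝ) ^ ((s : ℝ) * (i : ℕ))) with hNdef
  have hN : IsAdm C F N := basisNorm_isAdm b fun i => by positivity
  have hNΦ : ∀ v, N (M.Φ v) ≤ (2 : ℝ) ^ (s : ℝ) * N v := basisNorm_Φ_le q M b hbi han ha hs
  set r : ℤ := s.num
  set d : ℕ := s.den
  have hd : 0 < d := s.den_pos
  have hsd : (s : ℝ) * d = r := by exact_mod_cast Rat.mul_den_eq_num s
  have hNd : ∀ (k : ℕ) v, N (phi M ^ k • v) ≤ (2 : ℝ) ^ ((s : ℝ) * k) * N v := by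
    intro k
    induction k with
    | zero => simp
    | succ k ih =>
      intro v
      rw [pow_succ', mul_smul, phi_smul]
      refine (hNΦ _).trans ((mul_le_mul_of_nonneg_left (ih v) (by positivity)).trans_eq ?_)
      rw [← mul_assoc, ← Real.rpow_add two_pos]; congr 2; push_cast; ring
  set ψ : AAut M.carrier := scalarAut M.carrier (xunit C F ^ r) * phi M ^ (d : ℤ) with hψ
  have hNψ : ∀ v, N (ψ • v) ≤ N v := by
    intro v
    rw [hψ, mul_smul, scalarAut_smul, coe_xunit_zpow, hN.smul, fabs_xvar_zpow, zpow_natCast]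
    refine (mul_le_mul_of_nonneg_left (hNd d v) (by positivity)).trans_eq ?_
    rw [hsd, Real.rpow_intCast, ← mul_assoc, ← zpow_add₀ two_ne_zero]; simp
  let k : Fin n → ℤ := fun i => ⌈(s : ℝ) * (i : ℕ)⌉
  set b' := b.unitsSMul fun i => xunit C F ^ k i with hb'
  set N₀ := basisNorm C b' (fun _ => 1) with hN₀def
  have hN₀ : IsAdm C F N₀ := basisNorm_isAdm b' fun _ => one_pos
  have hrepr : ∀ v i, b'.repr v i = xvar C F ^ (-k i) * b.repr v i := by
    intro v i
    rw [hb', Module.Basis.repr_unitsSMul, ← zpow_neg, Units.smul_def, coe_xunit_zpow, smul_eq_mul]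
  have hle : ∀ v, N v ≤ 1 ↔ N₀ v ≤ 1 := by
    intro v
    have key : ∀ i, fabs C (b.repr v i) * (2 : ℝ) ^ ((s : ℝ) * (i : ℕ)) ≤ 1 ↔
        fabs C (b'.repr v i) * 1 ≤ 1 := by
      intro i
      by_cases h0 : b.repr v i = 0
      · rw [hrepr, h0]; simp
      obtain ⟨o, ho⟩ := exists_fabs_eq (C := C) h0
      rw [hrepr, fabs_mul, fabs_xvar_zpow, ho, neg_neg, ← Real.rpow_intCast, ← Real.rpow_intCast,
        ← Real.rpow_add two_pos, mul_one, ← Real.rpow_add two_pos]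
      have h1 : (1 : ℝ) = (2 : ℝ) ^ (0 : ℝ) := by simp
      rw [h1, Real.rpow_le_rpow_left_iff one_lt_two, Real.rpow_le_rpow_left_iff one_lt_two]
      have h2 : ∀ t : ℝ, (o : ℝ) + t ≤ 0 ↔ t ≤ ((-o : ℤ) : ℝ) := fun t => by
        push_cast; constructor <;> intro h <;> linarith
      rw [add_comm ((k i : ℤ) : ℝ), h2, h2, ← Int.ceil_le, Int.cast_le]
    constructor
    · intro h
      exact basisNorm_le _ _ _ zero_le_one fun i => (key i).1
        ((le_basisNorm (C := C) b (fun i => (2 : ℝ) ^ ((s : ℝ) * (i : ℕ))) v i).trans h)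
    · intro h
      exact basisNorm_le _ _ _ zero_le_one fun i => (key i).2
        ((le_basisNorm (C := C) b' (fun _ => 1) v i).trans h)
  have hint : ∀ i j, fabs C (b'.repr (ψ • b' j) i) ≤ 1 := by
    intro i j
    have h1 : N₀ (b' j) ≤ 1 := by
      refine basisNorm_le _ _ _ zero_le_one fun i => ?_
      rw [Module.Basis.repr_self, Finsupp.single_apply]
      split_ifs <;> simp
    have h2 := (hle _).1 ((hNψ _).trans ((hle _).2 h1))
    have h3 := le_basisNorm (C := C) b' (fun _ => 1) (ψ • b' j) i
    rw [mul_one] at h3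
    exact h3.trans h2
  obtain ⟨A₀, hA₀⟩ := exists_residue b' (isShift_zpow q (σ := σ) d) (xphi_smul q M r d) hint
  obtain ⟨K, p, c, hK, hpp, hpB, hBp, hcB, hBc, hcp, hpc⟩ := exists_fitting A₀
  obtain ⟨E, hE, hEb⟩ := hA₀ K
  have hsemi := smul_pow_semilinear (xphi_smul q M r d) K
  have hshift : IsShift (q ^ ((d * K : ℕ) : ℤ)) ((σ ^ (d : ℤ)) ^ K : RingAut F) := by
    have := isShift_zpow q (σ := σ) ((d * K : ℕ) : ℤ)
    rwa [Nat.cast_mul, zpow_mul σ, zpow_natCast _ K, ← Nat.cast_mul] at this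
  obtain ⟨P, Q, hPQ, hP, hQ, hPN, hQN⟩ := exists_split b' hshift hsemi (A₀ ^ K) p c E hE hEb hpp hpB
    hBp hcB hBc hcp hpc
  set e : ℕ := d * K with he
  have hepos : 0 < e := Nat.mul_pos hd hK
  have hse : (s : ℝ) * e = r * K := by rw [he]; push_cast; rw [← mul_assoc, hsd]
  have hzj : ∀ (j : ℤ) v, N₀ ((ψ ^ K) ^ j • v) =
      (2 : ℝ) ^ (-((s : ℝ) * e * j)) * N₀ (phi M ^ ((e : ℤ) * j) • v) := by
    intro j v
    obtain ⟨f, hf, h⟩ := xphi_zpow (C := C) q M r d (K * j)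
    rw [← zpow_natCast, ← zpow_mul, h, hN₀.smul, hf, ← Real.rpow_intCast, ← mul_assoc (d : ℤ), he,
      hse]
    push_cast; congr 2; ring
  -- the isometric part has slope `s`
  have hPs : P ≤ slopePart q M (s : ℝ) := by
    intro v hv
    have hPiff := smul_mem_iff_of_forward hsemi hP
    have hPj : ∀ j : ℤ, (ψ ^ K) ^ j • v ∈ P ∧ N₀ ((ψ ^ K) ^ j • v) = N₀ v := by
      intro j
      induction j using Int.induction_on with
      | zero => simpa using hv
      | succ j ih =>
        rw [add_comm, zpow_one_add, mul_smul]
        exact ⟨hP _ ih.1, (hPN _ ih.1).trans ih.2⟩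
      | pred j ih =>
        have e1 : (ψ ^ K) • (ψ ^ K) ^ (-(j : ℤ) - 1) • v = (ψ ^ K) ^ (-(j : ℤ)) • v := by
          rw [← mul_smul, ← zpow_one_add]; congr 2; ring
        have h1 : (ψ ^ K) ^ (-(j : ℤ) - 1) • v ∈ P := by
          rw [← hPiff, e1]; exact ih.1
        exact ⟨h1, by rw [← ih.2, ← e1]; exact (hPN _ h1).symm⟩
    rw [mem_slopePart_iff q hN₀]
    choose D hD0 hD using fun j : ℕ => exists_phi_bound q M hN₀ (j : ℤ)
    refine ⟨∑ i ∈ Finset.range e, D i * (2 : ℝ) ^ (-((s : ℝ) * i)) * N₀ v, fun k => ?_⟩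
    have hmod : ((k % e).toNat : ℤ) = k % e := Int.toNat_of_nonneg (Int.emod_nonneg _ (by omega))
    have hk : k = ((k % e).toNat : ℤ) + e * (k / e) := by
      rw [hmod]; exact (Int.emod_add_mul_ediv k e).symm
    set i := (k % e).toNat with hi
    have hie : i < e := by
      have := Int.emod_lt_of_pos k (by omega : (0 : ℤ) < e)
      omega
    have h1 := hzj (k / e) v
    rw [(hPj _).2] at h1
    have h2 : N₀ (phi M ^ ((e : ℤ) * (k / e)) • v) =
        (2 : ℝ) ^ ((s : ℝ) * e * ((k / e : ℤ) : ℝ)) * N₀ v := by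
      rw [h1, ← mul_assoc, ← Real.rpow_add two_pos, add_neg_cancel, Real.rpow_zero, one_mul]
    have h3 : N₀ (phi M ^ k • v) ≤ (D i * (2 : ℝ) ^ (-((s : ℝ) * i)) * N₀ v) * (2 : ℝ) ^ ((s : ℝ) * k) := by
      conv_lhs => rw [hk, zpow_add, mul_smul]
      refine (hD i _).trans_eq ?_
      rw [h2]
      have : (2 : ℝ) ^ ((s : ℝ) * k) = (2 : ℝ) ^ ((s : ℝ) * i) *
          (2 : ℝ) ^ ((s : ℝ) * e * ((k / e : ℤ) : ℝ)) := by
        rw [← Real.rpow_add two_pos]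
        congr 1
        have : (k : ℝ) = (i : ℝ) + e * ((k / e : ℤ) : ℝ) := by exact_mod_cast hk
        conv_lhs => rw [this]
        ring
      have h4 : (2 : ℝ) ^ (-((s : ℝ) * i)) * (2 : ℝ) ^ ((s : ℝ) * i) = 1 := by
        rw [← Real.rpow_add two_pos]; simp
      rw [this]
      linear_combination (-(D i * N₀ v * (2 : ℝ) ^ ((s : ℝ) * e * ((k / e : ℤ) : ℝ)))) * h4
    refine h3.trans (mul_le_mul_of_nonneg_right ?_ (by positivity))
    exact Finset.single_le_sum (f := fun i : ℕ => D i * (2 : ℝ) ^ (-((s : ℝ) * i)) * N₀ v)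
      (fun j _ => mul_nonneg (mul_nonneg (hD0 j).le (by positivity)) (hN₀.nonneg v))
      (Finset.mem_range.2 hie)
  -- the contracted part
  set Q' := forwardPart q M e ((s : ℝ) * e - 1) with hQ'
  obtain ⟨D₁, hD₁, hb₁⟩ := hN₀.exists_bound_linear (stdNorm_isAdm (C := C) (F := F) (V := M.carrier))
    LinearMap.id
  have hQQ' : Q ≤ Q' := by
    intro v hv
    have h1 : ∀ k : ℕ, (ψ ^ K) ^ k • v ∈ Q ∧ N₀ ((ψ ^ K) ^ k • v) ≤ (1 / 2 : ℝ) ^ k * N₀ v := by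
      intro k
      induction k with
      | zero => simpa using hv
      | succ k ih =>
        rw [pow_succ', mul_smul]
        refine ⟨hQ _ ih.1, (hQN _ ih.1).trans ?_⟩
        rw [pow_succ', mul_assoc]
        exact mul_le_mul_of_nonneg_left ih.2 (by norm_num)
    refine ⟨D₁ * N₀ v, fun k => ?_⟩
    have h2 := (h1 k).2
    have h3 := hzj k v
    rw [zpow_natCast] at h3
    rw [h3] at h2
    refine (hb₁ _).trans ((mul_le_mul_of_nonneg_left ?_ hD₁.le).trans_eq (mul_assoc _ _ _).symm)
    have h5 : (2 : ℝ) ^ (((s : ℝ) * e - 1) * k) = (1 / 2 : ℝ) ^ k * (2 : ℝ) ^ ((s : ℝ) * e * k) := by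
      rw [one_div, inv_pow, ← Real.rpow_natCast, ← Real.rpow_neg two_pos.le,
        ← Real.rpow_add two_pos]; congr 1; ring
    rw [h5, ← mul_assoc, mul_comm (N₀ v)]
    rw [Real.rpow_neg two_pos.le, inv_mul_le_iff₀ (by positivity)] at h2
    rw [Nat.cast_mul]
    refine h2.trans_eq ?_
    rw [Int.cast_natCast]
    ring
  have hmQ : m ∉ Q' := by
    rintro ⟨D, hD⟩
    obtain ⟨D₂, hD₂, hb₂⟩ := (stdNorm_isAdm (C := C) (F := F) (V := M.carrier)).exists_bound_linear hN
      LinearMap.id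
    have h1 : ∀ k : ℕ, (2 : ℝ) ^ k ≤ D₂ * D := by
      intro k
      obtain ⟨i, hi⟩ := initial_form q M b hbi han ha (c := fabs C (a (Fin.last n)) *
        (2 : ℝ) ^ ((s : ℝ) * n)) (mul_pos (fabs_pos han) (by positivity)) hs hi₀ hsi
        (by rw [Fin.val_last]) ((e * k : ℕ) : ℤ)
      have h2 := hi.trans ((le_basisNorm (C := C) b (fun i => (2 : ℝ) ^ ((s : ℝ) * (i : ℕ)))
        (phi M ^ ((e * k : ℕ) : ℤ) • m) i).trans ((hb₂ _).trans
        (mul_le_mul_of_nonneg_left (hD k) hD₂.le)))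
      have h5 : (2 : ℝ) ^ ((s : ℝ) * (((e * k : ℕ) : ℤ) : ℝ)) =
          (2 : ℝ) ^ k * (2 : ℝ) ^ (((s : ℝ) * e - 1) * k) := by
        rw [← Real.rpow_natCast, ← Real.rpow_add two_pos]; congr 1; push_cast; ring
      rw [h5, ← mul_assoc] at h2
      exact le_of_mul_le_mul_right h2 (by positivity)
    obtain ⟨k, hk⟩ := pow_unbounded_of_one_lt (D₂ * D) one_lt_two
    exact absurd (h1 k) (not_le.2 hk)
  have hlt : Module.finrank F Q' < n := by
    rw [← hn]
    exact Submodule.finrank_lt (fun h => hmQ (h ▸ Submodule.mem_top))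
  have hst : M.IsStable Q' := forwardPart_stable q M e _
  have hind := ih _ hlt (M.sub Q' hst) rfl
  have hQ'le : Q' ≤ ⨆ μ : ℚ, slopePart q M (μ : ℝ) := by
    have h1 : (⊤ : Submodule F (M.sub Q' hst).carrier).map (QDiffModule.lin (subIncl M hst)) = Q' :=
      (Submodule.map_top _).trans Q'.range_subtype
    rw [← h1, ← hind, Submodule.map_iSup]
    refine iSup_mono fun μ => ?_
    rintro _ ⟨v, hv, rfl⟩
    exact slopePart_map q _ _ hv
  rw [eq_top_iff, ← hPQ]
  exact sup_le (hPs.trans (le_iSup (fun μ : ℚ => slopePart q M (μ : ℝ)) s)) (hQQ'.trans hQ'le)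

end Splitting

section LaurentPoly

variable {C : Type u} [NormedField C] (F : Type w) [Field F] [GrowthField C F]
  {V : Type v} [AddCommGroup V] [Module F V]

/-- Laurent polynomials as elements of `F`. -/
def polyF : AddMonoidAlgebra C ℤ →+* F :=
  AddMonoidAlgebra.liftNCRingHom (cst F) ((Units.coeHom F).comp (zpowersHom Fˣ (xunit C F)))
    fun _ _ => Commute.all _ _

theorem polyF_single (k : ℤ) (c : C) :
    polyF F (AddMonoidAlgebra.single k c) = cst F c * xvar C F ^ k := by
  rw [polyF, AddMonoidAlgebra.liftNCRingHom_single, ← coe_xunit_zpow]; rfl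

variable (C) in
/-- Laurent polynomials as Laurent series. -/
abbrev laur : AddMonoidAlgebra C ℤ →+* LaurentSeries C := polyF (LaurentSeries C)

theorem laur_single (k : ℤ) (c : C) :
    laur C (AddMonoidAlgebra.single k c) = HahnSeries.single k c := by
  rw [laur, polyF_single]
  exact ι_cst_mul_xvar_zpow (F := LaurentSeries C) c k

theorem ι_polyF (P : AddMonoidAlgebra C ℤ) : ι (polyF F P) = laur C P := by
  induction P using AddMonoidAlgebra.induction_linear with
  | zero => simp
  | add P Q hP hQ => rw [map_add, map_add, hP, hQ, map_add]
  | single k c => rw [polyF_single, ι_cst_mul_xvar_zpow, laur_single]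

theorem coeff_laur (P : AddMonoidAlgebra C ℤ) (k : ℤ) : (laur C P).coeff k = P.coeff k := by
  induction P using AddMonoidAlgebra.induction_linear with
  | zero => simp
  | add P Q hP hQ => rw [map_add, HahnSeries.coeff_add, hP, hQ]; simp
  | single j c =>
    rw [laur_single, AddMonoidAlgebra.coeff_single, Finsupp.single_apply, HahnSeries.coeff_single]
    split_ifs <;> simp_all

/-- Truncation of a Laurent series. -/
def trunc (f : LaurentSeries C) (K : ℤ) : AddMonoidAlgebra C ℤ :=
  ∑ k ∈ Finset.Ico f.order K, AddMonoidAlgebra.single k (f.coeff k)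

theorem labs_sub_trunc_le (f : LaurentSeries C) (K : ℤ) :
    labs (f - laur C (trunc f K)) ≤ (2 : ℝ) ^ (-K) := by
  rw [labs_le_iff]
  intro k hk
  rw [HahnSeries.coeff_sub, trunc, map_sum, HahnSeries.coeff_sum]
  simp only [laur_single]
  by_cases h : f.order ≤ k
  · rw [Finset.sum_eq_single k]
    · simp
    · intro j _ hj
      rw [HahnSeries.coeff_single_of_ne hj.symm]
    · simp [h, hk]
  · push Not at h
    rw [HahnSeries.coeff_eq_zero_of_lt_order h, zero_sub, neg_eq_zero]
    refine Finset.sum_eq_zero fun j hj => ?_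
    rw [HahnSeries.coeff_single_of_ne]
    rintro rfl
    exact absurd (Finset.mem_Ico.1 hj).1 (not_le.2 h)

theorem exists_approx (f : LaurentSeries C) {δ : ℝ} (hδ : 0 < δ) {B B' ε : ℝ} (hB : 0 ≤ B)
    (hB' : 0 ≤ B') (hε : 0 < ε) : ∃ P, labs (f - laur C P) * B ≤ ε ∧
      labs (f - laur C P) ^ δ * B' ≤ ε ∧ labs (f - laur C P) ≤ ε := by
  obtain ⟨k, hk⟩ := exists_pow_lt_of_lt_one (show 0 < min (min (ε / (B + 1)) ε) ((ε / (B' + 1)) ^ δ⁻¹)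
    by positivity) (by norm_num : (1 / 2 : ℝ) < 1)
  have h1 := labs_sub_trunc_le f k
  rw [zpow_neg, zpow_natCast, ← inv_pow, ← one_div] at h1
  have h2 := h1.trans hk.le
  rw [le_min_iff, le_min_iff] at h2
  have h0 := labs_nonneg (f - laur C (trunc f k))
  refine ⟨trunc f k, ?_, ?_, h2.1.2⟩
  · have := h2.1.1
    rw [le_div_iff₀ (by positivity)] at this
    nlinarith
  · have h3 : labs (f - laur C (trunc f k)) ^ δ ≤ ε / (B' + 1) := by
      refine (Real.rpow_le_rpow h0 h2.2 hδ.le).trans_eq ?_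
      rw [← Real.rpow_mul (by positivity), inv_mul_cancel₀ hδ.ne', Real.rpow_one]
    rw [le_div_iff₀ (by positivity)] at h3
    have : 0 ≤ labs (f - laur C (trunc f k)) ^ δ := by positivity
    nlinarith

/-- The action of Laurent polynomials through an automorphism. -/
def act (z : AAut V) : AddMonoidAlgebra C ℤ →+ AddMonoid.End V :=
  AddMonoidAlgebra.liftNC ((Module.toAddMonoidEnd F V).comp (cst F : C →+* F)).toAddMonoidHom
    fun k => ((z ^ k.toAdd : AAut V) : AddMonoid.End V)

theorem act_single (z : AAut V) (k : ℤ) (c : C) (v : V) :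
    act F z (AddMonoidAlgebra.single k c) v = cst F c • (z ^ k • v) := by
  rw [act, AddMonoidAlgebra.liftNC_single]; rfl

theorem act_add (z : AAut V) (P Q : AddMonoidAlgebra C ℤ) (v : V) :
    act F z (P + Q) v = act F z P v + act F z Q v := by rw [map_add]; rfl

theorem act_sub (z : AAut V) (P Q : AddMonoidAlgebra C ℤ) (v : V) :
    act F z (P - Q) v = act F z P v - act F z Q v := by rw [map_sub]; rfl

theorem act_sum {α : Type*} (z : AAut V) (s : Finset α) (P : α → AddMonoidAlgebra C ℤ) (v : V) :
    act F z (∑ i ∈ s, P i) v = ∑ i ∈ s, act F z (P i) v := by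
  rw [map_sum]
  exact map_sum (AddMonoidHom.eval v : (V →+ V) →+ V) _ _

theorem act_eq_sum (z : AAut V) (P : AddMonoidAlgebra C ℤ) (v : V) :
    act F z P v = ∑ k ∈ P.coeff.support, cst F (P.coeff k) • (z ^ k • v) := by
  conv_lhs => rw [← AddMonoidAlgebra.sum_coeff_single P]
  rw [Finsupp.sum, act_sum]
  exact Finset.sum_congr rfl fun k _ => act_single F z k _ v

theorem act_map {F' : Type*} [Field F'] [GrowthField C F'] {W : Type*} [AddCommGroup W]
    [Module F' W] {z : AAut V} {z' : AAut W} (g : V →+ W)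
    (hc : ∀ (c : C) v, g (cst F c • v) = cst F' c • g v) (hz : ∀ v, g (z • v) = z' • g v)
    (P : AddMonoidAlgebra C ℤ) (v : V) : g (act F z P v) = act F' z' P (g v) := by
  rw [act_eq_sum, act_eq_sum, map_sum]
  refine Finset.sum_congr rfl fun k _ => ?_
  rw [hc, semiconj_zpow g hz]

end LaurentPoly

section Var

variable {C : Type u} [NormedField C] {F : Type w} [Field F] [GrowthField C F]
  {V : Type v} [AddCommGroup V] [Module F V]

variable (C F) in
/-- The automorphism `z` behaves like a variable of absolute value `2 ^ (-δ)`. -/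
structure IsVar (N : V → ℝ) (z : AAut V) (δ : ℝ) : Prop where
  adm : IsAdm C F N
  pos : 0 < δ
  comm : ∀ (c : C) (v : V), z • (cst F c • v) = cst F c • (z • v)
  scale : ∀ v : V, N (z • v) = (2 : ℝ) ^ (-δ) * N v

theorem norm_zpow_of_scale {V : Type*} [AddCommGroup V] {N : V → ℝ} {z : AAut V} {μ : ℝ}
    (h : ∀ v, N (z • v) = (2 : ℝ) ^ μ * N v) (k : ℤ) (v : V) :
    N (z ^ k • v) = (2 : ℝ) ^ (μ * k) * N v := by
  induction k using Int.induction_on generalizing v with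
  | zero => simp
  | succ k ih =>
    rw [zpow_add_one, mul_smul, ih, h, ← mul_assoc, ← Real.rpow_add two_pos]
    congr 2; push_cast; ring
  | pred k ih =>
    have h1 : N (z⁻¹ • v) = (2 : ℝ) ^ (-μ) * N v := by
      have := h (z⁻¹ • v)
      rw [smul_inv_smul] at this
      rw [this, ← mul_assoc, ← Real.rpow_add two_pos]; simp
    rw [zpow_sub_one, mul_smul, ih, h1, ← mul_assoc, ← Real.rpow_add two_pos]
    congr 2; push_cast; ring

variable (F) in
/-- `w` is the value `f(z) v`. -/
def Evals (N : V → ℝ) (z : AAut V) (δ : ℝ) (f : LaurentSeries C) (v w : V) : Prop :=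
  ∀ P, N (w - act F z P v) ≤ labs (f - laur C P) ^ δ * N v

theorem Evals.norm_le {N : V → ℝ} {z : AAut V} {δ : ℝ} {f : LaurentSeries C} {v w : V}
    (h : Evals F N z δ f v w) : N w ≤ labs f ^ δ * N v := by
  simpa using h 0

namespace IsVar

variable {N : V → ℝ} {z : AAut V} {δ : ℝ} (h : IsVar C F N z δ)
include h

theorem comm_zpow (c : C) (k : ℤ) (v : V) : z ^ k • (cst F c • v) = cst F c • (z ^ k • v) :=
  (semiconj_zpow (fun v => cst F c • v) (fun v => (h.comm c v).symm) k v).symm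

theorem norm_act_le (P : AddMonoidAlgebra C ℤ) (v : V) :
    N (act F z P v) ≤ labs (laur C P) ^ δ * N v := by
  have h0 : 0 ≤ labs (laur C P) ^ δ * N v :=
    mul_nonneg (Real.rpow_nonneg (labs_nonneg _) _) (h.adm.nonneg v)
  rw [act_eq_sum]
  refine h.adm.sum_le _ _ h0 fun k hk => ?_
  rw [Finsupp.mem_support_iff] at hk
  rw [h.adm.smul, fabs_cst hk, one_mul, norm_zpow_of_scale h.scale]
  refine mul_le_mul_of_nonneg_right ?_ (h.adm.nonneg v)
  have h1 : (2 : ℝ) ^ (-k) ≤ labs (laur C P) := by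
    have hne : laur C P ≠ 0 := by
      intro h'
      apply hk
      rw [← coeff_laur, h', HahnSeries.coeff_zero]
    rw [labs_of_ne hne]
    refine zpow_le_zpow_right₀ one_le_two (neg_le_neg (HahnSeries.order_le_of_coeff_ne_zero ?_))
    rwa [coeff_laur]
  refine le_trans (le_of_eq ?_) (Real.rpow_le_rpow (by positivity) h1 h.pos.le)
  rw [← Real.rpow_intCast, ← Real.rpow_mul two_pos.le]
  congr 1; push_cast; ring

theorem act_mul (P Q : AddMonoidAlgebra C ℤ) (v : V) :
    act F z (P * Q) v = act F z P (act F z Q v) := by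
  induction P using AddMonoidAlgebra.induction_linear with
  | zero => simp
  | add P P' hP hP' => rw [add_mul, act_add, act_add, hP, hP']
  | single k c =>
    induction Q using AddMonoidAlgebra.induction_linear with
    | zero => simp
    | add Q Q' hQ hQ' =>
      rw [mul_add, act_add, act_add, hQ, hQ', map_add]
    | single j d =>
      rw [AddMonoidAlgebra.single_mul_single, act_single, act_single, act_single, h.comm_zpow,
        smul_smul, ← map_mul, ← mul_smul, ← zpow_add]

theorem evals_of_approx {f : LaurentSeries C} {v w : V}
    (H : ∀ ε > 0, ∃ P, labs (f - laur C P) ≤ ε ∧ N (w - act F z P v) ≤ ε) :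
    Evals F N z δ f v w := by
  intro P
  refine le_of_forall_pos_le_add fun η hη => ?_
  have hv := h.adm.nonneg v
  have hpos : 0 < min η ((η / (N v + 1)) ^ δ⁻¹) := by positivity
  obtain ⟨Q, h1, h2⟩ := H _ hpos
  have hl : labs (laur C (Q - P)) ≤
      max (min η ((η / (N v + 1)) ^ δ⁻¹)) (labs (f - laur C P)) := by
    have e : laur C (Q - P) = -(f - laur C Q) + (f - laur C P) := by rw [map_sub]; ring
    rw [e]
    refine (labs_add_le _ _).trans ?_
    rw [labs_neg]
    exact max_le_max h1 le_rfl
  have hl2 : labs (laur C (Q - P)) ^ δ * N v ≤ labs (f - laur C P) ^ δ * N v + η := by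
    have h0 : 0 ≤ labs (f - laur C P) ^ δ * N v :=
      mul_nonneg (Real.rpow_nonneg (labs_nonneg _) _) hv
    rcases le_max_iff.1 hl with h3 | h3
    · have h4 : labs (laur C (Q - P)) ^ δ ≤ η / (N v + 1) := by
        refine (Real.rpow_le_rpow (labs_nonneg _) (h3.trans (min_le_right _ _)) h.pos.le).trans_eq ?_
        rw [← Real.rpow_mul (by positivity), inv_mul_cancel₀ h.pos.ne', Real.rpow_one]
      rw [le_div_iff₀ (by positivity)] at h4
      have : 0 ≤ labs (laur C (Q - P)) ^ δ := Real.rpow_nonneg (labs_nonneg _) _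
      nlinarith
    · have := mul_le_mul_of_nonneg_right (Real.rpow_le_rpow (labs_nonneg _) h3 h.pos.le) hv
      linarith
  have e : w - act F z P v = (w - act F z Q v) + act F z (Q - P) v := by
    rw [act_sub]; abel
  rw [e]
  refine (h.adm.add_le _ _).trans (max_le ?_ ((h.norm_act_le _ _).trans hl2))
  have h0 : 0 ≤ labs (f - laur C P) ^ δ * N v :=
    mul_nonneg (Real.rpow_nonneg (labs_nonneg _) _) hv
  have := h2.trans (min_le_left _ _)
  linarith

theorem evals_unique {f : LaurentSeries C} {v w w' : V} (h1 : Evals F N z δ f v w)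
    (h2 : Evals F N z δ f v w') : w = w' := by
  rw [← sub_eq_zero]
  by_contra hne
  have hpos := h.adm.pos hne
  obtain ⟨P, -, hP, -⟩ := exists_approx f h.pos le_rfl (h.adm.nonneg v) (half_pos hpos)
  have e : w - w' = (w - act F z P v) - (w' - act F z P v) := by abel
  have h3 := h.adm.sub_le (w - act F z P v) (w' - act F z P v)
  rw [← e] at h3
  have h4 := h3.trans (max_le ((h1 P).trans hP) ((h2 P).trans hP))
  linarith

theorem evals_poly (P : AddMonoidAlgebra C ℤ) (v : V) : Evals F N z δ (laur C P) v (act F z P v) :=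
  h.evals_of_approx fun ε hε => ⟨P, by simpa using hε.le, by simpa [h.adm.map_zero] using hε.le⟩

theorem evals_add_left {f g : LaurentSeries C} {v w w' : V} (h1 : Evals F N z δ f v w)
    (h2 : Evals F N z δ g v w') : Evals F N z δ (f + g) v (w + w') := by
  refine h.evals_of_approx fun ε hε => ?_
  obtain ⟨P, -, hP, hP'⟩ := exists_approx f h.pos le_rfl (h.adm.nonneg v) hε
  obtain ⟨Q, -, hQ, hQ'⟩ := exists_approx g h.pos le_rfl (h.adm.nonneg v) hε
  refine ⟨P + Q, ?_, ?_⟩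
  · rw [map_add, add_sub_add_comm]
    exact (labs_add_le _ _).trans (max_le hP' hQ')
  · rw [act_add, add_sub_add_comm]
    exact (h.adm.add_le _ _).trans (max_le ((h1 P).trans hP) ((h2 Q).trans hQ))

theorem evals_add_right {f : LaurentSeries C} {v v' w w' : V} (h1 : Evals F N z δ f v w)
    (h2 : Evals F N z δ f v' w') : Evals F N z δ f (v + v') (w + w') := by
  refine h.evals_of_approx fun ε hε => ?_
  obtain ⟨P, -, hP, hP'⟩ := exists_approx f h.pos le_rfl (add_nonneg (h.adm.nonneg v) (h.adm.nonneg v')) hε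
  have h0 : 0 ≤ labs (f - laur C P) ^ δ := Real.rpow_nonneg (labs_nonneg _) _
  have hv := h.adm.nonneg v
  have hv' := h.adm.nonneg v'
  refine ⟨P, hP', ?_⟩
  rw [map_add, add_sub_add_comm]
  exact (h.adm.add_le _ _).trans (max_le ((h1 P).trans (by nlinarith)) ((h2 P).trans (by nlinarith)))

theorem evals_mul {f g : LaurentSeries C} {v w x : V} (h1 : Evals F N z δ f w x)
    (h2 : Evals F N z δ g v w) : Evals F N z δ (f * g) v x := by
  refine h.evals_of_approx fun ε hε => ?_
  obtain ⟨P, hP1, hP2, -⟩ := exists_approx f h.pos (labs_nonneg g) (h.adm.nonneg w) hε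
  obtain ⟨Q, hQ1, hQ2, -⟩ := exists_approx g h.pos (labs_nonneg (laur C P))
    (mul_nonneg (Real.rpow_nonneg (labs_nonneg (laur C P)) δ) (h.adm.nonneg v)) hε
  refine ⟨P * Q, ?_, ?_⟩
  · have e : f * g - laur C (P * Q) = (f - laur C P) * g + laur C P * (g - laur C Q) := by
      rw [map_mul]; ring
    rw [e]
    refine (labs_add_le _ _).trans (max_le ?_ ?_)
    · rw [labs_mul]; exact hP1
    · rw [labs_mul, mul_comm]; exact hQ1
  · have e : x - act F z (P * Q) v = (x - act F z P w) + act F z P (w - act F z Q v) := by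
      rw [h.act_mul, map_sub]; abel
    rw [e]
    refine (h.adm.add_le _ _).trans (max_le ((h1 P).trans hP2) ?_)
    refine (h.norm_act_le _ _).trans ((mul_le_mul_of_nonneg_left (h2 Q)
      (Real.rpow_nonneg (labs_nonneg _) _)).trans (le_trans (le_of_eq ?_) hQ2))
    ring

theorem evals_map {F' : Type*} [Field F'] [GrowthField C F'] {W : Type*} [AddCommGroup W]
    [Module F' W] {N' : W → ℝ} {z' : AAut W} {δ' : ℝ} (h' : IsVar C F' N' z' δ') (g : V →+ W)
    (hc : ∀ (c : C) v, g (cst F c • v) = cst F' c • g v) (hz : ∀ v, g (z • v) = z' • g v)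
    (hN : ∀ ε > 0, ∃ η > 0, ∀ v, N v ≤ η → N' (g v) ≤ ε) {f : LaurentSeries C} {v w : V}
    (h1 : Evals F N z δ f v w) : Evals F' N' z' δ' f (g v) (g w) := by
  refine h'.evals_of_approx fun ε hε => ?_
  obtain ⟨η, hη, hg⟩ := hN ε hε
  obtain ⟨P, -, hP, hP'⟩ := exists_approx f h.pos le_rfl (h.adm.nonneg v) (lt_min hη hε)
  refine ⟨P, hP'.trans (min_le_right _ _), ?_⟩
  rw [← act_map F g hc hz, ← map_sub]
  exact hg _ ((h1 P).trans (hP.trans (min_le_left _ _)))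

end IsVar

variable (V) in
/-- Multiplication by `x`. -/
def xAut : AAut V := scalarAut V (xunit C F)

theorem xAut_smul (v : V) : xAut (C := C) (F := F) V • v = xvar C F • v := rfl

theorem xAut_isVar {N : V → ℝ} (hN : IsAdm C F N) : IsVar C F N (xAut (C := C) (F := F) V) 1 where
  adm := hN
  pos := one_pos
  comm c v := by rw [xAut_smul, xAut_smul, smul_comm]
  scale v := by rw [xAut_smul, hN.smul, fabs_xvar, Real.rpow_neg_one, one_div]

theorem act_xAut (P : AddMonoidAlgebra C ℤ) (v : V) :
    act F (xAut (C := C) (F := F) V) P v = polyF F P • v := by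
  induction P using AddMonoidAlgebra.induction_linear with
  | zero => simp
  | add P Q hP hQ => rw [act_add, hP, hQ, map_add, add_smul]
  | single k c =>
    have : (xAut (C := C) (F := F) V) ^ k = scalarAut V (xunit C F ^ k) :=
      (map_zpow (Units.map (Module.toAddMonoidEnd F V).toMonoidHom) (xunit C F) k).symm
    rw [act_single, polyF_single, this, scalarAut_smul, coe_xunit_zpow, smul_smul]

theorem evals_xAut {N : V → ℝ} (hN : IsAdm C F N) (f : F) (v : V) :
    Evals (C := C) F N (xAut (C := C) (F := F) V) 1 (ι f) v (f • v) := by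
  intro P
  rw [act_xAut, ← sub_smul, hN.smul, Real.rpow_one, ← ι_polyF F, ← map_sub, fabs]

/-- A continuous additive map that commutes with the constants and with `x` is linear. -/
theorem linear_of_comm {F' : Type*} [Field F'] [GrowthField C F'] {W : Type*} [AddCommGroup W]
    [Module F' W] {N : V → ℝ} (hN : IsAdm C F N) {N' : W → ℝ} (hN' : IsAdm C F' N') (g : V →+ W)
    (hc : ∀ (c : C) v, g (cst F c • v) = cst F' c • g v)
    (hx : ∀ v, g (xvar C F • v) = xvar C F' • g v)
    (hg : ∀ ε > 0, ∃ η > 0, ∀ v, N v ≤ η → N' (g v) ≤ ε) {f : F} {f' : F'}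
    (hf : (ι f : LaurentSeries C) = ι f') (v : V) : g (f • v) = f' • g v := by
  have h1 := (xAut_isVar hN).evals_map (xAut_isVar hN') g hc hx hg (evals_xAut hN f v)
  rw [hf] at h1
  exact (xAut_isVar hN').evals_unique h1 (evals_xAut hN' f' (g v))

end Var

section VectorNorm

variable {C : Type u} [NormedField C] {F : Type w} [Field F] [GrowthField C F]
  {V : Type v} [AddCommGroup V] [Module F V] {n : ℕ}

variable (C) in
/-- The weighted norm of a vector. -/
def vrn (b : Module.Basis (Fin n) F V) (ρ : ℝ) (v : V) : ENNReal :=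
  ∑ i, rnorm (ν F) ρ (ι (b.repr v i) : LaurentSeries C)

variable (C) in
/-- The weighted norm of an operator. -/
def arn (b : Module.Basis (Fin n) F V) (ρ : ℝ) (z : AAut V) : ENNReal :=
  ∑ j, vrn C b ρ (z • b j)

variable (b : Module.Basis (Fin n) F V)

theorem rnorm_le_vrn (ρ : ℝ) (v : V) (i : Fin n) :
    rnorm (ν F) ρ (ι (b.repr v i) : LaurentSeries C) ≤ vrn C b ρ v :=
  Finset.single_le_sum (f := fun i => rnorm (ν F) ρ (ι (b.repr v i) : LaurentSeries C))
    (fun _ _ => zero_le) (Finset.mem_univ i)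

theorem vrn_zero (ρ : ℝ) : vrn C b ρ (0 : V) = 0 := by
  simp [vrn, rnorm_zero]

theorem vrn_add_le {ρ : ℝ} (hρ : 0 < ρ) (v w : V) :
    vrn C b ρ (v + w) ≤ vrn C b ρ v + vrn C b ρ w := by
  unfold vrn
  rw [← Finset.sum_add_distrib]
  refine Finset.sum_le_sum fun i _ => ?_
  rw [map_add, Finsupp.add_apply, map_add]
  exact rnorm_add_le hρ _ _

theorem vrn_sum_le {ρ : ℝ} (hρ : 0 < ρ) {α : Type*} (s : Finset α) (f : α → V) :
    vrn C b ρ (∑ i ∈ s, f i) ≤ ∑ i ∈ s, vrn C b ρ (f i) := by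
  classical
  induction s using Finset.induction_on with
  | empty => simp [vrn_zero]
  | insert a s ha ih =>
    rw [Finset.sum_insert ha, Finset.sum_insert ha]
    exact (vrn_add_le b hρ _ _).trans (by gcongr)

theorem vrn_smul_le {ρ : ℝ} (hρ : 0 < ρ) (f : F) (v : V) :
    vrn C b ρ (f • v) ≤ rnorm (ν F) ρ (ι f : LaurentSeries C) * vrn C b ρ v := by
  unfold vrn
  rw [Finset.mul_sum]
  refine Finset.sum_le_sum fun i _ => ?_
  rw [map_smul, Finsupp.smul_apply, smul_eq_mul, map_mul]
  exact rnorm_mul_le hρ _ _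

theorem rnorm_cst (ρ : ℝ) (c : C) :
    rnorm (ν F) ρ (ι (cst F c) : LaurentSeries C) = ENNReal.ofReal (ν F c) := by
  rw [ι_cst]
  unfold rnorm
  rw [tsum_eq_single 0]
  · simp
  · intro k hk
    simp [HahnSeries.coeff_single_of_ne hk]

theorem vrn_cst_smul_le {ρ : ℝ} (hρ : 0 < ρ) (c : C) (v : V) :
    vrn C b ρ (cst F c • v) ≤ ENNReal.ofReal (ν F c) * vrn C b ρ v := by
  rw [← rnorm_cst (F := F) ρ c]
  exact vrn_smul_le b hρ _ v

theorem vrn_neg (ρ : ℝ) (v : V) : vrn C b ρ (-v) = vrn C b ρ v := by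
  simp [vrn, rnorm]

theorem vrn_semi_le {ρ : ℝ} (hρ : 0 < ρ) {u : Cˣ} (hu : ν F (u : C) = 1) {z : AAut V}
    (hz : IsSemi F u z) (v : V) : vrn C b ρ (z • v) ≤ arn C b ρ z * vrn C b ρ v := by
  choose g hg1 hg2 using fun i => hz.exists hu (b.repr v i) (b i)
  have e : z • v = ∑ i, g i • (z • b i) := by
    conv_lhs => rw [← b.sum_repr v, Finset.smul_sum]
    exact Finset.sum_congr rfl fun i _ => (hg2 i).2
  rw [e]
  refine (vrn_sum_le b hρ _ _).trans ?_
  rw [arn, Finset.sum_mul]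
  refine Finset.sum_le_sum fun i _ => (vrn_smul_le b hρ _ _).trans ?_
  rw [hg1, rnorm_shift hu, mul_comm]
  exact mul_le_mul' le_rfl (rnorm_le_vrn b ρ v i)

theorem eventually_vrn (v : V) :
    ∀ᶠ ρ in nhdsWithin (0 : ℝ) (Set.Ioi 0), vrn C b ρ v < ⊤ := by
  have : ∀ i, ∀ᶠ ρ in nhdsWithin (0 : ℝ) (Set.Ioi 0),
    rnorm (ν F) ρ (ι (b.repr v i) : LaurentSeries C) < ⊤ := fun i => eventually_rnorm _
  simp only [← Filter.eventually_all] at this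
  filter_upwards [this] with ρ h
  exact ENNReal.sum_lt_top.2 fun i _ => h i

theorem eventually_arn (z : AAut V) :
    ∀ᶠ ρ in nhdsWithin (0 : ℝ) (Set.Ioi 0), arn C b ρ z < ⊤ := by
  have : ∀ j, ∀ᶠ ρ in nhdsWithin (0 : ℝ) (Set.Ioi 0), vrn C b ρ (z • b j) < ⊤ :=
    fun j => eventually_vrn b _
  simp only [← Filter.eventually_all] at this
  filter_upwards [this] with ρ h
  exact ENNReal.sum_lt_top.2 fun i _ => h i

theorem arn_small {z : AAut V} (hz : ∀ i j, fabs C (b.repr (z • b j) i) ≤ 1 / 2)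
    {ε : ENNReal} (hε : 0 < ε) :
    ∀ᶠ ρ in nhdsWithin (0 : ℝ) (Set.Ioi 0), arn C b ρ z ≤ ε := by
  filter_upwards [mrn_small (E := Matrix.of fun i j => b.repr (z • b j) i) hz hε] with ρ h
  refine le_trans (le_of_eq ?_) h
  unfold arn vrn mrn
  exact Finset.sum_comm

theorem sum_range_le_of_contract (a : ℕ → ENNReal) (m : ℕ) (h : ∀ l, a (l + m) ≤ 2⁻¹ * a l) (j : ℕ) :
    ∑ l ∈ Finset.range (m * j), a l ≤ 2 * ∑ l ∈ Finset.range m, a l := by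
  induction j with
  | zero => simp
  | succ j ih =>
    rw [mul_add, mul_one, add_comm, Finset.sum_range_add, two_mul]
    gcongr
    calc ∑ l ∈ Finset.range (m * j), a (m + l) ≤ ∑ l ∈ Finset.range (m * j), 2⁻¹ * a l :=
          Finset.sum_le_sum fun l _ => by rw [add_comm]; exact h l
      _ = 2⁻¹ * ∑ l ∈ Finset.range (m * j), a l := by rw [Finset.mul_sum]
      _ ≤ 2⁻¹ * (2 * ∑ l ∈ Finset.range m, a l) := by gcongr
      _ = _ := by rw [← mul_assoc, ENNReal.inv_mul_cancel two_ne_zero ENNReal.ofNat_ne_top, one_mul]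

end VectorNorm

section Existence

variable {C : Type u} [NormedField C] {F : Type w} [Field F] [GrowthField C F]
  {V : Type v} [AddCommGroup V] [Module F V]

/-- Coordinatewise limits of a sequence which is Cauchy for an admissible norm. -/
theorem exists_vector_limit {n : ℕ} (b : Module.Basis (Fin n) F V) {N : V → ℝ} (hN : IsAdm C F N)
    (y : ℕ → V) {ρ : ℝ} (hρ : 0 < ρ) {R : ENNReal} (hR : R < ⊤) (hr : ∀ m, vrn C b ρ (y m) ≤ R)
    (hy : ∀ ε > 0, ∃ M, ∀ m ≥ M, N (y m - y M) ≤ ε) :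
    ∃ w, ∀ ε > 0, ∃ M, ∀ m ≥ M, N (w - y m) ≤ ε := by
  choose D hD using fun i => hN.bdd (b.coord i)
  have hlim := fun i => exists_limit (C := C) hρ (fun m => b.repr (y m) i) (fun K => by
    obtain ⟨M, hM⟩ := hy ((2 : ℝ) ^ (-K) / (|D i| + 1)) (by positivity)
    refine ⟨M, fun m hm => ?_⟩
    have h1 := hD i (y m - y M)
    rw [Module.Basis.coord_apply, map_sub, Finsupp.sub_apply] at h1
    refine h1.trans ?_
    have h2 := hM m hm
    have h0 := hN.nonneg (y m - y M)
    rw [le_div_iff₀ (by positivity)] at h2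
    have := le_abs_self (D i)
    nlinarith) hR (fun m => (rnorm_le_vrn b ρ (y m) i).trans (hr m))
  choose g hg _ using hlim
  refine ⟨∑ i, g i • b i, fun ε hε => ?_⟩
  have hpos : ∀ i, 0 < ε / (N (b i) + 1) := fun i => div_pos hε (by have := hN.nonneg (b i); linarith)
  have hK : ∀ i, ∃ K : ℕ, (2 : ℝ) ^ (-(K : ℤ)) ≤ ε / (N (b i) + 1) := fun i => by
    obtain ⟨k, hk⟩ := exists_pow_lt_of_lt_one (hpos i) (by norm_num : (1 / 2 : ℝ) < 1)
    refine ⟨k, ?_⟩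
    rw [zpow_neg, zpow_natCast, ← inv_pow, ← one_div]
    exact hk.le
  choose K hK using hK
  choose M hM using fun i => hg i (K i)
  refine ⟨Finset.univ.sup M, fun m hm => ?_⟩
  have e : ∑ i, g i • b i - y m = ∑ i, (g i - b.repr (y m) i) • b i := by
    conv_lhs => rw [← b.sum_repr (y m)]
    rw [← Finset.sum_sub_distrib]
    exact Finset.sum_congr rfl fun i _ => (sub_smul _ _ _).symm
  rw [e]
  refine hN.sum_le _ _ hε.le fun i _ => ?_
  have h1 := (hM i m ((Finset.le_sup (Finset.mem_univ i)).trans hm)).trans (hK i)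
  have h0 := hN.nonneg (b i)
  rw [hN.smul]
  rw [le_div_iff₀ (by positivity)] at h1
  have := fabs_nonneg (C := C) (g i - b.repr (y m) i)
  nlinarith

theorem act_trunc (z : AAut V) (f : LaurentSeries C) (n : ℕ) (v : V) :
    act F z (trunc f (f.order + n)) v =
      ∑ k ∈ Finset.range n, cst F (f.coeff (f.order + k)) • (z ^ (f.order + k) • v) := by
  rw [trunc, act_sum]
  simp only [act_single]
  refine (Finset.sum_bij (fun (k : ℕ) _ => f.order + (k : ℤ)) ?_ ?_ ?_ ?_).symm
  · intro k hk
    rw [Finset.mem_range] at hk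
    rw [Finset.mem_Ico]; omega
  · intro k _ k' _ h; omega
  · intro k hk
    rw [Finset.mem_Ico] at hk
    exact ⟨(k - f.order).toNat, by rw [Finset.mem_range]; omega, by omega⟩
  · intro k _; rfl

theorem IsVar.exists_pow_small [FiniteDimensional F V] {N : V → ℝ} {z : AAut V} {δ : ℝ}
    (h : IsVar C F N z δ) {n : ℕ} (b : Module.Basis (Fin n) F V) :
    ∃ m : ℕ, 0 < m ∧ ∀ i j, fabs C (b.repr (z ^ m • b j) i) ≤ 1 / 2 := by
  choose D hD using fun i => h.adm.bdd (b.coord i)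
  have hpos : 0 < (1 / 2 : ℝ) / (∑ i, ∑ j, |D i| * N (b j) + 1) := by
    have : 0 ≤ ∑ i, ∑ j, |D i| * N (b j) := Finset.sum_nonneg fun i _ => Finset.sum_nonneg fun j _ =>
      mul_nonneg (abs_nonneg _) (h.adm.nonneg _)
    positivity
  obtain ⟨m, hm⟩ := exists_pow_lt_of_lt_one hpos
    (Real.rpow_lt_one_of_one_lt_of_neg one_lt_two (neg_lt_zero.2 h.pos))
  refine ⟨m + 1, m.succ_pos, fun i j => ?_⟩
  have h1 := hD i (z ^ (m + 1) • b j)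
  rw [Module.Basis.coord_apply] at h1
  refine h1.trans ?_
  have h2 : N (z ^ (m + 1) • b j) ≤ ((2 : ℝ) ^ (-δ)) ^ m * N (b j) := by
    rw [← zpow_natCast z, norm_zpow_of_scale h.scale, ← Real.rpow_natCast, ← Real.rpow_mul two_pos.le]
    refine mul_le_mul_of_nonneg_right (Real.rpow_le_rpow_of_exponent_le one_le_two ?_) (h.adm.nonneg _)
    push_cast
    nlinarith [h.pos]
  have h3 : |D i| * N (b j) ≤ ∑ i, ∑ j, |D i| * N (b j) :=
    (Finset.single_le_sum (f := fun j => |D i| * N (b j))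
      (fun j _ => mul_nonneg (abs_nonneg _) (h.adm.nonneg _)) (Finset.mem_univ j)).trans
    (Finset.single_le_sum (f := fun i => ∑ j, |D i| * N (b j)) (fun i _ => Finset.sum_nonneg fun j _ =>
      mul_nonneg (abs_nonneg _) (h.adm.nonneg _)) (Finset.mem_univ i))
  rw [lt_div_iff₀ (by
    have := Finset.sum_nonneg (s := Finset.univ) (f := fun i => ∑ j, |D i| * N (b j))
      fun i _ => Finset.sum_nonneg fun j _ => mul_nonneg (abs_nonneg _) (h.adm.nonneg _)
    linarith)] at hm
  have h4 : 0 < ((2 : ℝ) ^ (-δ)) ^ m := by positivity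
  calc D i * N (z ^ (m + 1) • b j) ≤ |D i| * N (z ^ (m + 1) • b j) :=
        mul_le_mul_of_nonneg_right (le_abs_self _) (h.adm.nonneg _)
    _ ≤ |D i| * (((2 : ℝ) ^ (-δ)) ^ m * N (b j)) := mul_le_mul_of_nonneg_left h2 (abs_nonneg _)
    _ ≤ 1 / 2 := by nlinarith

theorem IsVar.exists_evals [FiniteDimensional F V] {N : V → ℝ} {z : AAut V} {δ : ℝ}
    (h : IsVar C F N z δ) {u : Cˣ} (hu : ν F (u : C) = 1) (hz : IsSemi F u z) (f : F) (v : V) :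
    ∃ w, Evals (C := C) F N z δ (ι f) v w := by
  set b := Module.finBasis F V
  set g : LaurentSeries C := ι f with hg
  obtain ⟨A, B, hB, hAB⟩ := (mem_range_iff (F := F) g).1 ⟨f, rfl⟩
  obtain ⟨m, hm0, hm⟩ := h.exists_pow_small b
  set v' := z ^ g.order • v
  have hBm : (0 : ENNReal) < 2⁻¹ * (ENNReal.ofReal (B ^ m))⁻¹ := by
    refine ENNReal.mul_pos (by simp) (ENNReal.inv_ne_zero.2 ENNReal.ofReal_ne_top)
  have hfin : ∀ l : Fin m, ∀ᶠ ρ in nhdsWithin (0 : ℝ) (Set.Ioi 0), vrn C b ρ (z ^ (l : ℕ) • v') < ⊤ :=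
    fun l => eventually_vrn b _
  simp only [← Filter.eventually_all] at hfin
  obtain ⟨ρ, ⟨h1, h2⟩, hρ⟩ := ((hfin.and (arn_small b hm hBm)).and self_mem_nhdsWithin).exists
  have hρ : 0 < ρ := hρ
  set a : ℕ → ENNReal := fun l => ENNReal.ofReal (B ^ l) * vrn C b ρ (z ^ l • v') with ha
  have hzm : IsSemi F (u ^ m) (z ^ m) := by simpa using hz.zpow hu m
  have hum : ν F ((u ^ m : Cˣ) : C) = 1 := by simpa using ν_zpow (F := F) hu m
  have ha1 : ∀ l, a (l + m) ≤ 2⁻¹ * a l := by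
    intro l
    have e : z ^ (l + m) • v' = z ^ m • (z ^ l • v') := by rw [add_comm, pow_add, mul_smul]
    simp only [ha]
    rw [e, pow_add, ENNReal.ofReal_mul (by positivity)]
    have hb0 : ENNReal.ofReal (B ^ m) ≠ 0 := by
      rw [Ne, ENNReal.ofReal_eq_zero, not_le]; positivity
    calc _ ≤ ENNReal.ofReal (B ^ l) * ENNReal.ofReal (B ^ m) *
          ((2⁻¹ * (ENNReal.ofReal (B ^ m))⁻¹) * vrn C b ρ (z ^ l • v')) := by
          gcongr
          exact (vrn_semi_le b hρ hum hzm _).trans (by gcongr)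
      _ = (ENNReal.ofReal (B ^ m) * (ENNReal.ofReal (B ^ m))⁻¹) *
          (2⁻¹ * (ENNReal.ofReal (B ^ l) * vrn C b ρ (z ^ l • v'))) := by ring
      _ = _ := by rw [ENNReal.mul_inv_cancel hb0 ENNReal.ofReal_ne_top, one_mul]
  have hsum : ∀ L, ∑ l ∈ Finset.range L, a l ≤ 2 * ∑ l ∈ Finset.range m, a l := fun L =>
    (Finset.sum_le_sum_of_subset (Finset.range_subset_range.2 (Nat.le_mul_of_pos_left L hm0))).trans
      (sum_range_le_of_contract a m ha1 L)
  have hS : ∑ l ∈ Finset.range m, a l < ⊤ := by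
    refine ENNReal.sum_lt_top.2 fun l hl => ENNReal.mul_lt_top ENNReal.ofReal_lt_top ?_
    exact h1 ⟨l, Finset.mem_range.1 hl⟩
  have hA : 0 ≤ A := by have := ((ν F).nonneg _).trans (hAB 0); simpa using this
  have hsc : ∀ k : ℕ, N (z ^ (g.order + k) • v) = (2 : ℝ) ^ (-δ * ((g.order + k : ℤ) : ℝ)) * N v :=
    fun k => norm_zpow_of_scale h.scale _ v
  have hdiff : ∀ M m' : ℕ, M ≤ m' → N (act F z (trunc g (g.order + m')) v -
      act F z (trunc g (g.order + M)) v) ≤ (2 : ℝ) ^ (-δ * ((g.order + M : ℤ) : ℝ)) * N v := by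
    intro M m' hM
    rw [act_trunc, act_trunc, ← Finset.sum_Ico_eq_sub _ hM]
    refine h.adm.sum_le _ _ (mul_nonneg (by positivity) (h.adm.nonneg v)) fun k hk => ?_
    rw [Finset.mem_Ico] at hk
    rw [h.adm.smul, hsc]
    refine (mul_le_of_le_one_left (mul_nonneg (by positivity) (h.adm.nonneg v))
      (fabs_cst_le _)).trans ?_
    refine mul_le_mul_of_nonneg_right (Real.rpow_le_rpow_of_exponent_le one_le_two ?_) (h.adm.nonneg v)
    have : (M : ℝ) ≤ k := by exact_mod_cast hk.1
    push_cast
    nlinarith [h.pos]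
  have hsmall : ∀ ε > 0, ∃ M : ℕ, (2 : ℝ) ^ (-δ * ((g.order + M : ℤ) : ℝ)) * N v ≤ ε := by
    intro ε hε
    have h0 : 0 < ε / ((2 : ℝ) ^ (-δ * (g.order : ℝ)) * (N v + 1)) := by
      have := h.adm.nonneg v
      positivity
    obtain ⟨M, hM⟩ := exists_pow_lt_of_lt_one h0
      (Real.rpow_lt_one_of_one_lt_of_neg one_lt_two (neg_lt_zero.2 h.pos))
    refine ⟨M, ?_⟩
    have h5 := h.adm.nonneg v
    rw [lt_div_iff₀ (by positivity)] at hM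
    push_cast
    rw [mul_add, Real.rpow_add two_pos, Real.rpow_mul two_pos.le _ (M : ℝ), Real.rpow_natCast]
    have h6 : 0 < (2 : ℝ) ^ (-δ * (g.order : ℝ)) := by positivity
    have h7 : 0 < ((2 : ℝ) ^ (-δ)) ^ M := by positivity
    nlinarith [mul_pos h6 h7]
  obtain ⟨w, hw⟩ := exists_vector_limit b h.adm (fun n => act F z (trunc g (g.order + n)) v) hρ
    (R := ENNReal.ofReal (A * B ^ g.order) * (2 * ∑ l ∈ Finset.range m, a l))
    (ENNReal.mul_lt_top ENNReal.ofReal_lt_top (ENNReal.mul_lt_top (by simp) hS))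
    (fun L => by
      rw [act_trunc]
      refine (vrn_sum_le b hρ _ _).trans (le_trans ?_ (mul_le_mul' le_rfl (hsum L)))
      rw [Finset.mul_sum]
      refine Finset.sum_le_sum fun k _ => (vrn_cst_smul_le b hρ _ _).trans ?_
      have e : z ^ (g.order + (k : ℤ)) • v = z ^ k • v' := by
        rw [← mul_smul, ← zpow_natCast, ← zpow_add, add_comm]
      rw [e]
      simp only [ha]
      rw [← mul_assoc, ← ENNReal.ofReal_mul (by positivity)]
      refine mul_le_mul' (ENNReal.ofReal_le_ofReal ((hAB _).trans_eq ?_)) le_rfl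
      rw [zpow_add₀ hB.ne', zpow_natCast, mul_assoc])
    (fun ε hε => by
      obtain ⟨M, hM⟩ := hsmall ε hε
      exact ⟨M, fun m' hm' => (hdiff M m' hm').trans hM⟩)
  refine ⟨w, h.evals_of_approx fun ε hε => ?_⟩
  obtain ⟨M, hM⟩ := hw ε hε
  obtain ⟨k, hk⟩ := exists_pow_lt_of_lt_one hε (by norm_num : (1 / 2 : ℝ) < 1)
  refine ⟨trunc g (g.order + (max M (k + g.order.natAbs) : ℕ)), ?_, hM _ (le_max_left _ _)⟩
  refine (labs_sub_trunc_le g _).trans (le_trans ?_ hk.le)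
  rw [one_div, inv_pow, ← zpow_natCast, ← zpow_neg]
  refine zpow_le_zpow_right₀ one_le_two ?_
  have := le_max_right M (k + g.order.natAbs)
  omega

end Existence

/-- A basis of a complement of `E₀` in `E₁`, with dual functionals. -/
theorem exists_dual_complement {K E : Type*} [Field K] [AddCommGroup E] [Module K E]
    [FiniteDimensional K E] (E₀ E₁ : Submodule K E) :
    ∃ (L : ℕ) (e : Fin L → E) (θ : Fin L → E →ₗ[K] K), (∀ l, e l ∈ E₁) ∧
      (∀ x ∈ E₁, x - ∑ l, θ l x • e l ∈ E₀) ∧ (∀ l, ∀ x ∈ E₀, θ l x = 0) ∧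
      ∀ c : Fin L → K, ∀ l, θ l (∑ j, c j • e j) = c l := by
  set Q := E₁.map E₀.mkQ
  set b := Module.finBasis K Q
  have he : ∀ l, ∃ x ∈ E₁, E₀.mkQ x = (b l : E ⧸ E₀) := fun l => Submodule.mem_map.1 (b l).2
  choose e he1 he2 using he
  choose φ hφ using fun l => LinearMap.exists_extend (b.coord l)
  have hφ' : ∀ l (x : Q), φ l x = b.repr x l := fun l x => by
    have := LinearMap.congr_fun (hφ l) x
    simpa using this
  refine ⟨_, e, fun l => φ l ∘ₗ E₀.mkQ, he1, fun x hx => ?_, fun l x hx => ?_, fun c l => ?_⟩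
  · rw [← Submodule.Quotient.mk_eq_zero, ← Submodule.mkQ_apply, map_sub, map_sum, sub_eq_zero]
    have hxQ : E₀.mkQ x ∈ Q := Submodule.mem_map_of_mem hx
    have := congrArg Subtype.val (b.sum_repr ⟨E₀.mkQ x, hxQ⟩)
    rw [AddSubmonoidClass.coe_finsetSum] at this
    refine this.symm.trans (Finset.sum_congr rfl fun l _ => ?_)
    rw [map_smul, he2, LinearMap.comp_apply, ← hφ' l ⟨E₀.mkQ x, hxQ⟩]; rfl
  · rw [LinearMap.comp_apply, Submodule.mkQ_apply, (Submodule.Quotient.mk_eq_zero E₀).2 hx, map_zero]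
  · have : E₀.mkQ (∑ j, c j • e j) = ((∑ j, c j • b j : Q) : E ⧸ E₀) := by
      rw [map_sum, AddSubmonoidClass.coe_finsetSum]
      exact Finset.sum_congr rfl fun j _ => by rw [map_smul, he2]; rfl
    rw [LinearMap.comp_apply, this, hφ', b.repr_sum_self]

section Digits

variable {C : Type u} [NormedField C] {F : Type w} [Field F] [GrowthField C F]
  {V : Type v} [AddCommGroup V] [Module F V]

theorem coeff_cst_mul (c : C) (f : F) (k : ℤ) :
    (ι (cst F c * f) : LaurentSeries C).coeff k = c * (ι f : LaurentSeries C).coeff k := by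
  rw [map_mul, ι_cst, HahnSeries.coeff_single_zero_mul]

theorem IsVar.exists_digits {N : V → ℝ} {z : AAut V} {δ : ℝ}
    (h : IsVar C F N z δ) {n : ℕ} (b : Module.Basis (Fin n) F V) :
    ∃ (L : ℕ) (g : Fin L → V) (θ : Fin L → V → C), (∀ l, N (g l) ≤ 1) ∧
      (∀ v, N v ≤ 1 → N (v - ∑ l, cst F (θ l v) • g l) ≤ (2 : ℝ) ^ (-δ)) ∧
      (∀ c : Fin L → C, N (∑ l, cst F (c l) • g l) ≤ (2 : ℝ) ^ (-δ) → c = 0) ∧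
      ∀ ρ > 0, ∃ B : ENNReal, B < ⊤ ∧
        ∀ l v, ENNReal.ofReal (ν F (θ l v)) ≤ B * vrn C b ρ v := by
  have hN := h.adm
  choose D hD using fun i => hN.bdd (b.coord i)
  obtain ⟨K₁, hK₁⟩ := pow_unbounded_of_one_lt (∑ i, |D i|) (one_lt_two : (1 : ℝ) < 2)
  have hsum : 0 ≤ ∑ i, N (b i) := Finset.sum_nonneg fun i _ => hN.nonneg _
  obtain ⟨K₂, hK₂⟩ := exists_pow_lt_of_lt_one
    (show 0 < (2 : ℝ) ^ (-δ) / (∑ i, N (b i) + 1) by positivity) (by norm_num : (1 / 2 : ℝ) < 1)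
  rw [lt_div_iff₀ (by positivity)] at hK₂
  set I := Fin n × Finset.Ico (-(K₁ : ℤ)) K₂
  let π : V →+ (I → C) :=
    { toFun := fun v p => (ι (b.repr v p.1) : LaurentSeries C).coeff p.2
      map_zero' := by ext p; simp
      map_add' := fun v w => by ext p; simp }
  have hπ : ∀ (c : C) v, π (cst F c • v) = c • π v := fun c v => by
    ext p
    change (ι (b.repr (cst F c • v) p.1) : LaurentSeries C).coeff p.2 = _
    rw [map_smul, Finsupp.smul_apply, smul_eq_mul, coeff_cst_mul]; rfl
  have hker : ∀ v, N v ≤ 1 → π v = 0 → N v ≤ (2 : ℝ) ^ (-δ) := by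
    intro v hv h0
    rw [← b.sum_repr v]
    refine hN.sum_le _ _ (by positivity) fun i _ => ?_
    have h1 : fabs C (b.repr v i) ≤ (2 : ℝ) ^ (-(-(K₁ : ℤ))) := by
      have h2 := hD i v
      rw [Module.Basis.coord_apply] at h2
      have h3 : |D i| ≤ ∑ i, |D i| :=
        Finset.single_le_sum (f := fun i => |D i|) (fun _ _ => abs_nonneg _) (Finset.mem_univ i)
      rw [neg_neg, zpow_natCast]
      have := le_abs_self (D i)
      have := hN.nonneg v
      have := abs_nonneg (D i)
      nlinarith
    have h4 : fabs C (b.repr v i) ≤ (2 : ℝ) ^ (-(K₂ : ℤ)) := by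
      rw [fabs, labs_le_iff] at h1 ⊢
      intro k hk
      rcases lt_or_ge k (-(K₁ : ℤ)) with h5 | h5
      · exact h1 k h5
      · exact congrFun h0 (i, ⟨k, Finset.mem_Ico.2 ⟨h5, hk⟩⟩)
    rw [zpow_neg, zpow_natCast, ← inv_pow, ← one_div] at h4
    have h6 : N (b i) ≤ ∑ i, N (b i) :=
      Finset.single_le_sum (f := fun i => N (b i)) (fun _ _ => hN.nonneg _) (Finset.mem_univ i)
    have := hN.nonneg (b i)
    have h7 : (0 : ℝ) < (1 / 2) ^ K₂ := by positivity
    rw [hN.smul]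
    nlinarith [mul_le_mul_of_nonneg_right h4 this]
  have hcst : ∀ (c : C) v, N (cst F c • v) ≤ N v := fun c v => by
    rw [hN.smul]
    exact mul_le_of_le_one_left (hN.nonneg v) (fabs_cst_le c)
  let im : ∀ t : ℝ, 0 ≤ t → Submodule C (I → C) := fun t ht =>
    { carrier := π '' {v | N v ≤ t}
      zero_mem' := ⟨0, by rw [Set.mem_ofPred_eq, hN.map_zero]; exact ht, map_zero π⟩
      add_mem' := by
        rintro _ _ ⟨v, hv, rfl⟩ ⟨w, hw, rfl⟩
        exact ⟨v + w, (hN.add_le v w).trans (max_le hv hw), map_add π v w⟩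
      smul_mem' := by
        rintro c _ ⟨v, hv, rfl⟩
        exact ⟨cst F c • v, (hcst c v).trans hv, hπ c v⟩ }
  have h20 : (0 : ℝ) ≤ (2 : ℝ) ^ (-δ) := by positivity
  have h21 : (2 : ℝ) ^ (-δ) ≤ 1 := (Real.rpow_lt_one_of_one_lt_of_neg one_lt_two
    (neg_lt_zero.2 h.pos)).le
  obtain ⟨L, e, θ, he, h1, h2, h3⟩ := exists_dual_complement (im _ h20) (im 1 zero_le_one)
  choose g hg1 hg2 using he
  have hg1 : ∀ l, N (g l) ≤ 1 := hg1
  have hπs : ∀ c : Fin L → C, π (∑ l, cst F (c l) • g l) = ∑ l, c l • e l := fun c => by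
    rw [map_sum]
    exact Finset.sum_congr rfl fun l _ => by rw [hπ, hg2]
  have hNs : ∀ c : Fin L → C, N (∑ l, cst F (c l) • g l) ≤ 1 := fun c =>
    hN.sum_le _ _ zero_le_one fun l _ => (hcst _ _).trans (hg1 l)
  refine ⟨L, g, fun l v => θ l (π v), hg1, fun v hv => ?_, fun c hc => ?_, fun ρ hρ => ?_⟩
  · obtain ⟨y, hy, hy'⟩ := h1 (π v) ⟨v, hv, rfl⟩
    have hy : N y ≤ (2 : ℝ) ^ (-δ) := hy
    set s := ∑ l, cst F (θ l (π v)) • g l with hs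
    have h4 : π (v - s - y) = 0 := by
      rw [map_sub, map_sub, hy', hs, hπs, sub_self]
    have h5 : N (v - s - y) ≤ 1 :=
      (hN.sub_le _ _).trans (max_le ((hN.sub_le _ _).trans (max_le hv (hNs _))) (hy.trans h21))
    have h6 := hker _ h5 h4
    have e : v - s = (v - s - y) + y := by abel
    rw [e]
    exact (hN.add_le _ _).trans (max_le h6 hy)
  · ext l
    rw [← h3 c l, ← hπs]
    exact h2 l _ ⟨_, hc, rfl⟩
  · refine ⟨∑ l, ∑ p : I, ENNReal.ofReal (ρ ^ (-(p.2 : ℤ))) *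
      ENNReal.ofReal (ν F (θ l fun j => if p = j then 1 else 0)), ?_, fun l v => ?_⟩
    · exact ENNReal.sum_lt_top.2 fun l _ => ENNReal.sum_lt_top.2 fun p _ =>
        ENNReal.mul_lt_top ENNReal.ofReal_lt_top ENNReal.ofReal_lt_top
    · have e : θ l (π v) = ∑ p : I, π v p • θ l fun j => if p = j then 1 else 0 :=
        LinearMap.pi_apply_eq_sum_univ _ _
      have h4 : ENNReal.ofReal (ν F (θ l (π v))) ≤ ∑ p : I, ENNReal.ofReal (ν F (π v p)) *
          ENNReal.ofReal (ν F (θ l fun j => if p = j then 1 else 0)) := by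
        rw [e]
        refine (ENNReal.ofReal_le_ofReal ((ν F).sum_le _ _)).trans ?_
        rw [ENNReal.ofReal_sum_of_nonneg fun _ _ => (ν F).nonneg _]
        refine Finset.sum_le_sum fun p _ => ?_
        rw [smul_eq_mul, map_mul, ENNReal.ofReal_mul ((ν F).nonneg _)]
      refine h4.trans (le_trans ?_ (mul_le_mul' (Finset.single_le_sum
        (f := fun l => ∑ p : I, ENNReal.ofReal (ρ ^ (-(p.2 : ℤ))) *
          ENNReal.ofReal (ν F (θ l fun j => if p = j then 1 else 0)))
        (fun _ _ => zero_le) (Finset.mem_univ l)) le_rfl))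
      rw [Finset.sum_mul]
      refine Finset.sum_le_sum fun p _ => ?_
      rw [mul_right_comm]
      refine mul_le_mul' ?_ le_rfl
      exact (coeff_le_rnorm hρ _ _).trans (mul_le_mul' le_rfl (rnorm_le_vrn b ρ v p.1))

theorem IsVar.exists_expansion [FiniteDimensional F V] {N : V → ℝ} {z : AAut V} {δ : ℝ}
    (h : IsVar C F N z δ) {u : Cˣ} (hu : ν F (u : C) = 1) (hz : IsSemi F u z) :
    ∃ (L : ℕ) (g : Fin L → V), (∀ l, N (g l) ≤ 1) ∧
      (∀ c : Fin L → C, N (∑ l, cst F (c l) • g l) ≤ (2 : ℝ) ^ (-δ) → c = 0) ∧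
      ∀ v, N v ≤ 1 → ∃ (f : Fin L → F) (w : Fin L → V),
        (∀ l, Evals (C := C) F N z δ (ι (f l)) (g l) (w l)) ∧ v = ∑ l, w l := by
  set b := Module.finBasis F V
  have hN := h.adm
  obtain ⟨L, g, θ, hg, hdig, hind, hbd⟩ := h.exists_digits b
  refine ⟨L, g, hg, hind, fun v hv => ?_⟩
  let step : V → V := fun v => z⁻¹ • (v - ∑ l, cst F (θ l v) • g l)
  let s : ℕ → V := fun k => step^[k] v
  have hs : ∀ k, z • s (k + 1) = s k - ∑ l, cst F (θ l (s k)) • g l := fun k => by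
    simp only [s, Function.iterate_succ_apply', step, smul_inv_smul]
  have hsN : ∀ k, N (s k) ≤ 1 := by
    intro k
    induction k with
    | zero => exact hv
    | succ k ih =>
      have h1 := hdig _ ih
      rw [← hs, h.scale] at h1
      exact le_of_mul_le_mul_left (by simpa using h1) (by positivity : (0 : ℝ) < 2 ^ (-δ))
  have htel : ∀ K : ℕ, v = ∑ l, act F z (∑ k ∈ Finset.range K,
      AddMonoidAlgebra.single (k : ℤ) (θ l (s k))) (g l) + z ^ (K : ℤ) • s K := by
    intro K
    induction K with
    | zero => simp [s]
    | succ K ih =>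
      conv_lhs => rw [ih]
      have e : s K = (∑ l, cst F (θ l (s K)) • g l) + z • s (K + 1) := by rw [hs]; abel
      conv_lhs => rw [e]
      simp only [Finset.sum_range_succ, act_add, Finset.sum_add_distrib, smul_add, Finset.smul_sum,
        h.comm_zpow, act_single]
      rw [← mul_smul, ← zpow_add_one, Nat.cast_add, Nat.cast_one, add_assoc]
  have hfin : ∀ l, ∀ᶠ ρ in nhdsWithin (0 : ℝ) (Set.Ioi 0), vrn C b ρ (g l) < ⊤ :=
    fun l => eventually_vrn b _
  simp only [← Filter.eventually_all] at hfin
  obtain ⟨ρ, ⟨⟨hr1, hr2⟩, hr3⟩, hρ⟩ := (((hfin.and (eventually_vrn (C := C) b v)).and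
    (eventually_arn (C := C) b z⁻¹)).and self_mem_nhdsWithin).exists
  have hρ : 0 < ρ := hρ
  obtain ⟨B, hB, hθ⟩ := hbd ρ hρ
  set H : ENNReal := arn C b ρ z⁻¹ * (1 + B * ∑ l, vrn C b ρ (g l)) with hH
  have hHtop : H ≠ ⊤ := (ENNReal.mul_lt_top hr3 (ENNReal.add_lt_top.2 ⟨ENNReal.one_lt_top,
    ENNReal.mul_lt_top hB (ENNReal.sum_lt_top.2 fun l _ => hr1 l)⟩)).ne
  have hui : ν F ((u⁻¹ : Cˣ) : C) = 1 := by simpa using ν_zpow (F := F) hu (-1)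
  have hvs : ∀ k, vrn C b ρ (s k) ≤ H ^ k * vrn C b ρ v := by
    intro k
    induction k with
    | zero => simp [s]
    | succ k ih =>
      have e : s (k + 1) = z⁻¹ • (s k + -∑ l, cst F (θ l (s k)) • g l) := by
        rw [eq_inv_smul_iff, hs, sub_eq_add_neg]
      rw [e]
      refine (vrn_semi_le b hρ hui hz.inv _).trans ?_
      calc _ ≤ arn C b ρ z⁻¹ * (vrn C b ρ (s k) +
            ∑ l, B * vrn C b ρ (s k) * vrn C b ρ (g l)) := by
            refine mul_le_mul' le_rfl ((vrn_add_le b hρ _ _).trans (add_le_add le_rfl ?_))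
            rw [vrn_neg]
            refine (vrn_sum_le b hρ _ _).trans (Finset.sum_le_sum fun l _ => ?_)
            exact (vrn_cst_smul_le b hρ _ _).trans (mul_le_mul' (hθ l _) le_rfl)
        _ = H * vrn C b ρ (s k) := by rw [← Finset.mul_sum, hH]; ring
        _ ≤ H * (H ^ k * vrn C b ρ v) := mul_le_mul' le_rfl ih
        _ = _ := by rw [pow_succ]; ring
  have hreal : ∀ l k, ν F (θ l (s k)) ≤ (B * vrn C b ρ v).toReal * (H.toReal + 1) ^ k := by
    intro l k
    have h1 : ENNReal.ofReal (ν F (θ l (s k))) ≤ (B * vrn C b ρ v) * H ^ k :=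
      (hθ l _).trans ((mul_le_mul' le_rfl (hvs k)).trans_eq (by ring))
    have h2 := ENNReal.toReal_mono (ENNReal.mul_lt_top (ENNReal.mul_lt_top hB hr2)
      (ENNReal.pow_lt_top hHtop.lt_top)).ne h1
    rw [ENNReal.toReal_ofReal ((ν F).nonneg _), ENNReal.toReal_mul, ENNReal.toReal_pow] at h2
    exact h2.trans (by gcongr; linarith)
  let f' : Fin L → LaurentSeries C := fun l => HahnSeries.ofSuppBddBelow
    (fun k : ℤ => if 0 ≤ k then θ l (s k.toNat) else 0) ⟨0, fun k hk => by
      by_contra h'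
      exact hk (if_neg h')⟩
  have hf'c : ∀ l k, (f' l).coeff k = if 0 ≤ k then θ l (s k.toNat) else 0 := fun _ _ => rfl
  have hf : ∀ l, ∃ f : F, ι f = f' l := fun l => by
    refine exists_ι_eq (A := (B * vrn C b ρ v).toReal) (B := H.toReal + 1)
      (by have := ENNReal.toReal_nonneg (a := H); linarith) fun k => ?_
    rw [hf'c]
    split_ifs with hk
    · have := hreal l k.toNat
      rwa [← zpow_natCast, Int.toNat_of_nonneg hk] at this
    · rw [map_zero]
      have := ENNReal.toReal_nonneg (a := H)
      have := ENNReal.toReal_nonneg (a := B * vrn C b ρ v)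
      positivity
  choose f hf using hf
  choose w hw using fun l => h.exists_evals hu hz (f l) (g l)
  refine ⟨f, w, hw, ?_⟩
  rw [← sub_eq_zero]
  refine hN.eq_zero (le_antisymm (le_of_forall_pos_le_add fun ε hε => ?_) (hN.nonneg _))
  rw [zero_add]
  obtain ⟨K, hK⟩ := exists_pow_lt_of_lt_one hε
    (Real.rpow_lt_one_of_one_lt_of_neg one_lt_two (neg_lt_zero.2 h.pos))
  have hKpow : (2 : ℝ) ^ (-δ * ((K : ℤ) : ℝ)) = ((2 : ℝ) ^ (-δ)) ^ K := by
    rw [Int.cast_natCast, Real.rpow_mul two_pos.le, Real.rpow_natCast]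
  have e : v - ∑ l, w l = z ^ (K : ℤ) • s K - ∑ l, (w l - act F z (∑ k ∈ Finset.range K,
      AddMonoidAlgebra.single (k : ℤ) (θ l (s k))) (g l)) := by
    rw [Finset.sum_sub_distrib]
    conv_lhs => rw [htel K]
    abel
  rw [e]
  refine (hN.sub_le _ _).trans (max_le ?_ (hN.sum_le _ _ hε.le fun l _ => ?_))
  · rw [norm_zpow_of_scale h.scale, hKpow]
    exact (mul_le_of_le_one_right (by positivity) (hsN K)).trans hK.le
  · refine (hw l _).trans ?_
    have h1 : labs (ι (f l) - laur C (∑ k ∈ Finset.range K,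
        AddMonoidAlgebra.single (k : ℤ) (θ l (s k)))) ≤ (2 : ℝ) ^ (-(K : ℤ)) := by
      rw [labs_le_iff]
      intro k hk
      rw [HahnSeries.coeff_sub, hf, hf'c, map_sum, HahnSeries.coeff_sum]
      simp only [laur_single]
      split_ifs with h0
      · rw [Finset.sum_eq_single k.toNat]
        · rw [Int.toNat_of_nonneg h0, HahnSeries.coeff_single_same, sub_self]
        · intro j _ hj
          rw [HahnSeries.coeff_single_of_ne]
          omega
        · intro h'
          rw [Finset.mem_range] at h'
          omega
      · rw [Finset.sum_eq_zero, sub_zero]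
        intro j _
        rw [HahnSeries.coeff_single_of_ne]
        omega
    refine (mul_le_of_le_one_right (Real.rpow_nonneg (labs_nonneg _) _) (hg l)).trans ?_
    refine (Real.rpow_le_rpow (labs_nonneg _) h1 h.pos.le).trans (le_trans (le_of_eq ?_) hK.le)
    rw [← hKpow, ← Real.rpow_intCast, ← Real.rpow_mul two_pos.le]
    congr 1; push_cast; ring

theorem IsVar.norm_lower_bound {N : V → ℝ} {z : AAut V} {δ : ℝ}
    (h : IsVar C F N z δ) {L : ℕ} {g : Fin L → V} (hg : ∀ l, N (g l) ≤ 1)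
    (hind : ∀ c : Fin L → C, N (∑ l, cst F (c l) • g l) ≤ (2 : ℝ) ^ (-δ) → c = 0)
    {f : Fin L → LaurentSeries C} {w : Fin L → V} (hw : ∀ l, Evals F N z δ (f l) (g l) (w l))
    (l : Fin L) : labs (f l) ^ δ ≤ (2 : ℝ) ^ δ * N (∑ l, w l) := by
  have hN := h.adm
  rcases eq_or_ne (f l) 0 with h0 | h0
  · rw [h0, labs_zero, Real.zero_rpow h.pos.ne']
    exact mul_nonneg (by positivity) (hN.nonneg _)
  obtain ⟨j, -, hj⟩ := Finset.exists_max_image Finset.univ (fun l => labs (f l)) ⟨l, Finset.mem_univ _⟩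
  have hj : ∀ i, labs (f i) ≤ labs (f j) := fun i => hj i (Finset.mem_univ i)
  have hj0 : f j ≠ 0 := by
    intro h'
    have h1 := (labs_pos h0).trans_le (hj l)
    rw [h', labs_zero] at h1
    exact lt_irrefl _ h1
  set K := (f j).order with hK
  have hjK : labs (f j) = (2 : ℝ) ^ (-K) := labs_of_ne hj0
  refine (Real.rpow_le_rpow (labs_nonneg _) (hj l) h.pos.le).trans ?_
  by_contra hlt
  push Not at hlt
  have hpw : labs (f j) ^ δ = (2 : ℝ) ^ (-δ * (K : ℝ)) := by
    rw [hjK, ← Real.rpow_intCast, ← Real.rpow_mul two_pos.le]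
    congr 1; push_cast; ring
  have hsmall : ∀ i, labs (f i - laur C (AddMonoidAlgebra.single K ((f i).coeff K))) ≤
      (2 : ℝ) ^ (-(K + 1)) := by
    intro i
    rw [labs_le_iff]
    intro k hk
    rw [HahnSeries.coeff_sub, laur_single]
    rcases (show k ≤ K by omega).lt_or_eq with h1 | rfl
    · have h2 := hj i
      rw [hjK, labs_le_iff] at h2
      rw [h2 k h1, HahnSeries.coeff_single_of_ne h1.ne, sub_zero]
    · rw [HahnSeries.coeff_single_same, sub_self]
  have e2 : (2 : ℝ) ^ (-δ * (K : ℝ)) = (2 : ℝ) ^ δ * (2 : ℝ) ^ (-δ * ((K : ℝ) + 1)) := by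
    rw [← Real.rpow_add two_pos]; congr 1; ring
  have h1 : N (∑ l, w l) ≤ (2 : ℝ) ^ (-δ * ((K : ℝ) + 1)) := by
    rw [hpw, e2] at hlt
    exact (lt_of_mul_lt_mul_left hlt (by positivity)).le
  have h2 : N (∑ i, (w i - act F z (AddMonoidAlgebra.single K ((f i).coeff K)) (g i))) ≤
      (2 : ℝ) ^ (-δ * ((K : ℝ) + 1)) := by
    refine hN.sum_le _ _ (by positivity) fun i _ => (hw i _).trans ?_
    refine (mul_le_of_le_one_right (Real.rpow_nonneg (labs_nonneg _) _) (hg i)).trans ?_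
    refine (Real.rpow_le_rpow (labs_nonneg _) (hsmall i) h.pos.le).trans_eq ?_
    rw [← Real.rpow_intCast, ← Real.rpow_mul two_pos.le]
    congr 1; push_cast; ring
  have h3 : N (z ^ K • ∑ i, cst F ((f i).coeff K) • g i) ≤ (2 : ℝ) ^ (-δ * ((K : ℝ) + 1)) := by
    have e : z ^ K • ∑ i, cst F ((f i).coeff K) • g i = ∑ i, w i -
        ∑ i, (w i - act F z (AddMonoidAlgebra.single K ((f i).coeff K)) (g i)) := by
      rw [Finset.sum_sub_distrib, sub_sub_cancel, Finset.smul_sum]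
      exact Finset.sum_congr rfl fun i _ => by rw [act_single, h.comm_zpow]
    rw [e]
    exact (hN.sub_le _ _).trans (max_le h1 h2)
  rw [norm_zpow_of_scale h.scale, show -δ * ((K : ℝ) + 1) = -δ * (K : ℝ) + -δ by ring,
    Real.rpow_add two_pos] at h3
  have h4 := hind _ (le_of_mul_le_mul_left h3 (by positivity))
  have h5 := congrFun h4 j
  exact HahnSeries.coeff_order_eq_zero.not.2 hj0 h5

end Digits

section Space

/-- A semilinear automorphism `z` of `V` that behaves like a variable. -/
structure VarData (C : Type u) [NormedField C] (F : Type w) [Field F] [GrowthField C F]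
    (V : Type v) [AddCommGroup V] [Module F V] where
  N : V → ℝ
  z : AAut V
  δ : ℝ
  isVar : IsVar C F N z δ
  u : Cˣ
  ν_eq : ν F (u : C) = 1
  semi : IsSemi F u z

variable {C : Type u} [NormedField C] {F : Type w} [Field F] [GrowthField C F]
  {V : Type v} [AddCommGroup V] [Module F V]

namespace VarData

/-- The group `V`, on which `x` will act through `z`. -/
@[nolint unusedArguments]
def Space (_ : VarData C F V) : Type v := V

variable (D : VarData C F V)

instance : AddCommGroup D.Space := inferInstanceAs (AddCommGroup V)

/-- The identity, as a map to the space with the new variable. -/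
def of : V ≃+ D.Space := AddEquiv.refl V

variable [FiniteDimensional F V]

/-- The value `f(z) v`. -/
def ev (f : F) (v : V) : V := (D.isVar.exists_evals D.ν_eq D.semi f v).choose

theorem evals_ev (f : F) (v : V) : Evals (C := C) F D.N D.z D.δ (ι f) v (D.ev f v) :=
  (D.isVar.exists_evals D.ν_eq D.semi f v).choose_spec

theorem ev_eq {f : F} {v w : V} (h : Evals (C := C) F D.N D.z D.δ (ι f) v w) : D.ev f v = w :=
  D.isVar.evals_unique (D.evals_ev f v) h

theorem ev_single (k : ℤ) (c : C) (v : V) :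
    D.ev (cst F c * xvar C F ^ k) v = cst F c • (D.z ^ k • v) := by
  refine D.ev_eq ?_
  have := D.isVar.evals_poly (AddMonoidAlgebra.single k c) v
  rwa [act_single, ← ι_polyF F, polyF_single] at this

instance : Module F D.Space where
  smul f v := D.of (D.ev f (D.of.symm v))
  one_smul v := by
    change D.of (D.ev 1 (D.of.symm v)) = v
    have := D.ev_single 0 1 (D.of.symm v)
    rw [map_one, one_mul, zpow_zero, one_smul, zpow_zero, one_smul] at this
    rw [this, AddEquiv.apply_symm_apply]
  mul_smul f g v := by
    refine congrArg D.of (D.ev_eq ?_)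
    rw [map_mul]
    exact D.isVar.evals_mul (D.evals_ev f _) (D.evals_ev g _)
  smul_zero f := by
    change D.of (D.ev f 0) = 0
    have h := (D.evals_ev f 0).norm_le
    rw [D.isVar.adm.map_zero, mul_zero] at h
    rw [D.isVar.adm.eq_zero (le_antisymm h (D.isVar.adm.nonneg _)), map_zero]
  smul_add f v w := by
    change D.of (D.ev f (D.of.symm (v + w))) = D.of (D.ev f (D.of.symm v)) + D.of (D.ev f (D.of.symm w))
    rw [map_add, ← map_add D.of]
    exact congrArg D.of (D.ev_eq (D.isVar.evals_add_right (D.evals_ev f _) (D.evals_ev f _)))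
  add_smul f g v := by
    change D.of (D.ev (f + g) (D.of.symm v)) = D.of (D.ev f (D.of.symm v)) + D.of (D.ev g (D.of.symm v))
    rw [← map_add D.of]
    refine congrArg D.of (D.ev_eq ?_)
    rw [map_add]
    exact D.isVar.evals_add_left (D.evals_ev f _) (D.evals_ev g _)
  zero_smul v := by
    change D.of (D.ev 0 (D.of.symm v)) = 0
    have h := (D.evals_ev 0 (D.of.symm v)).norm_le
    rw [RingHom.map_zero, labs_zero, Real.zero_rpow D.isVar.pos.ne', zero_mul] at h
    rw [D.isVar.adm.eq_zero (le_antisymm h (D.isVar.adm.nonneg _)), AddEquiv.map_zero]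

theorem smul_of (f : F) (v : V) : f • D.of v = D.of (D.ev f v) := rfl

theorem cst_smul_of (c : C) (v : V) : cst F c • D.of v = D.of (cst F c • v) := by
  have := D.ev_single 0 c v
  rw [zpow_zero, mul_one, zpow_zero, one_smul] at this
  rw [smul_of, this]

theorem xvar_zpow_smul_of (k : ℤ) (v : V) : xvar C F ^ k • D.of v = D.of (D.z ^ k • v) := by
  have := D.ev_single k 1 v
  rw [map_one, one_mul, one_smul] at this
  rw [smul_of, this]

theorem xvar_smul_of (v : V) : xvar C F • D.of v = D.of (D.z • v) := by
  simpa using D.xvar_zpow_smul_of 1 v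

theorem N_ev (f : F) (v : V) : D.N (D.ev f v) = fabs C f ^ D.δ * D.N v := by
  rcases eq_or_ne f 0 with rfl | hf
  · have h : D.ev (0 : F) v = 0 := D.of.injective (by
      rw [← smul_of, zero_smul, AddEquiv.map_zero])
    rw [h, fabs_zero, Real.zero_rpow D.isVar.pos.ne', zero_mul, D.isVar.adm.map_zero]
  refine le_antisymm (D.evals_ev f v).norm_le ?_
  have h1 := (D.evals_ev f⁻¹ (D.ev f v)).norm_le
  have h2 : D.ev f⁻¹ (D.ev f v) = v := D.of.injective (by
    rw [← smul_of, ← smul_of, smul_smul, inv_mul_cancel₀ hf, one_smul])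
  have hp : 0 < fabs C f ^ D.δ := Real.rpow_pos_of_pos (fabs_pos hf) _
  change _ ≤ fabs C f⁻¹ ^ D.δ * _ at h1
  rw [h2, fabs_inv, Real.inv_rpow (fabs_nonneg _)] at h1
  calc fabs C f ^ D.δ * D.N v ≤ fabs C f ^ D.δ * ((fabs C f ^ D.δ)⁻¹ * D.N (D.ev f v)) := by gcongr
    _ = _ := by rw [← mul_assoc, mul_inv_cancel₀ hp.ne', one_mul]

theorem exists_basis : ∃ (L : ℕ) (b : Module.Basis (Fin L) F D.Space),
    ∀ v i, fabs C (b.repr (D.of v) i) ^ D.δ ≤ (2 : ℝ) ^ D.δ * D.N v := by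
  obtain ⟨L, g, hg, hind, hexp⟩ := D.isVar.exists_expansion D.ν_eq D.semi
  have hlow : ∀ f : Fin L → F, ∀ l, fabs C (f l) ^ D.δ ≤
      (2 : ℝ) ^ D.δ * D.N (∑ l, D.ev (f l) (g l)) := fun f l =>
    D.isVar.norm_lower_bound hg hind (fun l => D.evals_ev (f l) (g l)) l
  have hsum : ∀ f : Fin L → F, ∑ l, f l • D.of (g l) = D.of (∑ l, D.ev (f l) (g l)) := fun f => by
    rw [map_sum]; rfl
  have hli : LinearIndependent F (fun l => D.of (g l)) := by
    rw [Fintype.linearIndependent_iff]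
    intro f hf l
    rw [hsum, AddEquiv.map_eq_zero_iff] at hf
    have h1 := hlow f l
    rw [hf, D.isVar.adm.map_zero, mul_zero] at h1
    have h2 := (Real.rpow_eq_zero (fabs_nonneg _) D.isVar.pos.ne').1
      (le_antisymm h1 (Real.rpow_nonneg (fabs_nonneg _) _))
    exact fabs_eq_zero.1 h2
  have hspan : ⊤ ≤ Submodule.span F (Set.range fun l => D.of (g l)) := by
    intro v _
    obtain ⟨v, rfl⟩ := D.of.surjective v
    obtain ⟨K, hK⟩ := exists_pow_lt_of_lt_one
      (show 0 < 1 / (D.N v + 1) by have := D.isVar.adm.nonneg v; positivity)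
      (Real.rpow_lt_one_of_one_lt_of_neg one_lt_two (neg_lt_zero.2 D.isVar.pos))
    have h1 : D.N (D.z ^ (K : ℤ) • v) ≤ 1 := by
      rw [norm_zpow_of_scale D.isVar.scale, Int.cast_natCast, Real.rpow_mul two_pos.le,
        Real.rpow_natCast]
      have h0 := D.isVar.adm.nonneg v
      rw [lt_div_iff₀ (by positivity)] at hK
      have : 0 < ((2 : ℝ) ^ (-D.δ)) ^ K := by positivity
      nlinarith
    obtain ⟨f, w, hw, hv⟩ := hexp _ h1
    have h2 : D.of (D.z ^ (K : ℤ) • v) ∈ Submodule.span F (Set.range fun l => D.of (g l)) := by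
      rw [hv, map_sum]
      refine Submodule.sum_mem _ fun l _ => ?_
      rw [← D.ev_eq (hw l), ← smul_of]
      exact Submodule.smul_mem _ _ (Submodule.subset_span ⟨l, rfl⟩)
    rw [← xvar_zpow_smul_of] at h2
    exact (Submodule.smul_mem_iff _ (zpow_ne_zero _ xvar_ne_zero)).1 h2
  refine ⟨L, Module.Basis.mk hli hspan, fun v i => ?_⟩
  set b := Module.Basis.mk hli hspan
  have h3 := hlow (fun l => b.repr (D.of v) l) i
  have h4 : D.of (∑ l, D.ev (b.repr (D.of v) l) (g l)) = D.of v := by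
    rw [← hsum]
    conv_rhs => rw [← b.sum_repr (D.of v)]
    exact Finset.sum_congr rfl fun l _ => by rw [Module.Basis.mk_apply]
  rwa [D.of.injective h4] at h3

instance : FiniteDimensional F D.Space :=
  let ⟨_, b, _⟩ := D.exists_basis
  b.finiteDimensional_of_finite

/-- The norm for which `x` has absolute value `1/2`. -/
def norm (v : D.Space) : ℝ := D.N (D.of.symm v) ^ D.δ⁻¹

omit [FiniteDimensional F V] in
theorem norm_of (v : V) : D.norm (D.of v) = D.N v ^ D.δ⁻¹ := rfl

theorem norm_isAdm : IsAdm C F D.norm := by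
  obtain ⟨L, b, hb⟩ := D.exists_basis
  have hN := D.isVar.adm
  have hδ : 0 ≤ D.δ⁻¹ := inv_nonneg.2 D.isVar.pos.le
  refine (basisNorm_isAdm (C := C) b (r := fun _ => 1) fun _ => one_pos).of_le
    (fun v => Real.rpow_nonneg (hN.nonneg _) _) (fun v w => ?_) (fun f v => ?_) (D := 2) fun v => ?_
  · change D.N (D.of.symm (v + w)) ^ D.δ⁻¹ ≤
      max (D.N (D.of.symm v) ^ D.δ⁻¹) (D.N (D.of.symm w) ^ D.δ⁻¹)
    rw [map_add]
    refine (Real.rpow_le_rpow (hN.nonneg _) (hN.add_le _ _) hδ).trans ?_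
    rcases le_total (D.N (D.of.symm v)) (D.N (D.of.symm w)) with h | h
    · rw [max_eq_right h]; exact le_max_right _ _
    · rw [max_eq_left h]; exact le_max_left _ _
  · obtain ⟨v, rfl⟩ := D.of.surjective v
    rw [smul_of, norm_of, norm_of, N_ev, Real.mul_rpow (Real.rpow_nonneg (fabs_nonneg _) _)
      (hN.nonneg _), Real.rpow_rpow_inv (fabs_nonneg _) D.isVar.pos.ne']
  · obtain ⟨v, rfl⟩ := D.of.surjective v
    rw [norm_of]
    refine basisNorm_le _ _ _ (mul_nonneg two_pos.le (Real.rpow_nonneg (hN.nonneg _) _)) fun i => ?_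
    rw [mul_one]
    have h := Real.rpow_le_rpow (Real.rpow_nonneg (fabs_nonneg _) _) (hb v i) hδ
    rwa [Real.rpow_rpow_inv (fabs_nonneg _) D.isVar.pos.ne', Real.mul_rpow (by positivity)
      (hN.nonneg _), Real.rpow_rpow_inv two_pos.le D.isVar.pos.ne'] at h

omit [FiniteDimensional F V] in
theorem norm_small_iff : ∀ ε > 0, ∃ η > 0, ∀ v, D.N v ≤ η → D.norm (D.of v) ≤ ε := by
  intro ε hε
  refine ⟨ε ^ D.δ, Real.rpow_pos_of_pos hε _, fun v hv => ?_⟩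
  rw [norm_of, ← Real.rpow_rpow_inv hε.le D.isVar.pos.ne']
  exact Real.rpow_le_rpow (D.isVar.adm.nonneg _) hv (inv_nonneg.2 D.isVar.pos.le)

omit [FiniteDimensional F V] in
theorem N_small : ∀ ε > 0, ∃ η > 0, ∀ v, D.norm v ≤ η → D.N (D.of.symm v) ≤ ε := by
  intro ε hε
  refine ⟨ε ^ D.δ⁻¹, Real.rpow_pos_of_pos hε _, fun v hv => ?_⟩
  exact (Real.rpow_le_rpow_iff (D.isVar.adm.nonneg _) hε.le (inv_pos.2 D.isVar.pos)).1 hv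

end VarData

end Space

/-- The integral Heisenberg group. -/
@[ext] structure Heis where
  e : ℤ
  i : ℤ
  j : ℤ

namespace Heis

instance : Mul Heis := ⟨fun g h => ⟨g.e + h.e + g.j * h.i, g.i + h.i, g.j + h.j⟩⟩
instance : One Heis := ⟨⟨0, 0, 0⟩⟩
instance : Inv Heis := ⟨fun g => ⟨-g.e + g.i * g.j, -g.i, -g.j⟩⟩

@[simp] theorem mul_e (g h : Heis) : (g * h).e = g.e + h.e + g.j * h.i := rfl
@[simp] theorem mul_i (g h : Heis) : (g * h).i = g.i + h.i := rfl
@[simp] theorem mul_j (g h : Heis) : (g * h).j = g.j + h.j := rfl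
@[simp] theorem one_e : (1 : Heis).e = 0 := rfl
@[simp] theorem one_i : (1 : Heis).i = 0 := rfl
@[simp] theorem one_j : (1 : Heis).j = 0 := rfl
@[simp] theorem inv_e (g : Heis) : g⁻¹.e = -g.e + g.i * g.j := rfl
@[simp] theorem inv_i (g : Heis) : g⁻¹.i = -g.i := rfl
@[simp] theorem inv_j (g : Heis) : g⁻¹.j = -g.j := rfl

instance : Group Heis := Group.ofLeftAxioms
  (fun a b c => by ext <;> simp <;> ring) (fun a => by ext <;> simp) (fun a => by ext <;> simp <;> ring)

/-- The first generator. -/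
def x : Heis := ⟨0, 1, 0⟩
/-- The second generator. -/
def y : Heis := ⟨0, 0, 1⟩
/-- The central generator. -/
def c : Heis := ⟨1, 0, 0⟩

/-- The first exponent. -/
def iHom : Heis →* Multiplicative ℤ where
  toFun g := Multiplicative.ofAdd g.i
  map_one' := rfl
  map_mul' _ _ := rfl

/-- The second exponent. -/
def jHom : Heis →* Multiplicative ℤ where
  toFun g := Multiplicative.ofAdd g.j
  map_one' := rfl
  map_mul' _ _ := rfl

theorem zpow_i (g : Heis) (n : ℤ) : (g ^ n).i = n * g.i := by
  have := congrArg Multiplicative.toAdd (map_zpow iHom g n)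
  simpa [iHom] using this

theorem zpow_j (g : Heis) (n : ℤ) : (g ^ n).j = n * g.j := by
  have := congrArg Multiplicative.toAdd (map_zpow jHom g n)
  simpa [jHom] using this

theorem c_zpow (n : ℤ) : c ^ n = ⟨n, 0, 0⟩ := by
  induction n using Int.induction_on with
  | zero => rfl
  | succ n ih => rw [zpow_add_one, ih]; ext <;> simp [c]
  | pred n ih => rw [zpow_sub_one, ih]; ext <;> simp [c]; rfl

theorem x_zpow (n : ℤ) : x ^ n = ⟨0, n, 0⟩ := by
  induction n using Int.induction_on with
  | zero => rfl
  | succ n ih => rw [zpow_add_one, ih]; ext <;> simp [x]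
  | pred n ih => rw [zpow_sub_one, ih]; ext <;> simp [x]; rfl

theorem y_zpow (n : ℤ) : y ^ n = ⟨0, 0, n⟩ := by
  induction n using Int.induction_on with
  | zero => rfl
  | succ n ih => rw [zpow_add_one, ih]; ext <;> simp [y]
  | pred n ih => rw [zpow_sub_one, ih]; ext <;> simp [y]; rfl

theorem eq_word (g : Heis) : g = c ^ g.e * x ^ g.i * y ^ g.j := by
  rw [c_zpow, x_zpow, y_zpow]; ext <;> simp

theorem c_eq : c = y * x * y⁻¹ * x⁻¹ := by
  ext <;> simp [c, x, y]

theorem induction {p : Heis → Prop} (hx : p x) (hy : p y) (hinv : ∀ g, p g → p g⁻¹)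
    (hmul : ∀ g h, p g → p h → p (g * h)) (g : Heis) : p g := by
  have h1 : p 1 := by rw [← mul_inv_cancel x]; exact hmul _ _ hx (hinv _ hx)
  have hz : ∀ h, p h → ∀ n : ℤ, p (h ^ n) := by
    intro h hh n
    induction n using Int.induction_on with
    | zero => rw [zpow_zero]; exact h1
    | succ n ih => rw [zpow_add_one]; exact hmul _ _ ih hh
    | pred n ih => rw [zpow_sub_one]; exact hmul _ _ ih (hinv _ hh)
  have hc : p c := by
    rw [c_eq]
    exact hmul _ _ (hmul _ _ (hmul _ _ hy hx) (hinv _ hy)) (hinv _ hx)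
  rw [eq_word g]
  exact hmul _ _ (hmul _ _ (hz _ hc _) (hz _ hx _)) (hz _ hy _)

theorem hom_ext {G : Type*} [Group G] {f g : Heis →* G} (hx : f x = g x) (hy : f y = g y) : f = g :=
  MonoidHom.ext (induction hx hy (fun h hh => by rw [map_inv, map_inv, hh])
    fun h k hh hk => by rw [map_mul, map_mul, hh, hk])

section Lift

variable {G : Type*} [Group G] {X Y Z : G}

theorem zpow_mul_zpow (hX : Commute Z X) (hY : Commute Z Y) (h : Y * X = Z * X * Y) (i j : ℤ) :
    Y ^ j * X ^ i = Z ^ (j * i) * X ^ i * Y ^ j := by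
  have h1 : SemiconjBy Y X (Z * X) := h
  have h2 : Y * X ^ i = Z ^ i * X ^ i * Y := by
    have := h1.zpow_right i
    rwa [hX.mul_zpow] at this
  have h3 : SemiconjBy (X ^ i)⁻¹ Y (Z ^ i * Y) := by
    refine SemiconjBy.inv_symm_left ?_
    change X ^ i * (Z ^ i * Y) = Y * X ^ i
    rw [h2, ← mul_assoc, (hX.zpow_zpow i i).eq]
  have h4 := h3.zpow_right j
  rw [(hY.zpow_left i).mul_zpow, ← zpow_mul] at h4
  have h5 : (X ^ i)⁻¹ * Y ^ j = Z ^ (i * j) * Y ^ j * (X ^ i)⁻¹ := h4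
  rw [inv_mul_eq_iff_eq_mul] at h5
  calc Y ^ j * X ^ i = X ^ i * (Z ^ (i * j) * Y ^ j * (X ^ i)⁻¹) * X ^ i := by rw [← h5]
    _ = X ^ i * Z ^ (i * j) * Y ^ j := by group
    _ = _ := by rw [← (hX.zpow_zpow (i * j) i).eq, mul_comm i j]

/-- The homomorphism determined by the images of the generators. -/
def lift (X Y Z : G) (hX : Commute Z X) (hY : Commute Z Y) (h : Y * X = Z * X * Y) : Heis →* G where
  toFun g := Z ^ g.e * X ^ g.i * Y ^ g.j
  map_one' := by simp
  map_mul' g k := by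
    simp only [mul_e, mul_i, mul_j, zpow_add]
    have e1 := zpow_mul_zpow hX hY h k.i g.j
    have e2 : Commute (Z ^ (g.j * k.i)) (X ^ g.i) := hX.zpow_zpow _ _
    have e3 : Commute (Z ^ k.e) (X ^ g.i * Y ^ g.j) :=
      (hX.zpow_zpow _ _).mul_right (hY.zpow_zpow _ _)
    calc Z ^ g.e * Z ^ k.e * Z ^ (g.j * k.i) * (X ^ g.i * X ^ k.i) * (Y ^ g.j * Y ^ k.j)
        = Z ^ g.e * Z ^ k.e * (Z ^ (g.j * k.i) * X ^ g.i) * X ^ k.i * Y ^ g.j * Y ^ k.j := by group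
      _ = Z ^ g.e * Z ^ k.e * X ^ g.i * (Z ^ (g.j * k.i) * X ^ k.i * Y ^ g.j) * Y ^ k.j := by
          rw [e2.eq]; group
      _ = Z ^ g.e * (Z ^ k.e * (X ^ g.i * Y ^ g.j)) * X ^ k.i * Y ^ k.j := by rw [← e1]; group
      _ = _ := by rw [e3.eq]; group

variable (hX : Commute Z X) (hY : Commute Z Y) (h : Y * X = Z * X * Y)

theorem lift_apply (g : Heis) : lift X Y Z hX hY h g = Z ^ g.e * X ^ g.i * Y ^ g.j := rfl
@[simp] theorem lift_x : lift X Y Z hX hY h x = X := by simp [lift_apply, x]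
@[simp] theorem lift_y : lift X Y Z hX hY h y = Y := by simp [lift_apply, y]
@[simp] theorem lift_c : lift X Y Z hX hY h c = Z := by simp [lift_apply, c]

end Lift

theorem commute_c (g : Heis) : Commute c g := by
  change c * g = g * c
  ext <;> simp [c, add_comm]

end Heis

/-- A pair of elements of the Heisenberg group that satisfy the relation of the generators. -/
structure Frame where
  α : Heis
  β : Heis
  det : α.i * β.j - α.j * β.i = 1

namespace Frame
open Heis

theorem rel (t : Frame) : t.β * t.α = c * t.α * t.β := by
  have := t.det
  ext
  · simp [c]; linarith
  · simp [c]; ring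
  · simp [c]; ring

/-- The endomorphism of the Heisenberg group attached to a frame. -/
def hom (t : Frame) : Heis →* Heis := lift t.α t.β c (commute_c _) (commute_c _) t.rel

@[simp] theorem hom_x (t : Frame) : t.hom x = t.α := lift_x _ _ _
@[simp] theorem hom_y (t : Frame) : t.hom y = t.β := lift_y _ _ _
@[simp] theorem hom_c (t : Frame) : t.hom c = c := lift_c _ _ _

theorem exists_right_inverse (t : Frame) : ∃ t' : Frame, t'.α.i = t.β.j ∧ t'.α.j = -t.α.j ∧
    t'.β.i = -t.β.i ∧ t'.β.j = t.α.i ∧ t.hom.comp t'.hom = MonoidHom.id _ := by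
  have hd := t.det
  set e₀ := (t.α ^ t.β.j * t.β ^ (-t.α.j)).e
  set e₁ := (t.α ^ (-t.β.i) * t.β ^ t.α.i).e
  refine ⟨⟨c ^ (-e₀) * (x ^ t.β.j * y ^ (-t.α.j)), c ^ (-e₁) * (x ^ (-t.β.i) * y ^ t.α.i), ?_⟩,
    ?_, ?_, ?_, ?_, ?_⟩
  · simp [zpow_i, zpow_j, c, x, y]; linarith
  · simp [zpow_i, c, x, y]
  · simp [zpow_j, c, x, y]
  · simp [zpow_i, c, x, y]
  · simp [zpow_j, c, x, y]
  · refine hom_ext ?_ ?_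
    · rw [MonoidHom.comp_apply, hom_x, MonoidHom.id_apply]
      simp only [map_mul, map_zpow, hom_x, hom_y, hom_c]
      rw [c_zpow]
      ext
      · rw [mul_e]; simp [x, e₀]; ring
      · simp [zpow_i, x]; linarith
      · simp [zpow_j, x]; ring
    · rw [MonoidHom.comp_apply, hom_y, MonoidHom.id_apply]
      simp only [map_mul, map_zpow, hom_x, hom_y, hom_c]
      rw [c_zpow]
      ext
      · rw [mul_e]; simp [y, e₁]; ring
      · simp [zpow_i, y]; ring
      · simp [zpow_j, y]; linarith

theorem exists_inverse (t : Frame) : ∃ t' : Frame, t'.α.i = t.β.j ∧ t'.α.j = -t.α.j ∧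
    t'.β.i = -t.β.i ∧ t'.β.j = t.α.i ∧ t.hom.comp t'.hom = MonoidHom.id _ ∧
    t'.hom.comp t.hom = MonoidHom.id _ := by
  obtain ⟨t', h1, h2, h3, h4, h⟩ := t.exists_right_inverse
  obtain ⟨t'', -, -, -, -, h'⟩ := t'.exists_right_inverse
  refine ⟨t', h1, h2, h3, h4, h, ?_⟩
  have e : t.hom = t''.hom := by
    calc t.hom = t.hom.comp (t'.hom.comp t''.hom) := by rw [h']; rfl
      _ = (t.hom.comp t'.hom).comp t''.hom := rfl
      _ = t''.hom := by rw [h]; rfl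
  rw [e, h']

theorem hom_surjective (t : Frame) : Function.Surjective t.hom := fun g =>
  let ⟨t', _, _, _, _, h, _⟩ := t.exists_inverse
  ⟨t'.hom g, DFunLike.congr_fun h g⟩

end Frame

section Rep

variable {C : Type u} [NormedField C] (q : Cˣ) {F : Type w} [Field F] [GrowthField C F]
  {σ : F ≃+* F}

theorem IsSemi.comm_cst {V : Type v} [AddCommGroup V] [Module F V] {u : Cˣ} {z : AAut V}
    (hz : IsSemi F u z) (c : C) (v : V) : z • (cst F c • v) = cst F c • (z • v) :=
  hz _ _ (by rw [ι_cst, shift_single]; simp) v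

variable (F) in
/-- A nonzero constant, as a unit of `F`. -/
def cstUnit : Cˣ →* Fˣ := Units.map (cst F : C →+* F).toMonoidHom

variable [hσ : IsShift q σ]
include hσ

omit hσ in
theorem commute_cst_xAut (V : Type v) [AddCommGroup V] [Module F V] :
    Commute (scalarAut V (cstUnit F q)) (xAut (C := C) (F := F) V) :=
  Units.ext (AddMonoidHom.ext fun v => smul_comm (cst F (q : C)) (xvar C F) v)

theorem commute_cst_phi (M : QDiffModule.{w, v} F σ) :
    Commute (scalarAut M.carrier (cstUnit F q)) (phi M) :=
  Units.ext (AddMonoidHom.ext fun v => ((phi_semi q M).comm_cst (q : C) v).symm)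

theorem phi_mul_xAut (M : QDiffModule.{w, v} F σ) : phi M * xAut (C := C) (F := F) M.carrier =
    scalarAut M.carrier (cstUnit F q) * xAut (C := C) (F := F) M.carrier * phi M :=
  Units.ext (AddMonoidHom.ext fun v => by
    change M.Φ (xvar C F • v) = cst F (q : C) • (xvar C F • M.Φ v)
    rw [M.Φ.map_smulₛₗ, smul_smul, ← shift_xvar q (σ := σ)]
    rfl)

/-- The action of the Heisenberg group on a `q`-difference module, by `x` and `Φ`. -/
def heis (M : QDiffModule.{w, v} F σ) : Heis →* AAut M.carrier :=
  Heis.lift (xAut (C := C) (F := F) M.carrier) (phi M) (scalarAut M.carrier (cstUnit F q))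
    (commute_cst_xAut q M.carrier) (commute_cst_phi q M) (phi_mul_xAut q M)

theorem heis_x (M : QDiffModule.{w, v} F σ) (v : M.carrier) :
    heis q M Heis.x • v = xvar C F • v := by
  rw [heis, Heis.lift_x]; rfl

theorem heis_y (M : QDiffModule.{w, v} F σ) (v : M.carrier) : heis q M Heis.y • v = M.Φ v := by
  rw [heis, Heis.lift_y]; rfl

theorem heis_c (M : QDiffModule.{w, v} F σ) :
    heis q M Heis.c = scalarAut M.carrier (cstUnit F q) := by
  rw [heis, Heis.lift_c]

theorem heis_c_smul (M : QDiffModule.{w, v} F σ) (v : M.carrier) :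
    heis q M Heis.c • v = cst F (q : C) • v := by
  rw [heis_c]; rfl

omit hσ in
theorem isSemi_scalarAut {V : Type v} [AddCommGroup V] [Module F V] (f : Fˣ) :
    IsSemi F (1 : Cˣ) (scalarAut V f) := by
  intro g g' h v
  rw [shift_one] at h
  rw [ι_injective h, scalarAut_smul, scalarAut_smul, smul_comm]

theorem heis_semi (M : QDiffModule.{w, v} F σ) (g : Heis) : IsSemi F (q ^ g.j) (heis q M g) := by
  have h1 : (ν F : AbsoluteValue C ℝ) ((1 : Cˣ) : C) = 1 := by simp
  have hx : ∀ f : Fˣ, ∀ n : ℤ, IsSemi F (1 : Cˣ) (scalarAut M.carrier f ^ n) := fun f n => by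
    simpa using (isSemi_scalarAut (V := M.carrier) f).zpow h1 n
  have := ((hx (cstUnit F q) g.e).mul h1 (hx (xunit C F) g.i)).mul (ν_zpow hσ.ν_eq g.j)
    ((phi_semi q M).zpow hσ.ν_eq g.j)
  rw [one_mul, one_mul] at this
  exact this

omit hσ in
/-- Maps that commute with `x` and `Φ` commute with the Heisenberg group. -/
theorem heis_equivariant {V W : Type*} [AddCommGroup V] [AddCommGroup W] (ρ : Heis →* AAut V)
    (ρ' : Heis →* AAut W) (f : V → W) (hx : ∀ v, f (ρ Heis.x • v) = ρ' Heis.x • f v)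
    (hy : ∀ v, f (ρ Heis.y • v) = ρ' Heis.y • f v) (g : Heis) (v : V) :
    f (ρ g • v) = ρ' g • f v := by
  revert v
  refine Heis.induction (p := fun g => ∀ v, f (ρ g • v) = ρ' g • f v) hx hy (fun g hg v => ?_)
    (fun g h hg hh v => ?_) g
  · rw [map_inv, map_inv, eq_inv_smul_iff, ← hg, smul_inv_smul]
  · rw [map_mul, map_mul, mul_smul, mul_smul, hg, hh]

variable (C) in
/-- An admissible norm for which `Φ` is a similarity of ratio `2 ^ μ`. -/
structure PureNorm {F : Type w} [Field F] [GrowthField C F] {σ : F ≃+* F}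
    (M : QDiffModule.{w, v} F σ) (μ : ℝ) where
  N : M.carrier → ℝ
  adm : IsAdm C F N
  scale : ∀ v, N (M.Φ v) = (2 : ℝ) ^ μ * N v

omit hσ in
theorem normPure_iff_nonempty (M : QDiffModule.{w, v} F σ) (μ : ℝ) :
    NormPure C M μ ↔ Nonempty (PureNorm C M μ) :=
  ⟨fun ⟨N, h, h'⟩ => ⟨⟨N, h, h'⟩⟩, fun ⟨P⟩ => ⟨P.N, P.adm, P.scale⟩⟩

theorem PureNorm.heis {M : QDiffModule.{w, v} F σ} {μ : ℝ} (P : PureNorm C M μ) (g : Heis)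
    (v : M.carrier) : P.N (heis q M g • v) = (2 : ℝ) ^ (-(g.i : ℝ) + μ * g.j) * P.N v := by
  revert v
  refine Heis.induction (p := fun g => ∀ v, P.N (QDiff.heis q M g • v) =
    (2 : ℝ) ^ (-(g.i : ℝ) + μ * g.j) * P.N v) (fun v => ?_) (fun v => ?_) (fun g hg v => ?_)
    (fun g h hg hh v => ?_) g
  · rw [heis_x, P.adm.smul, fabs_xvar]
    simp [Heis.x, Real.rpow_neg_one]
  · rw [heis_y, P.scale]
    simp [Heis.y]
  · have := hg ((QDiff.heis q M g)⁻¹ • v)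
    rw [smul_inv_smul] at this
    rw [map_inv, this, ← mul_assoc, ← Real.rpow_add two_pos, Heis.inv_i, Heis.inv_j,
      show -((-g.i : ℤ) : ℝ) + μ * ((-g.j : ℤ) : ℝ) + (-(g.i : ℝ) + μ * g.j) = 0 by push_cast; ring,
      Real.rpow_zero, one_mul]
  · rw [map_mul, mul_smul, hg, hh, ← mul_assoc, ← Real.rpow_add two_pos]
    congr 2; simp; ring

end Rep

section ScaleVar

variable {C : Type u} [NormedField C] {F : Type w} [Field F] [GrowthField C F]
  {V : Type v} [AddCommGroup V] [Module F V]

theorem act_scalar_mul {z : AAut V} {s : AAut V} {u : Cˣ} (hs : ∀ v : V, s • v = cst F (u : C) • v)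
    (hz : ∀ v : V, z • (s • v) = s • (z • v)) (P : AddMonoidAlgebra C ℤ) :
    ∃ P' : AddMonoidAlgebra C ℤ, laur C P' = shift u (laur C P) ∧
      ∀ v : V, act F (s * z) P v = act F z P' v := by
  have hpow : ∀ (k : ℤ) (v : V), s ^ k • v = cst F ((u ^ k : Cˣ) : C) • v := by
    have h1 : s = scalarAut V (cstUnit F u) := Units.ext (AddMonoidHom.ext hs)
    intro k v
    have : scalarAut V (cstUnit F u) ^ k = scalarAut V (cstUnit F (u ^ k)) := by
      rw [map_zpow, scalarAut, ← map_zpow]; rfl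
    rw [h1, this]; rfl
  have hc : Commute s z := Units.ext (AddMonoidHom.ext fun v => (hz v).symm)
  induction P using AddMonoidAlgebra.induction_linear with
  | zero => exact ⟨0, by simp, by simp⟩
  | add P Q hP hQ =>
    obtain ⟨P', h1, h2⟩ := hP
    obtain ⟨Q', h3, h4⟩ := hQ
    exact ⟨P' + Q', by rw [map_add, h1, h3, map_add, map_add],
      fun v => by rw [act_add, act_add, h2, h4]⟩
  | single k c =>
    refine ⟨AddMonoidAlgebra.single k (((u ^ k : Cˣ) : C) * c), ?_, fun v => ?_⟩
    · rw [laur_single, laur_single, shift_single]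
    · rw [act_single, act_single, hc.mul_zpow, mul_smul, hpow, smul_smul, ← map_mul, mul_comm]

theorem Evals.of_scalar_mul {N : V → ℝ} {z s : AAut V} {δ : ℝ} {u : Cˣ}
    (hs : ∀ v : V, s • v = cst F (u : C) • v) (h : IsVar C F N z δ) {f : LaurentSeries C} {v w : V}
    (hE : Evals F N (s * z) δ f v w) : Evals F N z δ (shift u f) v w := by
  refine h.evals_of_approx fun ε hε => ?_
  obtain ⟨P, -, h1, h2⟩ := exists_approx f h.pos le_rfl (h.adm.nonneg v) hε
  obtain ⟨P', h3, h4⟩ := act_scalar_mul (F := F) (z := z) hs (fun v => by rw [hs, hs, h.comm]) P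
  refine ⟨P', ?_, ?_⟩
  · rw [h3, ← map_sub, shift_order]; exact h2
  · rw [← h4]; exact (hE P).trans h1

end ScaleVar

section Twist

variable {C : Type u} [NormedField C] (q : Cˣ) {F : Type w} [Field F] [GrowthField C F]
  {σ : F ≃+* F} [hσ : IsShift q σ]
include hσ

theorem PureNorm.isVar {M : QDiffModule.{w, v} F σ} {μ : ℝ} (P : PureNorm C M μ) (g : Heis)
    (hg : 0 < (g.i : ℝ) - μ * g.j) : IsVar C F P.N (QDiff.heis q M g) (g.i - μ * g.j) where
  adm := P.adm
  pos := hg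
  comm c v := (heis_semi q M g).comm_cst c v
  scale v := by rw [P.heis q g v]; congr 2; ring

/-- A pure module with the new variable given by the first vector of a frame. -/
def pureVar {M : QDiffModule.{w, v} F σ} {μ : ℝ} (P : PureNorm C M μ) (t : Frame)
    (ht : 0 < (t.α.i : ℝ) - μ * t.α.j) : VarData C F M.carrier where
  N := P.N
  z := heis q M t.α
  δ := t.α.i - μ * t.α.j
  isVar := P.isVar q t.α ht
  u := q ^ t.α.j
  ν_eq := ν_zpow hσ.ν_eq _
  semi := heis_semi q M t.α

variable {M : QDiffModule.{w, v} F σ} {μ : ℝ} (P : PureNorm C M μ) (t : Frame)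
  (ht : 0 < (t.α.i : ℝ) - μ * t.α.j)

theorem heis_β_ev (f : F) (v : M.carrier) : heis q M t.β • (pureVar q P t ht).ev f v =
    (pureVar q P t ht).ev (σ f) (heis q M t.β • v) := by
  set D := pureVar q P t ht
  refine (D.ev_eq ?_).symm
  rw [hσ.map_shift]
  have hv := D.isVar
  have hs : ∀ v : M.carrier, heis q M Heis.c • v = cst F (q : C) • v := heis_c_smul q M
  have hv' : IsVar C F D.N (heis q M Heis.c * D.z) D.δ :=
    { adm := hv.adm
      pos := hv.pos
      comm := fun c v => by rw [mul_smul, mul_smul, hv.comm, hs, hs, smul_comm]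
      scale := fun v => by rw [mul_smul, hs, hv.adm.smul, fabs_cst q.ne_zero, one_mul, hv.scale] }
  refine Evals.of_scalar_mul hs hv ?_
  refine hv.evals_map hv' (DistribSMul.toAddMonoidHom M.carrier (heis q M t.β))
    (fun c v => (heis_semi q M t.β).comm_cst c v) (fun v => ?_) (fun ε hε => ?_) (D.evals_ev f v)
  · change heis q M t.β • (heis q M t.α • v) = (heis q M Heis.c * heis q M t.α) • (heis q M t.β • v)
    rw [← mul_smul, ← map_mul, t.rel, map_mul, map_mul, mul_smul]
  · refine ⟨ε / (2 : ℝ) ^ (-(t.β.i : ℝ) + μ * t.β.j), by positivity, fun v hv => ?_⟩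
    change P.N (heis q M t.β • v) ≤ ε
    rw [P.heis q]
    rwa [le_div_iff₀' (by positivity)] at hv

/-- The pure module `M`, with the variable and the operator given by the frame `t`. -/
def twist : QDiffModule.{w, v} F σ where
  carrier := (pureVar q P t ht).Space
  Φ :=
    { toFun := fun v => (pureVar q P t ht).of (heis q M t.β • (pureVar q P t ht).of.symm v)
      map_add' := fun v w => by rw [map_add, smul_add, map_add]
      map_smul' := fun f v => congrArg (pureVar q P t ht).of
        (heis_β_ev q P t ht f ((pureVar q P t ht).of.symm v)) }
  bijective := (pureVar q P t ht).of.bijective.comp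
    ((MulAction.bijective (heis q M t.β)).comp (pureVar q P t ht).of.symm.bijective)

/-- The identity, as a map to the twisted module. -/
def toTwist : M.carrier ≃+ (twist q P t ht).carrier := (pureVar q P t ht).of

theorem toTwist_cst (c : C) (v : M.carrier) :
    toTwist q P t ht (cst F c • v) = cst F c • toTwist q P t ht v :=
  ((pureVar q P t ht).cst_smul_of c v).symm

theorem heis_twist (g : Heis) (v : M.carrier) :
    toTwist q P t ht (heis q M (t.hom g) • v) = heis q (twist q P t ht) g • toTwist q P t ht v := by
  refine heis_equivariant ((heis q M).comp t.hom) (heis q (twist q P t ht)) (toTwist q P t ht)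
    (fun v => ?_) (fun v => ?_) g v
  · rw [MonoidHom.comp_apply, Frame.hom_x, heis_x]
    exact ((pureVar q P t ht).xvar_smul_of v).symm
  · rw [MonoidHom.comp_apply, Frame.hom_y, heis_y]
    rfl

/-- The norm of the twisted module. -/
def twistNorm : PureNorm C (twist q P t ht)
    ((-(t.β.i : ℝ) + μ * t.β.j) / (t.α.i - μ * t.α.j)) where
  N := (pureVar q P t ht).norm
  adm := (pureVar q P t ht).norm_isAdm
  scale v := by
    obtain ⟨v, rfl⟩ := (toTwist q P t ht).surjective v
    have e : (twist q P t ht).Φ (toTwist q P t ht v) = toTwist q P t ht (heis q M t.β • v) := rfl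
    rw [e]
    change P.N (heis q M t.β • v) ^ _ = _ * P.N v ^ _
    rw [P.heis q, Real.mul_rpow (by positivity) (P.adm.nonneg _), ← Real.rpow_mul two_pos.le]
    rfl

theorem twistNorm_small : ∀ ε > 0, ∃ η > 0, ∀ v, P.N v ≤ η →
    (twistNorm q P t ht).N (toTwist q P t ht v) ≤ ε := (pureVar q P t ht).norm_small_iff

theorem untwist_small : ∀ ε > 0, ∃ η > 0, ∀ v, (twistNorm q P t ht).N v ≤ η →
    P.N ((toTwist q P t ht).symm v) ≤ ε := (pureVar q P t ht).N_small

omit hσ in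
/-- A bounded additive map has the required continuity. -/
theorem small_of_bound {V W : Type*} {N : V → ℝ} {N' : W → ℝ} {g : V → W} {D : ℝ} (hD : 0 < D)
    (h : ∀ v, N' (g v) ≤ D * N v) : ∀ ε > 0, ∃ η > 0, ∀ v, N v ≤ η → N' (g v) ≤ ε := by
  intro ε hε
  refine ⟨ε / D, by positivity, fun v hv => (h v).trans ?_⟩
  rwa [le_div_iff₀' hD] at hv

/-- Continuous maps that commute with the constants and with the Heisenberg group are morphisms. -/
def homOfHeis {L L' : QDiffModule.{w, v} F σ} {N : L.carrier → ℝ} (hN : IsAdm C F N)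
    {N' : L'.carrier → ℝ} (hN' : IsAdm C F N') (g : L.carrier →+ L'.carrier)
    (hc : ∀ (c : C) v, g (cst F c • v) = cst F c • g v)
    (hg : ∀ a v, g (heis q L a • v) = heis q L' a • g v)
    (hs : ∀ ε > 0, ∃ η > 0, ∀ v, N v ≤ η → N' (g v) ≤ ε) : L ⟶ L' where
  toLinearMap :=
    { toFun := g
      map_add' := map_add g
      map_smul' := fun f v => linear_of_comm (C := C) hN hN' g hc
        (fun v => by have := hg Heis.x v; rwa [heis_x, heis_x] at this) hs rfl v }
  comm v := by have := hg Heis.y v; rwa [heis_y, heis_y] at this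

theorem lin_heis {L L' : QDiffModule.{w, v} F σ} (f : L ⟶ L') (a : Heis) (v : L.carrier) :
    QDiffModule.lin f (heis q L a • v) = heis q L' a • QDiffModule.lin f v :=
  heis_equivariant (heis q L) (heis q L') (QDiffModule.lin f)
    (fun v => by rw [heis_x, heis_x, map_smul]) (fun v => by rw [heis_y, heis_y, lin_Φ]) a v

variable {M' : QDiffModule.{w, v} F σ} {μ' : ℝ} (P' : PureNorm C M' μ')
  (ht' : 0 < (t.α.i : ℝ) - μ' * t.α.j)

/-- Twisted morphisms. -/
def twistMap (f : M ⟶ M') : twist q P t ht ⟶ twist q P' t ht' :=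
  homOfHeis q (twistNorm q P t ht).adm (twistNorm q P' t ht').adm
    ((toTwist q P' t ht').toAddMonoidHom.comp ((QDiffModule.lin f).toAddMonoidHom.comp
      (toTwist q P t ht).symm.toAddMonoidHom))
    (fun c v => by
      obtain ⟨v, rfl⟩ := (toTwist q P t ht).surjective v
      rw [← toTwist_cst q P t ht]
      change toTwist q P' t ht' (QDiffModule.lin f ((toTwist q P t ht).symm
        (toTwist q P t ht (cst F c • v)))) = cst F c • toTwist q P' t ht' (QDiffModule.lin f
          ((toTwist q P t ht).symm (toTwist q P t ht v)))
      rw [AddEquiv.symm_apply_apply, AddEquiv.symm_apply_apply, map_smul, toTwist_cst])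
    (fun a v => by
      obtain ⟨v, rfl⟩ := (toTwist q P t ht).surjective v
      rw [← heis_twist q P t ht]
      change toTwist q P' t ht' (QDiffModule.lin f ((toTwist q P t ht).symm
        (toTwist q P t ht (heis q M (t.hom a) • v)))) = heis q (twist q P' t ht') a •
          toTwist q P' t ht' (QDiffModule.lin f ((toTwist q P t ht).symm (toTwist q P t ht v)))
      rw [AddEquiv.symm_apply_apply, AddEquiv.symm_apply_apply, lin_heis, heis_twist])
    (fun ε hε => by
      obtain ⟨D, hD, h⟩ := P.adm.exists_bound_linear P'.adm (QDiffModule.lin f)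
      obtain ⟨η, hη, h1⟩ := twistNorm_small q P' t ht' ε hε
      obtain ⟨η', hη', h2⟩ := small_of_bound hD h η hη
      obtain ⟨η'', hη'', h3⟩ := untwist_small q P t ht η' hη'
      exact ⟨η'', hη'', fun v hv => h1 _ (h2 _ (h3 v hv))⟩)

theorem twistMap_apply (f : M ⟶ M') (v : M.carrier) :
    QDiffModule.lin (twistMap q P t ht P' ht' f) (toTwist q P t ht v) =
      toTwist q P' t ht' (QDiffModule.lin f v) := rfl

/-- Untwisted morphisms. -/
def untwistMap (f : twist q P t ht ⟶ twist q P' t ht') : M ⟶ M' :=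
  homOfHeis q P.adm P'.adm
    ((toTwist q P' t ht').symm.toAddMonoidHom.comp ((QDiffModule.lin f).toAddMonoidHom.comp
      (toTwist q P t ht).toAddMonoidHom))
    (fun c v => by
      apply (toTwist q P' t ht').injective
      simp [toTwist_cst])
    (fun a v => by
      obtain ⟨a, rfl⟩ := t.hom_surjective a
      apply (toTwist q P' t ht').injective
      simp [lin_heis, heis_twist])
    (fun ε hε => by
      obtain ⟨D, hD, h⟩ := (twistNorm q P t ht).adm.exists_bound_linear (twistNorm q P' t ht').adm
        (QDiffModule.lin f)
      obtain ⟨η, hη, h1⟩ := untwist_small q P' t ht' ε hε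
      obtain ⟨η', hη', h2⟩ := small_of_bound hD h η hη
      obtain ⟨η'', hη'', h3⟩ := twistNorm_small q P t ht η' hη'
      exact ⟨η'', hη'', fun v hv => h1 _ (h2 _ (h3 v hv))⟩)

theorem untwistMap_apply (f : twist q P t ht ⟶ twist q P' t ht') (v : M.carrier) :
    toTwist q P' t ht' (QDiffModule.lin (untwistMap q P t ht P' ht' f) v) =
      QDiffModule.lin f (toTwist q P t ht v) := rfl

omit hσ [GrowthField C F] [NormedField C] in
theorem hom_ext_apply {L L' : QDiffModule.{w, v} F σ} {f g : L ⟶ L'}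
    (h : ∀ v, QDiffModule.lin f v = QDiffModule.lin g v) : f = g :=
  QDiffModule.Hom.ext (LinearMap.ext h)

omit hσ [GrowthField C F] [NormedField C] in
theorem lin_comp_apply {L L' L'' : QDiffModule.{w, v} F σ} (f : L ⟶ L') (g : L' ⟶ L'')
    (v : L.carrier) : QDiffModule.lin (f ≫ g) v = QDiffModule.lin g (QDiffModule.lin f v) := rfl

/-- Isomorphic modules have isomorphic twists. -/
def twistIso (e : M ≅ M') : twist q P t ht ≅ twist q P' t ht' where
  hom := twistMap q P t ht P' ht' e.hom
  inv := twistMap q P' t ht' P ht e.inv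
  hom_inv_id := hom_ext_apply fun v => by
    obtain ⟨v, rfl⟩ := (toTwist q P t ht).surjective v
    rw [lin_comp_apply, twistMap_apply, twistMap_apply, ← lin_comp_apply, e.hom_inv_id]; rfl
  inv_hom_id := hom_ext_apply fun v => by
    obtain ⟨v, rfl⟩ := (toTwist q P' t ht').surjective v
    rw [lin_comp_apply, twistMap_apply, twistMap_apply, ← lin_comp_apply, e.inv_hom_id]; rfl

/-- Modules with isomorphic twists are isomorphic. -/
def untwistIso (e : twist q P t ht ≅ twist q P' t ht') : M ≅ M' where
  hom := untwistMap q P t ht P' ht' e.hom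
  inv := untwistMap q P' t ht' P ht e.inv
  hom_inv_id := hom_ext_apply fun v => (toTwist q P t ht).injective (by
    rw [lin_comp_apply, untwistMap_apply, untwistMap_apply, ← lin_comp_apply, e.hom_inv_id]; rfl)
  inv_hom_id := hom_ext_apply fun v => (toTwist q P' t ht').injective (by
    rw [lin_comp_apply, untwistMap_apply, untwistMap_apply, ← lin_comp_apply, e.inv_hom_id]; rfl)

/-- The twists by inverse frames are inverse to each other. -/
theorem twist_twist {ν : ℝ} (P₁ : PureNorm C (twist q P t ht) ν) (t' : Frame)
    (ht' : 0 < (t'.α.i : ℝ) - ν * t'.α.j) (h : t.hom.comp t'.hom = MonoidHom.id _) :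
    Nonempty (twist q P₁ t' ht' ≅ M) := by
  have key : ∀ (a : Heis) (v : M.carrier), toTwist q P₁ t' ht' (toTwist q P t ht (heis q M a • v)) =
      heis q (twist q P₁ t' ht') a • toTwist q P₁ t' ht' (toTwist q P t ht v) := by
    intro a v
    rw [← heis_twist, ← heis_twist, show t.hom (t'.hom a) = a from DFunLike.congr_fun h a]
  obtain ⟨D, hD, hb⟩ := (twistNorm q P t ht).adm.exists_bound_linear P₁.adm LinearMap.id
  obtain ⟨D', hD', hb'⟩ := P₁.adm.exists_bound_linear (twistNorm q P t ht).adm LinearMap.id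
  refine ⟨⟨homOfHeis q (twistNorm q P₁ t' ht').adm P.adm ((toTwist q P t ht).symm.toAddMonoidHom.comp
      (toTwist q P₁ t' ht').symm.toAddMonoidHom) (fun c v => ?_) (fun a v => ?_) (fun ε hε => ?_),
    homOfHeis q P.adm (twistNorm q P₁ t' ht').adm ((toTwist q P₁ t' ht').toAddMonoidHom.comp
      (toTwist q P t ht).toAddMonoidHom) (fun c v => ?_) (fun a v => key a v) (fun ε hε => ?_),
    hom_ext_apply fun v => ?_, hom_ext_apply fun v => ?_⟩⟩
  · obtain ⟨v, rfl⟩ := (toTwist q P₁ t' ht').surjective v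
    obtain ⟨v, rfl⟩ := (toTwist q P t ht).surjective v
    rw [← toTwist_cst, ← toTwist_cst]
    simp
  · obtain ⟨v, rfl⟩ := (toTwist q P₁ t' ht').surjective v
    obtain ⟨v, rfl⟩ := (toTwist q P t ht).surjective v
    rw [← key]
    simp
  · obtain ⟨η, hη, h1⟩ := untwist_small q P t ht ε hε
    obtain ⟨η', hη', h2⟩ := small_of_bound hD' hb' η hη
    obtain ⟨η'', hη'', h3⟩ := untwist_small q P₁ t' ht' η' hη'
    exact ⟨η'', hη'', fun v hv => h1 _ (h2 _ (h3 v hv))⟩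
  · change toTwist q P₁ t' ht' (toTwist q P t ht (cst F c • v)) = _
    rw [toTwist_cst, toTwist_cst]; rfl
  · obtain ⟨η, hη, h1⟩ := twistNorm_small q P₁ t' ht' ε hε
    obtain ⟨η', hη', h2⟩ := small_of_bound hD hb η hη
    obtain ⟨η'', hη'', h3⟩ := twistNorm_small q P t ht η' hη'
    exact ⟨η'', hη'', fun v hv => h1 _ (h2 _ (h3 v hv))⟩
  · change toTwist q P₁ t' ht' (toTwist q P t ht ((toTwist q P t ht).symm
      ((toTwist q P₁ t' ht').symm v))) = v
    rw [AddEquiv.apply_symm_apply, AddEquiv.apply_symm_apply]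
  · change (toTwist q P t ht).symm ((toTwist q P₁ t' ht').symm (toTwist q P₁ t' ht'
      (toTwist q P t ht v))) = v
    rw [AddEquiv.symm_apply_apply, AddEquiv.symm_apply_apply]

end Twist

section Iso

variable {F : Type w} [Field F] {σ : F ≃+* F}

/-- A bijective morphism is an isomorphism. -/
def isoOfBijective {L L' : QDiffModule.{w, v} F σ} (f : L ⟶ L')
    (h : Function.Bijective (QDiffModule.lin f)) : L ≅ L' where
  hom := f
  inv :=
    { toLinearMap := (LinearEquiv.ofBijective (QDiffModule.lin f) h).symm
      comm := fun v => by
        apply h.1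
        rw [lin_Φ]
        have e : ∀ w, QDiffModule.lin f ((LinearEquiv.ofBijective (QDiffModule.lin f) h).symm w) = w :=
          (LinearEquiv.ofBijective (QDiffModule.lin f) h).apply_symm_apply
        change QDiffModule.lin f ((LinearEquiv.ofBijective (QDiffModule.lin f) h).symm _) =
          L'.Φ (QDiffModule.lin f ((LinearEquiv.ofBijective (QDiffModule.lin f) h).symm _))
        rw [e, e] }
  hom_inv_id := hom_ext_apply fun v =>
    (LinearEquiv.ofBijective (QDiffModule.lin f) h).symm_apply_apply v
  inv_hom_id := hom_ext_apply fun v =>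
    (LinearEquiv.ofBijective (QDiffModule.lin f) h).apply_symm_apply v

theorem lin_bijective {L L' : QDiffModule.{w, v} F σ} (e : L ≅ L') :
    Function.Bijective (QDiffModule.lin e.hom) :=
  ⟨Function.LeftInverse.injective (g := QDiffModule.lin e.inv) fun v =>
    DFunLike.congr_fun (congrArg QDiffModule.lin e.hom_inv_id) v,
   Function.RightInverse.surjective (g := QDiffModule.lin e.inv) fun v =>
    DFunLike.congr_fun (congrArg QDiffModule.lin e.inv_hom_id) v⟩

end Iso

section Formal

variable {C : Type u} [NormedField C] {q : Cˣ}

theorem coe_cst (c : C) : (cst (germField C) c).1 = cst (LaurentSeries C) c := by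
  have h1 : (cst (germField C) c).1 = HahnSeries.single 0 c := ι_cst (F := germField C) c
  have h2 : cst (LaurentSeries C) c = HahnSeries.single 0 c := ι_cst (F := LaurentSeries C) c
  rw [h1, h2]

theorem coe_xvar : (xvar C (germField C)).1 = xvar C (LaurentSeries C) := by
  have h1 : (xvar C (germField C)).1 = HahnSeries.single 1 1 := ι_xvar (C := C) (F := germField C)
  have h2 : xvar C (LaurentSeries C) = HahnSeries.single 1 1 := ι_xvar (C := C) (F := LaurentSeries C)
  rw [h1, h2]

/-- Germs are dense in the formal series. -/
theorem exists_germ_approx (f : LaurentSeries C) {ε : ℝ} (hε : 0 < ε) :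
    ∃ g : germField C, fabs C (f - g.1) ≤ ε := by
  obtain ⟨P, -, -, h⟩ := exists_approx f one_pos le_rfl le_rfl hε
  refine ⟨polyF (germField C) P, ?_⟩
  have : (polyF (germField C) P).1 = laur C P := ι_polyF (germField C) P
  rw [this]
  exact h

theorem exists_toFormal_approx (M : Bq q) {N : (formalization q M).carrier → ℝ}
    (hN : IsAdm C (LaurentSeries C) N) (w : (formalization q M).carrier) {ε : ℝ} (hε : 0 < ε) :
    ∃ v, N (w - toFormal q M v) ≤ ε := by
  set b := Module.finBasis (germField C) M.carrier
  set b' := formalBasis q M b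
  choose g hg using fun i => exists_germ_approx (b'.repr w i)
    (show 0 < ε / (N (b' i) + 1) by have := hN.nonneg (b' i); positivity)
  refine ⟨∑ i, g i • b i, ?_⟩
  have e : w - toFormal q M (∑ i, g i • b i) = ∑ i, (b'.repr w i - (g i).1) • b' i := by
    conv_lhs => rw [← b'.sum_repr w]
    rw [map_sum, ← Finset.sum_sub_distrib]
    refine Finset.sum_congr rfl fun i _ => ?_
    rw [toFormal_smul, sub_smul, formalBasis_apply]
  rw [e]
  refine hN.sum_le _ _ hε.le fun i _ => ?_
  have h0 := hN.nonneg (b' i)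
  have h1 := hg i
  rw [le_div_iff₀ (by positivity)] at h1
  rw [hN.smul]
  have := fabs_nonneg (C := C) (b'.repr w i - (g i).1)
  nlinarith

/-- A formal module containing an analytic module isometrically and densely is its
formalization. -/
theorem nonempty_formalization_iso {L : Bq q} {L' : BqHat q} {N : L.carrier → ℝ}
    (hN : IsAdm C (germField C) N) {N' : L'.carrier → ℝ} (hN' : IsAdm C (LaurentSeries C) N')
    (g : L.carrier →+ L'.carrier) (hg : ∀ (f : germField C) v, g (f • v) = f.1 • g v)
    (hΦ : ∀ v, g (L.Φ v) = L'.Φ (g v)) (hiso : ∀ v, N' (g v) = N v)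
    (hdense : ∀ w, ∀ ε > 0, ∃ v, N' (w - g v) ≤ ε) : Nonempty (formalization q L ≅ L') := by
  set b := Module.finBasis (germField C) L.carrier
  set b' := formalBasis q L b
  set h : (formalization q L).carrier →ₗ[LaurentSeries C] L'.carrier :=
    b'.constr (LaurentSeries C) fun i => g (b i) with hh
  have hh1 : ∀ v, h (toFormal q L v) = g v := by
    intro v
    conv_lhs => rw [← b.sum_repr v]
    conv_rhs => rw [← b.sum_repr v]
    rw [map_sum, map_sum, map_sum]
    refine Finset.sum_congr rfl fun i _ => ?_
    rw [toFormal_smul, map_smul, hg, ← formalBasis_apply, hh, Module.Basis.constr_basis]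
  have hcomm : ∀ w, h ((formalization q L).Φ w) = L'.Φ (h w) := by
    intro w
    rw [← b'.sum_repr w]
    simp only [map_sum]
    refine Finset.sum_congr rfl fun i _ => ?_
    rw [LinearMap.map_smulₛₗ, map_smul, map_smul, LinearMap.map_smulₛₗ, formalBasis_apply,
      ← toFormal_Φ, hh1, hh1, hΦ]
  let f : formalization q L ⟶ L' := ⟨h, hcomm⟩
  refine ⟨isoOfBijective f ⟨?_, ?_⟩⟩
  · change Function.Injective h
    rw [injective_iff_map_eq_zero]
    intro w hw
    choose D hD using fun i => hN.bdd (b.coord i)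
    set S := ∑ i, N (b i) with hS
    have hS0 : 0 ≤ S := Finset.sum_nonneg fun i _ => hN.nonneg _
    refine b'.repr.map_eq_zero_iff.1 (Finsupp.ext fun i => ?_)
    rw [Finsupp.zero_apply, ← fabs_eq_zero (C := C)]
    refine le_antisymm (le_of_forall_pos_le_add fun ε hε => ?_) (fabs_nonneg _)
    rw [zero_add]
    have hη : 0 < ε / ((1 + |D i|) * (1 + S)) := by positivity
    set η := ε / ((1 + |D i|) * (1 + S)) with hηdef
    have hηe : η * ((1 + |D i|) * (1 + S)) = ε := by
      rw [hηdef]; field_simp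
    choose a ha using fun j => exists_germ_approx (b'.repr w j) hη
    have h1 : N (∑ j, a j • b j) ≤ η * S := by
      rw [← hiso, map_sum]
      have e : ∑ j, g (a j • b j) = -∑ j, (b'.repr w j - (a j).1) • g (b j) := by
        have e2 : ∑ j, b'.repr w j • g (b j) = 0 := by
          rw [← hw]
          conv_rhs => rw [← b'.sum_repr w]
          rw [map_sum]
          exact Finset.sum_congr rfl fun j _ => by
            rw [map_smul, hh, Module.Basis.constr_basis]
        simp only [sub_smul, Finset.sum_sub_distrib, e2, zero_sub, neg_neg, hg]
      rw [e, hN'.map_neg]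
      refine hN'.sum_le _ _ (by positivity) fun j _ => ?_
      rw [hN'.smul, hiso]
      exact mul_le_mul (ha j) (Finset.single_le_sum (f := fun i => N (b i))
        (fun _ _ => hN.nonneg _) (Finset.mem_univ j)) (hN.nonneg _) hη.le
    have h2 : fabs C (a i) ≤ |D i| * (η * S) := by
      have h3 := hD i (∑ j, a j • b j)
      rw [Module.Basis.coord_apply, b.repr_sum_self] at h3
      exact (h3.trans (mul_le_mul_of_nonneg_right (le_abs_self _) (hN.nonneg _))).trans
        (mul_le_mul_of_nonneg_left h1 (abs_nonneg _))
    have h4 : fabs C (b'.repr w i) ≤ max η (|D i| * (η * S)) := by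
      have e : b'.repr w i = (b'.repr w i - (a i).1) + (a i).1 := by ring
      rw [e]
      exact (fabs_add_le _ _).trans (max_le_max (ha i) h2)
    refine h4.trans (max_le ?_ ?_) <;> nlinarith [mul_nonneg (abs_nonneg (D i)) hS0,
      mul_nonneg hη.le (mul_nonneg (abs_nonneg (D i)) hS0), mul_nonneg hη.le hS0,
      mul_nonneg hη.le (abs_nonneg (D i))]
  · change Function.Surjective h
    rw [← LinearMap.range_eq_top]
    by_contra hne
    obtain ⟨φ, hφ, hφ'⟩ := Submodule.exists_le_ker_of_lt_top _ (lt_top_iff_ne_top.2 hne)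
    apply hφ
    obtain ⟨D, hD⟩ := hN'.bdd φ
    refine LinearMap.ext fun w => ?_
    rw [LinearMap.zero_apply, ← fabs_eq_zero (C := C)]
    refine le_antisymm (le_of_forall_pos_le_add fun ε hε => ?_) (fabs_nonneg _)
    obtain ⟨v, hv⟩ := hdense w (ε / (|D| + 1)) (by positivity)
    have e : φ w = φ (w - g v) := by
      have : φ (h (toFormal q L v)) = 0 := hφ' ⟨_, rfl⟩
      rw [map_sub, ← hh1, this, sub_zero]
    rw [e, zero_add]
    refine (hD _).trans ?_
    rw [le_div_iff₀ (by positivity)] at hv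
    have := hN'.nonneg (w - g v)
    have := le_abs_self D
    nlinarith

/-- The formalization of a morphism. -/
def formalizationMap {M M' : Bq q} (f : M ⟶ M') : formalization q M ⟶ formalization q M' where
  toLinearMap := (QDiffModule.lin f).baseChange (LaurentSeries C)
  comm z := by
    refine TensorProduct.induction_on z ?_ (fun g m => ?_) (fun a b ha hb => ?_)
    · exact (congrArg _ (map_zero (formalization q M).Φ)).trans ((map_zero _).trans
        ((congrArg _ (map_zero _)).trans (map_zero (formalization q M').Φ)).symm)
    · exact congrArg (fun w => (shift q g) ⊗ₜ[germField C] w) (lin_Φ f m)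
    · have e1 := map_add (formalization q M).Φ a b
      have e2 := map_add (formalization q M').Φ ((QDiffModule.lin f).baseChange (LaurentSeries C) a)
        ((QDiffModule.lin f).baseChange (LaurentSeries C) b)
      exact (congrArg _ e1).trans ((map_add _ _ _).trans ((congrArg₂ (· + ·) ha hb).trans
        (e2.symm.trans (congrArg _ (map_add _ _ _).symm))))

theorem formalizationMap_toFormal {M M' : Bq q} (f : M ⟶ M') (v : M.carrier) :
    QDiffModule.lin (formalizationMap f) (toFormal q M v) = toFormal q M' (QDiffModule.lin f v) := rfl

/-- Isomorphic modules have isomorphic formalizations. -/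
def formalizationIso {M M' : Bq q} (e : M ≅ M') : formalization q M ≅ formalization q M' where
  hom := formalizationMap e.hom
  inv := formalizationMap e.inv
  hom_inv_id := by
    refine QDiffModule.Hom.ext ((LinearMap.baseChange_comp (A := LaurentSeries C) _ _).symm.trans ?_)
    have : (QDiffModule.lin e.inv) ∘ₗ (QDiffModule.lin e.hom) = LinearMap.id :=
      congrArg QDiffModule.lin e.hom_inv_id
    rw [this]
    exact LinearMap.baseChange_id
  inv_hom_id := by
    refine QDiffModule.Hom.ext ((LinearMap.baseChange_comp (A := LaurentSeries C) _ _).symm.trans ?_)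
    have : (QDiffModule.lin e.hom) ∘ₗ (QDiffModule.lin e.inv) = LinearMap.id :=
      congrArg QDiffModule.lin e.inv_hom_id
    rw [this]
    exact LinearMap.baseChange_id

/-- The restriction of a norm to the analytic module. -/
def restrictNorm (M : Bq q) {μ : ℝ} (P : PureNorm C (formalization q M) μ) : PureNorm C M μ where
  N v := P.N (toFormal q M v)
  adm :=
    { nonneg := fun v => P.adm.nonneg _
      add_le := fun v w => by rw [map_add]; exact P.adm.add_le _ _
      smul := fun f v => by rw [toFormal_smul, P.adm.smul]; rfl
      bdd := fun φ => by
        set b := Module.finBasis (germField C) M.carrier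
        set b' := formalBasis q M b
        set φ' := b'.constr (LaurentSeries C) fun i => (φ (b i)).1 with hφ'
        obtain ⟨D, hD⟩ := P.adm.bdd φ'
        refine ⟨D, fun v => ?_⟩
        have e : φ' (toFormal q M v) = (φ v).1 := by
          conv_lhs => rw [← b.sum_repr v]
          conv_rhs => rw [← b.sum_repr v]
          rw [map_sum, map_sum, map_sum, AddSubmonoidClass.coe_finsetSum]
          refine Finset.sum_congr rfl fun i _ => ?_
          rw [toFormal_smul, map_smul, ← formalBasis_apply, hφ', Module.Basis.constr_basis, map_smul]
          rfl
        have := hD (toFormal q M v)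
        rw [e] at this
        exact this }
  scale v := by rw [toFormal_Φ, P.scale]

variable [IsShift q (germShift q)]

theorem toFormal_heis (M : Bq q) (g : Heis) (v : M.carrier) :
    toFormal q M (heis q M g • v) = heis q (formalization q M) g • toFormal q M v :=
  heis_equivariant (heis q M) (heis q (formalization q M)) (toFormal q M)
    (fun v => by rw [heis_x, heis_x, toFormal_smul, coe_xvar])
    (fun v => by rw [heis_y, heis_y, toFormal_Φ]) g v

/-- Twists commute with the formalization. -/
theorem formalization_twist (M : Bq q) {μ : ℝ} (P : PureNorm C (formalization q M) μ) (t : Frame)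
    (ht : 0 < (t.α.i : ℝ) - μ * t.α.j) :
    Nonempty (formalization q (twist q (restrictNorm M P) t ht) ≅ twist q P t ht) := by
  set R := restrictNorm M P
  let g : (twist q R t ht).carrier →+ (twist q P t ht).carrier :=
    (toTwist q P t ht).toAddMonoidHom.comp ((toFormal q M).comp
      (toTwist q R t ht).symm.toAddMonoidHom)
  have hg0 : ∀ v, g (toTwist q R t ht v) = toTwist q P t ht (toFormal q M v) := fun v => rfl
  have hheis : ∀ a v, g (heis q (twist q R t ht) a • v) = heis q (twist q P t ht) a • g v := by
    intro a v
    obtain ⟨v, rfl⟩ := (toTwist q R t ht).surjective v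
    rw [← heis_twist, hg0, hg0, ← heis_twist, toFormal_heis]
  have hiso : ∀ v, (twistNorm q P t ht).N (g v) = (twistNorm q R t ht).N v := fun v => rfl
  refine nonempty_formalization_iso (twistNorm q R t ht).adm (twistNorm q P t ht).adm g
    (fun f v => linear_of_comm (C := C) (twistNorm q R t ht).adm (twistNorm q P t ht).adm g
      (fun c v => ?_) (fun v => ?_) (fun ε hε => ⟨ε, hε, fun v hv => ?_⟩) (f := f) (f' := f.1) rfl v)
    (fun v => ?_) hiso (fun w ε hε => ?_)
  · obtain ⟨v, rfl⟩ := (toTwist q R t ht).surjective v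
    rw [← toTwist_cst, hg0, hg0, ← toTwist_cst, toFormal_smul, coe_cst]
  · have := hheis Heis.x v
    rwa [heis_x, heis_x] at this
  · rwa [hiso]
  · have := hheis Heis.y v
    rwa [heis_y, heis_y] at this
  · obtain ⟨w, rfl⟩ := (toTwist q P t ht).surjective w
    obtain ⟨η, hη, h1⟩ := twistNorm_small q P t ht ε hε
    obtain ⟨v, hv⟩ := exists_toFormal_approx M P.adm w hη
    refine ⟨toTwist q R t ht v, ?_⟩
    rw [hg0, ← map_sub]
    exact h1 _ hv

theorem nonempty_formalization_twist_iso (hq : ‖(q : C)‖ = 1)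
    (hroot : ∀ n : ℕ, 0 < n → q ^ n ≠ 1) {M : Bq q} {μ : ℝ} (P : PureNorm C M μ) (t : Frame)
    (ht : 0 < (t.α.i : ℝ) - μ * t.α.j) : ∃ P' : PureNorm C (formalization q M) μ,
      Nonempty (formalization q (twist q P t ht) ≅ twist q P' t ht) := by
  obtain ⟨P'⟩ := (normPure_iff_nonempty _ _).1 ((normPure_formalization_iff hq hroot M μ).2
    ((normPure_iff_nonempty _ _).2 ⟨P⟩))
  obtain ⟨e⟩ := formalization_twist M P' t ht
  exact ⟨P', ⟨formalizationIso (twistIso q P t ht (restrictNorm M P') ht (Iso.refl M)) ≪≫ e⟩⟩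

/-- Formally isomorphic pure modules have formally isomorphic twists, and conversely. -/
theorem formal_twist_iff (hq : ‖(q : C)‖ = 1) (hroot : ∀ n : ℕ, 0 < n → q ^ n ≠ 1)
    {M M' : Bq q} {μ : ℝ} (P : PureNorm C M μ) (P' : PureNorm C M' μ) (t : Frame)
    (ht : 0 < (t.α.i : ℝ) - μ * t.α.j) :
    Nonempty (formalization q (twist q P t ht) ≅ formalization q (twist q P' t ht)) ↔
      Nonempty (formalization q M ≅ formalization q M') := by
  obtain ⟨R, ⟨e⟩⟩ := nonempty_formalization_twist_iso hq hroot P t ht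
  obtain ⟨R', ⟨e'⟩⟩ := nonempty_formalization_twist_iso hq hroot P' t ht
  exact ⟨fun ⟨f⟩ => ⟨untwistIso q R t ht R' ht (e.symm ≪≫ f ≪≫ e')⟩,
    fun ⟨f⟩ => ⟨e ≪≫ twistIso q R t ht R' ht f ≪≫ e'.symm⟩⟩

end Formal

theorem eq_of_iSupIndep_of_le {α : Type*} [CompleteLattice α] [IsModularLattice α] {ι : Type*}
    {A B : ι → α} (hB : iSupIndep B) (h : ∀ i, A i ≤ B i) (hA : ⨆ i, A i = ⊤) : A = B := by
  funext i
  have h1 : A i ⊔ ⨆ (j) (_ : j ≠ i), B j = ⊤ := by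
    rw [eq_top_iff, ← hA]
    refine iSup_le fun j => ?_
    by_cases hj : j = i
    · rw [hj]; exact le_sup_left
    · exact (h j).trans (le_sup_of_le_right (le_iSup₂_of_le j hj le_rfl))
  have h2 := sup_inf_assoc_of_le (⨆ (j) (_ : j ≠ i), B j) (h i)
  rw [h1, top_inf_eq, inf_comm, (hB i).eq_bot, sup_bot_eq] at h2
  exact h2.symm

section Components

variable {C : Type u} [NormedField C] (q : Cˣ) {F : Type w} [Field F] [GrowthField C F]
  {σ : F ≃+* F} [hσ : IsShift q σ]
include hσ

/-- The component of slope `μ`. -/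
def comp (M : QDiffModule.{w, v} F σ) (μ : ℚ) : QDiffModule.{w, v} F σ :=
  M.sub (slopePart q M (μ : ℝ)) (slopePart_stable q M μ)

/-- The inclusion of a component. -/
def compIncl (M : QDiffModule.{w, v} F σ) (μ : ℚ) : comp q M μ ⟶ M :=
  subIncl M (slopePart_stable q M μ)

theorem comp_normPure (M : QDiffModule.{w, v} F σ) (μ : ℚ) : NormPure C (comp q M μ) (μ : ℝ) :=
  slopePart_normPure q M μ

theorem compIncl_injective (M : QDiffModule.{w, v} F σ) (μ : ℚ) :
    Function.Injective (QDiffModule.lin (compIncl q M μ)) := Subtype.val_injective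

theorem lin_mem_slopePart {X M : QDiffModule.{w, v} F σ} {μ : ℝ} (hX : NormPure C X μ) (f : X ⟶ M)
    (v : X.carrier) : QDiffModule.lin f v ∈ slopePart q M μ :=
  slopePart_map q f μ ((normPure_iff q X μ).1 hX ▸ Submodule.mem_top)

/-- A morphism from a pure module factors through the component. -/
def compLift {X M : QDiffModule.{w, v} F σ} {μ : ℚ} (hX : NormPure C X (μ : ℝ)) (f : X ⟶ M) :
    X ⟶ comp q M μ where
  toLinearMap := (QDiffModule.lin f).codRestrict (slopePart q M μ) (lin_mem_slopePart q hX f)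
  comm v := Subtype.ext (lin_Φ f v)

theorem compIncl_compLift {X M : QDiffModule.{w, v} F σ} {μ : ℚ} (hX : NormPure C X (μ : ℝ))
    (f : X ⟶ M) (v : X.carrier) :
    QDiffModule.lin (compIncl q M μ) (QDiffModule.lin (compLift q hX f) v) =
      QDiffModule.lin f v := rfl

/-- The map induced on components. -/
def compMap {M N : QDiffModule.{w, v} F σ} (f : M ⟶ N) (μ : ℚ) : comp q M μ ⟶ comp q N μ :=
  compLift q (comp_normPure q M μ) (compIncl q M μ ≫ f)

theorem compIncl_compMap {M N : QDiffModule.{w, v} F σ} (f : M ⟶ N) (μ : ℚ)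
    (v : (comp q M μ).carrier) :
    QDiffModule.lin (compIncl q N μ) (QDiffModule.lin (compMap q f μ) v) =
      QDiffModule.lin f (QDiffModule.lin (compIncl q M μ) v) := rfl

theorem compMap_id (M : QDiffModule.{w, v} F σ) (μ : ℚ) : compMap q (𝟙 M) μ = 𝟙 _ := rfl

theorem compMap_comp {M N L : QDiffModule.{w, v} F σ} (f : M ⟶ N) (g : N ⟶ L) (μ : ℚ) :
    compMap q (f ≫ g) μ = compMap q f μ ≫ compMap q g μ := rfl

/-- Isomorphic modules have isomorphic components. -/
def compIso {M N : QDiffModule.{w, v} F σ} (e : M ≅ N) (μ : ℚ) : comp q M μ ≅ comp q N μ where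
  hom := compMap q e.hom μ
  inv := compMap q e.inv μ
  hom_inv_id := hom_ext_apply fun v => compIncl_injective q M μ (by
    rw [lin_comp_apply, compIncl_compMap, compIncl_compMap, ← lin_comp_apply, e.hom_inv_id]; rfl)
  inv_hom_id := hom_ext_apply fun v => compIncl_injective q N μ (by
    rw [lin_comp_apply, compIncl_compMap, compIncl_compMap, ← lin_comp_apply, e.inv_hom_id]; rfl)

/-- A family of injective morphisms from pure modules whose images span identifies the
components. -/
theorem nonempty_comp_iso {M : QDiffModule.{w, v} F σ} (X : ℚ → QDiffModule.{w, v} F σ)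
    (hX : ∀ μ, NormPure C (X μ) (μ : ℝ)) (i : ∀ μ, X μ ⟶ M)
    (hi : ∀ μ, Function.Injective (QDiffModule.lin (i μ)))
    (hsup : ⨆ μ, LinearMap.range (QDiffModule.lin (i μ)) = ⊤) (μ : ℚ) :
    Nonempty (X μ ≅ comp q M μ) := by
  have h := eq_of_iSupIndep_of_le (slopePart_iSupIndep q M) (A := fun μ =>
    LinearMap.range (QDiffModule.lin (i μ))) (fun μ => by
      rintro _ ⟨v, rfl⟩
      exact lin_mem_slopePart q (hX μ) (i μ) v) hsup
  refine ⟨isoOfBijective (compLift q (hX μ) (i μ)) ⟨fun v w hvw => hi μ ?_, fun w => ?_⟩⟩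
  · rw [← compIncl_compLift q (hX μ), hvw, compIncl_compLift]
  · have hw : QDiffModule.lin (compIncl q M μ) w ∈ LinearMap.range (QDiffModule.lin (i μ)) := by
      rw [show LinearMap.range (QDiffModule.lin (i μ)) = slopePart q M μ from congrFun h μ]
      exact w.2
    obtain ⟨v, hv⟩ := hw
    exact ⟨v, compIncl_injective q M μ (by rw [compIncl_compLift, hv])⟩

theorem finite_comp (M : QDiffModule.{w, v} F σ) : {μ : ℚ | Nontrivial (comp q M μ).carrier}.Finite := by
  refine (WellFoundedGT.finite_ne_bot_of_iSupIndep (slopePart_iSupIndep q M)).subset fun μ hμ => ?_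
  intro h0
  have h1 : Nontrivial (slopePart q M (μ : ℝ)) := hμ
  rw [Submodule.nontrivial_iff_ne_bot] at h1
  exact h1 h0

variable (hroot : ∀ n : ℕ, 0 < n → q ^ n ≠ 1)
include hroot

theorem slopePart_induction {M : QDiffModule.{w, v} F σ} {p : M.carrier → Prop}
    (mem : ∀ (μ : ℚ) v, p (QDiffModule.lin (compIncl q M μ) v)) (zero : p 0)
    (add : ∀ v w, p v → p w → p (v + w)) (v : M.carrier) : p v :=
  Submodule.iSup_induction (fun μ : ℚ => slopePart q M (μ : ℝ)) (x := v)
    (by rw [slopePart_iSup q hroot]; exact Submodule.mem_top) (fun μ x hx => mem μ ⟨x, hx⟩) zero add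

theorem hom_ext_comp {M N : QDiffModule.{w, v} F σ} {f g : M ⟶ N}
    (h : ∀ μ, compMap q f μ = compMap q g μ) : f = g := by
  refine hom_ext_apply (slopePart_induction q hroot (fun μ v => ?_) (by rw [map_zero, map_zero])
    fun v w hv hw => by rw [map_add, map_add, hv, hw])
  rw [← compIncl_compMap, h, compIncl_compMap]

theorem isInternal_slopePart (M : QDiffModule.{w, v} F σ) :
    DirectSum.IsInternal fun μ : ℚ => slopePart q M (μ : ℝ) :=
  DirectSum.isInternal_submodule_of_iSupIndep_of_iSup_eq_top (slopePart_iSupIndep q M)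
    (slopePart_iSup q hroot M)

theorem exists_glue {M N : QDiffModule.{w, v} F σ} (φ : ∀ μ, comp q M μ ⟶ comp q N μ) :
    ∃ f : M ⟶ N, ∀ μ, compMap q f μ = φ μ := by
  let e := LinearEquiv.ofBijective (DirectSum.coeLinearMap fun μ : ℚ => slopePart q M (μ : ℝ))
    (isInternal_slopePart q hroot M)
  let ψ : ∀ μ : ℚ, slopePart q M (μ : ℝ) →ₗ[F] N.carrier := fun μ =>
    QDiffModule.lin (compIncl q N μ) ∘ₗ QDiffModule.lin (φ μ)
  let g : M.carrier →ₗ[F] N.carrier := DirectSum.toModule F ℚ N.carrier ψ ∘ₗ e.symm.toLinearMap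
  have hg : ∀ μ v, g (QDiffModule.lin (compIncl q M μ) v) =
      QDiffModule.lin (compIncl q N μ) (QDiffModule.lin (φ μ) v) := by
    intro μ v
    have h1 : e (DirectSum.lof F ℚ (fun μ : ℚ => slopePart q M (μ : ℝ)) μ v) =
        QDiffModule.lin (compIncl q M μ) v := DirectSum.coeLinearMap_lof _ _ _
    rw [← h1]
    change DirectSum.toModule F ℚ N.carrier ψ (e.symm (e _)) = ψ μ v
    rw [LinearEquiv.symm_apply_apply]; exact DirectSum.toModule_lof F μ (φ := ψ) v
  have hcomm : ∀ v, g (M.Φ v) = N.Φ (g v) := by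
    refine slopePart_induction q hroot (fun μ v => ?_) ?_ fun v w hv hw => ?_
    · rw [← lin_Φ, hg, hg, lin_Φ, lin_Φ]
    · rw [map_zero, map_zero, map_zero]
    · rw [map_add, map_add, hv, hw, map_add, map_add]
  refine ⟨⟨g, hcomm⟩, fun μ => hom_ext_apply fun v => compIncl_injective q N μ ?_⟩
  rw [compIncl_compMap]
  exact hg μ v

theorem nonempty_iso_of_comp {M N : QDiffModule.{w, v} F σ}
    (h : ∀ μ, Nonempty (comp q M μ ≅ comp q N μ)) : Nonempty (M ≅ N) := by
  have e := fun μ => (h μ).some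
  obtain ⟨f, hf⟩ := exists_glue q hroot fun μ => (e μ).hom
  obtain ⟨g, hg⟩ := exists_glue q hroot fun μ => (e μ).inv
  refine ⟨⟨f, g, hom_ext_comp q hroot fun μ => ?_, hom_ext_comp q hroot fun μ => ?_⟩⟩
  · rw [compMap_comp, hf, hg, Iso.hom_inv_id, compMap_id]
  · rw [compMap_comp, hf, hg, Iso.inv_hom_id, compMap_id]

end Components

section DSum

variable {F : Type w} [Field F] {σ : F ≃+* F} (X : ℚ → QDiffModule.{w, v} F σ)

theorem iSup_range_lof : ⨆ μ, LinearMap.range (DirectSum.lof F ℚ (fun μ => (X μ).carrier) μ) = ⊤ := by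
  rw [eq_top_iff]
  intro v _
  induction v using DirectSum.induction_on with
  | zero => exact zero_mem _
  | of μ v => exact Submodule.mem_iSup_of_mem μ ⟨v, rfl⟩
  | add v w hv hw => exact add_mem (hv Submodule.mem_top) (hw Submodule.mem_top)

variable (hfin : {μ : ℚ | Nontrivial (X μ).carrier}.Finite)
include hfin

theorem finiteDimensional_directSum : FiniteDimensional F (DirectSum ℚ fun μ => (X μ).carrier) := by
  refine Module.finite_def.2 ?_
  have h : ⨆ μ ∈ hfin.toFinset, LinearMap.range (DirectSum.lof F ℚ (fun μ => (X μ).carrier) μ) = ⊤ := by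
    rw [eq_top_iff, ← iSup_range_lof X]
    refine iSup_le fun μ => ?_
    by_cases hμ : Nontrivial (X μ).carrier
    · exact le_iSup₂_of_le μ (hfin.mem_toFinset.2 hμ) le_rfl
    · rw [not_nontrivial_iff_subsingleton] at hμ
      rintro _ ⟨v, rfl⟩
      rw [Subsingleton.elim v 0, map_zero]
      exact zero_mem _
  rw [← h]
  refine Submodule.fg_biSup _ _ fun μ _ => ?_
  rw [LinearMap.range_eq_map]
  exact Module.Finite.fg_top.map _

/-- The direct sum of a finitely supported family of `q`-difference modules. -/
def dsum : QDiffModule.{w, v} F σ where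
  carrier := DirectSum ℚ fun μ => (X μ).carrier
  finiteDimensional := finiteDimensional_directSum X hfin
  Φ :=
    { toFun := DirectSum.map fun μ => (X μ).Φ.toAddMonoidHom
      map_add' := map_add _
      map_smul' := fun f v => by
        refine DFinsupp.ext fun μ => ?_
        have h1 := DirectSum.map_apply (fun μ => (X μ).Φ.toAddMonoidHom) μ (f • v)
        have h2 := DirectSum.map_apply (fun μ => (X μ).Φ.toAddMonoidHom) μ v
        refine h1.trans ?_
        rw [DirectSum.smul_apply]
        refine ((X μ).Φ.map_smulₛₗ f (v μ)).trans ?_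
        exact congrArg _ h2.symm }
  bijective := ⟨(DirectSum.map_injective _).2 fun μ => (X μ).bijective.1,
    (DirectSum.map_surjective _).2 fun μ => (X μ).bijective.2⟩

/-- The inclusion of a summand. -/
def dsumIncl (μ : ℚ) : X μ ⟶ dsum X hfin where
  toLinearMap := DirectSum.lof F ℚ (fun μ => (X μ).carrier) μ
  comm v := (DirectSum.map_of (fun μ => (X μ).Φ.toAddMonoidHom) μ v).symm

theorem dsumIncl_injective (μ : ℚ) : Function.Injective (QDiffModule.lin (dsumIncl X hfin μ)) :=
  DirectSum.of_injective (β := fun μ => (X μ).carrier) μ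

theorem iSup_range_dsumIncl : ⨆ μ, LinearMap.range (QDiffModule.lin (dsumIncl X hfin μ)) = ⊤ :=
  iSup_range_lof X

theorem nonempty_comp_dsum_iso {C : Type u} [NormedField C] [GrowthField C F] (q : Cˣ)
    [IsShift q σ] (hX : ∀ μ : ℚ, NormPure C (X μ) (μ : ℝ)) (μ : ℚ) :
    Nonempty (X μ ≅ comp q (dsum X hfin) μ) :=
  nonempty_comp_iso q X hX (dsumIncl X hfin) (dsumIncl_injective X hfin)
    (iSup_range_dsumIncl X hfin) μ

end DSum

section Transfer

variable {C : Type u} [NormedField C] {q : Cˣ} [hσ : IsShift q (germShift q)] (hq : ‖(q : C)‖ = 1)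
  (hroot : ∀ n : ℕ, 0 < n → q ^ n ≠ 1)

omit hσ in
theorem isIsoObj_of_iso {M N : Bq q} (e : M ≅ N) (h : isIsoObj q M) : isIsoObj q N := fun L ⟨f⟩ =>
  let ⟨g⟩ := h L ⟨f ≪≫ formalizationIso e.symm⟩
  ⟨g ≪≫ e⟩

omit hσ in
theorem lin_formalizationMap_injective {M N : Bq q} {f : M ⟶ N}
    (hf : Function.Injective (QDiffModule.lin f)) :
    Function.Injective (QDiffModule.lin (formalizationMap f)) :=
  Module.Flat.lTensor_preserves_injective_linearMap (M := LaurentSeries C) _ hf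

include hq hroot

/-- The formalization commutes with the components. -/
theorem nonempty_formalization_comp_iso (M : Bq q) (μ : ℚ) :
    Nonempty (formalization q (comp q M μ) ≅ comp q (formalization q M) μ) := by
  refine nonempty_comp_iso q (fun μ => formalization q (comp q M μ))
    (fun μ => (normPure_formalization_iff hq hroot _ _).2 (comp_normPure q M μ))
    (fun μ => formalizationMap (compIncl q M μ))
    (fun μ => lin_formalizationMap_injective (compIncl_injective q M μ)) ?_ μ
  set S := ⨆ μ : ℚ, LinearMap.range (QDiffModule.lin (formalizationMap (compIncl q M μ)))
  have h1 : ∀ v, toFormal q M v ∈ S := by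
    refine slopePart_induction q hroot (fun μ v => ?_) ?_ fun v w hv hw => ?_
    · exact Submodule.mem_iSup_of_mem μ ⟨toFormal q _ v, formalizationMap_toFormal _ _⟩
    · rw [map_zero]; exact zero_mem _
    · rw [map_add]; exact add_mem hv hw
  rw [eq_top_iff]
  intro w _
  have b := Module.finBasis (germField C) M.carrier
  rw [← (formalBasis q M b).sum_repr w]
  refine Submodule.sum_mem _ fun i _ => Submodule.smul_mem _ _ ?_
  rw [formalBasis_apply]
  exact h1 _

omit hσ in
theorem normPure_of_formalization_iso {M N : Bq q} {μ : ℝ} (hM : NormPure C M μ)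
    (e : formalization q N ≅ formalization q M) : NormPure C N μ :=
  (normPure_formalization_iff hq hroot N μ).1
    (((normPure_formalization_iff hq hroot M μ).2 hM).of_iso q e.symm)

theorem formalization_iso_iff_comp (M N : Bq q) : Nonempty (formalization q N ≅ formalization q M) ↔
    ∀ μ, Nonempty (formalization q (comp q N μ) ≅ formalization q (comp q M μ)) := by
  have hM := fun μ => (nonempty_formalization_comp_iso hq hroot M μ).some
  have hN := fun μ => (nonempty_formalization_comp_iso hq hroot N μ).some
  exact ⟨fun ⟨e⟩ μ => ⟨hN μ ≪≫ compIso q e μ ≪≫ (hM μ).symm⟩, fun h =>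
    nonempty_iso_of_comp q hroot fun μ => ⟨(hN μ).symm ≪≫ (h μ).some ≪≫ hM μ⟩⟩

theorem isIsoObj_of_comp {M : Bq q} (h : ∀ μ, isIsoObj q (comp q M μ)) : isIsoObj q M := fun N e =>
  nonempty_iso_of_comp q hroot fun μ => h μ _ ((formalization_iso_iff_comp hq hroot M N).1 e μ)

theorem isIsoObj_comp {M : Bq q} (h : isIsoObj q M) (μ : ℚ) : isIsoObj q (comp q M μ) := by
  rintro N ⟨e⟩
  have hN := normPure_of_formalization_iso hq hroot (comp_normPure q M μ) e
  set X : ℚ → Bq q := Function.update (comp q M) μ N with hX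
  have hfin : {ν : ℚ | Nontrivial (X ν).carrier}.Finite := by
    refine ((finite_comp q M).insert μ).subset fun ν hν => ?_
    by_cases h1 : ν = μ
    · exact Or.inl h1
    · right
      have h2 : Nontrivial (X ν).carrier := hν
      rwa [hX, Function.update_of_ne h1] at h2
  have hpure : ∀ ν : ℚ, NormPure C (X ν) (ν : ℝ) := by
    intro ν
    by_cases h1 : ν = μ
    · subst h1; rwa [hX, Function.update_self]
    · rw [hX, Function.update_of_ne h1]; exact comp_normPure q M ν
  have hc := fun ν => (nonempty_comp_dsum_iso X hfin q hpure ν).some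
  have e1 : Nonempty (formalization q (dsum X hfin) ≅ formalization q M) := by
    refine (formalization_iso_iff_comp hq hroot M _).2 fun ν => ?_
    have e2 : Nonempty (formalization q (X ν) ≅ formalization q (comp q M ν)) := by
      by_cases h1 : ν = μ
      · subst h1; rw [hX, Function.update_self]; exact ⟨e⟩
      · rw [hX, Function.update_of_ne h1]; exact ⟨Iso.refl _⟩
    obtain ⟨e2⟩ := e2
    exact ⟨formalizationIso (hc ν).symm ≪≫ e2⟩
  obtain ⟨f⟩ := h _ e1
  have e3 : X μ = N := Function.update_self _ _ _
  exact ⟨eqToIso e3.symm ≪≫ hc μ ≪≫ compIso q f μ⟩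

end Transfer

section SlopeTwist

theorem exists_slopeFrame (μ : ℚ) : ∃ t : Frame, t.β.i = μ.num ∧ t.β.j = μ.den := by
  have h := Int.gcd_eq_gcd_ab μ.den μ.num
  have h1 : Int.gcd μ.den μ.num = 1 := by
    rw [Int.gcd_comm]; exact μ.reduced
  rw [h1] at h
  exact ⟨⟨⟨0, Int.gcdA μ.den μ.num, -Int.gcdB μ.den μ.num⟩, ⟨0, μ.num, μ.den⟩, by
    push_cast at h ⊢; linarith⟩, rfl, rfl⟩

/-- A frame adapted to the slope `μ`. -/
def slopeFrame (μ : ℚ) : Frame := (exists_slopeFrame μ).choose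

theorem slopeFrame_i (μ : ℚ) : (slopeFrame μ).β.i = μ.num := (exists_slopeFrame μ).choose_spec.1
theorem slopeFrame_j (μ : ℚ) : (slopeFrame μ).β.j = μ.den := (exists_slopeFrame μ).choose_spec.2

theorem slopeFrame_pos (μ : ℚ) :
    0 < ((slopeFrame μ).α.i : ℝ) - ((μ : ℚ) : ℝ) * (slopeFrame μ).α.j := by
  have hd : (0 : ℝ) < μ.den := by exact_mod_cast μ.den_pos
  have h : ((slopeFrame μ).α.i : ℝ) * μ.den - (slopeFrame μ).α.j * μ.num = 1 := by
    have := (slopeFrame μ).det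
    rw [slopeFrame_i, slopeFrame_j] at this
    exact_mod_cast this
  have hμ : (μ : ℝ) = μ.num / μ.den := Rat.cast_def μ
  rw [hμ]
  have e : ((slopeFrame μ).α.i : ℝ) - (μ.num : ℝ) / μ.den * (slopeFrame μ).α.j = 1 / μ.den := by
    field_simp
    linarith
  rw [e]
  positivity

theorem slopeFrame_slope (μ : ℚ) :
    -((slopeFrame μ).β.i : ℝ) + ((μ : ℚ) : ℝ) * (slopeFrame μ).β.j = 0 := by
  have hd : (μ.den : ℝ) ≠ 0 := by exact_mod_cast μ.den_ne_zero
  rw [slopeFrame_i, slopeFrame_j, Rat.cast_def μ]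
  push_cast
  field_simp
  ring

variable {C : Type u} [NormedField C] {q : Cˣ} [hσ : IsShift q (germShift q)]

/-- The twist of slope zero of a pure module. -/
def slopeTwist {M : Bq q} {μ : ℚ} (P : PureNorm C M (μ : ℝ)) : Bq q :=
  twist q P (slopeFrame μ) (slopeFrame_pos μ)

theorem slopeTwist_normPure {M : Bq q} {μ : ℚ} (P : PureNorm C M (μ : ℝ)) :
    NormPure C (slopeTwist P) 0 := by
  have := (normPure_iff_nonempty _ _).2 ⟨twistNorm q P (slopeFrame μ) (slopeFrame_pos μ)⟩
  rwa [slopeFrame_slope, zero_div] at this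

theorem exists_slopeTwist_iso (μ : ℚ) {L : Bq q} (hL : NormPure C L 0) :
    ∃ (M : Bq q) (P : PureNorm C M (μ : ℝ)), Nonempty (slopeTwist P ≅ L) := by
  obtain ⟨R⟩ := (normPure_iff_nonempty _ _).1 hL
  obtain ⟨t', h1, h2, h3, h4, -, h6⟩ := (slopeFrame μ).exists_inverse
  rw [slopeFrame_j] at h1
  rw [slopeFrame_i] at h3
  have hd : (0 : ℝ) < μ.den := by exact_mod_cast μ.den_pos
  have ht' : 0 < (t'.α.i : ℝ) - 0 * t'.α.j := by
    rw [h1, zero_mul, sub_zero]; exact_mod_cast μ.den_pos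
  have hs : (-(t'.β.i : ℝ) + 0 * t'.β.j) / (t'.α.i - 0 * t'.α.j) = μ := by
    rw [h1, h3, Rat.cast_def μ]; push_cast; ring
  let P : PureNorm C (twist q R t' ht') (μ : ℝ) :=
    { N := (twistNorm q R t' ht').N
      adm := (twistNorm q R t' ht').adm
      scale := fun v => by rw [← hs]; exact (twistNorm q R t' ht').scale v }
  exact ⟨_, P, twist_twist q R t' ht' P (slopeFrame μ) (slopeFrame_pos μ) h6⟩

theorem slopeTwist_isIsoObj_iff (hq : ‖(q : C)‖ = 1) (hroot : ∀ n : ℕ, 0 < n → q ^ n ≠ 1)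
    {M : Bq q} {μ : ℚ} (P : PureNorm C M (μ : ℝ)) :
    isIsoObj q (slopeTwist P) ↔ isIsoObj q M := by
  have hM : NormPure C M (μ : ℝ) := (normPure_iff_nonempty _ _).2 ⟨P⟩
  constructor
  · rintro h N ⟨e⟩
    obtain ⟨R⟩ := (normPure_iff_nonempty _ _).1 (normPure_of_formalization_iso hq hroot hM e)
    obtain ⟨f⟩ := h (slopeTwist R) ((formal_twist_iff hq hroot R P _ _).2 ⟨e⟩)
    exact ⟨untwistIso q R _ _ P _ f⟩
  · rintro h N ⟨e⟩
    have hN := normPure_of_formalization_iso hq hroot (slopeTwist_normPure P) e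
    obtain ⟨M', R, ⟨f⟩⟩ := exists_slopeTwist_iso μ hN
    obtain ⟨g⟩ := h M' ((formal_twist_iff hq hroot R P _ _).1 ⟨formalizationIso f ≪≫ e⟩)
    exact ⟨f.symm ≪≫ twistIso q R _ _ P _ g⟩

end SlopeTwist

section Grading

variable {C : Type u} [NormedField C] {q : Cˣ} [hσ : IsShift q (germShift q)]

/-- A norm exhibiting the purity of a component. -/
def compNorm (M : Bq q) (μ : ℚ) : PureNorm C (comp q M μ) (μ : ℝ) :=
  ((normPure_iff_nonempty _ _).1 (comp_normPure q M μ)).some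

variable (hq : ‖(q : C)‖ = 1) (hroot : ∀ n : ℕ, 0 < n → q ^ n ≠ 1)
include hq hroot

theorem slopeTwist_isPure {M : Bq q} {μ : ℚ} (P : PureNorm C M (μ : ℝ)) :
    isPure q 0 (slopeTwist P) :=
  (isPure_iff_normPure hq hroot _ 0).2 (by rw [Rat.cast_zero]; exact slopeTwist_normPure P)

/-- The components of a module, twisted to slope zero. -/
def gradedObj (M : Biso q) : GradedBisoF q where
  obj μ := ⟨slopeTwist (compNorm M.obj μ),
    (slopeTwist_isIsoObj_iff hq hroot _).2 (isIsoObj_comp hq hroot M.property μ),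
    slopeTwist_isPure hq hroot _⟩
  property := (finite_comp q M.obj).subset fun μ hμ =>
    have : Nontrivial (twist q (compNorm M.obj μ) (slopeFrame μ) (slopeFrame_pos μ)).carrier := hμ
    (toTwist q (compNorm M.obj μ) (slopeFrame μ) (slopeFrame_pos μ)).toEquiv.nontrivial

/-- The functor sending a module to the graded module of its components, twisted to slope zero. -/
def gradedFunctor : Biso q ⥤ GradedBisoF q where
  obj := gradedObj hq hroot
  map {M N} f := ObjectProperty.homMk fun μ => ObjectProperty.homMk
    (twistMap q (compNorm M.obj μ) (slopeFrame μ) (slopeFrame_pos μ) (compNorm N.obj μ)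
      (slopeFrame_pos μ) (compMap q f.hom μ))
  map_id _ := rfl
  map_comp _ _ := rfl

omit hq hroot in
theorem twistMap_injective {M N : Bq q} {μ : ℝ} (P : PureNorm C M μ) (t : Frame)
    (ht : 0 < (t.α.i : ℝ) - μ * t.α.j) (R : PureNorm C N μ) {f g : M ⟶ N}
    (h : twistMap q P t ht R ht f = twistMap q P t ht R ht g) : f = g :=
  hom_ext_apply fun v => (toTwist q R t ht).injective
    (congrArg (fun φ => QDiffModule.lin φ (toTwist q P t ht v)) h)

instance gradedFunctor_faithful : (gradedFunctor hq hroot).Faithful where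
  map_injective h := ObjectProperty.hom_ext _ (hom_ext_comp q hroot fun μ =>
    twistMap_injective _ _ _ _ (congrArg (fun φ => (φ.hom μ).hom) h))

instance gradedFunctor_full : (gradedFunctor hq hroot).Full where
  map_surjective {M N} φ := by
    obtain ⟨f, hf⟩ := exists_glue q hroot fun μ => untwistMap q (compNorm M.obj μ) (slopeFrame μ)
      (slopeFrame_pos μ) (compNorm N.obj μ) (slopeFrame_pos μ) (φ.hom μ).hom
    refine ⟨ObjectProperty.homMk f, ObjectProperty.hom_ext _ (funext fun μ =>
      ObjectProperty.hom_ext _ ?_)⟩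
    change twistMap q _ _ _ _ _ (compMap q f μ) = (φ.hom μ).hom
    rw [hf]
    rfl

instance gradedFunctor_essSurj : (gradedFunctor hq hroot).EssSurj where
  mem_essImage X := by
    have hX : ∀ μ, NormPure C (X.obj μ).obj 0 := fun μ => by
      simpa using (isPure_iff_normPure hq hroot _ 0).1 (X.obj μ).property.2
    choose L P e using fun μ => exists_slopeTwist_iso μ (hX μ)
    have hL : ∀ μ, NormPure C (L μ) (μ : ℝ) := fun μ => (normPure_iff_nonempty _ _).2 ⟨P μ⟩
    have hfin : {μ : ℚ | Nontrivial (L μ).carrier}.Finite := X.property.subset fun μ hμ => by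
      have : Nontrivial (L μ).carrier := hμ
      have e1 := (toTwist q (P μ) (slopeFrame μ) (slopeFrame_pos μ)).toEquiv.trans
        (LinearEquiv.ofBijective _ (lin_bijective (e μ).some)).toEquiv
      exact e1.symm.nontrivial
    have c := fun μ => (nonempty_comp_dsum_iso L hfin q hL μ).some
    have hiso : isIsoObj q (dsum L hfin) := isIsoObj_of_comp hq hroot fun μ =>
      isIsoObj_of_iso (c μ) ((slopeTwist_isIsoObj_iff hq hroot (P μ)).1
        (isIsoObj_of_iso (e μ).some.symm (X.obj μ).property.1))
    refine ⟨⟨dsum L hfin, hiso⟩, ⟨ObjectProperty.isoMk _ (GradedObject.isoMk _ _ fun μ =>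
      ObjectProperty.isoMk _ ?_)⟩⟩
    exact twistIso q _ _ _ (P μ) _ (c μ).symm ≪≫ (e μ).some

theorem gradedFunctor_isEquivalence : (gradedFunctor hq hroot).IsEquivalence where

theorem isPure_iff_subsingleton_gradedObj (M : Biso q) (μ : ℚ) : isPure q μ M.obj ↔
    ∀ ν : ℚ, ν ≠ μ → Subsingleton ((gradedObj hq hroot M).obj ν).obj.carrier := by
  have h1 : ∀ ν : ℚ, Subsingleton ((gradedObj hq hroot M).obj ν).obj.carrier ↔
      slopePart q M.obj (ν : ℝ) = ⊥ := fun ν =>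
    (toTwist q (compNorm M.obj ν) (slopeFrame ν)
      (slopeFrame_pos ν)).toEquiv.subsingleton_congr.symm.trans Submodule.subsingleton_iff_eq_bot
  simp_rw [h1]
  rw [isPure_iff_normPure hq hroot, normPure_iff q]
  constructor
  · intro h ν hν
    have := slopePart_disjoint q M.obj (μ := ν) (ν := μ) (by exact_mod_cast hν)
    rwa [h, disjoint_top] at this
  · intro h
    rw [eq_top_iff, ← slopePart_iSup q hroot M.obj]
    refine iSup_le fun ν => ?_
    by_cases hν : ν = μ
    · rw [hν]
    · rw [h ν hν]; exact bot_le

theorem isSlopeGrading_slopePart (M : Biso q) :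
    IsSlopeGrading q M.obj fun μ => slopePart q M.obj (μ : ℝ) :=
  ⟨isInternal_slopePart q hroot M.obj, fun μ => ⟨slopePart_stable q M.obj μ,
    isIsoObj_comp hq hroot M.property μ,
    (isPure_iff_normPure hq hroot _ μ).2 (comp_normPure q M.obj μ)⟩⟩

theorem IsSlopeGrading.eq_slopePart {M : Bq q} {W : ℚ → Submodule (germField C) M.carrier}
    (h : IsSlopeGrading q M W) : W = fun μ : ℚ => slopePart q M (μ : ℝ) := by
  refine eq_of_iSupIndep_of_le (slopePart_iSupIndep q M) (fun μ v hv => ?_)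
    h.1.submodule_iSup_eq_top
  obtain ⟨hs, -, hp⟩ := h.2 μ
  exact lin_mem_slopePart q ((isPure_iff_normPure hq hroot _ μ).1 hp) (subIncl M hs) ⟨v, hv⟩

end Grading
end QDiff
end

theorem mainTheorem3 {C : Type u} [NormedField C] [IsAlgClosed C]
    (hC : IsUltrametricDist C ∨ ∃ e : C ≃+* ℂ, ∀ z, ‖e z‖ = ‖z‖)
    (q : Cˣ) (hq : ‖(q : C)‖ = 1) (hroot : ∀ n : ℕ, 0 < n → q ^ n ≠ 1)
    (hconv : QDiff.IsConvergent
      (PowerSeries.mk fun n => (∏ k ∈ Finset.range n, (1 - (q : C) ^ (k + 1)))⁻¹)) :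
    (∃ E : QDiff.Biso q ≌ QDiff.GradedBisoF q, ∀ (M : QDiff.Biso q) (μ : ℚ),
      QDiff.isPure q μ M.obj ↔
        ∀ ν : ℚ, ν ≠ μ → Subsingleton ((E.functor.obj M).obj ν).obj.carrier) ∧
    (∀ M : QDiff.Biso q, ∃ W, QDiff.IsSlopeGrading q M.obj W) ∧
    (∀ (M N : QDiff.Biso q) (W : ℚ → Submodule (QDiff.germField C) M.obj.carrier)
      (W' : ℚ → Submodule (QDiff.germField C) N.obj.carrier),
      QDiff.IsSlopeGrading q M.obj W → QDiff.IsSlopeGrading q N.obj W' →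
      ∀ (f : M.obj ⟶ N.obj) (μ : ℚ), W μ ≤ (W' μ).comap (QDiff.QDiffModule.lin f)) ∧
    (∀ (M N : QDiff.Bq q) (μ ν : ℚ), μ ≠ ν → QDiff.isPure q μ M → QDiff.isPure q ν N →
      ∀ f : M ⟶ N, QDiff.QDiffModule.lin f = 0) := by
  have := QDiff.isShift_germShift hq
  have := QDiff.gradedFunctor_isEquivalence hq hroot
  refine ⟨⟨(QDiff.gradedFunctor hq hroot).asEquivalence,
    QDiff.isPure_iff_subsingleton_gradedObj hq hroot⟩,
    fun M => ⟨_, QDiff.isSlopeGrading_slopePart hq hroot M⟩, ?_, ?_⟩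
  · intro M N W W' hW hW' f μ v hv
    rw [hW.eq_slopePart hq hroot] at hv
    rw [hW'.eq_slopePart hq hroot]
    exact QDiff.slopePart_map q f μ hv
  · intro M N μ ν h hM hN f
    exact QDiff.NormPure.lin_eq_zero q (by exact_mod_cast h)
      ((QDiff.isPure_iff_normPure hq hroot M μ).1 hM)
      ((QDiff.isPure_iff_normPure hq hroot N ν).1 hN) f
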